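/- Let $m\ge 1$, $k_0>0$, and let $Q(x,t)$ be an $m\times m$ complex matrix potential, considered at a fixed time $t$. Assume that $x\mapsto Q(x,t)$ is continuous, $Q(x,t)\to Q_\pm$ as $x\to\pm\infty$ with $Q_\pm Q_\pm^\dagger=Q_\pm^\dagger Q_\pm=k_0^2I_m$, and $Q-Q_+\in L^1(c,\infty)$, $Q-Q_-\in L^1(-\infty,c)$ for every $c\in\mathbb R$. Put $k(z)=\frac12(z-k_0^2/z)$, $\lambda(z)=\frac12(z+k_0^2/z)$, $\theta(x,t;z)=\lambda\,(x+(4k^2-2k_0^2)t)$, $\gamma(z)=1+k_0^2/z^2$, $\sigma_3=\mathrm{diag}(I_m,-I_m)$, $D^\pm=\{z:\pm(|z|^2-k_0^2)\,\mathrm{Im}\,z>0\}$, $\Sigma=\mathbb R\cup\{|z|=k_0\}$, oriented with $D^+$ on its left, and $\Sigma_0=\Sigma\setminus\{0,\pm ik_0\}$. Let $\Phi=(\phi,\bar\phi)$ and $\Psi=(\bar\psi,\psi)$ be the Jost solutions of the focusing scattering problem $v_x=\begin{pmatrix}-ikI_m&Q\\-Q^\dagger&ikI_m\end{pmatrix}v$,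 normalized by $\Phi e^{i\theta\sigma_3}\to E_-$ as $x\to-\infty$ and $\Psi e^{i\theta\sigma_3}\to E_+$ as $x\to+\infty$, where $E_\pm=\begin{pmatrix}I_m&-\frac izQ_\pm\\-\frac izQ_\pm^\dagger&I_m\end{pmatrix}$. Here $\phi,\psi$ are taken for $z\in D^+\cup\Sigma_0$ and $\bar\phi,\bar\psi$ for $z\in D^-\cup\Sigma_0$. On $\Sigma_0$ let $S=\Psi^{-1}\Phi=\begin{pmatrix}a&\bar b\\b&\bar a\end{pmatrix}$ and $\rho=ba^{-1}$; let $a$ be extended to $D^+$ by $\gamma(z)a(z)=\bar\psi(x,t;z^*)^\dagger\phi(x,t;z)$. Write $\rho^\dagger(z^*)$ for the Hermitian conjugate of $\rho(z^*)$. Assume that $\det a$ does not vanish on $\Sigma$, with at worst poles at the branch points: $\det a\ne0$ on $\Sigma_0$, and for each $w\in\{ik_0,-ik_0\}$ there is an integer $p\ge0$ such that $(z-w)^p\det a(z)$ has a nonzero limit as $z\to w$ in $D^+$. Assume that the zeros of $\det a$ in $D^+\cap\{\mathrm{Im}\,z>0\}$ are the distinct points $z_1,\dots,z_{\mathcal N}$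 ($\mathcal N\ge 0$). Let $\delta_n,\theta_\pm\in\mathbb R$ be any numbers with $z_n=|z_n|e^{i\delta_n}$ and $\det Q_\pm=k_0^me^{i\theta_\pm}$. Then $a$ is holomorphic in $D^+$ and continuous on $D^+\cup\Sigma_0$, where on $\Sigma_0$ it is the upper left block of $S$, and $$\lim_{z\to0,\;z\in D^+}\det a(z)=\frac1{k_0^{2m}}\det Q_+\det Q_-^\dagger .$$ There is a logarithm $L(\zeta)=\log\det(I_m+\rho^\dagger(\zeta^*)\rho(\zeta))$ on $\Sigma_0$ that is continuous there and real on the real axis (these properties determine it), and $L(\zeta)/(\zeta-z)$ for $z\in D^+$ and $L(\zeta)/\zeta$ are absolutely integrable over $\Sigma$. Simple zeros: if $(\det a)'(z_n)\ne0$ for all $n$, then $$\det a(z)=\exp\Big(-\frac1{2\pi i}\int_\Sigma\frac{L(\zeta)}{\zeta-z}\,d\zeta\Big)\prod_{n=1}^{\mathcal N}\frac{(z-z_n)(z+k_0^2/z_n^*)}{(z-z_n^*)(z+k_0^2/z_n)},\qquad z\in D^+,$$ $$\det Q_+\det Q_-^\dagger=k_0^{2m}\exp\Big(-\frac1{2\pi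 i}\int_\Sigma L(\zeta)\frac{d\zeta}\zeta\Big)\prod_{n=1}^{\mathcal N}e^{4i\delta_n},$$ $$\theta_+-\theta_-\equiv\frac1{2\pi}\int_\Sigma L(\zeta)\frac{d\zeta}\zeta+4\sum_{n=1}^{\mathcal N}\delta_n\pmod{2\pi}.$$ Double zeros: if $(\det a)'(z_n)=0\neq(\det a)''(z_n)$ for all $n$, then the same three formulas hold with each factor of the product over $n$ in the first one squared, with $e^{8i\delta_n}$ in place of $e^{4i\delta_n}$, and with $8\sum_n\delta_n$ in place of $4\sum_n\delta_n$. -/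

import Mathlib

open Filter Topology MeasureTheory

noncomputable section

namespace MMKdV

/-- `k(z) = (z - k₀² / z) / 2`, the spectral parameter in the focusing case. -/
def kOf (k₀ : ℝ) (z : ℂ) : ℂ := (z - (k₀ : ℂ) ^ 2 / z) / 2

/-- `λ(z) = (z + k₀² / z) / 2`. -/
def lamOf (k₀ : ℝ) (z : ℂ) : ℂ := (z + (k₀ : ℂ) ^ 2 / z) / 2

/-- `γ(z) = 1 + k₀² / z²`. -/
def gam (k₀ : ℝ) (z : ℂ) : ℂ := 1 + (k₀ : ℂ) ^ 2 / z ^ 2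

/-- The phase `θ(x,t;z) = λ (x + (4 k² - 2 k₀²) t)`. -/
def phase (k₀ x t : ℝ) (z : ℂ) : ℂ :=
  lamOf k₀ z * ((x : ℂ) + (4 * kOf k₀ z ^ 2 - 2 * (k₀ : ℂ) ^ 2) * (t : ℂ))

/-- The region `D⁺`. -/
def Dplus (k₀ : ℝ) : Set ℂ := {z | 0 < (‖z‖ ^ 2 - k₀ ^ 2) * z.im}

/-- The region `D⁻`. -/
def Dminus (k₀ : ℝ) : Set ℂ := {z | (‖z‖ ^ 2 - k₀ ^ 2) * z.im < 0}

/-- The continuous spectrum: the real axis together with the circle of radius `k₀`. -/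
def Sig (k₀ : ℝ) : Set ℂ := {z | z.im = 0} ∪ {z | ‖z‖ = k₀}

/-- The continuous spectrum without the two branch points `± i k₀` and without the origin, at
which `k(z)` and `λ(z)` are not defined. -/
def Sig₀ (k₀ : ℝ) : Set ℂ := Sig k₀ \ {0, Complex.I * k₀, -(Complex.I * k₀)}

variable {m : ℕ}

/-- The matrix `-i k σ₃ + [[0, q], [-q†, 0]]` of the focusing scattering problem. -/
def laxM (k₀ : ℝ) (q : Matrix (Fin m) (Fin m) ℂ) (z : ℂ) :
    Matrix (Fin m ⊕ Fin m) (Fin m ⊕ Fin m) ℂ :=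
  Matrix.fromBlocks (-(Complex.I * kOf k₀ z) • (1 : Matrix (Fin m) (Fin m) ℂ)) q
    (-q.conjTranspose) ((Complex.I * kOf k₀ z) • (1 : Matrix (Fin m) (Fin m) ℂ))

/-- The first `m` columns of the eigenvector matrix `E(z) = I - (i/z) σ₃ [[0, q], [-q†, 0]]`. -/
def eigL (q : Matrix (Fin m) (Fin m) ℂ) (z : ℂ) : Matrix (Fin m ⊕ Fin m) (Fin m) ℂ :=
  Matrix.fromRows (1 : Matrix (Fin m) (Fin m) ℂ) (-(Complex.I / z) • q.conjTranspose)

/-- The last `m` columns of the eigenvector matrix `E(z)`. -/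
def eigR (q : Matrix (Fin m) (Fin m) ℂ) (z : ℂ) : Matrix (Fin m ⊕ Fin m) (Fin m) ℂ :=
  Matrix.fromRows (-(Complex.I / z) • q) (1 : Matrix (Fin m) (Fin m) ℂ)

/-- `F` solves the scattering problem at time `t` and `e^{s i θ(x,t;z)} F(x) → E` along `l`. -/
structure IsJost (k₀ : ℝ) (Q : ℝ → ℝ → Matrix (Fin m) (Fin m) ℂ) (t : ℝ) (z : ℂ)
    (s : ℂ) (l : Filter ℝ) (E : Matrix (Fin m ⊕ Fin m) (Fin m) ℂ)
    (F : ℝ → Matrix (Fin m ⊕ Fin m) (Fin m) ℂ) : Prop where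
  ode : ∀ x i j, HasDerivAt (fun y => F y i j) ((laxM k₀ (Q x t) z * F x) i j) x
  asymp : Tendsto (fun x : ℝ => Complex.exp (s * Complex.I * phase k₀ x t z) • F x) l (𝓝 E)

open Classical in
/-- The solution that is singled out by `IsJost` (and `0` if there is none). -/
def jost (k₀ : ℝ) (Q : ℝ → ℝ → Matrix (Fin m) (Fin m) ℂ) (t : ℝ) (z : ℂ)
    (s : ℂ) (l : Filter ℝ) (E : Matrix (Fin m ⊕ Fin m) (Fin m) ℂ) :
    ℝ → Matrix (Fin m ⊕ Fin m) (Fin m) ℂ :=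
  if h : ∃ F, IsJost k₀ Q t z s l E F then h.choose else 0

/-- `φ ~ E₋,₁ e^{-iθ}` as `x → -∞`; used for `z ∈ D⁺ ∪ Σ₀`. -/
def phi (k₀ : ℝ) (Q : ℝ → ℝ → Matrix (Fin m) (Fin m) ℂ) (Qm : Matrix (Fin m) (Fin m) ℂ)
    (t : ℝ) (z : ℂ) : ℝ → Matrix (Fin m ⊕ Fin m) (Fin m) ℂ :=
  jost k₀ Q t z 1 atBot (eigL Qm z)

/-- `φ̄ ~ E₋,₂ e^{iθ}` as `x → -∞`; used for `z ∈ Σ₀`. -/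
def phiBar (k₀ : ℝ) (Q : ℝ → ℝ → Matrix (Fin m) (Fin m) ℂ) (Qm : Matrix (Fin m) (Fin m) ℂ)
    (t : ℝ) (z : ℂ) : ℝ → Matrix (Fin m ⊕ Fin m) (Fin m) ℂ :=
  jost k₀ Q t z (-1) atBot (eigR Qm z)

/-- `ψ̄ ~ E₊,₁ e^{-iθ}` as `x → +∞`; used for `z ∈ D⁻ ∪ Σ₀`. -/
def psiBar (k₀ : ℝ) (Q : ℝ → ℝ → Matrix (Fin m) (Fin m) ℂ) (Qp : Matrix (Fin m) (Fin m) ℂ)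
    (t : ℝ) (z : ℂ) : ℝ → Matrix (Fin m ⊕ Fin m) (Fin m) ℂ :=
  jost k₀ Q t z 1 atTop (eigL Qp z)

/-- `ψ ~ E₊,₂ e^{iθ}` as `x → +∞`; used for `z ∈ Σ₀`. -/
def psi (k₀ : ℝ) (Q : ℝ → ℝ → Matrix (Fin m) (Fin m) ℂ) (Qp : Matrix (Fin m) (Fin m) ℂ)
    (t : ℝ) (z : ℂ) : ℝ → Matrix (Fin m ⊕ Fin m) (Fin m) ℂ :=
  jost k₀ Q t z (-1) atTop (eigR Qp z)

/-- The scattering matrix `S(z) = Ψ(x,t;z)⁻¹ Φ(x,t;z)` for `z ∈ Σ₀`, with `Φ = (φ, φ̄)` and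
`Ψ = (ψ̄, ψ)`.  It does not depend on `x`, and `x = 0` is used. -/
def scatS (k₀ : ℝ) (Q : ℝ → ℝ → Matrix (Fin m) (Fin m) ℂ) (Qp Qm : Matrix (Fin m) (Fin m) ℂ)
    (t : ℝ) (z : ℂ) : Matrix (Fin m ⊕ Fin m) (Fin m ⊕ Fin m) ℂ :=
  (Matrix.fromCols (psiBar k₀ Q Qp t z 0) (psi k₀ Q Qp t z 0))⁻¹ *
    Matrix.fromCols (phi k₀ Q Qm t z 0) (phiBar k₀ Q Qm t z 0)

/-- The scattering coefficient `a(z)` for `z ∈ D⁺ ∪ Σ₀`, given by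
`γ(z) a(z) = ψ̄(x,t;z*)† φ(x,t;z)`; the right side does not depend on `x`, and `x = 0` is used.
On `Σ₀` this is the upper left block of `S(z)`. -/
def scatA (k₀ : ℝ) (Q : ℝ → ℝ → Matrix (Fin m) (Fin m) ℂ) (Qp Qm : Matrix (Fin m) (Fin m) ℂ)
    (t : ℝ) (z : ℂ) : Matrix (Fin m) (Fin m) ℂ :=
  (gam k₀ z)⁻¹ •
    ((psiBar k₀ Q Qp t ((starRingEnd ℂ) z) 0).conjTranspose * phi k₀ Q Qm t z 0)

/-- The reflection coefficient `ρ = b a⁻¹` on `Σ₀`, where `a` and `b` are the upper and the lower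
left block of `S`. -/
def refl (k₀ : ℝ) (Q : ℝ → ℝ → Matrix (Fin m) (Fin m) ℂ) (Qp Qm : Matrix (Fin m) (Fin m) ℂ)
    (t : ℝ) (z : ℂ) : Matrix (Fin m) (Fin m) ℂ :=
  (scatS k₀ Q Qp Qm t z).toBlocks₂₁ * ((scatS k₀ Q Qp Qm t z).toBlocks₁₁)⁻¹

/-- `det (I + ρ†(ζ*) ρ(ζ))`, where `ρ†(ζ*)` is the Hermitian conjugate of `ρ(ζ*)`. -/
def jumpDet (k₀ : ℝ) (Q : ℝ → ℝ → Matrix (Fin m) (Fin m) ℂ) (Qp Qm : Matrix (Fin m) (Fin m) ℂ)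
    (t : ℝ) (z : ℂ) : ℂ :=
  (1 + (refl k₀ Q Qp Qm t ((starRingEnd ℂ) z)).conjTranspose * refl k₀ Q Qp Qm t z).det

/-- `ℓ` is the logarithm of `d` on `Σ₀` that is continuous there and real on the real axis.  These
conditions determine `ℓ` on `Σ₀`. -/
structure IsLogOnSig (k₀ : ℝ) (d ℓ : ℂ → ℂ) : Prop where
  cont : ContinuousOn ℓ (Sig₀ k₀)
  exp_eq : ∀ z ∈ Sig₀ k₀, Complex.exp (ℓ z) = d z
  real : ∀ x : ℝ, x ≠ 0 → (ℓ (x : ℂ)).im = 0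

/-- Absolute integrability over the contour `Σ`. -/
def SigIntegrable (k₀ : ℝ) (f : ℂ → ℂ) : Prop :=
  Integrable (fun x : ℝ => f (x : ℂ)) ∧
    IntervalIntegrable (fun u : ℝ => f (k₀ * Complex.exp (Complex.I * u))) volume
      (-Real.pi) Real.pi

/-- The integral over `Σ`, oriented with `D⁺` on its left: the rays `(-∞, -k₀)` and `(k₀, ∞)` from
left to right, the segment from `k₀` to `-k₀`, the upper semicircle clockwise and the lower
semicircle counterclockwise, both from `-k₀` to `k₀`. -/
def sigInt (k₀ : ℝ) (f : ℂ → ℂ) : ℂ :=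
  (∫ x in Set.Iio (-k₀), f (x : ℂ)) + (∫ x in Set.Ioi k₀, f (x : ℂ))
    - (∫ x in (-k₀)..k₀, f (x : ℂ))
    - (∫ u in (0 : ℝ)..Real.pi,
        f (k₀ * Complex.exp (Complex.I * u)) * (Complex.I * (k₀ * Complex.exp (Complex.I * u))))
    + ∫ u in (-Real.pi)..(0 : ℝ),
        f (k₀ * Complex.exp (Complex.I * u)) * (Complex.I * (k₀ * Complex.exp (Complex.I * u)))

/-- The Blaschke-type factor
`(z - w)(z + k₀²/w*) / ((z - w*)(z + k₀²/w))` of the quartet of `w`. -/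
def quartet (k₀ : ℝ) (w z : ℂ) : ℂ :=
  ((z - w) * (z + (k₀ : ℂ) ^ 2 / (starRingEnd ℂ) w)) /
    ((z - (starRingEnd ℂ) w) * (z + (k₀ : ℂ) ^ 2 / w))

end MMKdV

end

set_option linter.unusedSectionVars false

noncomputable section

namespace MMKdV

/-! ### Volterra equations in a Banach algebra: solution, differential equation, uniqueness -/

section Volterra

open Set

variable {E : Type*} [NormedAddCommGroup E] [NormedSpace ℝ E]

/-! Construction of `det a`. Once the factor e^{-iθ} is removed, the first Jost solution at -∞
satisfies M' = (L + iλ)M. Since Q₋Q₋† = k₀², the limit L₋ of the Lax matrix squares to -λ², so L₋ +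
iλ = 2iλP₂ with a spectral projection P₂, and M solves a Volterra equation with kernel P₁ +
e^{2iλ(x-y)}P₂. That kernel is bounded when Im λ ≥ 0, that is on D⁺ ∪ Σ₀ (the set `Good`), and the
Picard series gives existence, uniqueness, continuity and holomorphy in z. The other Jost solutions
come from the symmetries (x,t,z,Q) → (-x,-t,-z,-Q) and z → -k₀²/z.

Algebraic input. Because L(z*)† = -L(z), the pairing F(z*)†G(z) of two solutions does not depend on
x. On Σ₀ this gives Ψ(z)⁻¹ = γ⁻¹Ψ(z*)† and hence a(z*)†a(z) + b(z*)†b(z) = 1. Two facts follow: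
det(I + ρ†ρ) is the inverse of det a(ζ) · conj det a(ζ*) (`ScatPot.jumpDet_eq`), and |det a| ≤ 1 on
the real axis (`ScatPot.norm_det_scatA_le`). Computing one Wronskian by two pairings gives det a(z)
= c · conj det a(-k₀²/z*) with c = det Q₊ det Q₋† / k₀^{2m} (`ScatPot.det_scatA_symm`). A
Riemann-Lebesgue argument gives det a → 1 at infinity, and the symmetry turns this into the value c
at the origin.

Trace formula. Division by the Blaschke product B removes the zeros. As B(ζ) · conj B(ζ*) = 1 on Σ,
the jump is unchanged, while the symmetry constant c is multiplied by a phase. In the coordinate z =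
k₀e^ω the outer component of D⁺ is a half-strip and the quotient has a logarithm H there; on the
inner component, z = k₀e^{-ω}, the symmetry supplies the logarithm conj H(`flip` ω) + κ. So L is
minus the sum of this logarithm and its Schwarz reflection. Cauchy's formula on the two half-strips
evaluates the first part at z ∈ D⁺; the second part is the conjugate of a Cauchy integral at z* ∈
D⁻, which vanishes. This is the trace formula. Letting z → 0 inside D⁺ gives ∫ L dζ/ζ = -2πiκ
(`LogData.fullInt_zero`), and e^κ = c · (phase of B) is the phase relation.

Analytic obstacles. A pole of `det a` at a branch point makes H logarithmically singular; near the
edge it is dominated by |log|cos u||, which is integrable. At infinity an L¹ potential gives no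
decay rate on the real axis. Positivity of L on ℝ replaces it: on the imaginary axis det a = 1 +
O(1/y) (`ScatPot.det_imag`), so R times the imaginary part of the Cauchy integral at iR stays
bounded, and this quantity controls the integral of L over the real axis
(`LogData.integrableOn_edge`). -/

theorem hasDerivAt_integral_Iic [CompleteSpace E] {f : ℝ → E} (hf : Continuous f)
    (hi : ∀ x, IntegrableOn f (Iic x)) (x : ℝ) :
    HasDerivAt (fun u => ∫ y in Iic u, f y) (f x) x := by
  have h : ∀ u, ∫ y in Iic u, f y = (∫ y in Iic x, f y) + ∫ y in x..u, f y := fun u => by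
    rw [← intervalIntegral.integral_Iic_sub_Iic (hi x) (hi u)]; abel
  have h1 : HasDerivAt (fun u => ∫ y in x..u, f y) (f x) x :=
    intervalIntegral.integral_hasDerivAt_right (hf.intervalIntegrable _ _)
      (hf.stronglyMeasurableAtFilter _ _) hf.continuousAt
  exact (h1.const_add (∫ y in Iic x, f y)).congr_of_eventuallyEq (Eventually.of_forall h)

theorem tendsto_integral_Iic_atBot {f : ℝ → E} {x₀ : ℝ} (hi : IntegrableOn f (Iic x₀)) :
    Tendsto (fun u => ∫ y in Iic u, f y) atBot (𝓝 0) := by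
  have h := intervalIntegral_tendsto_integral_Iic x₀ hi tendsto_id
  have h2 : Tendsto (fun u => (∫ y in Iic x₀, f y) - ∫ y in u..x₀, f y) atBot (𝓝 0) := by
    simpa using h.const_sub (∫ y in Iic x₀, f y)
  refine h2.congr' ?_
  filter_upwards [eventually_le_atBot x₀] with u hu
  rw [← intervalIntegral.integral_Iic_sub_Iic (hi.mono_set (Iic_subset_Iic.2 hu)) hi]
  abel

variable {𝔸 : Type*} [NormedRing 𝔸] [NormedAlgebra ℂ 𝔸]

/-- The Volterra kernel `p₁ + e^{μ s} p₂`. -/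
def vker (p₁ p₂ : 𝔸) (μ : ℂ) (s : ℝ) : 𝔸 := p₁ + Complex.exp (μ * s) • p₂

/-- The accumulated mass `∫_{-∞}^x ‖V‖` of the potential. -/
def vmass (V : ℝ → 𝔸) (x : ℝ) : ℝ := ∫ y in Iic x, ‖V y‖

/-- The Picard iterates of `M = e + ∫_{-∞}^x K(x-y) V(y) M(y) dy`. -/
def picard (p₁ p₂ : 𝔸) (μ : ℂ) (V : ℝ → 𝔸) (e : 𝔸) : ℕ → ℝ → 𝔸
  | 0, _ => e
  | n + 1, x => ∫ y in Iic x, vker p₁ p₂ μ (x - y) * (V y * picard p₁ p₂ μ V e n y)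

/-- The solution of the Volterra equation. -/
def volt (p₁ p₂ : 𝔸) (μ : ℂ) (V : ℝ → 𝔸) (e : 𝔸) (x : ℝ) : 𝔸 := ∑' n, picard p₁ p₂ μ V e n x

theorem norm_exp_mul_le_one {μ : ℂ} (hμ : μ.re ≤ 0) {s : ℝ} (hs : 0 ≤ s) :
    ‖Complex.exp (μ * s)‖ ≤ 1 := by
  rw [Complex.norm_exp, Real.exp_le_one_iff]
  simp only [Complex.mul_re, Complex.ofReal_re, Complex.ofReal_im, mul_zero, sub_zero]
  exact mul_nonpos_of_nonpos_of_nonneg hμ hs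

theorem norm_vker_le {p₁ p₂ : 𝔸} {μ : ℂ} (hμ : μ.re ≤ 0) {s : ℝ} (hs : 0 ≤ s) :
    ‖vker p₁ p₂ μ s‖ ≤ ‖p₁‖ + ‖p₂‖ := by
  refine (norm_add_le _ _).trans ?_
  rw [norm_smul]
  gcongr
  exact mul_le_of_le_one_left (norm_nonneg _) (norm_exp_mul_le_one hμ hs)

theorem continuous_vker (p₁ p₂ : 𝔸) (μ : ℂ) : Continuous (vker p₁ p₂ μ) := by
  unfold vker; fun_prop

theorem integrableOn_exp_smul {μ : ℂ} (hμ : μ.re ≤ 0) {f : ℝ → 𝔸} (hf : Continuous f) {x : ℝ}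
    (hi : IntegrableOn f (Iic x)) :
    IntegrableOn (fun y : ℝ => Complex.exp (-(μ * y)) • f y) (Iic x) := by
  refine Integrable.mono' (g := fun y => Real.exp (-(μ.re * x)) * ‖f y‖) (hi.norm.const_mul _)
    (Continuous.aestronglyMeasurable (by fun_prop)) ?_
  filter_upwards [ae_restrict_mem measurableSet_Iic] with y hy
  rw [norm_smul, Complex.norm_exp]
  gcongr
  simp only [Complex.neg_re, Complex.mul_re, Complex.ofReal_re, Complex.ofReal_im, mul_zero,
    sub_zero]
  nlinarith [mem_Iic.1 hy]

variable [CompleteSpace 𝔸]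

/-- Splitting the convolution with the Volterra kernel. -/
theorem integral_vker_mul {p₁ p₂ : 𝔸} {μ : ℂ} (hμ : μ.re ≤ 0) {f : ℝ → 𝔸} (hf : Continuous f)
    {x : ℝ} (hi : IntegrableOn f (Iic x)) :
    ∫ y in Iic x, vker p₁ p₂ μ (x - y) * f y =
      p₁ * (∫ y in Iic x, f y) +
        Complex.exp (μ * x) • (p₂ * ∫ y in Iic x, Complex.exp (-(μ * y)) • f y) := by
  have h1 := integrableOn_exp_smul hμ hf hi
  have e : ∀ y : ℝ, vker p₁ p₂ μ (x - y) * f y =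
      p₁ * f y + Complex.exp (μ * x) • (p₂ * (Complex.exp (-(μ * y)) • f y)) := fun y => by
    simp only [vker, add_mul, smul_mul_assoc, mul_smul_comm, smul_smul, ← Complex.exp_add]
    congr 3
    push_cast; ring
  simp_rw [e]
  refine (integral_add (hi.const_mul p₁)
    ((h1.const_mul p₂).smul (Complex.exp (μ * x)))).trans ?_
  simp only [Pi.smul_apply]
  rw [integral_smul]
  congr 1
  · exact integral_const_mul_of_integrable hi
  · congr 1; exact integral_const_mul_of_integrable h1

/-- Only the p₂ part of the convolution carries the factor e^{μx}, so differentiating that factor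
returns μ times this part, which is the whole convolution minus its p₁ part. -/
theorem hasDerivAt_integral_vker_mul {p₁ p₂ : 𝔸} {μ : ℂ} (hμ : μ.re ≤ 0) {f : ℝ → 𝔸}
    (hf : Continuous f) (hi : ∀ x, IntegrableOn f (Iic x)) (x : ℝ) :
    HasDerivAt (fun x => ∫ y in Iic x, vker p₁ p₂ μ (x - y) * f y)
      ((p₁ + p₂) * f x + μ • ((∫ y in Iic x, vker p₁ p₂ μ (x - y) * f y) -
        p₁ * ∫ y in Iic x, f y)) x := by
  have e := fun x => integral_vker_mul (p₁ := p₁) (p₂ := p₂) hμ hf (hi x)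
  have h1 := (hasDerivAt_integral_Iic hf hi x).const_mul p₁
  have h2 := (hasDerivAt_integral_Iic (f := fun y : ℝ => Complex.exp (-(μ * y)) • f y)
    (by fun_prop) (fun x => integrableOn_exp_smul hμ hf (hi x)) x).const_mul p₂
  have h3 : HasDerivAt (fun x : ℝ => Complex.exp (μ * x)) (Complex.exp (μ * x) * μ) x := by
    have := (((Complex.ofRealCLM.hasDerivAt (x := x)).const_mul μ)).cexp
    simpa using this
  have h4 := h1.add (h3.smul h2)
  have h5 := h4.congr_of_eventuallyEq (Eventually.of_forall e)
  refine h5.congr_deriv ?_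
  rw [e x, add_sub_cancel_left, add_mul, mul_smul_comm, smul_smul, ← Complex.exp_add,
    add_neg_cancel, Complex.exp_zero, one_smul, smul_smul, mul_comm μ (Complex.exp _), add_assoc]

theorem continuous_integral_vker_mul {p₁ p₂ : 𝔸} {μ : ℂ} (hμ : μ.re ≤ 0) {f : ℝ → 𝔸}
    (hf : Continuous f) (hi : ∀ x, IntegrableOn f (Iic x)) :
    Continuous (fun x => ∫ y in Iic x, vker p₁ p₂ μ (x - y) * f y) :=
  continuous_iff_continuousAt.2 fun x => (hasDerivAt_integral_vker_mul hμ hf hi x).continuousAt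

theorem norm_integral_vker_mul_le {p₁ p₂ : 𝔸} {μ : ℂ} (hμ : μ.re ≤ 0) {C : ℝ}
    (hC : ‖p₁‖ + ‖p₂‖ ≤ C) {f : ℝ → 𝔸} {x : ℝ} {g : ℝ → ℝ} (hg : IntegrableOn g (Iic x))
    (hfg : ∀ y ≤ x, ‖f y‖ ≤ g y) :
    ‖∫ y in Iic x, vker p₁ p₂ μ (x - y) * f y‖ ≤ C * ∫ y in Iic x, g y := by
  rw [← integral_const_mul]
  refine norm_integral_le_of_norm_le (hg.const_mul C) ?_
  filter_upwards [ae_restrict_mem measurableSet_Iic] with y hy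
  refine (norm_mul_le _ _).trans ?_
  have := (norm_vker_le (p₁ := p₁) (p₂ := p₂) hμ (sub_nonneg.2 hy)).trans hC
  exact mul_le_mul this (hfg y hy) (norm_nonneg _) ((norm_nonneg _).trans this)

variable {V : ℝ → 𝔸}

theorem vmass_nonneg (x : ℝ) : 0 ≤ vmass V x := integral_nonneg fun _ => norm_nonneg _

theorem vmass_mono (hVi : ∀ x, IntegrableOn V (Iic x)) : Monotone (vmass V) := fun _ y h =>
  setIntegral_mono_set (hVi y).norm (Eventually.of_forall fun _ => norm_nonneg _)
    (Iic_subset_Iic.2 h).eventuallyLE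

theorem hasDerivAt_vmass (hV : Continuous V) (hVi : ∀ x, IntegrableOn V (Iic x)) (x : ℝ) :
    HasDerivAt (vmass V) ‖V x‖ x :=
  hasDerivAt_integral_Iic hV.norm (fun x => (hVi x).norm) x

theorem continuous_vmass (hV : Continuous V) (hVi : ∀ x, IntegrableOn V (Iic x)) :
    Continuous (vmass V) :=
  continuous_iff_continuousAt.2 fun x => (hasDerivAt_vmass hV hVi x).continuousAt

theorem tendsto_vmass (hVi : ∀ x, IntegrableOn V (Iic x)) : Tendsto (vmass V) atBot (𝓝 0) :=
  tendsto_integral_Iic_atBot (hVi 0).norm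

theorem integrableOn_mass_exp (hV : Continuous V) (hVi : ∀ x, IntegrableOn V (Iic x)) {C : ℝ}
    (hC : 0 ≤ C) (x : ℝ) :
    IntegrableOn (fun y => ‖V y‖ * Real.exp (2 * C * vmass V y)) (Iic x) := by
  have hc := continuous_vmass hV hVi
  refine Integrable.mono' (g := fun y => ‖V y‖ * Real.exp (2 * C * vmass V x))
    ((hVi x).norm.mul_const _) (Continuous.aestronglyMeasurable (by fun_prop)) ?_
  filter_upwards [ae_restrict_mem measurableSet_Iic] with y hy
  rw [Real.norm_of_nonneg (by positivity)]
  gcongr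
  exact vmass_mono hVi hy

/-- The weight e^{2Cv}, v the accumulated mass, is its own tool: 2C‖V‖e^{2Cv} is its derivative, so
one Volterra step gains a factor 1/2. This makes the Picard series geometric. -/
theorem integral_mass_exp_le (hV : Continuous V) (hVi : ∀ x, IntegrableOn V (Iic x)) {C : ℝ}
    (hC : 0 ≤ C) (x : ℝ) :
    C * ∫ y in Iic x, ‖V y‖ * Real.exp (2 * C * vmass V y) ≤ Real.exp (2 * C * vmass V x) / 2 := by
  have h1 : ∀ y ∈ Iic x, HasDerivAt (fun y => Real.exp (2 * C * vmass V y))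
      (2 * C * (‖V y‖ * Real.exp (2 * C * vmass V y))) y := fun y _ => by
    convert ((hasDerivAt_vmass hV hVi y).const_mul (2 * C)).exp using 1; ring
  have h2 : Tendsto (fun y => Real.exp (2 * C * vmass V y)) atBot (𝓝 1) := by
    have := ((tendsto_vmass hVi).const_mul (2 * C)).rexp
    simpa using this
  have h3 := integral_Iic_of_hasDerivAt_of_tendsto' h1
    ((integrableOn_mass_exp hV hVi hC x).const_mul _) h2
  rw [integral_const_mul] at h3
  linarith

variable {p₁ p₂ e : 𝔸} {μ : ℂ}

/-- Continuity and bound are proved together: continuity of the next iterate needs integrability of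
V times the present one, which comes from its bound. -/
theorem picard_aux (hV : Continuous V) (hVi : ∀ x, IntegrableOn V (Iic x)) (hμ : μ.re ≤ 0)
    {C : ℝ} (hC : ‖p₁‖ + ‖p₂‖ ≤ C) (n : ℕ) :
    Continuous (picard p₁ p₂ μ V e n) ∧
      ∀ x, ‖picard p₁ p₂ μ V e n x‖ ≤ ‖e‖ * (1 / 2) ^ n * Real.exp (2 * C * vmass V x) := by
  have hC0 : 0 ≤ C := (by positivity : 0 ≤ ‖p₁‖ + ‖p₂‖).trans hC
  induction n with
  | zero =>
    refine ⟨continuous_const, fun x => ?_⟩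
    have : 1 ≤ Real.exp (2 * C * vmass V x) :=
      Real.one_le_exp (mul_nonneg (by positivity) (vmass_nonneg x))
    simpa [picard] using le_mul_of_one_le_right (norm_nonneg e) this
  | succ n ih =>
    obtain ⟨h1, h2⟩ := ih
    have hg := fun x => (integrableOn_mass_exp hV hVi hC0 x).const_mul (‖e‖ * (1 / 2) ^ n)
    have hb : ∀ y, ‖V y * picard p₁ p₂ μ V e n y‖ ≤
        ‖e‖ * (1 / 2) ^ n * (‖V y‖ * Real.exp (2 * C * vmass V y)) := fun y => by
      refine (norm_mul_le _ _).trans ((mul_le_mul_of_nonneg_left (h2 y) (norm_nonneg _)).trans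
        (le_of_eq (by ring)))
    constructor
    · refine continuous_integral_vker_mul hμ (hV.mul h1) fun x => ?_
      exact Integrable.mono' (hg x) (hV.mul h1).aestronglyMeasurable (Eventually.of_forall hb)
    · intro x
      have h3 := norm_integral_vker_mul_le (p₁ := p₁) (p₂ := p₂) hμ hC (hg x) fun y _ => hb y
      rw [integral_const_mul] at h3
      have h4 := integral_mass_exp_le hV hVi hC0 x
      calc _ ≤ _ := h3
        _ = ‖e‖ * (1 / 2) ^ n * (C * ∫ y in Iic x, ‖V y‖ * Real.exp (2 * C * vmass V y)) := by ring
        _ ≤ ‖e‖ * (1 / 2) ^ n * (Real.exp (2 * C * vmass V x) / 2) := by gcongr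
        _ = _ := by ring

theorem continuous_picard (hV : Continuous V) (hVi : ∀ x, IntegrableOn V (Iic x))
    (hμ : μ.re ≤ 0) (n : ℕ) : Continuous (picard p₁ p₂ μ V e n) :=
  (picard_aux hV hVi hμ le_rfl n).1

theorem norm_picard_le (hV : Continuous V) (hVi : ∀ x, IntegrableOn V (Iic x)) (hμ : μ.re ≤ 0)
    {C : ℝ} (hC : ‖p₁‖ + ‖p₂‖ ≤ C) (n : ℕ) (x : ℝ) :
    ‖picard p₁ p₂ μ V e n x‖ ≤ ‖e‖ * (1 / 2) ^ n * Real.exp (2 * C * vmass V x) :=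
  (picard_aux hV hVi hμ hC n).2 x

theorem summable_picard (hV : Continuous V) (hVi : ∀ x, IntegrableOn V (Iic x)) (hμ : μ.re ≤ 0)
    (x : ℝ) : Summable fun n => picard p₁ p₂ μ V e n x := by
  refine Summable.of_norm_bounded (g := fun n : ℕ => ‖e‖ * (1 / 2) ^ n *
    Real.exp (2 * (‖p₁‖ + ‖p₂‖) * vmass V x)) ?_ fun n => norm_picard_le hV hVi hμ le_rfl n x
  exact ((summable_geometric_two).mul_left _).mul_right _

theorem norm_volt_le (hV : Continuous V) (hVi : ∀ x, IntegrableOn V (Iic x)) (hμ : μ.re ≤ 0)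
    {C : ℝ} (hC : ‖p₁‖ + ‖p₂‖ ≤ C) (x : ℝ) :
    ‖volt p₁ p₂ μ V e x‖ ≤ 2 * ‖e‖ * Real.exp (2 * C * vmass V x) := by
  have h : HasSum (fun n : ℕ => ‖e‖ * (1 / 2) ^ n * Real.exp (2 * C * vmass V x))
      (‖e‖ * 2 * Real.exp (2 * C * vmass V x)) :=
    (hasSum_geometric_two.mul_left _).mul_right _
  exact (tsum_of_norm_bounded h fun n => norm_picard_le hV hVi hμ hC n x).trans
    (le_of_eq (by ring))

theorem continuous_volt (hV : Continuous V) (hVi : ∀ x, IntegrableOn V (Iic x))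
    (hμ : μ.re ≤ 0) : Continuous (volt p₁ p₂ μ V e) := by
  rw [continuous_iff_continuousAt]
  intro x
  -- The mass may grow without bound to the right, so uniform convergence is available only on left
  -- half lines.
  have : ContinuousOn (volt p₁ p₂ μ V e) (Iio (x + 1)) := by
    refine continuousOn_tsum (u := fun n : ℕ => ‖e‖ * (1 / 2) ^ n *
      Real.exp (2 * (‖p₁‖ + ‖p₂‖) * vmass V (x + 1)))
      (fun n => (continuous_picard hV hVi hμ n).continuousOn)
      (((summable_geometric_two).mul_left _).mul_right _) fun n y hy => ?_
    refine (norm_picard_le hV hVi hμ le_rfl n y).trans ?_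
    gcongr
    exact vmass_mono hVi (le_of_lt hy)
  exact this.continuousAt (Iio_mem_nhds (by linarith))

theorem integrableOn_mul_of_bound (hV : Continuous V) (hVi : ∀ x, IntegrableOn V (Iic x))
    {M : ℝ → 𝔸} (hM : Continuous M) {B x : ℝ} (hB : ∀ y ≤ x, ‖M y‖ ≤ B) :
    IntegrableOn (fun y => V y * M y) (Iic x) := by
  refine Integrable.mono' ((hVi x).norm.mul_const B) (hV.mul hM).aestronglyMeasurable ?_
  filter_upwards [ae_restrict_mem measurableSet_Iic] with y hy
  exact (norm_mul_le _ _).trans (mul_le_mul_of_nonneg_left (hB y hy) (norm_nonneg _))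

theorem norm_volt_le_of_le (hV : Continuous V) (hVi : ∀ x, IntegrableOn V (Iic x))
    (hμ : μ.re ≤ 0) {x y : ℝ} (hy : y ≤ x) :
    ‖volt p₁ p₂ μ V e y‖ ≤ 2 * ‖e‖ * Real.exp (2 * (‖p₁‖ + ‖p₂‖) * vmass V x) := by
  refine (norm_volt_le hV hVi hμ le_rfl y).trans ?_
  gcongr
  exact vmass_mono hVi hy

theorem integrableOn_mul_volt (hV : Continuous V) (hVi : ∀ x, IntegrableOn V (Iic x))
    (hμ : μ.re ≤ 0) (x : ℝ) : IntegrableOn (fun y => V y * volt p₁ p₂ μ V e y) (Iic x) :=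
  integrableOn_mul_of_bound hV hVi (continuous_volt hV hVi hμ)
    fun _ hy => norm_volt_le_of_le hV hVi hμ hy

/-- The Volterra integral equation. -/
theorem volt_eq (hV : Continuous V) (hVi : ∀ x, IntegrableOn V (Iic x)) (hμ : μ.re ≤ 0) (x : ℝ) :
    volt p₁ p₂ μ V e x =
      e + ∫ y in Iic x, vker p₁ p₂ μ (x - y) * (V y * volt p₁ p₂ μ V e y) := by
  have hs := fun y => summable_picard (p₁ := p₁) (p₂ := p₂) (e := e) hV hVi hμ y
  rw [volt, (hs x).tsum_eq_zero_add]
  congr 1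
  have e1 : ∀ y, vker p₁ p₂ μ (x - y) * (V y * volt p₁ p₂ μ V e y) =
      ∑' n, vker p₁ p₂ μ (x - y) * (V y * picard p₁ p₂ μ V e n y) := fun y => by
    rw [((hs y).mul_left (V y)).tsum_mul_left, (hs y).tsum_mul_left, volt]
  simp_rw [e1]
  set C := ‖p₁‖ + ‖p₂‖ with hCdef
  have hC0 : 0 ≤ C := by positivity
  have hb : ∀ n, ∀ y ∈ Iic x, ‖vker p₁ p₂ μ (x - y) * (V y * picard p₁ p₂ μ V e n y)‖ ≤
      (C * ‖e‖ * (‖V y‖ * Real.exp (2 * C * vmass V y))) * (1 / 2) ^ n := fun n y hy => by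
    refine (norm_mul_le _ _).trans ?_
    have h1 := norm_vker_le (p₁ := p₁) (p₂ := p₂) hμ (sub_nonneg.2 hy)
    have h2 := (norm_mul_le (V y) (picard p₁ p₂ μ V e n y)).trans
      (mul_le_mul_of_nonneg_left (norm_picard_le hV hVi hμ le_rfl n y) (norm_nonneg _))
    exact (mul_le_mul h1 h2 (norm_nonneg _) hC0).trans (le_of_eq (by ring))
  have hg := (integrableOn_mass_exp hV hVi hC0 x).const_mul (C * ‖e‖)
  have hF : ∀ n, IntegrableOn (fun y => vker p₁ p₂ μ (x - y) * (V y * picard p₁ p₂ μ V e n y))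
      (Iic x) := fun n => by
    have := continuous_vker p₁ p₂ μ
    have := continuous_picard (p₁ := p₁) (p₂ := p₂) (e := e) hV hVi hμ n
    refine Integrable.mono' (hg.mul_const ((1 / 2) ^ n))
      (Continuous.aestronglyMeasurable (by fun_prop)) ?_
    filter_upwards [ae_restrict_mem measurableSet_Iic] with y hy using hb n y hy
  -- Interchange of sum and integral, justified by the geometric factor and the integrable weight.
  refine (hasSum_integral_of_summable_integral_norm hF ?_).tsum_eq
  refine Summable.of_nonneg_of_le (fun n => integral_nonneg fun _ => norm_nonneg _) (fun n => ?_)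
    (summable_geometric_two.mul_left
      (∫ y in Iic x, C * ‖e‖ * (‖V y‖ * Real.exp (2 * C * vmass V y))))
  rw [← integral_mul_const]
  refine setIntegral_mono_on (hF n).norm (hg.mul_const _) measurableSet_Iic fun y hy => hb n y hy

theorem tendsto_volt (hV : Continuous V) (hVi : ∀ x, IntegrableOn V (Iic x)) (hμ : μ.re ≤ 0) :
    Tendsto (volt p₁ p₂ μ V e) atBot (𝓝 e) := by
  set B := 2 * ‖e‖ * Real.exp (2 * (‖p₁‖ + ‖p₂‖) * vmass V 0)
  have h : ∀ᶠ x in atBot, ‖volt p₁ p₂ μ V e x - e‖ ≤ (‖p₁‖ + ‖p₂‖) * (vmass V x * B) := by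
    filter_upwards [eventually_le_atBot 0] with x hx
    rw [volt_eq hV hVi hμ x, add_sub_cancel_left, vmass, ← integral_mul_const]
    refine norm_integral_vker_mul_le hμ le_rfl ((hVi x).norm.mul_const B) fun y hy => ?_
    exact (norm_mul_le _ _).trans (mul_le_mul_of_nonneg_left
      (norm_volt_le_of_le hV hVi hμ (hy.trans hx)) (norm_nonneg _))
  rw [tendsto_iff_norm_sub_tendsto_zero]
  refine squeeze_zero' (Eventually.of_forall fun _ => norm_nonneg _) h ?_
  simpa using ((tendsto_vmass hVi).mul_const B).const_mul (‖p₁‖ + ‖p₂‖)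

/-- The Volterra solution solves the differential equation. -/
theorem hasDerivAt_volt (hV : Continuous V) (hVi : ∀ x, IntegrableOn V (Iic x)) (hμ : μ.re ≤ 0)
    (h1 : p₁ + p₂ = 1) (h2 : p₂ * p₁ = 0) (he : p₂ * e = 0) (x : ℝ) :
    HasDerivAt (volt p₁ p₂ μ V e)
      (V x * volt p₁ p₂ μ V e x + μ • (p₂ * volt p₁ p₂ μ V e x)) x := by
  have hf : Continuous fun y => V y * volt p₁ p₂ μ V e y :=
    hV.mul (continuous_volt (p₁ := p₁) (p₂ := p₂) (e := e) hV hVi hμ)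
  have hi := integrableOn_mul_volt (p₁ := p₁) (p₂ := p₂) (e := e) hV hVi hμ
  have h3 := (hasDerivAt_integral_vker_mul (p₁ := p₁) (p₂ := p₂) hμ hf hi x).const_add e
  have h4 := h3.congr_of_eventuallyEq (Eventually.of_forall (volt_eq hV hVi hμ))
  have h22 : p₂ * p₂ = p₂ := by
    have := congrArg (p₂ * ·) h1
    simpa [mul_add, h2] using this
  refine h4.congr_deriv ?_
  rw [h1, one_mul]
  congr 2
  conv_rhs => rw [volt_eq hV hVi hμ x]
  -- Here p₂ annihilates both the initial value and the p₁ part, so p₂ applied to the solution is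
  -- exactly the oscillating part of the integral.
  rw [mul_add, he, zero_add, integral_vker_mul hμ hf (hi x), mul_add, ← mul_assoc, h2, zero_mul,
    zero_add, add_sub_cancel_left, mul_smul_comm, ← mul_assoc, h22]

/-- Uniqueness for the homogeneous Volterra problem. -/
theorem eq_zero_of_hasDerivAt (hV : Continuous V) (hVi : ∀ x, IntegrableOn V (Iic x))
    (hμ : μ.re ≤ 0) (h1 : p₁ + p₂ = 1) (h2 : p₂ * p₁ = 0) {D : ℝ → 𝔸}
    (hD : ∀ x, HasDerivAt D (V x * D x + μ • (p₂ * D x)) x) (h0 : Tendsto D atBot (𝓝 0)) :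
    D = 0 := by
  have hDc : Continuous D := continuous_iff_continuousAt.2 fun x => (hD x).continuousAt
  have h22 : p₂ * p₂ = p₂ := by
    have := congrArg (p₂ * ·) h1
    simpa [mul_add, h2] using this
  have h12 : p₁ * p₂ = 0 := by
    have := congrArg (· * p₂) h1
    simpa [add_mul, h22] using this
  have hbd : ∀ x, ∃ B, ∀ y ≤ x, ‖D y‖ ≤ B := fun x => by
    obtain ⟨a, ha⟩ := (h0.norm.eventually (gt_mem_nhds (by simp : ‖(0 : 𝔸)‖ < 1))).exists_forall_of_atBot
    obtain ⟨B, hB⟩ := isCompact_Icc.exists_bound_of_continuousOn (s := Icc a x) hDc.continuousOn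
    refine ⟨max 1 B, fun y hy => ?_⟩
    rcases le_total y a with h | h
    · exact (ha y h).le.trans (le_max_left _ _)
    · exact (hB y ⟨h, hy⟩).trans (le_max_right _ _)
  set C := ‖p₁‖ + ‖p₂‖ with hCdef
  have hC0 : 0 ≤ C := by positivity
  -- The derivative of K(x-y)D(y) in y loses its μ terms, because the kernel and the equation
  -- produce them with opposite signs. Integrating from -∞ to x leaves the boundary value (p₁ +
  -- p₂)D(x) = D(x).
  have hint : ∀ x, D x = ∫ y in Iic x, vker p₁ p₂ μ (x - y) * (V y * D y) := fun x => by
    obtain ⟨B, hB⟩ := hbd x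
    have hi := integrableOn_mul_of_bound hV hVi hDc hB
    have hvc := continuous_vker p₁ p₂ μ
    have key : ∀ y ∈ Iic x, HasDerivAt (fun y : ℝ => vker p₁ p₂ μ (x - y) * D y)
        (vker p₁ p₂ μ (x - y) * (V y * D y)) y := fun y _ => by
      have h3 : HasDerivAt (fun y : ℝ => Complex.exp (μ * ((x - y : ℝ) : ℂ)))
          (Complex.exp (μ * ((x - y : ℝ) : ℂ)) * (-μ)) y := by
        have := ((((hasDerivAt_id y).const_sub x).ofReal_comp).const_mul μ).cexp
        simpa using this
      have h4 := ((h3.smul_const p₂).const_add p₁).mul (hD y)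
      refine h4.congr_deriv ?_
      simp only [vker, mul_add, add_mul, smul_mul_assoc, mul_smul_comm, ← mul_assoc, h12, h22,
        smul_smul, zero_add, mul_neg, neg_smul]
      rw [mul_comm μ (Complex.exp _), neg_mul, smul_mul_assoc]
      abel
    have hlim : Tendsto (fun y : ℝ => vker p₁ p₂ μ (x - y) * D y) atBot (𝓝 0) := by
      rw [tendsto_zero_iff_norm_tendsto_zero]
      refine squeeze_zero' (Eventually.of_forall fun _ => norm_nonneg _)
        (g := fun y => C * ‖D y‖) ?_ (by simpa using h0.norm.const_mul C)
      filter_upwards [eventually_le_atBot x] with y hy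
      refine (norm_mul_le _ _).trans (mul_le_mul_of_nonneg_right
        (norm_vker_le hμ (sub_nonneg.2 hy)) (norm_nonneg _))
    have hii : IntegrableOn (fun y => vker p₁ p₂ μ (x - y) * (V y * D y)) (Iic x) := by
      refine Integrable.mono' (hi.norm.const_mul C)
        (Continuous.aestronglyMeasurable (by fun_prop)) ?_
      filter_upwards [ae_restrict_mem measurableSet_Iic] with y hy
      exact (norm_mul_le _ _).trans (mul_le_mul_of_nonneg_right
        (norm_vker_le hμ (sub_nonneg.2 hy)) (norm_nonneg _))
    rw [integral_Iic_of_hasDerivAt_of_tendsto' key hii hlim]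
    simp [vker, h1]
  -- Each substitution of the homogeneous equation into itself halves the weighted bound, which
  -- forces D = 0.
  have hiter : ∀ x B, (∀ y ≤ x, ‖D y‖ ≤ B) → 0 ≤ B → ∀ n : ℕ, ∀ y ≤ x,
      ‖D y‖ ≤ B * (1 / 2) ^ n * Real.exp (2 * C * vmass V y) := by
    intro x B hB hB0 n
    induction n with
    | zero =>
      intro y hy
      have : 1 ≤ Real.exp (2 * C * vmass V y) :=
        Real.one_le_exp (mul_nonneg (by positivity) (vmass_nonneg y))
      simpa using (hB y hy).trans (le_mul_of_one_le_right hB0 this)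
    | succ n ih =>
      intro y hy
      rw [hint y]
      have hg := (integrableOn_mass_exp hV hVi hC0 y).const_mul (B * (1 / 2) ^ n)
      have h3 := norm_integral_vker_mul_le (p₁ := p₁) (p₂ := p₂) hμ le_rfl hg
        (f := fun y => V y * D y) fun u hu => (norm_mul_le _ _).trans
          ((mul_le_mul_of_nonneg_left (ih u (hu.trans hy)) (norm_nonneg _)).trans
            (le_of_eq (by ring)))
      rw [integral_const_mul] at h3
      have h4 := integral_mass_exp_le hV hVi hC0 y
      calc _ ≤ _ := h3
        _ = B * (1 / 2) ^ n * (C * ∫ y in Iic y, ‖V y‖ * Real.exp (2 * C * vmass V y)) := by ring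
        _ ≤ B * (1 / 2) ^ n * (Real.exp (2 * C * vmass V y) / 2) := by gcongr
        _ = _ := by ring
  funext x
  obtain ⟨B, hB⟩ := hbd x
  have hB0 : 0 ≤ B := (norm_nonneg _).trans (hB x le_rfl)
  have hl : Tendsto (fun n : ℕ => B * (1 / 2 : ℝ) ^ n * Real.exp (2 * C * vmass V x)) atTop
      (𝓝 0) := by
    have := ((tendsto_pow_atTop_nhds_zero_of_lt_one (by norm_num : (0 : ℝ) ≤ 1 / 2)
      (by norm_num)).const_mul B).mul_const (Real.exp (2 * C * vmass V x))
    simpa using this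
  have := ge_of_tendsto' hl fun n => hiter x B hB hB0 n x le_rfl
  simpa using this

end Volterra

/-! ### Dependence of Volterra solutions on the spectral parameter -/

section VolterraParameter

open Set

/-- A dominated integral of holomorphic functions is holomorphic. -/
theorem differentiableOn_integral_of_dominated {E α : Type*} [NormedAddCommGroup E]
    [NormedSpace ℂ E] [MeasurableSpace α] {ν : Measure α} {F : ℂ → α → E} {U : Set ℂ}
    (hU : IsOpen U) {bound : α → ℝ}
    (hm : ∀ z ∈ U, AEStronglyMeasurable (F z) ν) (hb : ∀ᵐ y ∂ν, ∀ z ∈ U, ‖F z y‖ ≤ bound y)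
    (hi : Integrable bound ν) (hd : ∀ᵐ y ∂ν, DifferentiableOn ℂ (F · y) U) :
    DifferentiableOn ℂ (fun z => ∫ y, F z y ∂ν) U := by
  intro z₀ hz₀
  obtain ⟨r, hr, hrU⟩ := Metric.isOpen_iff.1 hU z₀ hz₀
  have hsub : ∀ z ∈ Metric.ball z₀ (r / 2), Metric.closedBall z (r / 4) ⊆ U := fun z hz w hw => by
    refine hrU ?_
    have h1 := Metric.mem_ball.1 hz
    have h2 := Metric.mem_closedBall.1 hw
    have h3 := dist_triangle w z z₀
    exact Metric.mem_ball.2 (by linarith)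
  have hlim : ∀ᵐ y ∂ν, HasDerivAt (F · y) (deriv (F · y) z₀) z₀ := by
    filter_upwards [hd] with y hy
    exact (hy.differentiableAt (hU.mem_nhds hz₀)).hasDerivAt
  -- A fixed sequence of increments: the z-derivative of the integrand is measurable in y as an
  -- almost everywhere limit of difference quotients.
  have hseq : Tendsto (fun n : ℕ => (((r / 2) / (n + 1) : ℝ) : ℂ)) atTop (𝓝[≠] 0) := by
    rw [tendsto_nhdsWithin_iff]
    constructor
    · have : Tendsto (fun n : ℕ => ((r / 2) / (n + 1) : ℝ)) atTop (𝓝 0) := by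
        have := tendsto_one_div_add_atTop_nhds_zero_nat (𝕜 := ℝ)
        simpa [div_eq_mul_inv] using this.const_mul (r / 2)
      exact (Complex.continuous_ofReal.tendsto' 0 0 (by simp)).comp this
    · refine Eventually.of_forall fun n => ?_
      have : (0 : ℝ) < (r / 2) / (n + 1) := by positivity
      exact Complex.ofReal_ne_zero.2 this.ne'
  have hz1 : ∀ n : ℕ, z₀ + (((r / 2) / (n + 1) : ℝ) : ℂ) ∈ U := fun n => by
    refine hrU (Metric.mem_ball.2 ?_)
    have h0 : (0 : ℝ) < (r / 2) / (n + 1) := by positivity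
    have h1 : (r / 2) / (n + 1 : ℝ) ≤ r / 2 := div_le_self (by positivity) (by linarith [n.cast_nonneg (α := ℝ)])
    rw [dist_eq_norm, add_sub_cancel_left, Complex.norm_real, Real.norm_of_nonneg h0.le]
    linarith
  -- Cauchy's estimate on circles of radius r/4 converts the bound on the integrand into the bound
  -- `bound y / (r / 4)` on its derivative.
  have key := hasDerivAt_integral_of_dominated_loc_of_deriv_le (𝕜 := ℂ) (F := F) (x₀ := z₀)
    (s := Metric.ball z₀ (r / 2)) (μ := ν) (F' := fun z y => deriv (F · y) z)
    (bound := fun y => bound y / (r / 4)) (Metric.ball_mem_nhds _ (by positivity))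
    (by filter_upwards [hU.mem_nhds hz₀] with z hz using hm z hz)
    (Integrable.mono' hi (hm z₀ hz₀) (hb.mono fun y hy => hy z₀ hz₀))
    (by
      refine aestronglyMeasurable_of_tendsto_ae atTop
        (f := fun (n : ℕ) y => ((((r / 2) / (n + 1) : ℝ) : ℂ))⁻¹ •
          (F (z₀ + (((r / 2) / (n + 1) : ℝ) : ℂ)) y - F z₀ y))
        (fun n => ((hm _ (hz1 n)).sub (hm z₀ hz₀)).const_smul _) ?_
      filter_upwards [hlim] with y hy
      exact (hasDerivAt_iff_tendsto_slope_zero.1 hy).comp hseq)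
    (by
      filter_upwards [hb, hd] with y hy hdy z hz
      refine Complex.norm_deriv_le_of_forall_mem_sphere_norm_le (by positivity) ?_ fun w hw =>
        hy w (hsub z hz (Metric.sphere_subset_closedBall hw))
      exact (hdy.mono (hsub z hz)).diffContOnCl_ball le_rfl)
    (hi.div_const _)
    (by
      filter_upwards [hd] with y hy z hz
      exact (hy.differentiableAt (hU.mem_nhds (hsub z hz (Metric.mem_closedBall_self
        (by positivity))))).hasDerivAt)
  exact key.2.differentiableAt.differentiableWithinAt

variable {𝔸 : Type*} [NormedRing 𝔸] [NormedAlgebra ℂ 𝔸] [CompleteSpace 𝔸]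
  {V : ℝ → 𝔸} {p₁ p₂ e : ℂ → 𝔸} {μ : ℂ → ℂ} {S U : Set ℂ} {C B : ℝ}

theorem norm_picard_integrand_le (hV : Continuous V) (hVi : ∀ x, IntegrableOn V (Iic x))
    (hμ : ∀ z ∈ S, (μ z).re ≤ 0) (hC : ∀ z ∈ S, ‖p₁ z‖ + ‖p₂ z‖ ≤ C) (hB : ∀ z ∈ S, ‖e z‖ ≤ B)
    (n : ℕ) {x y : ℝ} (hy : y ≤ x) {z : ℂ} (hz : z ∈ S) :
    ‖vker (p₁ z) (p₂ z) (μ z) (x - y) * (V y * picard (p₁ z) (p₂ z) (μ z) V (e z) n y)‖ ≤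
      C * B * Real.exp (2 * C * vmass V x) * ‖V y‖ := by
  have hC0 : 0 ≤ C := (by positivity : 0 ≤ ‖p₁ z‖ + ‖p₂ z‖).trans (hC z hz)
  have hB0 : 0 ≤ B := (norm_nonneg _).trans (hB z hz)
  have h1 := (norm_vker_le (hμ z hz) (sub_nonneg.2 hy)).trans (hC z hz)
  have h2 : ‖picard (p₁ z) (p₂ z) (μ z) V (e z) n y‖ ≤ B * Real.exp (2 * C * vmass V x) := by
    refine (norm_picard_le hV hVi (hμ z hz) (hC z hz) n y).trans ?_
    have h3 : ‖e z‖ * (1 / 2 : ℝ) ^ n ≤ B :=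
      (mul_le_of_le_one_right (norm_nonneg _) (pow_le_one₀ (by norm_num) (by norm_num))).trans
        (hB z hz)
    gcongr
    exact vmass_mono hVi hy
  calc _ ≤ _ := norm_mul_le _ _
    _ ≤ C * (‖V y‖ * (B * Real.exp (2 * C * vmass V x))) :=
      mul_le_mul h1 ((norm_mul_le _ _).trans (mul_le_mul_of_nonneg_left h2 (norm_nonneg _)))
        (norm_nonneg _) hC0
    _ = _ := by ring

theorem aestronglyMeasurable_picard_integrand (hV : Continuous V)
    (hVi : ∀ x, IntegrableOn V (Iic x)) {p₁ p₂ e : 𝔸} {μ : ℂ}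
    (hμ : μ.re ≤ 0) (n : ℕ) (x : ℝ) (ν : Measure ℝ) :
    AEStronglyMeasurable (fun y => vker p₁ p₂ μ (x - y) * (V y * picard p₁ p₂ μ V e n y)) ν := by
  have h1 := continuous_vker p₁ p₂ μ
  have h2 := continuous_picard (p₁ := p₁) (p₂ := p₂) (e := e) hV hVi hμ n
  exact Continuous.aestronglyMeasurable (by fun_prop)

theorem continuousOn_picard (hV : Continuous V) (hVi : ∀ x, IntegrableOn V (Iic x))
    (hμ : ∀ z ∈ S, (μ z).re ≤ 0) (hC : ∀ z ∈ S, ‖p₁ z‖ + ‖p₂ z‖ ≤ C) (hB : ∀ z ∈ S, ‖e z‖ ≤ B)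
    (h1 : ContinuousOn p₁ S) (h2 : ContinuousOn p₂ S) (he : ContinuousOn e S)
    (hμc : ContinuousOn μ S) (n : ℕ) (x : ℝ) :
    ContinuousOn (fun z => picard (p₁ z) (p₂ z) (μ z) V (e z) n x) S := by
  induction n generalizing x with
  | zero => exact he
  | succ n ih =>
    refine continuousOn_of_dominated (bound := fun y => C * B * Real.exp (2 * C * vmass V x) * ‖V y‖)
      (fun z hz => aestronglyMeasurable_picard_integrand hV hVi (hμ z hz) n x _)
      (fun z hz => ?_) ((hVi x).norm.const_mul _) ?_
    · filter_upwards [ae_restrict_mem measurableSet_Iic] with y hy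
      exact norm_picard_integrand_le hV hVi hμ hC hB n hy hz
    · refine Eventually.of_forall fun y => ?_
      have := ih y
      unfold vker
      fun_prop

theorem differentiableOn_picard (hV : Continuous V) (hVi : ∀ x, IntegrableOn V (Iic x))
    (hS : IsOpen S)
    (hμ : ∀ z ∈ S, (μ z).re ≤ 0) (hC : ∀ z ∈ S, ‖p₁ z‖ + ‖p₂ z‖ ≤ C) (hB : ∀ z ∈ S, ‖e z‖ ≤ B)
    (h1 : DifferentiableOn ℂ p₁ S) (h2 : DifferentiableOn ℂ p₂ S) (he : DifferentiableOn ℂ e S)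
    (hμc : DifferentiableOn ℂ μ S) (n : ℕ) (x : ℝ) :
    DifferentiableOn ℂ (fun z => picard (p₁ z) (p₂ z) (μ z) V (e z) n x) S := by
  induction n generalizing x with
  | zero => exact he
  | succ n ih =>
    refine differentiableOn_integral_of_dominated hS
      (bound := fun y => C * B * Real.exp (2 * C * vmass V x) * ‖V y‖)
      (fun z hz => aestronglyMeasurable_picard_integrand hV hVi (hμ z hz) n x _)
      ?_ ((hVi x).norm.const_mul _) ?_
    · filter_upwards [ae_restrict_mem measurableSet_Iic] with y hy z hz
      exact norm_picard_integrand_le hV hVi hμ hC hB n hy hz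
    · refine Eventually.of_forall fun y => ?_
      have h3 := ih y
      have h4 : DifferentiableOn ℂ (fun z => vker (p₁ z) (p₂ z) (μ z) (x - y)) S :=
        h1.add ((hμc.mul_const _).cexp.smul h2)
      exact h4.mul (h3.const_mul _)

theorem norm_picard_le_of_mem (hV : Continuous V) (hVi : ∀ x, IntegrableOn V (Iic x))
    (hμ : ∀ z ∈ S, (μ z).re ≤ 0) (hC : ∀ z ∈ S, ‖p₁ z‖ + ‖p₂ z‖ ≤ C) (hB : ∀ z ∈ S, ‖e z‖ ≤ B)
    (x : ℝ) (n : ℕ) (z : ℂ) (hz : z ∈ S) :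
    ‖picard (p₁ z) (p₂ z) (μ z) V (e z) n x‖ ≤
      B * (1 / 2) ^ n * Real.exp (2 * C * vmass V x) :=
  (norm_picard_le hV hVi (hμ z hz) (hC z hz) n x).trans (by gcongr; exact hB z hz)

/-- The projections blow up at λ = 0, so constants uniform in z exist only locally; this suffices
for continuity and holomorphy. -/
theorem locally_bounded (h1 : ContinuousOn p₁ S) (h2 : ContinuousOn p₂ S) (he : ContinuousOn e S)
    {z₀ : ℂ} (hz₀ : z₀ ∈ S) :
    ∃ O, IsOpen O ∧ z₀ ∈ O ∧ (∀ z ∈ S ∩ O, ‖p₁ z‖ + ‖p₂ z‖ ≤ ‖p₁ z₀‖ + ‖p₂ z₀‖ + 1) ∧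
      ∀ z ∈ S ∩ O, ‖e z‖ ≤ ‖e z₀‖ + 1 := by
  have h3 := ((h1 z₀ hz₀).norm.add (h2 z₀ hz₀).norm).eventually
    (gt_mem_nhds (show ‖p₁ z₀‖ + ‖p₂ z₀‖ < ‖p₁ z₀‖ + ‖p₂ z₀‖ + 1 by linarith))
  have h4 := (he z₀ hz₀).norm.eventually (gt_mem_nhds (show ‖e z₀‖ < ‖e z₀‖ + 1 by linarith))
  obtain ⟨O, hO, hz, hsub⟩ := mem_nhdsWithin.1 (h3.and h4)
  exact ⟨O, hO, hz, fun z hz => (hsub ⟨hz.2, hz.1⟩).1.le, fun z hz => (hsub ⟨hz.2, hz.1⟩).2.le⟩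

/-- The Volterra solution depends continuously on parameters. -/
theorem continuousOn_volt (hV : Continuous V) (hVi : ∀ x, IntegrableOn V (Iic x))
    (hμ : ∀ z ∈ S, (μ z).re ≤ 0) (h1 : ContinuousOn p₁ S) (h2 : ContinuousOn p₂ S)
    (he : ContinuousOn e S) (hμc : ContinuousOn μ S) (x : ℝ) :
    ContinuousOn (fun z => volt (p₁ z) (p₂ z) (μ z) V (e z) x) S := by
  intro z₀ hz₀
  obtain ⟨O, hO, hzO, hC, hB⟩ := locally_bounded h1 h2 he hz₀
  have hμ' : ∀ z ∈ S ∩ O, (μ z).re ≤ 0 := fun z hz => hμ z hz.1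
  have : ContinuousOn (fun z => volt (p₁ z) (p₂ z) (μ z) V (e z) x) (S ∩ O) :=
    continuousOn_tsum (fun n => continuousOn_picard hV hVi hμ' hC hB
        (h1.mono inter_subset_left) (h2.mono inter_subset_left) (he.mono inter_subset_left)
        (hμc.mono inter_subset_left) n x)
      (((summable_geometric_two).mul_left _).mul_right _)
      (fun n z hz => norm_picard_le_of_mem hV hVi hμ' hC hB x n z hz)
  exact (this z₀ ⟨hz₀, hzO⟩).mono_of_mem_nhdsWithin
    (inter_mem_nhdsWithin S (hO.mem_nhds hzO))

/-- The Volterra solution depends holomorphically on parameters. -/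
theorem differentiableOn_volt (hV : Continuous V) (hVi : ∀ x, IntegrableOn V (Iic x))
    (hS : IsOpen S) (hμ : ∀ z ∈ S, (μ z).re ≤ 0) (h1 : DifferentiableOn ℂ p₁ S)
    (h2 : DifferentiableOn ℂ p₂ S) (he : DifferentiableOn ℂ e S) (hμc : DifferentiableOn ℂ μ S)
    (x : ℝ) :
    DifferentiableOn ℂ (fun z => volt (p₁ z) (p₂ z) (μ z) V (e z) x) S := by
  intro z₀ hz₀
  obtain ⟨O, hO, hzO, hC, hB⟩ :=
    locally_bounded h1.continuousOn h2.continuousOn he.continuousOn hz₀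
  have hμ' : ∀ z ∈ S ∩ O, (μ z).re ≤ 0 := fun z hz => hμ z hz.1
  have : DifferentiableOn ℂ (fun z => volt (p₁ z) (p₂ z) (μ z) V (e z) x) (S ∩ O) :=
    Complex.differentiableOn_tsum_of_summable_norm
      (((summable_geometric_two).mul_left _).mul_right _)
      (fun n => differentiableOn_picard hV hVi (hS.inter hO) hμ' hC hB
        (h1.mono inter_subset_left) (h2.mono inter_subset_left) (he.mono inter_subset_left)
        (hμc.mono inter_subset_left) n x) (hS.inter hO)
      (fun n z hz => norm_picard_le_of_mem hV hVi hμ' hC hB x n z hz)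
  exact (this.differentiableAt ((hS.inter hO).mem_nhds ⟨hz₀, hzO⟩)).differentiableWithinAt

/-- If the first Picard iterate is at most `B` in norm, then the solution is `O(B)`-close to
its initial value. -/
theorem norm_volt_sub_le {p₁ p₂ e : 𝔸} {μ : ℂ} (hV : Continuous V)
    (hVi : ∀ x, IntegrableOn V (Iic x)) (hμ : μ.re ≤ 0) (hC : ‖p₁‖ + ‖p₂‖ ≤ C) {x : ℝ}
    (hB0 : 0 ≤ B) (hB : ∀ y ≤ x, ‖picard p₁ p₂ μ V e 1 y‖ ≤ B) :
    ‖volt p₁ p₂ μ V e x - e‖ ≤ 2 * B * Real.exp (2 * C * vmass V x) := by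
  have hC0 : 0 ≤ C := (by positivity : 0 ≤ ‖p₁‖ + ‖p₂‖).trans hC
  -- The weighted induction is restarted at the first iterate, so that its smallness propagates to
  -- all later ones.
  have hn : ∀ n : ℕ, ∀ y ≤ x, ‖picard p₁ p₂ μ V e (n + 1) y‖ ≤
      B * (1 / 2) ^ n * Real.exp (2 * C * vmass V y) := by
    intro n
    induction n with
    | zero =>
      intro y hy
      have : 1 ≤ Real.exp (2 * C * vmass V y) :=
        Real.one_le_exp (mul_nonneg (by positivity) (vmass_nonneg y))
      simpa using (hB y hy).trans (le_mul_of_one_le_right hB0 this)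
    | succ n ih =>
      intro y hy
      have hg := (integrableOn_mass_exp hV hVi hC0 y).const_mul (B * (1 / 2) ^ n)
      have h3 := norm_integral_vker_mul_le (p₁ := p₁) (p₂ := p₂) hμ hC hg
        (f := fun y => V y * picard p₁ p₂ μ V e (n + 1) y) fun u hu => (norm_mul_le _ _).trans
          ((mul_le_mul_of_nonneg_left (ih u (hu.trans hy)) (norm_nonneg _)).trans
            (le_of_eq (by ring)))
      rw [integral_const_mul] at h3
      have h4 := integral_mass_exp_le hV hVi hC0 y
      calc _ ≤ _ := h3
        _ = B * (1 / 2) ^ n * (C * ∫ y in Iic y, ‖V y‖ * Real.exp (2 * C * vmass V y)) := by ring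
        _ ≤ B * (1 / 2) ^ n * (Real.exp (2 * C * vmass V y) / 2) := by gcongr
        _ = _ := by ring
  rw [volt, (summable_picard hV hVi hμ x).tsum_eq_zero_add]
  simp only [picard, add_sub_cancel_left]
  have h : HasSum (fun n : ℕ => B * (1 / 2) ^ n * Real.exp (2 * C * vmass V x))
      (B * 2 * Real.exp (2 * C * vmass V x)) :=
    (hasSum_geometric_two.mul_left _).mul_right _
  exact (tsum_of_norm_bounded h fun n => hn n x le_rfl).trans (le_of_eq (by ring))

/-- If the first Picard iterates tend to zero pointwise along a filter of parameters, then the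
Volterra solutions tend to the limit of the initial values. -/
theorem tendsto_volt_parameter {l : Filter ℂ} [l.IsCountablyGenerated] (hV : Continuous V)
    (hVi : ∀ x, IntegrableOn V (Iic x))
    (hS : S ∈ l) (hμ : ∀ z ∈ S, (μ z).re ≤ 0) (hC : ∀ z ∈ S, ‖p₁ z‖ + ‖p₂ z‖ ≤ C)
    (hB : ∀ z ∈ S, ‖e z‖ ≤ B) {e₀ : 𝔸} (he : Tendsto e l (𝓝 e₀))
    (h1 : ∀ x, Tendsto (fun z => picard (p₁ z) (p₂ z) (μ z) V (e z) 1 x) l (𝓝 0)) (x : ℝ) :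
    Tendsto (fun z => volt (p₁ z) (p₂ z) (μ z) V (e z) x) l (𝓝 e₀) := by
  have hn : ∀ n x, Tendsto (fun z => picard (p₁ z) (p₂ z) (μ z) V (e z) (n + 1) x) l (𝓝 0) := by
    intro n
    induction n with
    | zero => exact h1
    | succ n ih =>
      intro x
      have : Tendsto (fun z => ∫ y in Iic x, vker (p₁ z) (p₂ z) (μ z) (x - y) *
          (V y * picard (p₁ z) (p₂ z) (μ z) V (e z) (n + 1) y)) l
          (𝓝 (∫ y in Iic x, (0 : 𝔸))) := by
        refine tendsto_integral_filter_of_dominated_convergence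
          (fun y => C * B * Real.exp (2 * C * vmass V x) * ‖V y‖) ?_ ?_
          ((hVi x).norm.const_mul _) ?_
        · filter_upwards [hS] with z hz
          exact aestronglyMeasurable_picard_integrand hV hVi (hμ z hz) (n + 1) x _
        · filter_upwards [hS] with z hz
          filter_upwards [ae_restrict_mem measurableSet_Iic] with y hy
          exact norm_picard_integrand_le hV hVi hμ hC hB (n + 1) hy hz
        · filter_upwards [ae_restrict_mem measurableSet_Iic] with y hy
          rw [tendsto_zero_iff_norm_tendsto_zero]
          refine squeeze_zero' (Eventually.of_forall fun _ => norm_nonneg _)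
            (g := fun z => C * (‖V y‖ * ‖picard (p₁ z) (p₂ z) (μ z) V (e z) (n + 1) y‖)) ?_ ?_
          · filter_upwards [hS] with z hz
            have h3 := (norm_vker_le (hμ z hz) (sub_nonneg.2 hy)).trans (hC z hz)
            exact (norm_mul_le _ _).trans (mul_le_mul h3 (norm_mul_le _ _) (norm_nonneg _)
              ((norm_nonneg _).trans h3))
          · simpa using ((ih y).norm.const_mul ‖V y‖).const_mul C
      rw [integral_zero] at this
      exact this
  -- In the limit only the zeroth term of the Picard series survives; the geometric bound permits
  -- the termwise limit.
  have h0 : ∑' n : ℕ, (if n = 0 then e₀ else 0) = e₀ := tsum_ite_eq 0 _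
  rw [← h0]
  refine tendsto_tsum_of_dominated_convergence
    (bound := fun n : ℕ => B * (1 / 2) ^ n * Real.exp (2 * C * vmass V x))
    (((summable_geometric_two).mul_left _).mul_right _) (fun n => ?_) ?_
  · cases n with
    | zero => exact he
    | succ n => simpa using hn n x
  · filter_upwards [hS] with z hz n
    exact norm_picard_le_of_mem hV hVi hμ hC hB x n z hz

end VolterraParameter

/-! ### A Riemann-Lebesgue lemma for complex frequencies -/

section RiemannLebesgue

open Set

variable {E : Type*} [NormedAddCommGroup E] [NormedSpace ℂ E] [CompleteSpace E]

theorem norm_integral_exp_smul_le {μ : ℂ} (hμ : μ.re ≤ 0) {f : ℝ → E} {x : ℝ}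
    (hi : IntegrableOn f (Iic x)) :
    ‖∫ y in Iic x, Complex.exp (μ * ((x - y : ℝ) : ℂ)) • f y‖ ≤ ∫ y in Iic x, ‖f y‖ := by
  refine norm_integral_le_of_norm_le hi.norm ?_
  filter_upwards [ae_restrict_mem measurableSet_Iic] with y hy
  rw [norm_smul]
  exact mul_le_of_le_one_left (norm_nonneg _) (norm_exp_mul_le_one hμ (sub_nonneg.2 hy))

theorem integrableOn_exp_sub_smul {μ : ℂ} (hμ : μ.re ≤ 0) {f : ℝ → E} {x : ℝ}
    (hi : IntegrableOn f (Iic x)) :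
    IntegrableOn (fun y => Complex.exp (μ * ((x - y : ℝ) : ℂ)) • f y) (Iic x) := by
  refine Integrable.mono' hi.norm ?_ ?_
  · exact (Continuous.aestronglyMeasurable (by fun_prop)).smul hi.aestronglyMeasurable
  filter_upwards [ae_restrict_mem measurableSet_Iic] with y hy
  rw [norm_smul]
  exact mul_le_of_le_one_left (norm_nonneg _) (norm_exp_mul_le_one hμ (sub_nonneg.2 hy))

/-- Integration by parts gains 1/|μ|. The compact support removes the boundary term at -∞, but the
one at y = x remains. -/
theorem norm_integral_exp_smul_le_of_contDiff {μ : ℂ} (hμ : μ.re ≤ 0) (hμ0 : μ ≠ 0) {g : ℝ → E}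
    (hg : ContDiff ℝ 1 g) (hs : HasCompactSupport g) (x : ℝ) :
    ‖∫ y in Iic x, Complex.exp (μ * ((x - y : ℝ) : ℂ)) • g y‖ ≤
      (‖g x‖ + ∫ y in Iic x, ‖deriv g y‖) / ‖μ‖ := by
  have hgi : Integrable g := hg.continuous.integrable_of_hasCompactSupport hs
  have hgi' : Integrable (deriv g) :=
    (hg.continuous_deriv le_rfl).integrable_of_hasCompactSupport hs.deriv
  have h1 := integrableOn_exp_sub_smul hμ (hgi.integrableOn (s := Iic x))
  have h2 := integrableOn_exp_sub_smul hμ (hgi'.integrableOn (s := Iic x))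
  have hd : ∀ y ∈ Iic x, HasDerivAt (fun y : ℝ => Complex.exp (μ * ((x - y : ℝ) : ℂ)) • g y)
      (Complex.exp (μ * ((x - y : ℝ) : ℂ)) • deriv g y -
        μ • (Complex.exp (μ * ((x - y : ℝ) : ℂ)) • g y)) y := fun y _ => by
    have h3 : HasDerivAt (fun y : ℝ => Complex.exp (μ * ((x - y : ℝ) : ℂ)))
        (Complex.exp (μ * ((x - y : ℝ) : ℂ)) * (-μ)) y := by
      have := ((((hasDerivAt_id y).const_sub x).ofReal_comp).const_mul μ).cexp
      simpa using this
    have h4 := h3.smul ((hg.differentiable one_ne_zero).differentiableAt.hasDerivAt (x := y))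
    refine h4.congr_deriv ?_
    rw [smul_smul, mul_neg, neg_smul, mul_comm μ (Complex.exp _), ← sub_eq_add_neg]
  have hlim : Tendsto (fun y : ℝ => Complex.exp (μ * ((x - y : ℝ) : ℂ)) • g y) atBot (𝓝 0) := by
    refine tendsto_const_nhds.congr' ?_
    have h5 : ∀ᶠ y in atBot, g y = 0 := by
      obtain ⟨R, hR⟩ := hs.isCompact.isBounded.subset_closedBall 0
      filter_upwards [eventually_lt_atBot (-R)] with y hy
      refine image_eq_zero_of_notMem_tsupport fun hmem => ?_
      have := hR hmem
      rw [Metric.mem_closedBall, dist_zero_right, Real.norm_eq_abs] at this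
      linarith [neg_abs_le y]
    filter_upwards [h5] with y hy
    rw [hy, smul_zero]
  have h7 := integral_Iic_of_hasDerivAt_of_tendsto' hd (h2.sub (h1.smul μ)) hlim
  have h8 : (∫ y in Iic x, (Complex.exp (μ * ((x - y : ℝ) : ℂ)) • deriv g y -
        μ • (Complex.exp (μ * ((x - y : ℝ) : ℂ)) • g y))) =
      (∫ y in Iic x, Complex.exp (μ * ((x - y : ℝ) : ℂ)) • deriv g y) -
        μ • ∫ y in Iic x, Complex.exp (μ * ((x - y : ℝ) : ℂ)) • g y := by
    rw [← integral_smul]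
    exact integral_sub h2 (h1.smul μ)
  rw [h8] at h7
  simp only [sub_self, Complex.ofReal_zero, mul_zero, Complex.exp_zero, one_smul, sub_zero] at h7
  rw [le_div_iff₀ (norm_pos_iff.2 hμ0), mul_comm, ← norm_smul]
  have h9 : μ • (∫ y in Iic x, Complex.exp (μ * ((x - y : ℝ) : ℂ)) • g y) =
      (∫ y in Iic x, Complex.exp (μ * ((x - y : ℝ) : ℂ)) • deriv g y) - g x := by
    rw [← h7]; abel
  rw [h9]
  refine (norm_sub_le _ _).trans ?_
  rw [add_comm]
  gcongr
  exact norm_integral_exp_smul_le hμ hgi'.integrableOn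

/-- The Riemann-Lebesgue lemma on a half line, uniformly in a closed half plane of frequencies. -/
theorem tendsto_integral_exp_smul {ι : Type*} {l : Filter ι} {μ : ι → ℂ}
    (hμ : ∀ᶠ z in l, (μ z).re ≤ 0) (hμ0 : Tendsto (fun z => ‖μ z‖) l atTop) {f : ℝ → E} {x : ℝ}
    (hi : IntegrableOn f (Iic x)) :
    Tendsto (fun z => ∫ y in Iic x, Complex.exp (μ z * ((x - y : ℝ) : ℂ)) • f y) l (𝓝 0) := by
  rw [Metric.tendsto_nhds]
  intro ε hε
  have hm : MemLp ((Iic x).indicator f) 1 volume :=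
    memLp_one_iff_integrable.2 (hi.integrable_indicator measurableSet_Iic)
  -- Approximation in L¹ by a smooth compactly supported function. The exponential has modulus at
  -- most 1 on y ≤ x, so the error is uniform in μ.
  obtain ⟨g, hgs, hgd, hge⟩ := hm.exist_eLpNorm_sub_le (by simp) le_rfl (half_pos hε)
  have hgd1 : ContDiff ℝ 1 g := hgd.of_le (by exact_mod_cast le_top)
  have hgi : Integrable g := hgd1.continuous.integrable_of_hasCompactSupport hgs
  have hdiff : ∫ y in Iic x, ‖f y - g y‖ ≤ ε / 2 := by
    have h1 : Integrable ((Iic x).indicator f - g) :=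
      (hi.integrable_indicator measurableSet_Iic).sub hgi
    have h2 : ∫ y, ‖((Iic x).indicator f - g) y‖ ≤ ε / 2 := by
      rw [eLpNorm_one_eq_lintegral_enorm, ← ofReal_integral_norm_eq_lintegral_enorm h1] at hge
      exact (ENNReal.ofReal_le_ofReal_iff (half_pos hε).le).1 hge
    refine le_trans ?_ h2
    calc ∫ y in Iic x, ‖f y - g y‖ = ∫ y in Iic x, ‖((Iic x).indicator f - g) y‖ := by
          refine setIntegral_congr_fun measurableSet_Iic fun y hy => ?_
          simp [indicator_of_mem hy]
      _ ≤ _ := setIntegral_le_integral h1.norm (Eventually.of_forall fun _ => norm_nonneg _)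
  set A := ‖g x‖ + ∫ y in Iic x, ‖deriv g y‖
  have hA : Tendsto (fun z => A / ‖μ z‖) l (𝓝 0) := hμ0.const_div_atTop A
  filter_upwards [hμ, hμ0.eventually_gt_atTop 0,
    hA.eventually (gt_mem_nhds (half_pos hε))] with z hz hz0 hz1
  rw [dist_zero_right]
  have hs : (∫ y in Iic x, Complex.exp (μ z * ((x - y : ℝ) : ℂ)) • f y) =
      (∫ y in Iic x, Complex.exp (μ z * ((x - y : ℝ) : ℂ)) • (f y - g y)) +
        ∫ y in Iic x, Complex.exp (μ z * ((x - y : ℝ) : ℂ)) • g y := by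
    have hfg : IntegrableOn (fun y => f y - g y) (Iic x) := hi.sub hgi.integrableOn
    rw [← integral_add (integrableOn_exp_sub_smul hz hfg)
      (integrableOn_exp_sub_smul hz hgi.integrableOn)]
    refine integral_congr_ae (Eventually.of_forall fun y => ?_)
    simp only [← smul_add, sub_add_cancel]
  rw [hs]
  have h3 := norm_integral_exp_smul_le hz (hi.sub hgi.integrableOn)
  have h4 := norm_integral_exp_smul_le_of_contDiff hz (norm_pos_iff.1 hz0) hgd1 hgs x
  calc _ ≤ _ := norm_add_le _ _
    _ < ε / 2 + ε / 2 := add_lt_add_of_le_of_lt (h3.trans hdiff) (h4.trans_lt hz1)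
    _ = ε := add_halves ε

end RiemannLebesgue

/-! ### The Lax matrix, its spectral projections, and the normalized Jost block -/

section Jost

open Set
open scoped Matrix Matrix.Norms.Operator

variable {m : ℕ} {k₀ : ℝ}

/-- Square matrices of size `2m` in block form. -/
abbrev BMat (m : ℕ) := Matrix (Fin m ⊕ Fin m) (Fin m ⊕ Fin m) ℂ

/-- The spectral parameters at which the first Jost solution at `-∞` exists. -/
def Good (k₀ : ℝ) : Set ℂ := {z | z ≠ 0 ∧ lamOf k₀ z ≠ 0 ∧ 0 ≤ (lamOf k₀ z).im}

/-- `BMat m` as a Banach algebra. -/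
def BAlg (m : ℕ) : Type := BMat m

instance : NormedRing (BAlg m) := inferInstanceAs (NormedRing (BMat m))

instance : NormedAlgebra ℂ (BAlg m) := inferInstanceAs (NormedAlgebra ℂ (BMat m))

instance : CompleteSpace (BAlg m) := inferInstanceAs (CompleteSpace (BMat m))

theorem lamOf_neg (z : ℂ) : lamOf k₀ (-z) = -lamOf k₀ z := by
  unfold lamOf; rw [div_neg]; ring

theorem kOf_neg (z : ℂ) : kOf k₀ (-z) = -kOf k₀ z := by
  unfold kOf; rw [div_neg]; ring

theorem lamOf_conj (z : ℂ) : lamOf k₀ ((starRingEnd ℂ) z) = (starRingEnd ℂ) (lamOf k₀ z) := by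
  simp [lamOf, show (starRingEnd ℂ) 2 = 2 from map_ofNat _ 2]

theorem kOf_conj (z : ℂ) : kOf k₀ ((starRingEnd ℂ) z) = (starRingEnd ℂ) (kOf k₀ z) := by
  simp [kOf, show (starRingEnd ℂ) 2 = 2 from map_ofNat _ 2]

theorem phase_neg_conj (x t : ℝ) (z : ℂ) :
    phase k₀ x t ((starRingEnd ℂ) z) = (starRingEnd ℂ) (phase k₀ x t z) := by
  simp [phase, lamOf_conj, kOf_conj, show (starRingEnd ℂ) 2 = 2 from map_ofNat _ 2,
    show (starRingEnd ℂ) 4 = 4 from map_ofNat _ 4]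

/-- The involution `z ↦ -k₀²/z`. -/
def hat (k₀ : ℝ) (z : ℂ) : ℂ := -((k₀ : ℂ) ^ 2 / z)

theorem hat_ne_zero (hk : k₀ ≠ 0) {z : ℂ} (hz : z ≠ 0) : hat k₀ z ≠ 0 := by
  have : (k₀ : ℂ) ≠ 0 := by exact_mod_cast hk
  exact neg_ne_zero.2 (div_ne_zero (pow_ne_zero 2 this) hz)

theorem hat_hat (hk : k₀ ≠ 0) {z : ℂ} (hz : z ≠ 0) : hat k₀ (hat k₀ z) = z := by
  have : (k₀ : ℂ) ≠ 0 := by exact_mod_cast hk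
  unfold hat; field_simp

theorem lamOf_hat (hk : k₀ ≠ 0) {z : ℂ} (hz : z ≠ 0) : lamOf k₀ (hat k₀ z) = -lamOf k₀ z := by
  have : (k₀ : ℂ) ≠ 0 := by exact_mod_cast hk
  unfold hat lamOf; field_simp; ring

theorem kOf_hat (hk : k₀ ≠ 0) {z : ℂ} (hz : z ≠ 0) : kOf k₀ (hat k₀ z) = kOf k₀ z := by
  have : (k₀ : ℂ) ≠ 0 := by exact_mod_cast hk
  unfold hat kOf; field_simp; ring

theorem phase_hat (hk : k₀ ≠ 0) {z : ℂ} (hz : z ≠ 0) (x t : ℝ) :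
    phase k₀ x t (hat k₀ z) = -phase k₀ x t z := by
  simp [phase, lamOf_hat hk hz, kOf_hat hk hz]

theorem laxM_hat (hk : k₀ ≠ 0) {z : ℂ} (hz : z ≠ 0) (q : Matrix (Fin m) (Fin m) ℂ) :
    laxM k₀ q (hat k₀ z) = laxM k₀ q z := by
  simp [laxM, kOf_hat hk hz]

theorem lamOf_sq {z : ℂ} (hz : z ≠ 0) :
    lamOf k₀ z ^ 2 = kOf k₀ z ^ 2 + (k₀ : ℂ) ^ 2 := by
  unfold lamOf kOf; field_simp; ring

/-- The off-diagonal blocks cancel, and the diagonal ones combine to -(k² + k₀²) = -λ². This is why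
a constant background has only the two eigenvalues ±iλ. -/
theorem laxM_mul_laxM {q : Matrix (Fin m) (Fin m) ℂ}
    (hq : q * qᴴ = (k₀ : ℂ) ^ 2 • 1 ∧ qᴴ * q = (k₀ : ℂ) ^ 2 • 1) {z : ℂ} (hz : z ≠ 0) :
    laxM k₀ q z * laxM k₀ q z = -(lamOf k₀ z ^ 2) • (1 : BMat m) := by
  rw [laxM, Matrix.fromBlocks_multiply, lamOf_sq hz, ← Matrix.fromBlocks_one,
    Matrix.fromBlocks_smul]
  simp only [Matrix.mul_neg, Matrix.neg_mul, hq.1, hq.2, smul_mul_smul_comm, mul_one,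
    Matrix.smul_mul, Matrix.mul_smul, one_mul, neg_smul, smul_neg, smul_zero]
  have h : -(Complex.I * kOf k₀ z * (Complex.I * kOf k₀ z)) = kOf k₀ z ^ 2 := by
    linear_combination (-kOf k₀ z ^ 2) * Complex.I_sq
  congr 1
  · rw [← smul_assoc, smul_eq_mul, ← neg_neg (Complex.I * kOf k₀ z * (Complex.I * kOf k₀ z)), h]
    module
  · abel
  · abel
  · rw [← neg_neg (Complex.I * kOf k₀ z * (Complex.I * kOf k₀ z)), h]
    module

/-- The spectral projection of `laxM` for the eigenvalue `iλ`. -/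
def projTwo (k₀ : ℝ) (q : Matrix (Fin m) (Fin m) ℂ) (z : ℂ) : BMat m :=
  (1 / 2 : ℂ) • (1 + (Complex.I * lamOf k₀ z)⁻¹ • laxM k₀ q z)

/-- The spectral projection of `laxM` for the eigenvalue `-iλ`. -/
def projOne (k₀ : ℝ) (q : Matrix (Fin m) (Fin m) ℂ) (z : ℂ) : BMat m :=
  (1 / 2 : ℂ) • (1 - (Complex.I * lamOf k₀ z)⁻¹ • laxM k₀ q z)

theorem projOne_add_projTwo (q : Matrix (Fin m) (Fin m) ℂ) (z : ℂ) :
    projOne k₀ q z + projTwo k₀ q z = 1 := by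
  unfold projOne projTwo; module

theorem projTwo_mul_projOne {q : Matrix (Fin m) (Fin m) ℂ}
    (hq : q * qᴴ = (k₀ : ℂ) ^ 2 • 1 ∧ qᴴ * q = (k₀ : ℂ) ^ 2 • 1) {z : ℂ} (hz : z ≠ 0)
    (hl : lamOf k₀ z ≠ 0) : projTwo k₀ q z * projOne k₀ q z = 0 := by
  have h1 : ((Complex.I * lamOf k₀ z)⁻¹ • laxM k₀ q z) * ((Complex.I * lamOf k₀ z)⁻¹ • laxM k₀ q z)
      = (1 : BMat m) := by
    rw [smul_mul_smul_comm, laxM_mul_laxM hq hz, smul_smul]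
    convert one_smul ℂ (1 : BMat m) using 2
    have := Complex.I_ne_zero
    field_simp
    rw [Complex.I_sq]
  unfold projTwo projOne
  rw [smul_mul_smul_comm, mul_sub, add_mul, add_mul, h1]
  simp only [mul_one, one_mul]
  module

theorem smul_projTwo (q : Matrix (Fin m) (Fin m) ℂ) {z : ℂ} (hl : lamOf k₀ z ≠ 0) :
    (2 * Complex.I * lamOf k₀ z) • projTwo k₀ q z =
      laxM k₀ q z + (Complex.I * lamOf k₀ z) • (1 : BMat m) := by
  have := Complex.I_ne_zero
  rw [projTwo, smul_smul, smul_add, smul_smul, add_comm]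
  congr 1
  · convert one_smul ℂ (laxM k₀ q z) using 2
    field_simp
  · congr 1; ring

/-- The off-diagonal matrix `[[0, q], [-q†, 0]]`. -/
def offDiag (q : Matrix (Fin m) (Fin m) ℂ) : BMat m := Matrix.fromBlocks 0 q (-qᴴ) 0

theorem laxM_sub (q q' : Matrix (Fin m) (Fin m) ℂ) (z : ℂ) :
    laxM k₀ q z - laxM k₀ q' z = offDiag (q - q') := by
  ext (i | i) (j | j) <;> simp [laxM, offDiag]
  ring

theorem smul_fromRows {ι κ ν : Type*} (c : ℂ) (A : Matrix ι ν ℂ) (B : Matrix κ ν ℂ) :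
    c • Matrix.fromRows A B = Matrix.fromRows (c • A) (c • B) := by
  ext (i | i) j <;> rfl

/-- The columns of `eigL` are eigenvectors of the background Lax matrix for -iλ, so the other
spectral projection kills them. -/
theorem projTwo_mul_eigL {q : Matrix (Fin m) (Fin m) ℂ}
    (hq : q * qᴴ = (k₀ : ℂ) ^ 2 • 1 ∧ qᴴ * q = (k₀ : ℂ) ^ 2 • 1) {z : ℂ} (hz : z ≠ 0)
    (hl : lamOf k₀ z ≠ 0) : projTwo k₀ q z * eigL q z = 0 := by
  have h : laxM k₀ q z * eigL q z = -(Complex.I * lamOf k₀ z) • eigL q z := by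
    rw [laxM, eigL, Matrix.fromBlocks_mul_fromRows, smul_fromRows]
    simp only [mul_one, Matrix.mul_smul, hq.1, Matrix.smul_mul,
      one_mul, smul_smul, neg_smul, Matrix.mul_neg]
    congr 1
    · have : Complex.I * kOf k₀ z + Complex.I / z * (k₀ : ℂ) ^ 2 = Complex.I * lamOf k₀ z := by
        unfold kOf lamOf; field_simp; ring
      rw [← this]; module
    · have : 1 + Complex.I / z * (Complex.I * kOf k₀ z) = -(Complex.I * lamOf k₀ z * (Complex.I / z)) := by
        unfold kOf lamOf; field_simp; rw [Complex.I_sq]; ring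
      calc -qᴴ + -((Complex.I / z * (Complex.I * kOf k₀ z)) • qᴴ)
          = -((1 + Complex.I / z * (Complex.I * kOf k₀ z)) • qᴴ) := by module
        _ = _ := by rw [this]; module
  rw [projTwo, Matrix.smul_mul, Matrix.add_mul, Matrix.one_mul, Matrix.smul_mul, h, smul_smul]
  have : (Complex.I * lamOf k₀ z)⁻¹ * -(Complex.I * lamOf k₀ z) = -1 := by
    have := Complex.I_ne_zero
    field_simp
  rw [this]; simp

theorem projOne_mul_eigL {q : Matrix (Fin m) (Fin m) ℂ}
    (hq : q * qᴴ = (k₀ : ℂ) ^ 2 • 1 ∧ qᴴ * q = (k₀ : ℂ) ^ 2 • 1) {z : ℂ} (hz : z ≠ 0)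
    (hl : lamOf k₀ z ≠ 0) : projOne k₀ q z * eigL q z = eigL q z := by
  have h := congrArg (· * eigL q z) (projOne_add_projTwo (k₀ := k₀) q z)
  simpa [Matrix.add_mul, projTwo_mul_eigL hq hz hl] using h

/-- A potential on the line, decaying to a unitary multiple at `-∞`. -/
structure LeftPot (k₀ : ℝ) (q : ℝ → Matrix (Fin m) (Fin m) ℂ) (q₀ : Matrix (Fin m) (Fin m) ℂ) :
    Prop where
  pos : 0 < k₀
  unit : q₀ * q₀ᴴ = (k₀ : ℂ) ^ 2 • 1 ∧ q₀ᴴ * q₀ = (k₀ : ℂ) ^ 2 • 1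
  cont : Continuous q
  lim : Tendsto q atBot (𝓝 q₀)
  int : ∀ (c : ℝ) (i j : Fin m), IntegrableOn (fun x => q x i j - q₀ i j) (Iio c)

/-- The perturbation of the potential. -/
def pert (q : ℝ → Matrix (Fin m) (Fin m) ℂ) (q₀ : Matrix (Fin m) (Fin m) ℂ) (x : ℝ) : BAlg m :=
  offDiag (q x - q₀)

theorem continuous_offDiag : Continuous (offDiag : Matrix (Fin m) (Fin m) ℂ → BMat m) :=
  continuous_const.matrix_fromBlocks continuous_id continuous_id.matrix_conjTranspose.neg
    continuous_const

variable {q : ℝ → Matrix (Fin m) (Fin m) ℂ} {q₀ : Matrix (Fin m) (Fin m) ℂ}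

theorem LeftPot.continuous_pert (h : LeftPot k₀ q q₀) : Continuous (pert q q₀) :=
  continuous_offDiag.comp (h.cont.sub continuous_const)

theorem LeftPot.integrableOn_pert (h : LeftPot k₀ q q₀) (x : ℝ) :
    IntegrableOn (pert q q₀) (Iic x) := by
  have h1 : ∀ i j, IntegrableOn (fun y => offDiag (q y - q₀) i j) (Iic x) := by
    have h2 : ∀ i j, IntegrableOn (fun x => q x i j - q₀ i j) (Iic x) := fun i j =>
      (h.int (x + 1) i j).mono_set fun y hy => lt_of_le_of_lt (mem_Iic.1 hy) (by linarith)
    intro i j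
    rcases i with i | i <;> rcases j with j | j
    · simp [offDiag]
    · simpa [offDiag] using h2 i j
    · have h3 : IntegrableOn (fun x => -(starRingEnd ℂ) (q x j i - q₀ j i)) (Iic x) :=
        (Complex.conjCLE.toContinuousLinearMap.integrable_comp (h2 j i)).neg
      simpa [offDiag] using h3
    · simp [offDiag]
  let b : Fin m ⊕ Fin m → Fin m ⊕ Fin m → BAlg m := fun i j => (Matrix.single i j (1 : ℂ) : BMat m)
  have h2 : pert q q₀ = fun y => ∑ i, ∑ j, (offDiag (q y - q₀) i j) • b i j := by
    funext y
    have h3 : offDiag (q y - q₀) =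
        ∑ i, ∑ j, (offDiag (q y - q₀) i j) • (Matrix.single i j (1 : ℂ) : BMat m) := by
      conv_lhs => rw [Matrix.matrix_eq_sum_single (offDiag (q y - q₀))]
      simp [Matrix.smul_single]
    exact h3
  rw [h2]
  exact integrable_finsetSum _ fun i _ => integrable_finsetSum _ fun j _ =>
    (h1 i j).smul_const _

/-- The normalized fundamental block `M(x; z)`. -/
def jostM (k₀ : ℝ) (q : ℝ → Matrix (Fin m) (Fin m) ℂ) (q₀ : Matrix (Fin m) (Fin m) ℂ) (z : ℂ)
    (x : ℝ) : BMat m :=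
  volt (𝔸 := BAlg m) (projOne k₀ q₀ z) (projTwo k₀ q₀ z) (2 * Complex.I * lamOf k₀ z)
    (pert q q₀) (projOne k₀ q₀ z) x

theorem re_two_I_lam_nonpos {z : ℂ} (hz : z ∈ Good k₀) : (2 * Complex.I * lamOf k₀ z).re ≤ 0 := by
  have := hz.2.2
  simp [Complex.mul_re]
  linarith

/-- The shift by iλ accounts for the removed exponential. At the background it equals 2iλ times
`projTwo`, and the deviation of the potential is exactly `pert`; this is the Volterra setting with μ
= 2iλ. -/
theorem LeftPot.hasDerivAt_jostM (h : LeftPot k₀ q q₀) {z : ℂ} (hz : z ∈ Good k₀) (x : ℝ) :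
    HasDerivAt (jostM k₀ q q₀ z)
      ((laxM k₀ (q x) z + (Complex.I * lamOf k₀ z) • 1) * jostM k₀ q q₀ z x) x := by
  have h1 := hasDerivAt_volt (𝔸 := BAlg m) (p₁ := projOne k₀ q₀ z) (p₂ := projTwo k₀ q₀ z)
    (e := projOne k₀ q₀ z) h.continuous_pert h.integrableOn_pert
    (re_two_I_lam_nonpos hz)
    (projOne_add_projTwo q₀ z) (projTwo_mul_projOne h.unit hz.1 hz.2.1)
    (projTwo_mul_projOne h.unit hz.1 hz.2.1) x
  have h2 : HasDerivAt (jostM k₀ q q₀ z) (offDiag (q x - q₀) * jostM k₀ q q₀ z x +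
    (2 * Complex.I * lamOf k₀ z) • (projTwo k₀ q₀ z * jostM k₀ q q₀ z x)) x := h1
  refine h2.congr_deriv ?_
  rw [← smul_mul_assoc, smul_projTwo q₀ hz.2.1, ← add_mul, ← laxM_sub (k₀ := k₀) _ _ z]
  congr 1
  abel

theorem LeftPot.tendsto_jostM (h : LeftPot k₀ q q₀) {z : ℂ} (hz : z ∈ Good k₀) :
    Tendsto (jostM k₀ q q₀ z) atBot (𝓝 (projOne k₀ q₀ z)) :=
  tendsto_volt (𝔸 := BAlg m) h.continuous_pert h.integrableOn_pert (re_two_I_lam_nonpos hz)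

/-- Uniqueness of solutions that vanish at `-∞` after normalization. -/
theorem LeftPot.eq_zero (h : LeftPot k₀ q q₀) {z : ℂ} (hz : z ∈ Good k₀) {D : ℝ → BMat m}
    (hD : ∀ x, HasDerivAt D ((laxM k₀ (q x) z + (Complex.I * lamOf k₀ z) • 1) * D x) x)
    (h0 : Tendsto D atBot (𝓝 0)) : D = 0 := by
  refine eq_zero_of_hasDerivAt (𝔸 := BAlg m) (p₁ := projOne k₀ q₀ z) (p₂ := projTwo k₀ q₀ z)
    (V := pert q q₀) (μ := 2 * Complex.I * lamOf k₀ z) h.continuous_pert h.integrableOn_pert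
    (re_two_I_lam_nonpos hz) (projOne_add_projTwo q₀ z)
    (projTwo_mul_projOne h.unit hz.1 hz.2.1) (D := D) (fun x => ?_) h0
  have h2 : HasDerivAt D (offDiag (q x - q₀) * D x +
      (2 * Complex.I * lamOf k₀ z) • (projTwo k₀ q₀ z * D x)) x := by
    refine (hD x).congr_deriv ?_
    rw [← smul_mul_assoc, smul_projTwo q₀ hz.2.1, ← add_mul, ← laxM_sub (k₀ := k₀) _ _ z]
    congr 1
    abel
  exact h2

theorem hasDerivAt_matrix {ι κ : Type*} [Fintype ι] [Fintype κ] {F : ℝ → Matrix ι κ ℂ}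
    {F' : Matrix ι κ ℂ} {x : ℝ} :
    HasDerivAt F F' x ↔ ∀ i j, HasDerivAt (fun y => F y i j) (F' i j) x := by
  have h1 : HasDerivAt F F' x ↔ ∀ i, HasDerivAt (fun y => F y i) (F' i) x := hasDerivAt_pi
  rw [h1]
  refine forall_congr' fun i => ?_
  exact hasDerivAt_pi

end Jost

/-! ### Existence and uniqueness of all Jost solutions by symmetry -/

section JostSolutions

open Set
open scoped Matrix

variable {m : ℕ} {k₀ t : ℝ} {Q : ℝ → ℝ → Matrix (Fin m) (Fin m) ℂ}
  {Qp Qm : Matrix (Fin m) (Fin m) ℂ} {z s : ℂ} {l l' : Filter ℝ}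
  {E : Matrix (Fin m ⊕ Fin m) (Fin m) ℂ} {F G : ℝ → Matrix (Fin m ⊕ Fin m) (Fin m) ℂ}

theorem IsJost.hasDerivAt (h : IsJost k₀ Q t z s l E F) (x : ℝ) :
    HasDerivAt F (laxM k₀ (Q x t) z * F x) x :=
  hasDerivAt_matrix.2 fun i j => h.ode x i j

theorem hasDerivAt_matrix_mul_const {ι κ ν : Type*} [Fintype ι] [Fintype κ] [Fintype ν]
    {F : ℝ → Matrix ι κ ℂ} {F' : Matrix ι κ ℂ} {x : ℝ} (h : HasDerivAt F F' x)
    (X : Matrix κ ν ℂ) : HasDerivAt (fun y => F y * X) (F' * X) x := by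
  rw [hasDerivAt_matrix] at h ⊢
  intro i j
  simp only [Matrix.mul_apply]
  exact HasDerivAt.fun_sum fun k _ => (h i k).mul_const _

theorem hasDerivAt_matrix_mul {ι κ ν : Type*} [Fintype ι] [Fintype κ] [Fintype ν]
    {F : ℝ → Matrix ι κ ℂ} {F' : Matrix ι κ ℂ} {G : ℝ → Matrix κ ν ℂ} {G' : Matrix κ ν ℂ}
    {x : ℝ} (h : HasDerivAt F F' x) (h2 : HasDerivAt G G' x) :
    HasDerivAt (fun y => F y * G y) (F' * G x + F x * G') x := by
  rw [hasDerivAt_matrix] at h h2 ⊢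
  intro i j
  simp only [Matrix.mul_apply, Matrix.add_apply, ← Finset.sum_add_distrib]
  exact HasDerivAt.fun_sum fun k _ => (h i k).mul (h2 k j)

theorem hasDerivAt_matrix_smul {ι κ : Type*} [Fintype ι] [Fintype κ]
    {F : ℝ → Matrix ι κ ℂ} {F' : Matrix ι κ ℂ} {c : ℝ → ℂ} {c' : ℂ}
    {x : ℝ} (hc : HasDerivAt c c' x) (h : HasDerivAt F F' x) :
    HasDerivAt (fun y => c y • F y) (c' • F x + c x • F') x := by
  rw [hasDerivAt_matrix] at h ⊢
  intro i j
  exact hc.mul (h i j)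

theorem hasDerivAt_matrix_conjTranspose {ι κ : Type*} [Fintype ι] [Fintype κ]
    {F : ℝ → Matrix ι κ ℂ} {F' : Matrix ι κ ℂ} {x : ℝ} (h : HasDerivAt F F' x) :
    HasDerivAt (fun y => (F y)ᴴ) F'ᴴ x := by
  rw [hasDerivAt_matrix] at h ⊢
  intro i j
  exact (h j i).star

theorem hasDerivAt_matrix_sub {ι κ : Type*} [Fintype ι] [Fintype κ]
    {F G : ℝ → Matrix ι κ ℂ} {F' G' : Matrix ι κ ℂ} {x : ℝ} (h : HasDerivAt F F' x)
    (h2 : HasDerivAt G G' x) : HasDerivAt (fun y => F y - G y) (F' - G') x := by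
  rw [hasDerivAt_matrix] at h h2 ⊢
  intro i j
  exact (h i j).sub (h2 i j)

theorem hasDerivAt_matrix_comp_neg {ι κ : Type*} [Fintype ι] [Fintype κ]
    {F : ℝ → Matrix ι κ ℂ} {F' : Matrix ι κ ℂ} {x : ℝ} (h : HasDerivAt F F' (-x)) :
    HasDerivAt (fun y => F (-y)) (-F') x := by
  rw [hasDerivAt_matrix] at h ⊢
  intro i j
  exact ((h i j).scomp x (hasDerivAt_neg x)).congr_deriv (by simp)

theorem hasDerivAt_matrix_congr {ι κ : Type*} [Fintype ι] [Fintype κ]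
    {F : ℝ → Matrix ι κ ℂ} {F' G' : Matrix ι κ ℂ} {x : ℝ} (h : HasDerivAt F F' x)
    (e : F' = G') : HasDerivAt F G' x := e ▸ h

theorem hasDerivAt_exp_phase (s z : ℂ) (t x : ℝ) :
    HasDerivAt (fun x : ℝ => Complex.exp (s * Complex.I * phase k₀ x t z))
      (s * Complex.I * lamOf k₀ z * Complex.exp (s * Complex.I * phase k₀ x t z)) x := by
  have h : HasDerivAt (fun x : ℝ => phase k₀ x t z) (lamOf k₀ z) x := by
    have := ((Complex.ofRealCLM.hasDerivAt (x := x)).add_const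
      ((4 * kOf k₀ z ^ 2 - 2 * (k₀ : ℂ) ^ 2) * (t : ℂ))).const_mul (lamOf k₀ z)
    exact this.congr_deriv (mul_one _)
  have h2 := (h.const_mul (s * Complex.I)).cexp
  exact h2.congr_deriv (by ring)

/-- Uniqueness of the first Jost solution at `-∞`. -/
theorem IsJost.unique (hQ : LeftPot k₀ (fun x => Q x t) Qm) (hz : z ∈ Good k₀)
    (hF : IsJost k₀ Q t z 1 atBot E F) (hG : IsJost k₀ Q t z 1 atBot E G) : F = G := by
  set c : ℝ → ℂ := fun x => Complex.exp (1 * Complex.I * phase k₀ x t z) with hc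
  -- The difference is padded by a zero block to a square matrix, so that uniqueness in the Banach
  -- algebra applies.
  set D : ℝ → BMat m := fun x => c x • Matrix.fromCols (F x - G x) 0 with hD
  have hd : ∀ x, HasDerivAt D
      ((laxM k₀ (Q x t) z + (Complex.I * lamOf k₀ z) • 1) * D x) x := fun x => by
    have h1 : HasDerivAt (fun x => (Matrix.fromCols (F x - G x) 0 : BMat m))
        (laxM k₀ (Q x t) z * Matrix.fromCols (F x - G x) 0) x := by
      rw [Matrix.mul_fromCols, Matrix.mul_zero, Matrix.mul_sub]
      have h2 := hasDerivAt_matrix.1 (hasDerivAt_matrix_sub (hF.hasDerivAt x) (hG.hasDerivAt x))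
      rw [hasDerivAt_matrix]
      rintro i (j | j)
      · exact h2 i j
      · exact hasDerivAt_const x (0 : ℂ)
    refine hasDerivAt_matrix_congr (hasDerivAt_matrix_smul (hasDerivAt_exp_phase 1 z t x) h1) ?_
    rw [hD, hc, add_mul, Matrix.mul_smul, Matrix.mul_smul, Matrix.smul_mul, Matrix.one_mul,
      smul_smul, add_comm]
    congr 2
    ring
  have h0 : Tendsto D atBot (𝓝 0) := by
    have h3 := hF.asymp.sub hG.asymp
    rw [sub_self] at h3
    have h4 : Continuous fun X : Matrix (Fin m ⊕ Fin m) (Fin m) ℂ =>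
        (Matrix.fromCols X 0 : BMat m) := by
      refine continuous_matrix ?_
      rintro i (j | j)
      · exact continuous_id.matrix_elem i j
      · exact continuous_const
    have h5 := (h4.tendsto 0).comp h3
    have h6 : (Matrix.fromCols (0 : Matrix (Fin m ⊕ Fin m) (Fin m) ℂ) 0 : BMat m) = 0 := by
      ext i (j | j) <;> rfl
    rw [h6] at h5
    refine h5.congr fun x => ?_
    ext i (j | j) <;> simp [D, c, mul_sub]
  have h7 := hQ.eq_zero hz hd h0
  funext x
  have h8 : c x • (Matrix.fromCols (F x - G x) 0 : BMat m) = 0 := congrFun h7 x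
  have h9 := (smul_eq_zero.1 h8).resolve_left (Complex.exp_ne_zero _)
  have h10 : F x - G x = 0 := by
    ext i j
    exact congrFun (congrFun h9 i) (Sum.inl j)
  exact sub_eq_zero.1 h10

/-- Existence of the first Jost solution at `-∞`. -/
theorem LeftPot.isJost (hQ : LeftPot k₀ (fun x => Q x t) Qm) (hz : z ∈ Good k₀) :
    IsJost k₀ Q t z 1 atBot (eigL Qm z) fun x =>
      Complex.exp (-1 * Complex.I * phase k₀ x t z) •
        (jostM k₀ (fun x => Q x t) Qm z x * eigL Qm z) := by
  constructor
  · intro x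
    rw [← hasDerivAt_matrix]
    have h1 := hasDerivAt_matrix_mul_const (hQ.hasDerivAt_jostM hz x) (eigL Qm z)
    refine hasDerivAt_matrix_congr
      (hasDerivAt_matrix_smul (hasDerivAt_exp_phase (-1) z t x) h1) ?_
    rw [add_mul, Matrix.add_mul, Matrix.smul_mul, Matrix.smul_mul, Matrix.one_mul, Matrix.mul_smul,
      Matrix.mul_assoc]
    module
  · have h1 := hQ.tendsto_jostM hz
    have h2 : Continuous fun X : BMat m => X * eigL Qm z := continuous_id.matrix_mul continuous_const
    have h3 := (h2.tendsto _).comp h1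
    rw [projOne_mul_eigL hQ.unit hz.1 hz.2.1] at h3
    refine h3.congr fun x => ?_
    rw [smul_smul, ← Complex.exp_add, Function.comp_apply]
    simp

/-- `jost` is a choice with default 0; it becomes a concrete solution only where both existence and
uniqueness are known. -/
theorem jost_eq (hF : IsJost k₀ Q t z s l E F)
    (hu : ∀ G, IsJost k₀ Q t z s l E G → G = F) : jost k₀ Q t z s l E = F := by
  have h : ∃ F, IsJost k₀ Q t z s l E F := ⟨F, hF⟩
  rw [jost, dif_pos h]
  exact hu _ h.choose_spec

theorem LeftPot.phi_eq (hQ : LeftPot k₀ (fun x => Q x t) Qm) (hz : z ∈ Good k₀) :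
    phi k₀ Q Qm t z = fun x => Complex.exp (-1 * Complex.I * phase k₀ x t z) •
        (jostM k₀ (fun x => Q x t) Qm z x * eigL Qm z) :=
  jost_eq (hQ.isJost hz) fun _ hG => hG.unique hQ hz (hQ.isJost hz)

theorem LeftPot.isJost_phi (hQ : LeftPot k₀ (fun x => Q x t) Qm) (hz : z ∈ Good k₀) :
    IsJost k₀ Q t z 1 atBot (eigL Qm z) (phi k₀ Q Qm t z) := by
  rw [hQ.phi_eq hz]; exact hQ.isJost hz

/-- The reflected potential. -/
def reflQ (Q : ℝ → ℝ → Matrix (Fin m) (Fin m) ℂ) (x t : ℝ) : Matrix (Fin m) (Fin m) ℂ :=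
  -Q (-x) (-t)

theorem reflQ_reflQ : reflQ (reflQ Q) = Q := by
  funext x t; simp [reflQ]

theorem laxM_neg (q : Matrix (Fin m) (Fin m) ℂ) : laxM k₀ (-q) (-z) = -laxM k₀ q z := by
  rw [laxM, laxM, Matrix.fromBlocks_neg]
  simp [kOf_neg]

theorem eigL_neg (q : Matrix (Fin m) (Fin m) ℂ) : eigL (-q) (-z) = eigL q z := by
  simp [eigL, div_neg]

theorem phase_reflect (x : ℝ) : phase k₀ x (-t) (-z) = phase k₀ (-x) t z := by
  simp [phase, lamOf_neg, kOf_neg]; ring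

/-- Both k and λ are odd in z, so changing the signs of x, t, z and Q preserves the equation and the
phase while interchanging the two ends of the line. -/
theorem IsJost.reflect (h : IsJost k₀ Q t z s l E F) (hl : Tendsto (fun x : ℝ => -x) l' l) :
    IsJost k₀ (reflQ Q) (-t) (-z) s l' E fun x => F (-x) := by
  constructor
  · intro x
    rw [← hasDerivAt_matrix]
    refine hasDerivAt_matrix_congr (hasDerivAt_matrix_comp_neg (h.hasDerivAt (-x))) ?_
    rw [reflQ, neg_neg, laxM_neg, Matrix.neg_mul]
  · refine (h.asymp.comp hl).congr fun x => ?_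
    rw [phase_reflect]
    rfl

theorem IsJost.reflect_symm (h : IsJost k₀ (reflQ Q) (-t) (-z) s l E F)
    (hl : Tendsto (fun x : ℝ => -x) l' l) : IsJost k₀ Q t z s l' E fun x => F (-x) := by
  have := h.reflect hl
  rwa [reflQ_reflQ, neg_neg, neg_neg] at this

theorem IsJost.mul_right (h : IsJost k₀ Q t z s l E F) (X : Matrix (Fin m) (Fin m) ℂ) :
    IsJost k₀ Q t z s l (E * X) fun x => F x * X := by
  constructor
  · intro x
    rw [← hasDerivAt_matrix, ← Matrix.mul_assoc]
    exact hasDerivAt_matrix_mul_const (h.hasDerivAt x) X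
  · have h2 : Continuous fun Y : Matrix (Fin m ⊕ Fin m) (Fin m) ℂ => Y * X :=
      continuous_id.matrix_mul continuous_const
    refine ((h2.tendsto _).comp h.asymp).congr fun x => ?_
    simp

/-- The involution z ↦ -k₀²/z keeps k, hence the equation, but reverses λ, hence the sign of the
exponent. -/
theorem IsJost.hat (hk : k₀ ≠ 0) (hz : z ≠ 0) (h : IsJost k₀ Q t z s l E F) :
    IsJost k₀ Q t (hat k₀ z) (-s) l E F := by
  constructor
  · intro x
    rw [laxM_hat hk hz]
    exact h.ode x
  · refine h.asymp.congr fun x => ?_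
    rw [phase_hat hk hz]
    simp

theorem IsJost.of_hat (hk : k₀ ≠ 0) (hz : z ≠ 0)
    (h : IsJost k₀ Q t (MMKdV.hat k₀ z) s l E F) : IsJost k₀ Q t z (-s) l E F := by
  have := h.hat hk (hat_ne_zero hk hz)
  rwa [hat_hat hk hz] at this

/-- This identity selects the constant right factor -(i/z)Q± by which the second Jost blocks at z
arise from the first ones at -k₀²/z. -/
theorem eigL_hat_mul (hk : k₀ ≠ 0) (hz : z ≠ 0) {q : Matrix (Fin m) (Fin m) ℂ}
    (hq : qᴴ * q = (k₀ : ℂ) ^ 2 • 1) :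
    eigL q (hat k₀ z) * ((-(Complex.I / z)) • q) = eigR q z := by
  have : (k₀ : ℂ) ≠ 0 := by exact_mod_cast hk
  rw [eigL, eigR, Matrix.fromRows_mul, Matrix.one_mul, smul_mul_smul_comm, hq, smul_smul]
  congr 1
  convert one_smul ℂ (1 : Matrix (Fin m) (Fin m) ℂ) using 2
  unfold hat
  field_simp
  rw [Complex.I_sq]; ring

/-- The data of the scattering problem at the fixed time `t`. -/
structure ScatPot (k₀ : ℝ) (Q : ℝ → ℝ → Matrix (Fin m) (Fin m) ℂ)
    (Qp Qm : Matrix (Fin m) (Fin m) ℂ) (t : ℝ) : Prop where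
  left : LeftPot k₀ (fun x => Q x t) Qm
  right : LeftPot k₀ (fun x => reflQ Q x (-t)) (-Qp)

theorem ScatPot.unit_right (h : ScatPot k₀ Q Qp Qm t) :
    Qp * Qpᴴ = (k₀ : ℂ) ^ 2 • 1 ∧ Qpᴴ * Qp = (k₀ : ℂ) ^ 2 • 1 := by
  simpa using h.right.unit

theorem ScatPot.pos (h : ScatPot k₀ Q Qp Qm t) : 0 < k₀ := h.left.pos

theorem IsJost.unique_right (h : ScatPot k₀ Q Qp Qm t) (hz : -z ∈ Good k₀)
    (hF : IsJost k₀ Q t z 1 atTop E F) (hG : IsJost k₀ Q t z 1 atTop E G) : F = G := by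
  have h1 := hF.reflect tendsto_neg_atBot_atTop
  have h2 := hG.reflect tendsto_neg_atBot_atTop
  have h3 := h1.unique h.right hz h2
  funext x
  simpa using congrFun h3 (-x)

theorem ScatPot.isJost_right (h : ScatPot k₀ Q Qp Qm t) (hz : -z ∈ Good k₀) :
    IsJost k₀ Q t z 1 atTop (eigL Qp z) fun x => phi k₀ (reflQ Q) (-Qp) (-t) (-z) (-x) := by
  have h1 := h.right.isJost_phi hz
  rw [eigL_neg] at h1
  exact h1.reflect_symm tendsto_neg_atTop_atBot

theorem ScatPot.psiBar_eq (h : ScatPot k₀ Q Qp Qm t) (hz : -z ∈ Good k₀) :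
    psiBar k₀ Q Qp t z = fun x => phi k₀ (reflQ Q) (-Qp) (-t) (-z) (-x) :=
  jost_eq (h.isJost_right hz) fun _ hG => hG.unique_right h hz (h.isJost_right hz)

theorem ScatPot.isJost_psiBar (h : ScatPot k₀ Q Qp Qm t) (hz : -z ∈ Good k₀) :
    IsJost k₀ Q t z 1 atTop (eigL Qp z) (psiBar k₀ Q Qp t z) := by
  rw [h.psiBar_eq hz]; exact h.isJost_right hz

theorem ScatPot.isJost_phiBar_aux (h : ScatPot k₀ Q Qp Qm t) (hz0 : z ≠ 0)
    (hz : hat k₀ z ∈ Good k₀) :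
    IsJost k₀ Q t z (-1) atBot (eigR Qm z)
      fun x => phi k₀ Q Qm t (hat k₀ z) x * ((-(Complex.I / z)) • Qm) := by
  have h1 := ((h.left.isJost_phi hz).mul_right ((-(Complex.I / z)) • Qm)).of_hat h.pos.ne' hz0
  rwa [eigL_hat_mul h.pos.ne' hz0 h.left.unit.2] at h1

theorem ScatPot.phiBar_eq (h : ScatPot k₀ Q Qp Qm t) (hz0 : z ≠ 0) (hz : hat k₀ z ∈ Good k₀) :
    phiBar k₀ Q Qm t z = fun x => phi k₀ Q Qm t (hat k₀ z) x * ((-(Complex.I / z)) • Qm) :=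
  jost_eq (h.isJost_phiBar_aux hz0 hz) fun G hG => by
    have h1 := hG.hat h.pos.ne' hz0
    have h2 := (h.isJost_phiBar_aux hz0 hz).hat h.pos.ne' hz0
    rw [neg_neg] at h1 h2
    exact h1.unique h.left hz h2

theorem ScatPot.isJost_phiBar (h : ScatPot k₀ Q Qp Qm t) (hz0 : z ≠ 0)
    (hz : hat k₀ z ∈ Good k₀) :
    IsJost k₀ Q t z (-1) atBot (eigR Qm z) (phiBar k₀ Q Qm t z) := by
  rw [h.phiBar_eq hz0 hz]; exact h.isJost_phiBar_aux hz0 hz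

theorem ScatPot.isJost_psi_aux (h : ScatPot k₀ Q Qp Qm t) (hz0 : z ≠ 0)
    (hz : -hat k₀ z ∈ Good k₀) :
    IsJost k₀ Q t z (-1) atTop (eigR Qp z)
      fun x => psiBar k₀ Q Qp t (hat k₀ z) x * ((-(Complex.I / z)) • Qp) := by
  have h1 := ((h.isJost_psiBar hz).mul_right ((-(Complex.I / z)) • Qp)).of_hat h.pos.ne' hz0
  rwa [eigL_hat_mul h.pos.ne' hz0 h.unit_right.2] at h1

theorem ScatPot.psi_eq (h : ScatPot k₀ Q Qp Qm t) (hz0 : z ≠ 0) (hz : -hat k₀ z ∈ Good k₀) :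
    psi k₀ Q Qp t z = fun x => psiBar k₀ Q Qp t (hat k₀ z) x * ((-(Complex.I / z)) • Qp) :=
  jost_eq (h.isJost_psi_aux hz0 hz) fun G hG => by
    have h1 := hG.hat h.pos.ne' hz0
    have h2 := (h.isJost_psi_aux hz0 hz).hat h.pos.ne' hz0
    rw [neg_neg] at h1 h2
    exact h1.unique_right h hz h2

theorem ScatPot.isJost_psi (h : ScatPot k₀ Q Qp Qm t) (hz0 : z ≠ 0)
    (hz : -hat k₀ z ∈ Good k₀) :
    IsJost k₀ Q t z (-1) atTop (eigR Qp z) (psi k₀ Q Qp t z) := by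
  rw [h.psi_eq hz0 hz]; exact h.isJost_psi_aux hz0 hz

end JostSolutions

/-! ### Conserved pairings and Wronskians -/

section Pairing

open Set
open scoped Matrix

/-- The determinant as a continuous multilinear map of the rows. -/
def detMultilinear (n : Type*) [Fintype n] [DecidableEq n] :
    ContinuousMultilinearMap ℂ (fun _ : n => n → ℂ) ℂ where
  toMultilinearMap := (Matrix.detRowAlternating (R := ℂ) (n := n)).toMultilinearMap
  cont := (continuous_id (X := Matrix n n ℂ)).matrix_det

theorem hasDerivAt_det {n : Type*} [Fintype n] [DecidableEq n] {X : ℝ → Matrix n n ℂ}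
    {X' : Matrix n n ℂ} {x : ℝ} (h : HasDerivAt X X' x) :
    HasDerivAt (fun y => (X y).det) (∑ i, ((X x).updateRow i (X' i)).det) x := by
  have h1 : HasDerivAt (F := n → n → ℂ) X X' x := h
  have h2 := ((detMultilinear n).hasFDerivAt (x := X x)).restrictScalars ℝ
  have h3 := h2.comp_hasDerivAt x h1
  refine h3.congr_deriv ?_
  exact ContinuousMultilinearMap.linearDeriv_apply (detMultilinear n) (X x) X'

/-- Liouville's formula for a traceless coefficient matrix. -/
theorem det_const_of_trace_zero {n : Type*} [Fintype n] [DecidableEq n] {X L : ℝ → Matrix n n ℂ}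
    (h : ∀ x, HasDerivAt X (L x * X x) x) (hL : ∀ x, (L x).trace = 0) (x y : ℝ) :
    (X x).det = (X y).det := by
  have h1 : ∀ x, HasDerivAt (fun y => (X y).det) 0 x := fun x => by
    refine (hasDerivAt_det (h x)).congr_deriv ?_
    have h2 : ∀ i, ((X x).updateRow i ((L x * X x) i)).det = L x i i * (X x).det := fun i => by
      have h3 : (L x * X x) i = ∑ k, L x i k • X x k := by
        ext j
        simp [Matrix.mul_apply]
      rw [h3, Matrix.det_updateRow_sum, smul_eq_mul]
    simp_rw [h2, ← Finset.sum_mul]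
    rw [show ∑ i, L x i i = 0 from hL x, zero_mul]
  exact is_const_of_deriv_eq_zero (fun x => (h1 x).differentiableAt) (fun x => (h1 x).deriv) x y

variable {m : ℕ} {k₀ t : ℝ} {Q : ℝ → ℝ → Matrix (Fin m) (Fin m) ℂ}
  {Qp Qm q : Matrix (Fin m) (Fin m) ℂ} {z s s' : ℂ} {l l' : Filter ℝ}
  {E E' : Matrix (Fin m ⊕ Fin m) (Fin m) ℂ} {F G : ℝ → Matrix (Fin m ⊕ Fin m) (Fin m) ℂ}

/-- The source of all conserved pairings: adjunction together with z ↦ z* makes the Lax matrix skew.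
-/
theorem laxM_conjTranspose (q : Matrix (Fin m) (Fin m) ℂ) (z : ℂ) :
    (laxM k₀ q ((starRingEnd ℂ) z))ᴴ = -laxM k₀ q z := by
  rw [laxM, laxM, Matrix.fromBlocks_conjTranspose, Matrix.fromBlocks_neg]
  simp [kOf_conj, Matrix.conjTranspose_smul]

theorem trace_laxM (q : Matrix (Fin m) (Fin m) ℂ) (z : ℂ) : (laxM k₀ q z).trace = 0 := by
  simp [laxM, Matrix.trace, Fintype.sum_sum_type]

/-- The pairing of a solution at `z*` with a solution at `z` is constant. -/
theorem IsJost.pairing_const (hF : IsJost k₀ Q t ((starRingEnd ℂ) z) s l E F)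
    (hG : IsJost k₀ Q t z s' l' E' G) (x y : ℝ) : (F x)ᴴ * G x = (F y)ᴴ * G y := by
  have h : ∀ x, HasDerivAt (fun x => (F x)ᴴ * G x) 0 x := fun x => by
    refine hasDerivAt_matrix_congr (hasDerivAt_matrix_mul
      (hasDerivAt_matrix_conjTranspose (hF.hasDerivAt x)) (hG.hasDerivAt x)) ?_
    rw [Matrix.conjTranspose_mul, laxM_conjTranspose, Matrix.mul_neg, Matrix.neg_mul,
      Matrix.mul_assoc, neg_add_cancel]
  ext i j
  have h2 := fun x => hasDerivAt_matrix.1 (h x) i j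
  exact is_const_of_deriv_eq_zero (fun x => (h2 x).differentiableAt) (fun x => (h2 x).deriv) x y

theorem IsJost.tendsto_pairing (hs : (starRingEnd ℂ) s = s)
    (hF : IsJost k₀ Q t ((starRingEnd ℂ) z) s l E F)
    (hG : IsJost k₀ Q t z s' l E' G) :
    Tendsto (fun x => Complex.exp ((s' - s) * Complex.I * phase k₀ x t z) • ((F x)ᴴ * G x)) l
      (𝓝 (Eᴴ * E')) := by
  have h1 : Continuous fun p : Matrix (Fin m ⊕ Fin m) (Fin m) ℂ × Matrix (Fin m ⊕ Fin m) (Fin m) ℂ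
      => p.1ᴴ * p.2 := continuous_fst.matrix_conjTranspose.matrix_mul continuous_snd
  refine ((h1.tendsto (E, E')).comp (hF.asymp.prodMk_nhds hG.asymp)).congr fun x => ?_
  simp only [Function.comp_apply]
  rw [Matrix.conjTranspose_smul, Matrix.smul_mul, Matrix.mul_smul, smul_smul]
  congr 1
  have : star (Complex.exp (s * Complex.I * phase k₀ x t ((starRingEnd ℂ) z))) =
      Complex.exp (-(s * Complex.I * phase k₀ x t z)) := by
    rw [phase_neg_conj]
    change (starRingEnd ℂ) _ = _
    rw [← Complex.exp_conj]
    simp [hs]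
  rw [this, ← Complex.exp_add]
  congr 1; ring

/-- The pairing of solutions of equal type equals the pairing of their asymptotics. -/
theorem IsJost.pairing_eq [l.NeBot] (hs : (starRingEnd ℂ) s = s)
    (hF : IsJost k₀ Q t ((starRingEnd ℂ) z) s l E F)
    (hG : IsJost k₀ Q t z s l E' G) (x : ℝ) : (F x)ᴴ * G x = Eᴴ * E' := by
  have h := IsJost.tendsto_pairing hs hF hG
  have h2 : Tendsto (fun _ : ℝ => (F x)ᴴ * G x) l (𝓝 (Eᴴ * E')) := by
    refine h.congr fun y => ?_
    rw [sub_self, zero_mul, zero_mul, Complex.exp_zero, one_smul, hF.pairing_const hG y x]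
  exact tendsto_nhds_unique tendsto_const_nhds h2

/-- The time part of the phase contributes a constant factor, so growth in x is decided by the sign
of c · Im λ alone. -/
theorem norm_exp_phase (c : ℝ) (x : ℝ) : ‖Complex.exp (c * Complex.I * phase k₀ x t z)‖ =
    Real.exp (-(c * (lamOf k₀ z).im * x)) * ‖Complex.exp (c * Complex.I * phase k₀ 0 t z)‖ := by
  have h : phase k₀ x t z = phase k₀ 0 t z + lamOf k₀ z * x := by
    simp [phase]; ring
  rw [h, mul_add, Complex.exp_add, norm_mul, mul_comm]
  congr 1
  rw [Complex.norm_exp]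
  congr 1
  simp
  ring

/-- If the asymptotics are orthogonal, or the exponential factor tends to zero, the pairing
vanishes. -/
theorem IsJost.pairing_eq_zero [l.NeBot] (hs : (starRingEnd ℂ) s = s)
    (hF : IsJost k₀ Q t ((starRingEnd ℂ) z) s l E F)
    (hG : IsJost k₀ Q t z s' l E' G)
    (h : Tendsto (fun x => Complex.exp ((s - s') * Complex.I * phase k₀ x t z) • (Eᴴ * E')) l (𝓝 0))
    (hb : ∃ B, ∀ᶠ x in l, ‖Complex.exp ((s - s') * Complex.I * phase k₀ x t z)‖ ≤ B)
    (x : ℝ) : (F x)ᴴ * G x = 0 := by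
  have h1 := IsJost.tendsto_pairing hs hF hG
  obtain ⟨B, hB⟩ := hb
  ext i j
  have h2 : Tendsto (fun y => (Complex.exp ((s' - s) * Complex.I * phase k₀ y t z) •
      ((F y)ᴴ * G y)) i j - (Eᴴ * E') i j) l (𝓝 0) := by
    have := (((continuous_id.matrix_elem i j).tendsto _).comp h1).sub_const ((Eᴴ * E') i j)
    simpa using this
  -- The constant pairing is an exponential times the rescaled pairing. The bounded exponential
  -- multiplies the rescaled pairing minus its limit, which tends to 0; the remaining term is the
  -- one controlled by `h`.
  have h3 : Tendsto (fun y => Complex.exp ((s - s') * Complex.I * phase k₀ y t z) *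
      ((Complex.exp ((s' - s) * Complex.I * phase k₀ y t z) •
      ((F y)ᴴ * G y)) i j - (Eᴴ * E') i j)) l (𝓝 0) := by
    rw [tendsto_zero_iff_norm_tendsto_zero]
    refine squeeze_zero' (Eventually.of_forall fun _ => norm_nonneg _) ?_
      (by simpa using h2.norm.const_mul B)
    filter_upwards [hB] with y hy
    rw [norm_mul]
    exact mul_le_mul_of_nonneg_right hy (norm_nonneg _)
  have h4 := h3.add (((continuous_id.matrix_elem i j).tendsto _).comp h)
  have h5 : Tendsto (fun _ : ℝ => ((F x)ᴴ * G x) i j) l (𝓝 0) := by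
    have : (0 : ℂ) + id (0 : Matrix (Fin m) (Fin m) ℂ) i j = 0 := by simp
    rw [this] at h4
    refine h4.congr fun y => ?_
    rw [hF.pairing_const hG x y]
    simp only [Function.comp_apply, id_eq, Matrix.smul_apply, smul_eq_mul, mul_sub, sub_add_cancel,
      ← mul_assoc]
    rw [← Complex.exp_add]
    ring_nf
    simp
  exact tendsto_nhds_unique tendsto_const_nhds h5

theorem gam_conj (z : ℂ) : (starRingEnd ℂ) (gam k₀ z) = gam k₀ ((starRingEnd ℂ) z) := by
  simp [gam]

theorem gam_eq_mul (hz : z ≠ 0) : gam k₀ z = 2 * lamOf k₀ z / z := by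
  unfold gam lamOf; field_simp

theorem eigL_pairing (hz : z ≠ 0) (hq : q * qᴴ = (k₀ : ℂ) ^ 2 • 1) :
    (eigL q ((starRingEnd ℂ) z))ᴴ * eigL q z = gam k₀ z • 1 := by
  rw [eigL, eigL, Matrix.conjTranspose_fromRows_eq_fromCols_conjTranspose,
    Matrix.fromCols_mul_fromRows, Matrix.conjTranspose_smul, Matrix.conjTranspose_conjTranspose,
    smul_mul_smul_comm, hq, smul_smul]
  have : gam k₀ z = 1 + star (-(Complex.I / (starRingEnd ℂ) z)) * -(Complex.I / z) * (k₀ : ℂ) ^ 2 := by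
    simp [gam]; field_simp; rw [Complex.I_sq]; ring
  rw [this, add_smul]
  simp

theorem eigR_pairing (hz : z ≠ 0) (hq : qᴴ * q = (k₀ : ℂ) ^ 2 • 1) :
    (eigR q ((starRingEnd ℂ) z))ᴴ * eigR q z = gam k₀ z • 1 := by
  rw [eigR, eigR, Matrix.conjTranspose_fromRows_eq_fromCols_conjTranspose,
    Matrix.fromCols_mul_fromRows, Matrix.conjTranspose_smul,
    smul_mul_smul_comm, hq, smul_smul]
  have : gam k₀ z = star (-(Complex.I / (starRingEnd ℂ) z)) * -(Complex.I / z) * (k₀ : ℂ) ^ 2 + 1 := by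
    simp [gam]; field_simp; rw [Complex.I_sq]; ring
  rw [this, add_smul]
  simp

theorem eigL_eigR_pairing (z : ℂ) : (eigL q ((starRingEnd ℂ) z))ᴴ * eigR q z = 0 := by
  rw [eigL, eigR, Matrix.conjTranspose_fromRows_eq_fromCols_conjTranspose,
    Matrix.fromCols_mul_fromRows, Matrix.conjTranspose_smul, Matrix.conjTranspose_conjTranspose]
  simp [neg_div]

theorem eigR_eigL_pairing (z : ℂ) : (eigR q ((starRingEnd ℂ) z))ᴴ * eigL q z = 0 := by
  rw [eigL, eigR, Matrix.conjTranspose_fromRows_eq_fromCols_conjTranspose,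
    Matrix.fromCols_mul_fromRows, Matrix.conjTranspose_smul]
  simp [neg_div]

end Pairing

/-! ### The regions of the spectral plane in terms of λ -/

section Domains

open Set
open scoped Matrix

variable {k₀ : ℝ} {z : ℂ}

/-- The dictionary between the geometric definitions of D± and Σ and the sign of Im λ, on which the
decay of the exponentials depends. -/
theorem lamOf_im (hz : z ≠ 0) :
    (lamOf k₀ z).im = (‖z‖ ^ 2 - k₀ ^ 2) * z.im / (2 * ‖z‖ ^ 2) := by
  have h : ‖z‖ ^ 2 ≠ 0 := pow_ne_zero 2 (norm_ne_zero_iff.2 hz)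
  have h1 : lamOf k₀ z = (1 / 2 : ℝ) * (z + (k₀ ^ 2 : ℝ) * z⁻¹) := by
    unfold lamOf; push_cast; ring
  rw [h1, Complex.im_ofReal_mul, Complex.add_im, Complex.im_ofReal_mul, Complex.inv_im,
    Complex.normSq_eq_norm_sq]
  field_simp
  ring

theorem ne_zero_of_mem_Dplus (hz : z ∈ Dplus k₀) : z ≠ 0 := by
  rintro rfl; simp [Dplus] at hz

theorem mem_Dplus_iff (hz : z ≠ 0) : z ∈ Dplus k₀ ↔ 0 < (lamOf k₀ z).im := by
  have h : 0 < ‖z‖ := norm_pos_iff.2 hz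
  rw [lamOf_im hz, Dplus, mem_ofPred_eq, div_pos_iff_of_pos_right (by positivity)]

theorem mem_Sig_iff (hk : 0 < k₀) (hz : z ≠ 0) : z ∈ Sig k₀ ↔ (lamOf k₀ z).im = 0 := by
  have h : 0 < ‖z‖ := norm_pos_iff.2 hz
  rw [lamOf_im hz, div_eq_zero_iff, mul_eq_zero, Sig, mem_union, mem_ofPred_eq, mem_ofPred_eq,
    sub_eq_zero, pow_left_inj₀ h.le hk.le two_ne_zero, or_iff_left (b := 2 * ‖z‖ ^ 2 = 0)
      (by positivity), or_comm]

theorem lamOf_eq_zero_iff (hz : z ≠ 0) :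
    lamOf k₀ z = 0 ↔ z = Complex.I * k₀ ∨ z = -(Complex.I * k₀) := by
  have h : lamOf k₀ z = (z - Complex.I * k₀) * (z + Complex.I * k₀) / (2 * z) := by
    unfold lamOf; field_simp; ring_nf; rw [Complex.I_sq]; ring
  rw [h, div_eq_zero_iff, mul_eq_zero, or_iff_left (by simpa using hz), sub_eq_zero,
    add_eq_zero_iff_eq_neg]

theorem mem_Sig₀_iff (hk : 0 < k₀) :
    z ∈ Sig₀ k₀ ↔ z ≠ 0 ∧ lamOf k₀ z ≠ 0 ∧ (lamOf k₀ z).im = 0 := by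
  by_cases hz : z = 0
  · simp [Sig₀, hz]
  · rw [Sig₀, Set.mem_sdiff, mem_Sig_iff hk hz, ne_eq (lamOf k₀ z), lamOf_eq_zero_iff hz]
    simp only [mem_insert_iff, mem_singleton_iff, hz, false_or]
    tauto

theorem good_of_mem (hk : 0 < k₀) (hz : z ∈ Dplus k₀ ∪ Sig₀ k₀) : z ∈ Good k₀ := by
  rcases hz with hz | hz
  · have h0 := ne_zero_of_mem_Dplus hz
    have h1 := (mem_Dplus_iff h0).1 hz
    refine ⟨h0, fun h => ?_, h1.le⟩
    rw [h] at h1; simp at h1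
  · have h1 := (mem_Sig₀_iff hk).1 hz
    exact ⟨h1.1, h1.2.1, h1.2.2.ge⟩

theorem mem_of_good (hk : 0 < k₀) (hz : z ∈ Good k₀) : z ∈ Dplus k₀ ∪ Sig₀ k₀ := by
  rcases hz.2.2.lt_or_eq with h | h
  · exact Or.inl ((mem_Dplus_iff hz.1).2 h)
  · exact Or.inr ((mem_Sig₀_iff hk).2 ⟨hz.1, hz.2.1, h.symm⟩)

/-- Im λ is invariant under z ↦ -z*, z ↦ -k₀²/z* and z ↦ k₀²/z. These three invariances make ψ̄(z*),
φ̄(z*) and ψ(z) available whenever φ(z) is. -/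
theorem Good.neg_conj (hz : z ∈ Good k₀) : -(starRingEnd ℂ) z ∈ Good k₀ := by
  refine ⟨by simpa using hz.1, ?_, ?_⟩
  · rw [lamOf_neg, lamOf_conj]; simpa using hz.2.1
  · rw [lamOf_neg, lamOf_conj]; simpa using hz.2.2

theorem Good.hat_conj (hk : 0 < k₀) (hz : z ∈ Good k₀) : hat k₀ ((starRingEnd ℂ) z) ∈ Good k₀ := by
  have h : (starRingEnd ℂ) z ≠ 0 := by simpa using hz.1
  refine ⟨hat_ne_zero hk.ne' h, ?_, ?_⟩
  · rw [lamOf_hat hk.ne' h, lamOf_conj]; simpa using hz.2.1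
  · rw [lamOf_hat hk.ne' h, lamOf_conj]; simpa using hz.2.2

theorem Good.neg_hat (hk : 0 < k₀) (hz : z ∈ Good k₀) : -hat k₀ z ∈ Good k₀ := by
  refine ⟨neg_ne_zero.2 (hat_ne_zero hk.ne' hz.1), ?_, ?_⟩
  · rw [lamOf_neg, lamOf_hat hk.ne' hz.1, neg_neg]; exact hz.2.1
  · rw [lamOf_neg, lamOf_hat hk.ne' hz.1, neg_neg]; exact hz.2.2

theorem Sig₀.conj (hk : 0 < k₀) (hz : z ∈ Sig₀ k₀) : (starRingEnd ℂ) z ∈ Sig₀ k₀ := by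
  rw [mem_Sig₀_iff hk] at hz ⊢
  refine ⟨by simpa using hz.1, ?_, ?_⟩
  · rw [lamOf_conj]; simpa using hz.2.1
  · rw [lamOf_conj]; simpa using hz.2.2

theorem hat_conj (z : ℂ) : hat k₀ ((starRingEnd ℂ) z) = (starRingEnd ℂ) (hat k₀ z) := by
  simp [hat]

theorem gam_ne_zero (hz : z ∈ Good k₀) : gam k₀ z ≠ 0 := by
  rw [gam_eq_mul hz.1]
  exact div_ne_zero (mul_ne_zero two_ne_zero hz.2.1) hz.1

theorem gam_hat (hk : k₀ ≠ 0) (hz : z ≠ 0) :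
    gam k₀ (hat k₀ z) = z ^ 2 / (k₀ : ℂ) ^ 2 * gam k₀ z := by
  have : (k₀ : ℂ) ≠ 0 := by exact_mod_cast hk
  unfold gam hat; field_simp; ring

end Domains

/-! ### Scattering coefficients: unitarity, the jump determinant, and the second symmetry -/

section Scattering

open Set
open scoped Matrix

variable {m : ℕ} {k₀ t : ℝ} {Q : ℝ → ℝ → Matrix (Fin m) (Fin m) ℂ}
  {Qp Qm q : Matrix (Fin m) (Fin m) ℂ} {z s s' : ℂ} {l l' : Filter ℝ}
  {E E' : Matrix (Fin m ⊕ Fin m) (Fin m) ℂ} {F G : ℝ → Matrix (Fin m ⊕ Fin m) (Fin m) ℂ}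

theorem Sig₀.good (hk : 0 < k₀) (hz : z ∈ Sig₀ k₀) : z ∈ Good k₀ := good_of_mem hk (Or.inr hz)

/-- Solutions of the two types at `-∞` are orthogonal. -/
theorem IsJost.orthogonal_atBot (hl : (lamOf k₀ z).im ≤ 0)
    (hF : IsJost k₀ Q t ((starRingEnd ℂ) z) 1 atBot (eigL q ((starRingEnd ℂ) z)) F)
    (hG : IsJost k₀ Q t z (-1) atBot (eigR q z) G) (x : ℝ) : (F x)ᴴ * G x = 0 := by
  refine IsJost.pairing_eq_zero (by simp) hF hG ?_
    ⟨‖Complex.exp ((2 : ℝ) * Complex.I * phase k₀ 0 t z)‖, ?_⟩ x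
  · rw [eigL_eigR_pairing]; simp
  · filter_upwards [eventually_le_atBot 0] with y hy
    have : (1 : ℂ) - -1 = (2 : ℝ) := by push_cast; ring
    rw [this, norm_exp_phase]
    refine mul_le_of_le_one_left (norm_nonneg _) (Real.exp_le_one_iff.2 ?_)
    nlinarith [mul_nonneg_of_nonpos_of_nonpos hl hy]

theorem IsJost.orthogonal_atTop (hl : (lamOf k₀ z).im ≤ 0)
    (hF : IsJost k₀ Q t ((starRingEnd ℂ) z) (-1) atTop (eigR q ((starRingEnd ℂ) z)) F)
    (hG : IsJost k₀ Q t z 1 atTop (eigL q z) G) (x : ℝ) : (F x)ᴴ * G x = 0 := by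
  refine IsJost.pairing_eq_zero (by simp) hF hG ?_
    ⟨‖Complex.exp ((-2 : ℝ) * Complex.I * phase k₀ 0 t z)‖, ?_⟩ x
  · rw [eigR_eigL_pairing]; simp
  · filter_upwards [eventually_ge_atTop 0] with y hy
    have : (-1 : ℂ) - 1 = (-2 : ℝ) := by push_cast; ring
    rw [this, norm_exp_phase]
    refine mul_le_of_le_one_left (norm_nonneg _) (Real.exp_le_one_iff.2 ?_)
    nlinarith [mul_nonpos_of_nonpos_of_nonneg hl hy]

/-- `b(z)`, up to the factor `γ(z)`. -/
def scatB (k₀ : ℝ) (Q : ℝ → ℝ → Matrix (Fin m) (Fin m) ℂ) (Qp Qm : Matrix (Fin m) (Fin m) ℂ)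
    (t : ℝ) (z : ℂ) : Matrix (Fin m) (Fin m) ℂ :=
  (gam k₀ z)⁻¹ •
    ((psi k₀ Q Qp t ((starRingEnd ℂ) z) 0)ᴴ * phi k₀ Q Qm t z 0)

/-- The fundamental matrix at `+∞`. -/
def psiMat (k₀ : ℝ) (Q : ℝ → ℝ → Matrix (Fin m) (Fin m) ℂ) (Qp : Matrix (Fin m) (Fin m) ℂ)
    (t : ℝ) (z : ℂ) : Matrix (Fin m ⊕ Fin m) (Fin m ⊕ Fin m) ℂ :=
  Matrix.fromCols (psiBar k₀ Q Qp t z 0) (psi k₀ Q Qp t z 0)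

theorem ScatPot.psiBar_of_sig (h : ScatPot k₀ Q Qp Qm t) (hz : z ∈ Sig₀ k₀) :
    IsJost k₀ Q t z 1 atTop (eigL Qp z) (psiBar k₀ Q Qp t z) := by
  have h1 := Good.neg_conj (Sig₀.good h.pos (Sig₀.conj h.pos hz))
  rw [Complex.conj_conj] at h1
  exact h.isJost_psiBar h1

theorem ScatPot.psi_of_sig (h : ScatPot k₀ Q Qp Qm t) (hz : z ∈ Sig₀ k₀) :
    IsJost k₀ Q t z (-1) atTop (eigR Qp z) (psi k₀ Q Qp t z) :=
  h.isJost_psi (Sig₀.good h.pos hz).1 (Good.neg_hat h.pos (Sig₀.good h.pos hz))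

/-- On Σ₀ both z and z* carry all Jost solutions. The diagonal pairings equal those of the
asymptotics, namely γ, and the mixed ones vanish; so γ⁻¹Ψ(z*)† inverts Ψ(z). -/
theorem ScatPot.psiMat_conj_mul (h : ScatPot k₀ Q Qp Qm t) (hz : z ∈ Sig₀ k₀) :
    (psiMat k₀ Q Qp t ((starRingEnd ℂ) z))ᴴ * psiMat k₀ Q Qp t z = gam k₀ z • 1 := by
  have hz' := Sig₀.conj h.pos hz
  have hl := ((mem_Sig₀_iff h.pos).1 hz).2.2
  have hl' := ((mem_Sig₀_iff h.pos).1 hz').2.2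
  have hz0 := (Sig₀.good h.pos hz).1
  have e12 : (psiBar k₀ Q Qp t ((starRingEnd ℂ) z) 0)ᴴ * psi k₀ Q Qp t z 0 = 0 := by
    have := IsJost.orthogonal_atTop (z := (starRingEnd ℂ) z) (q := Qp) hl'.le
      (by rw [Complex.conj_conj]; exact h.psi_of_sig hz) (h.psiBar_of_sig hz') 0
    rw [← Matrix.conjTranspose_conjTranspose (psi k₀ Q Qp t z 0), ← Matrix.conjTranspose_mul, this,
      Matrix.conjTranspose_zero]
  have e21 := IsJost.orthogonal_atTop (q := Qp) hl.le (h.psi_of_sig hz') (h.psiBar_of_sig hz) 0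
  have e11 := IsJost.pairing_eq (by simp) (h.psiBar_of_sig hz') (h.psiBar_of_sig hz) 0
  have e22 := IsJost.pairing_eq (by simp) (h.psi_of_sig hz') (h.psi_of_sig hz) 0
  rw [eigL_pairing hz0 h.unit_right.1] at e11
  rw [eigR_pairing hz0 h.unit_right.2] at e22
  rw [psiMat, psiMat, Matrix.conjTranspose_fromCols_eq_fromRows_conjTranspose,
    Matrix.fromRows_mul_fromCols, e11, e12, e21, e22, ← Matrix.fromBlocks_one,
    Matrix.fromBlocks_smul, smul_zero]

theorem ScatPot.scatS_eq (h : ScatPot k₀ Q Qp Qm t) (hz : z ∈ Sig₀ k₀) :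
    scatS k₀ Q Qp Qm t z = (gam k₀ z)⁻¹ • ((psiMat k₀ Q Qp t ((starRingEnd ℂ) z))ᴴ *
      Matrix.fromCols (phi k₀ Q Qm t z 0) (phiBar k₀ Q Qm t z 0)) := by
  have h1 : (psiMat k₀ Q Qp t z)⁻¹ =
      (gam k₀ z)⁻¹ • (psiMat k₀ Q Qp t ((starRingEnd ℂ) z))ᴴ := by
    refine Matrix.inv_eq_left_inv ?_
    rw [Matrix.smul_mul, h.psiMat_conj_mul hz, smul_smul,
      inv_mul_cancel₀ (gam_ne_zero (Sig₀.good h.pos hz)), one_smul]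
  change (psiMat k₀ Q Qp t z)⁻¹ * _ = _
  rw [h1, Matrix.smul_mul]

theorem ScatPot.scatS_blocks (h : ScatPot k₀ Q Qp Qm t) (hz : z ∈ Sig₀ k₀) :
    (scatS k₀ Q Qp Qm t z).toBlocks₁₁ = scatA k₀ Q Qp Qm t z ∧
      (scatS k₀ Q Qp Qm t z).toBlocks₂₁ = scatB k₀ Q Qp Qm t z := by
  rw [h.scatS_eq hz, psiMat, Matrix.conjTranspose_fromCols_eq_fromRows_conjTranspose,
    Matrix.fromRows_mul_fromCols, Matrix.fromBlocks_smul, Matrix.toBlocks_fromBlocks₁₁,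
    Matrix.toBlocks_fromBlocks₂₁]
  exact ⟨rfl, rfl⟩

/-- The two terms assemble to γ⁻² φ(z*)† Ψ(z)Ψ(z*)† φ(z). The middle product is γ, since a one-sided
inverse of a square matrix is two-sided, and φ(z*)†φ(z) is another γ. -/
theorem ScatPot.unitarity (h : ScatPot k₀ Q Qp Qm t) (hz : z ∈ Sig₀ k₀) :
    (scatA k₀ Q Qp Qm t ((starRingEnd ℂ) z))ᴴ * scatA k₀ Q Qp Qm t z +
      (scatB k₀ Q Qp Qm t ((starRingEnd ℂ) z))ᴴ * scatB k₀ Q Qp Qm t z = 1 := by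
  have hz' := Sig₀.conj h.pos hz
  have hg := gam_ne_zero (Sig₀.good h.pos hz)
  have hz0 := (Sig₀.good h.pos hz).1
  have e1 : psiMat k₀ Q Qp t z * (psiMat k₀ Q Qp t ((starRingEnd ℂ) z))ᴴ = gam k₀ z • 1 := by
    have h1 : ((gam k₀ z)⁻¹ • (psiMat k₀ Q Qp t ((starRingEnd ℂ) z))ᴴ) * psiMat k₀ Q Qp t z = 1 := by
      rw [Matrix.smul_mul, h.psiMat_conj_mul hz, smul_smul, inv_mul_cancel₀ hg, one_smul]
    have h2 := mul_eq_one_comm.1 h1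
    rw [Matrix.mul_smul] at h2
    rw [← h2, smul_smul, mul_inv_cancel₀ hg, one_smul]
  rw [psiMat, psiMat, Matrix.conjTranspose_fromCols_eq_fromRows_conjTranspose,
    Matrix.fromCols_mul_fromRows] at e1
  have e2 := IsJost.pairing_eq (by simp) (h.left.isJost_phi (Sig₀.good h.pos hz'))
    (h.left.isJost_phi (Sig₀.good h.pos hz)) 0
  rw [eigL_pairing hz0 h.left.unit.1] at e2
  have hs : star (gam k₀ ((starRingEnd ℂ) z)) = gam k₀ z := by
    rw [← gam_conj]; exact Complex.conj_conj _
  simp only [scatA, scatB, Matrix.conjTranspose_smul, Matrix.conjTranspose_mul,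
    Matrix.conjTranspose_conjTranspose, Complex.conj_conj, Matrix.smul_mul, Matrix.mul_smul,
    smul_smul, star_inv₀, hs, ← smul_add]
  have e3 : ∀ (P : Matrix (Fin m) (Fin m ⊕ Fin m) ℂ) (A B : Matrix (Fin m ⊕ Fin m) (Fin m) ℂ)
      (C D : Matrix (Fin m) (Fin m ⊕ Fin m) ℂ) (u : Matrix (Fin m ⊕ Fin m) (Fin m) ℂ),
      P * A * (C * u) + P * B * (D * u) = P * (A * C + B * D) * u := fun P A B C D u => by
    rw [Matrix.mul_add, Matrix.add_mul]
    simp only [Matrix.mul_assoc]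
  rw [e3, e1, Matrix.mul_smul, Matrix.mul_one, Matrix.smul_mul, e2, smul_smul, smul_smul]
  convert one_smul ℂ (1 : Matrix (Fin m) (Fin m) ℂ) using 2
  field_simp

/-- Multiplying 1 + ρ(z*)†ρ(z) by a(z*)† on the left and by a(z) on the right yields the unitarity
relation; determinants are then taken. -/
theorem ScatPot.jumpDet_eq (h : ScatPot k₀ Q Qp Qm t) (hz : z ∈ Sig₀ k₀)
    (hn : ∀ z ∈ Sig₀ k₀, (scatA k₀ Q Qp Qm t z).det ≠ 0) :
    jumpDet k₀ Q Qp Qm t z = ((scatA k₀ Q Qp Qm t z).det *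
      (starRingEnd ℂ) (scatA k₀ Q Qp Qm t ((starRingEnd ℂ) z)).det)⁻¹ := by
  have hz' := Sig₀.conj h.pos hz
  have hu := h.unitarity hz
  unfold jumpDet refl
  rw [(h.scatS_blocks hz).1, (h.scatS_blocks hz).2, (h.scatS_blocks hz').1, (h.scatS_blocks hz').2]
  have ha := hn z hz
  have ha' := hn _ hz'
  generalize scatA k₀ Q Qp Qm t z = a at *
  generalize scatA k₀ Q Qp Qm t ((starRingEnd ℂ) z) = a' at *
  generalize scatB k₀ Q Qp Qm t z = b at *
  generalize scatB k₀ Q Qp Qm t ((starRingEnd ℂ) z) = b' at *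
  have e1 : a'.det * (starRingEnd ℂ) a'.det ≠ 0 := mul_ne_zero ha' (by simpa using ha')
  have key : a'ᴴ * (1 + (b' * a'⁻¹)ᴴ * (b * a⁻¹)) * a = 1 := by
    have h1 : a'ᴴ * (a'⁻¹)ᴴ = 1 := by
      rw [← Matrix.conjTranspose_mul, Matrix.nonsing_inv_mul _ (Ne.isUnit ha'),
        Matrix.conjTranspose_one]
    have h2 : a⁻¹ * a = 1 := Matrix.nonsing_inv_mul _ (Ne.isUnit ha)
    rw [Matrix.mul_add, Matrix.add_mul, Matrix.mul_one, Matrix.conjTranspose_mul, ← hu]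
    congr 1
    calc a'ᴴ * ((a'⁻¹)ᴴ * b'ᴴ * (b * a⁻¹)) * a = (a'ᴴ * (a'⁻¹)ᴴ) * b'ᴴ * b * (a⁻¹ * a) := by
          simp only [Matrix.mul_assoc]
      _ = b'ᴴ * b := by rw [h1, h2, Matrix.one_mul, Matrix.mul_one]
  have h3 := congrArg Matrix.det key
  rw [Matrix.det_mul, Matrix.det_mul, Matrix.det_one, Matrix.det_conjTranspose] at h3
  refine eq_inv_of_mul_eq_one_left ?_
  rw [← h3]
  simp only [starRingEnd_apply]
  ring

-- Since b†b is positive, every eigenvalue of a†a lies in [0, 1], and |det a|² is their product.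
open scoped ComplexOrder in
theorem norm_det_le_one {a b : Matrix (Fin m) (Fin m) ℂ} (h : aᴴ * a + bᴴ * b = 1) :
    ‖a.det‖ ≤ 1 := by
  have hA : (aᴴ * a).PosSemidef := Matrix.posSemidef_conjTranspose_mul_self a
  have hB : (bᴴ * b).PosSemidef := Matrix.posSemidef_conjTranspose_mul_self b
  have h1 : ∀ i, hA.1.eigenvalues i ≤ 1 := fun i => by
    rw [hA.1.eigenvalues_eq]
    have h2 : aᴴ * a = 1 - bᴴ * b := eq_sub_of_add_eq h
    have h3 := hB.re_dotProduct_nonneg (hA.1.eigenvectorBasis i : Fin m → ℂ)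
    have h4 : (star (hA.1.eigenvectorBasis i : Fin m → ℂ)) ⬝ᵥ
        (hA.1.eigenvectorBasis i : Fin m → ℂ) = 1 := by
      have := hA.1.eigenvectorBasis.orthonormal.1 i
      have h5 : inner ℂ (hA.1.eigenvectorBasis i) (hA.1.eigenvectorBasis i) = (1 : ℂ) := by
        rw [inner_self_eq_norm_sq_to_K, this]; simp
      rw [EuclideanSpace.inner_eq_star_dotProduct] at h5
      rw [dotProduct_comm]; exact h5
    generalize (hA.1.eigenvectorBasis i : Fin m → ℂ) = v at h3 h4 ⊢
    rw [h2, Matrix.sub_mulVec, Matrix.one_mulVec, dotProduct_sub, h4, map_sub]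
    simp only [RCLike.one_re]
    linarith
  have h5 : (aᴴ * a).det = ((‖a.det‖ ^ 2 : ℝ) : ℂ) := by
    rw [Matrix.det_mul, Matrix.det_conjTranspose]
    have := Complex.conj_mul' a.det
    push_cast; exact this
  rw [hA.1.det_eq_prod_eigenvalues] at h5
  have h6 : ∏ i, hA.1.eigenvalues i = ‖a.det‖ ^ 2 := by
    exact Complex.ofReal_injective (by rw [← h5, Complex.ofReal_prod]; rfl)
  have h7 : ∏ i, hA.1.eigenvalues i ≤ 1 :=
    Finset.prod_le_one (fun i _ => hA.eigenvalues_nonneg i) fun i _ => h1 i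
  rw [h6] at h7
  exact (sq_le_one_iff₀ (norm_nonneg _)).1 h7

theorem ScatPot.norm_det_scatA_le (h : ScatPot k₀ Q Qp Qm t) {x : ℝ} (hx : x ≠ 0) :
    ‖(scatA k₀ Q Qp Qm t x).det‖ ≤ 1 := by
  have hz : (x : ℂ) ∈ Sig₀ k₀ := by
    refine ⟨Or.inl (by simp), ?_⟩
    rintro (h1 | h1 | h1)
    · exact hx (by exact_mod_cast h1)
    · have := congrArg Complex.im h1; simp at this; exact h.pos.ne' this.symm
    · have := congrArg Complex.im h1; simp at this; exact h.pos.ne' this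
  have := h.unitarity hz
  rw [Complex.conj_ofReal] at this
  exact norm_det_le_one this

theorem det_eigenvector (hz : z ≠ 0) (hq : qᴴ * q = (k₀ : ℂ) ^ 2 • 1) :
    (Matrix.fromCols (eigL q z) (eigR q z)).det = gam k₀ z ^ m := by
  have h : Matrix.fromCols (eigL q z) (eigR q z) =
      Matrix.fromBlocks 1 (-(Complex.I / z) • q) (-(Complex.I / z) • qᴴ) 1 := by
    ext (i | i) (j | j) <;> rfl
  rw [h, Matrix.det_fromBlocks_one₁₁, smul_mul_smul_comm, hq, smul_smul]
  have h2 : (1 : Matrix (Fin m) (Fin m) ℂ) -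
      (-(Complex.I / z) * -(Complex.I / z) * (k₀ : ℂ) ^ 2) • 1 = gam k₀ z • 1 := by
    have : gam k₀ z = 1 - (-(Complex.I / z) * -(Complex.I / z) * (k₀ : ℂ) ^ 2) := by
      simp only [gam]; field_simp; rw [Complex.I_sq]; ring
    rw [this, sub_smul, one_smul]
  rw [h2, Matrix.det_smul, Matrix.det_one, mul_one, Fintype.card_fin]

theorem det_eigenvector_conj (hz : z ≠ 0) (hq : qᴴ * q = (k₀ : ℂ) ^ 2 • 1) :
    (Matrix.fromRows (eigL q ((starRingEnd ℂ) z))ᴴ (eigR q ((starRingEnd ℂ) z))ᴴ).det =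
      gam k₀ z ^ m := by
  rw [← Matrix.conjTranspose_fromCols_eq_fromRows_conjTranspose, Matrix.det_conjTranspose,
    det_eigenvector (by simpa using hz) hq, star_pow, ← gam_conj]
  congr 1
  exact Complex.conj_conj _

theorem continuous_fromRows : Continuous fun p : Matrix (Fin m) (Fin m ⊕ Fin m) ℂ ×
    Matrix (Fin m) (Fin m ⊕ Fin m) ℂ => Matrix.fromRows p.1 p.2 := by
  refine continuous_matrix ?_
  rintro (i | i) j
  · exact continuous_fst.matrix_elem i j
  · exact continuous_snd.matrix_elem i j

/-- The Wronskian is constant in x because the Lax matrix is traceless. -/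
theorem trace_const (hF : IsJost k₀ Q t z s l E F) (hG : IsJost k₀ Q t z s' l' E' G) (x y : ℝ) :
    (Matrix.fromCols (F x) (G x)).det = (Matrix.fromCols (F y) (G y)).det := by
  refine det_const_of_trace_zero (X := fun x => Matrix.fromCols (F x) (G x))
    (L := fun x => laxM k₀ (Q x t) z) (fun x => ?_) (fun x => trace_laxM _ _) x y
  rw [Matrix.mul_fromCols]
  have h1 := hasDerivAt_matrix.1 (hF.hasDerivAt x)
  have h2 := hasDerivAt_matrix.1 (hG.hasDerivAt x)
  rw [hasDerivAt_matrix]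
  rintro i (j | j)
  · exact h1 i j
  · exact h2 i j

theorem det_fromRows_mul_det_fromCols {P Y : Matrix (Fin m) (Fin m ⊕ Fin m) ℂ}
    {v u : Matrix (Fin m ⊕ Fin m) (Fin m) ℂ} (h : P * u = 0) :
    (Matrix.fromRows P Y).det * (Matrix.fromCols v u).det = (P * v).det * (Y * u).det := by
  rw [← Matrix.det_mul, Matrix.fromRows_mul_fromCols, h, Matrix.det_fromBlocks_zero₁₂]

theorem det_fromRows_mul_det_fromCols' {P Y : Matrix (Fin m) (Fin m ⊕ Fin m) ℂ}
    {v u : Matrix (Fin m ⊕ Fin m) (Fin m) ℂ} (h : P * v = 0) :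
    (Matrix.fromRows Y P).det * (Matrix.fromCols v u).det = (Y * v).det * (P * u).det := by
  rw [← Matrix.det_mul, Matrix.fromRows_mul_fromCols, h, Matrix.det_fromBlocks_zero₂₁]

/-- The conjugate of the normalized asymptotics. -/
theorem IsJost.tendsto_conjTranspose (hs : (starRingEnd ℂ) s = s)
    (hF : IsJost k₀ Q t ((starRingEnd ℂ) z) s l E F) :
    Tendsto (fun x => Complex.exp (-s * Complex.I * phase k₀ x t z) • (F x)ᴴ) l (𝓝 Eᴴ) := by
  refine ((continuous_id.matrix_conjTranspose.tendsto E).comp hF.asymp).congr fun x => ?_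
  simp only [Function.comp_apply, id_eq]
  rw [Matrix.conjTranspose_smul]
  congr 1
  rw [phase_neg_conj]
  change (starRingEnd ℂ) _ = _
  rw [← Complex.exp_conj]
  simp [hs]

/-- For `Im λ ≤ 0` the pairing of the two first solutions equals the Wronskian. -/
theorem ScatPot.det_pairing_left (h : ScatPot k₀ Q Qp Qm t) (hz0 : z ≠ 0) (hl0 : lamOf k₀ z ≠ 0)
    (hl : (lamOf k₀ z).im ≤ 0)
    (hF : IsJost k₀ Q t ((starRingEnd ℂ) z) 1 atBot (eigL Qm ((starRingEnd ℂ) z)) F)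
    {u v : ℝ → Matrix (Fin m ⊕ Fin m) (Fin m) ℂ}
    (hu : IsJost k₀ Q t z (-1) atBot (eigR Qm z) u)
    (hv : IsJost k₀ Q t z s l E v) :
    ((F 0)ᴴ * v 0).det = (Matrix.fromCols (v 0) (u 0)).det := by
  set Y := (eigR Qm ((starRingEnd ℂ) z))ᴴ with hY
  set c : ℝ → ℂ := fun x => Complex.exp (-1 * Complex.I * phase k₀ x t z)
  -- As F†u = 0, the product of (F†; Y) with (v, u) is block triangular. The same factor c
  -- normalizes F† and u, and the constant row block Y is chosen so that both accompanying
  -- determinants tend to γ^m.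
  have e : ∀ x, (Matrix.fromRows (c x • (F x)ᴴ) Y).det * (Matrix.fromCols (v 0) (u 0)).det =
      ((F 0)ᴴ * v 0).det * (Y * (c x • u x)).det := fun x => by
    have hc : c x ≠ 0 := Complex.exp_ne_zero _
    have h1 : (c x • (F x)ᴴ) * u x = 0 := by
      rw [Matrix.smul_mul, hF.orthogonal_atBot hl hu x, smul_zero]
    have h2 := det_fromRows_mul_det_fromCols (Y := Y) (v := v x) h1
    rw [trace_const hv hu 0 x, h2, Matrix.smul_mul, hF.pairing_const hv 0 x, Matrix.mul_smul,
      Matrix.det_smul, Matrix.det_smul]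
    ring
  have t1 : Tendsto (fun x => (Matrix.fromRows (c x • (F x)ᴴ) Y).det *
      (Matrix.fromCols (v 0) (u 0)).det) atBot
      (𝓝 (gam k₀ z ^ m * (Matrix.fromCols (v 0) (u 0)).det)) := by
    rw [← det_eigenvector_conj hz0 h.left.unit.2]
    have := hF.tendsto_conjTranspose (by simp)
    exact (((continuous_fromRows.matrix_det).tendsto (_, Y)).comp
      (this.prodMk_nhds tendsto_const_nhds)).mul_const _
  have t2 : Tendsto (fun x => ((F 0)ᴴ * v 0).det * (Y * (c x • u x)).det) atBot
      (𝓝 (((F 0)ᴴ * v 0).det * gam k₀ z ^ m)) := by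
    have h3 : (Y * eigR Qm z).det = gam k₀ z ^ m := by
      rw [eigR_pairing hz0 h.left.unit.2, Matrix.det_smul, Matrix.det_one, mul_one, Fintype.card_fin]
    rw [← h3]
    exact (((continuous_const.matrix_mul continuous_id).matrix_det.tendsto _).comp
      hu.asymp).const_mul _
  have hg : gam k₀ z ^ m ≠ 0 := by
    rw [gam_eq_mul hz0]
    exact pow_ne_zero _ (div_ne_zero (mul_ne_zero two_ne_zero hl0) hz0)
  have := tendsto_nhds_unique (t1.congr e) t2
  rw [mul_comm] at this
  exact (mul_right_cancel₀ hg this).symm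

theorem ScatPot.det_pairing_right (h : ScatPot k₀ Q Qp Qm t) (hz0 : z ≠ 0) (hl0 : lamOf k₀ z ≠ 0)
    (hl : (lamOf k₀ z).im ≤ 0)
    (hF : IsJost k₀ Q t ((starRingEnd ℂ) z) (-1) atTop (eigR Qp ((starRingEnd ℂ) z)) F)
    {u v : ℝ → Matrix (Fin m ⊕ Fin m) (Fin m) ℂ}
    (hv : IsJost k₀ Q t z 1 atTop (eigL Qp z) v)
    (hu : IsJost k₀ Q t z s l E u) :
    ((F 0)ᴴ * u 0).det = (Matrix.fromCols (v 0) (u 0)).det := by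
  set Y := (eigL Qp ((starRingEnd ℂ) z))ᴴ with hY
  set c : ℝ → ℂ := fun x => Complex.exp (1 * Complex.I * phase k₀ x t z)
  have e : ∀ x, (Matrix.fromRows Y (c x • (F x)ᴴ)).det * (Matrix.fromCols (v 0) (u 0)).det =
      ((F 0)ᴴ * u 0).det * (Y * (c x • v x)).det := fun x => by
    have hc : c x ≠ 0 := Complex.exp_ne_zero _
    have h1 : (c x • (F x)ᴴ) * v x = 0 := by
      rw [Matrix.smul_mul, hF.orthogonal_atTop hl hv x, smul_zero]
    have h2 := det_fromRows_mul_det_fromCols' (Y := Y) (u := u x) h1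
    rw [trace_const hv hu 0 x, h2, Matrix.smul_mul, hF.pairing_const hu 0 x, Matrix.mul_smul,
      Matrix.det_smul, Matrix.det_smul]
    ring
  have t1 : Tendsto (fun x => (Matrix.fromRows Y (c x • (F x)ᴴ)).det *
      (Matrix.fromCols (v 0) (u 0)).det) atTop
      (𝓝 (gam k₀ z ^ m * (Matrix.fromCols (v 0) (u 0)).det)) := by
    rw [← det_eigenvector_conj hz0 h.unit_right.2]
    have := hF.tendsto_conjTranspose (by simp)
    rw [neg_neg] at this
    exact (((continuous_fromRows.matrix_det).tendsto (Y, _)).comp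
      (tendsto_const_nhds.prodMk_nhds this)).mul_const _
  have t2 : Tendsto (fun x => ((F 0)ᴴ * u 0).det * (Y * (c x • v x)).det) atTop
      (𝓝 (((F 0)ᴴ * u 0).det * gam k₀ z ^ m)) := by
    have h3 : (Y * eigL Qp z).det = gam k₀ z ^ m := by
      rw [eigL_pairing hz0 h.unit_right.1, Matrix.det_smul, Matrix.det_one, mul_one, Fintype.card_fin]
    rw [← h3]
    exact (((continuous_const.matrix_mul continuous_id).matrix_det.tendsto _).comp
      hv.asymp).const_mul _
  have hg : gam k₀ z ^ m ≠ 0 := by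
    rw [gam_eq_mul hz0]
    exact pow_ne_zero _ (div_ne_zero (mul_ne_zero two_ne_zero hl0) hz0)
  have := tendsto_nhds_unique (t1.congr e) t2
  rw [mul_comm] at this
  exact (mul_right_cancel₀ hg this).symm

theorem gam_pow_mul_det (hz : z ∈ Good k₀) :
    gam k₀ z ^ m * (scatA k₀ Q Qp Qm t z).det =
      ((psiBar k₀ Q Qp t ((starRingEnd ℂ) z) 0)ᴴ * phi k₀ Q Qm t z 0).det := by
  rw [scatA, Matrix.det_smul, Fintype.card_fin, ← mul_assoc, ← mul_pow,
    mul_inv_cancel₀ (gam_ne_zero hz), one_pow, one_mul]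

/-- The symmetry of `det a` under `z ↦ -k₀²/z*`. -/
theorem ScatPot.det_scatA_symm (h : ScatPot k₀ Q Qp Qm t) (hz : z ∈ Good k₀) :
    (scatA k₀ Q Qp Qm t z).det = 1 / (k₀ : ℂ) ^ (2 * m) * (Qp.det * (Qmᴴ).det) *
      (starRingEnd ℂ) (scatA k₀ Q Qp Qm t (hat k₀ ((starRingEnd ℂ) z))).det := by
  have hk : (k₀ : ℂ) ≠ 0 := by exact_mod_cast h.pos.ne'
  set w := (starRingEnd ℂ) z with hw
  have hzw : (starRingEnd ℂ) w = z := Complex.conj_conj z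
  have hw0 : w ≠ 0 := by simpa [hw] using hz.1
  have hlw0 : lamOf k₀ w ≠ 0 := by rw [hw, lamOf_conj]; simpa using hz.2.1
  have hlw : (lamOf k₀ w).im ≤ 0 := by rw [hw, lamOf_conj]; simpa using hz.2.2
  have hgw : hat k₀ w ∈ Good k₀ := Good.hat_conj h.pos hz
  have jpsiBar := h.isJost_psiBar (z := w) (Good.neg_conj hz)
  have jphiBar := h.isJost_phiBar hw0 hgw
  have jphi : IsJost k₀ Q t ((starRingEnd ℂ) w) 1 atBot (eigL Qm ((starRingEnd ℂ) w))
      (phi k₀ Q Qm t z) := by rw [hzw]; exact h.left.isJost_phi hz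
  have jpsi : IsJost k₀ Q t ((starRingEnd ℂ) w) (-1) atTop (eigR Qp ((starRingEnd ℂ) w))
      (psi k₀ Q Qp t z) := by rw [hzw]; exact h.isJost_psi hz.1 (Good.neg_hat h.pos hz)
  -- Both sides equal the Wronskian of ψ̄ and φ̄ at z*. This works in D⁺ itself, not only on Σ₀;
  -- expressing φ̄ and ψ through φ and ψ̄ at the image point then yields the symmetry.
  have e1 : ((phi k₀ Q Qm t z 0)ᴴ * psiBar k₀ Q Qp t w 0).det =
      ((psi k₀ Q Qp t z 0)ᴴ * phiBar k₀ Q Qm t w 0).det := by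
    rw [h.det_pairing_left hw0 hlw0 hlw jphi jphiBar jpsiBar,
      h.det_pairing_right hw0 hlw0 hlw jpsi jpsiBar jphiBar]
  have e2 := congrArg star e1
  rw [← Matrix.det_conjTranspose, ← Matrix.det_conjTranspose, Matrix.conjTranspose_mul,
    Matrix.conjTranspose_mul, Matrix.conjTranspose_conjTranspose,
    Matrix.conjTranspose_conjTranspose, ← gam_pow_mul_det hz, h.phiBar_eq hw0 hgw,
    h.psi_eq hz.1 (Good.neg_hat h.pos hz)] at e2
  have e3 := gam_pow_mul_det (Q := Q) (Qp := Qp) (Qm := Qm) (t := t) hgw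
  rw [← hat_conj, hzw] at e3
  have e4 := congrArg star e3
  rw [← Matrix.det_conjTranspose, Matrix.conjTranspose_mul, Matrix.conjTranspose_conjTranspose,
    gam_hat h.pos.ne' hw0] at e4
  rw [Matrix.conjTranspose_mul, ← Matrix.mul_assoc, Matrix.mul_assoc _ _ (psiBar _ _ _ _ _ _),
    Matrix.det_mul, Matrix.det_mul, ← e4, Matrix.conjTranspose_smul, Matrix.det_smul,
    Matrix.det_smul, Fintype.card_fin, star_mul, star_pow, star_mul, star_div₀, star_pow, star_pow]
    at e2
  have hg := gam_ne_zero hz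
  have s1 : star (gam k₀ w) = gam k₀ z := by
    change (starRingEnd ℂ) _ = _
    rw [gam_conj, hzw]
  have s2 : star w = z := hzw
  have s3 : star (k₀ : ℂ) = k₀ := Complex.conj_ofReal _
  have s4 : star (-(Complex.I / w)) = Complex.I / z := by
    rw [star_neg, star_div₀, s2]
    change -((starRingEnd ℂ) _ / _) = _
    rw [Complex.conj_I]; ring
  rw [s1, s2, s3, s4] at e2
  refine mul_left_cancel₀ (pow_ne_zero m hg) ?_
  rw [e2]
  simp only [starRingEnd_apply]
  have e5 : (Complex.I / z) ^ m * (z ^ 2 / (k₀ : ℂ) ^ 2 * gam k₀ z) ^ m * (-(Complex.I / z)) ^ m =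
      gam k₀ z ^ m * (1 / (k₀ : ℂ) ^ (2 * m)) := by
    rw [pow_mul, one_div, ← inv_pow, ← mul_pow, ← mul_pow, ← mul_pow]
    congr 1
    have := hz.1
    field_simp
    rw [Complex.I_sq]; ring
  linear_combination (Qmᴴ.det * Qp.det * star (scatA k₀ Q Qp Qm t (hat k₀ w)).det) * e5

end Scattering

/-! ### Holomorphy and continuity of the scattering coefficient -/

section Parameter

open Set
open scoped Matrix

variable {m : ℕ} {k₀ t : ℝ} {Q : ℝ → ℝ → Matrix (Fin m) (Fin m) ℂ}
  {Qp Qm : Matrix (Fin m) (Fin m) ℂ} {z : ℂ} {q : ℝ → Matrix (Fin m) (Fin m) ℂ}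
  {q₀ : Matrix (Fin m) (Fin m) ℂ}

instance : FiniteDimensional ℂ (BAlg m) := inferInstanceAs (FiniteDimensional ℂ (BMat m))

/-- The matrix `σ₃` in the Banach algebra. -/
def sigThree (m : ℕ) : BAlg m := (Matrix.fromBlocks 1 0 0 (-1) : BMat m)

/-- The projection on the first `m` coordinates. -/
def fstProj (m : ℕ) : BAlg m := (Matrix.fromBlocks 1 0 0 0 : BMat m)

/-- A constant off-diagonal matrix in the Banach algebra. -/
def offAlg (q : Matrix (Fin m) (Fin m) ℂ) : BAlg m := offDiag q

/-- `projOne` with values in the Banach algebra. -/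
def projAlg₁ (k₀ : ℝ) (q : Matrix (Fin m) (Fin m) ℂ) (z : ℂ) : BAlg m := projOne k₀ q z

/-- `projTwo` with values in the Banach algebra. -/
def projAlg₂ (k₀ : ℝ) (q : Matrix (Fin m) (Fin m) ℂ) (z : ℂ) : BAlg m := projTwo k₀ q z

/-- `jostM` at the origin with values in the Banach algebra. -/
def jostAlg (k₀ : ℝ) (q : ℝ → Matrix (Fin m) (Fin m) ℂ) (q₀ : Matrix (Fin m) (Fin m) ℂ) (z : ℂ) :
    BAlg m := jostM k₀ q q₀ z 0

/-- A matrix entry as a continuous linear functional. -/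
def entry (i j : Fin m ⊕ Fin m) : BAlg m →L[ℂ] ℂ :=
  LinearMap.toContinuousLinearMap
    ({ toFun := fun X : BMat m => X i j, map_add' := fun _ _ => rfl, map_smul' := fun _ _ => rfl } :
      BMat m →ₗ[ℂ] ℂ)

theorem kOf_div_lamOf (hz : z ∈ Good k₀) :
    (lamOf k₀ z)⁻¹ * kOf k₀ z = 1 - (k₀ : ℂ) ^ 2 / z * (lamOf k₀ z)⁻¹ := by
  have h1 : kOf k₀ z = lamOf k₀ z - (k₀ : ℂ) ^ 2 / z := by unfold kOf lamOf; ring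
  rw [h1, mul_sub, inv_mul_cancel₀ hz.2.1, mul_comm]

/-- With k/λ rewritten as 1 - k₀²/(zλ), the projection is a constant matrix plus terms with explicit
factors 1/λ. Holomorphy and the behaviour at infinity can both be read off. -/
theorem projAlg₁_eq (hz : z ∈ Good k₀) (q : Matrix (Fin m) (Fin m) ℂ) :
    projAlg₁ k₀ q z = fstProj m + ((lamOf k₀ z)⁻¹ *
      (-((k₀ : ℂ) ^ 2 / (2 * z)))) • sigThree m + ((lamOf k₀ z)⁻¹ * (Complex.I / 2)) • offAlg q := by
  have h := kOf_div_lamOf hz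
  have h2 : (Complex.I * lamOf k₀ z)⁻¹ = (lamOf k₀ z)⁻¹ * -Complex.I := by
    rw [mul_inv, Complex.inv_I, mul_comm]
  have e : ∀ i j, (projOne k₀ q z : BMat m) i j = ((Matrix.fromBlocks 1 0 0 0 : BMat m) +
      ((lamOf k₀ z)⁻¹ * (-((k₀ : ℂ) ^ 2 / (2 * z)))) • (Matrix.fromBlocks 1 0 0 (-1) : BMat m) +
      ((lamOf k₀ z)⁻¹ * (Complex.I / 2)) • offDiag q) i j := by
    have h3 : Complex.I * Complex.I = -1 := Complex.I_mul_I
    rintro (i | i) (j | j)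
    · by_cases hij : i = j
      · subst hij
        simp [projOne, laxM, offDiag, h2]
        linear_combination (1 / 2) * h - (1 / 2 * (lamOf k₀ z)⁻¹ * kOf k₀ z) * h3
      · simp [projOne, laxM, offDiag, hij]
    · simp [projOne, laxM, offDiag, h2]; ring
    · simp [projOne, laxM, offDiag, h2]; ring
    · by_cases hij : i = j
      · subst hij
        simp [projOne, laxM, offDiag, h2]
        linear_combination (-1 / 2) * h + (1 / 2 * (lamOf k₀ z)⁻¹ * kOf k₀ z) * h3
      · simp [projOne, laxM, offDiag, hij]
  exact Matrix.ext e

theorem projAlg₂_eq (q : Matrix (Fin m) (Fin m) ℂ) (z : ℂ) :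
    projAlg₂ k₀ q z = 1 - projAlg₁ k₀ q z := by
  have := projOne_add_projTwo (k₀ := k₀) q z
  exact eq_sub_of_add_eq' this

theorem differentiableOn_lamOf : DifferentiableOn ℂ (lamOf k₀) {z | z ≠ 0} := by
  unfold lamOf
  exact (differentiableOn_id.add ((differentiableOn_const _).div differentiableOn_id
    fun z hz => hz)).div_const 2

theorem differentiableOn_projAlg₁ (q : Matrix (Fin m) (Fin m) ℂ) {S : Set ℂ} (hS : S ⊆ Good k₀) :
    DifferentiableOn ℂ (projAlg₁ k₀ q) S := by
  have h : DifferentiableOn ℂ (fun z => fstProj m + ((lamOf k₀ z)⁻¹ *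
      (-((k₀ : ℂ) ^ 2 / (2 * z)))) • sigThree m + ((lamOf k₀ z)⁻¹ * (Complex.I / 2)) • offAlg q)
      S := by
    have h1 : DifferentiableOn ℂ (fun z => (lamOf k₀ z)⁻¹) S :=
      (differentiableOn_lamOf.mono fun z hz => (hS hz).1).inv fun z hz => (hS hz).2.1
    have h2 : DifferentiableOn ℂ (fun z : ℂ => -((k₀ : ℂ) ^ 2 / (2 * z))) S := by
      exact ((differentiableOn_const _).div (differentiableOn_id.const_mul 2)
        fun z hz => mul_ne_zero two_ne_zero (hS hz).1).neg
    exact (((h1.mul h2).smul_const _).const_add _).add ((h1.mul_const _).smul_const _)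
  exact h.congr fun z hz => projAlg₁_eq (hS hz) q

theorem differentiableOn_projAlg₂ (q : Matrix (Fin m) (Fin m) ℂ) {S : Set ℂ} (hS : S ⊆ Good k₀) :
    DifferentiableOn ℂ (projAlg₂ k₀ q) S :=
  ((differentiableOn_projAlg₁ q hS).const_sub 1).congr fun z _ => projAlg₂_eq q z

theorem isOpen_Dplus : IsOpen (Dplus k₀) := isOpen_lt continuous_const (by fun_prop)

theorem Dplus_subset (hk : 0 < k₀) : Dplus k₀ ⊆ Good k₀ := fun _ hz => good_of_mem hk (Or.inl hz)

theorem LeftPot.differentiableOn_jostAlg (h : LeftPot k₀ q q₀) :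
    DifferentiableOn ℂ (jostAlg k₀ q q₀) (Dplus k₀) :=
  differentiableOn_volt (𝔸 := BAlg m) h.continuous_pert h.integrableOn_pert isOpen_Dplus
    (fun _ hz => re_two_I_lam_nonpos (Dplus_subset h.pos hz))
    (differentiableOn_projAlg₁ q₀ (Dplus_subset h.pos))
    (differentiableOn_projAlg₂ q₀ (Dplus_subset h.pos))
    (differentiableOn_projAlg₁ q₀ (Dplus_subset h.pos))
    ((differentiableOn_lamOf.mono fun _ hz => (Dplus_subset h.pos hz).1).const_mul _) 0

theorem LeftPot.continuousOn_jostAlg (h : LeftPot k₀ q q₀) :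
    ContinuousOn (jostAlg k₀ q q₀) (Good k₀) :=
  continuousOn_volt (𝔸 := BAlg m) h.continuous_pert h.integrableOn_pert
    (fun _ hz => re_two_I_lam_nonpos hz)
    (differentiableOn_projAlg₁ q₀ subset_rfl).continuousOn
    (differentiableOn_projAlg₂ q₀ subset_rfl).continuousOn
    (differentiableOn_projAlg₁ q₀ subset_rfl).continuousOn
    ((differentiableOn_lamOf.mono fun _ hz => hz.1).const_mul _).continuousOn 0

/-- The normalized first Jost solution at `x = 0`, without its exponential factor. -/
def jostCol (k₀ : ℝ) (q : ℝ → Matrix (Fin m) (Fin m) ℂ) (q₀ : Matrix (Fin m) (Fin m) ℂ) (z : ℂ) :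
    Matrix (Fin m ⊕ Fin m) (Fin m) ℂ := jostM k₀ q q₀ z 0 * eigL q₀ z

theorem differentiableOn_eigL (q₀ : Matrix (Fin m) (Fin m) ℂ) (i j) :
    DifferentiableOn ℂ (fun z => eigL q₀ z i j) {z | z ≠ 0} := by
  rcases i with i | i
  · exact differentiableOn_const _
  · exact (((differentiableOn_const Complex.I).div differentiableOn_id
      fun z hz => hz).neg).mul_const (q₀ᴴ i j)

theorem LeftPot.differentiableOn_jostCol (h : LeftPot k₀ q q₀) (i j) :
    DifferentiableOn ℂ (fun z => jostCol k₀ q q₀ z i j) (Dplus k₀) := by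
  simp only [jostCol, Matrix.mul_apply]
  refine DifferentiableOn.fun_sum fun k _ => DifferentiableOn.mul ?_
    ((differentiableOn_eigL q₀ k j).mono fun z hz => (Dplus_subset h.pos hz).1)
  exact (entry i k).differentiable.comp_differentiableOn h.differentiableOn_jostAlg

theorem LeftPot.continuousOn_jostCol (h : LeftPot k₀ q q₀) :
    ContinuousOn (jostCol k₀ q q₀) (Good k₀) := by
  refine continuousOn_pi.2 fun i => continuousOn_pi.2 fun j => ?_
  simp only [jostCol, Matrix.mul_apply]
  refine continuousOn_finsetSum _ fun k _ => ContinuousOn.mul ?_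
    ((differentiableOn_eigL q₀ k j).continuousOn.mono fun z hz => hz.1)
  exact (entry i k).continuous.comp_continuousOn h.continuousOn_jostAlg

/-- The exponential factors of ψ̄(z*)† and φ(z) cancel, so the essential singularities of the phase
at 0 and ∞ do not enter `a`. -/
theorem ScatPot.scatA_eq (h : ScatPot k₀ Q Qp Qm t) (hz : z ∈ Good k₀) :
    scatA k₀ Q Qp Qm t z = (gam k₀ z)⁻¹ •
      ((jostCol k₀ (fun x => reflQ Q x (-t)) (-Qp) (-(starRingEnd ℂ) z))ᴴ *
        jostCol k₀ (fun x => Q x t) Qm z) := by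
  have hz' := Good.neg_conj hz
  rw [scatA, h.psiBar_eq hz', h.left.phi_eq hz]
  rw [h.right.phi_eq hz']
  simp only [neg_zero]
  rw [phase_reflect, phase_neg_conj, neg_zero, Matrix.conjTranspose_smul,
    Matrix.smul_mul, Matrix.mul_smul, smul_smul]
  have e : star (Complex.exp (-1 * Complex.I * (starRingEnd ℂ) (phase k₀ 0 t z))) *
      Complex.exp (-1 * Complex.I * phase k₀ 0 t z) = 1 := by
    change (starRingEnd ℂ) _ * _ = _
    rw [← Complex.exp_conj, ← Complex.exp_add]
    simp
  rw [smul_smul, mul_assoc, e, mul_one]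
  rfl

theorem differentiableOn_gam : DifferentiableOn ℂ (gam k₀) {z | z ≠ 0} := by
  unfold gam
  exact ((differentiableOn_const _).div (differentiableOn_id.pow 2)
    fun z hz => pow_ne_zero 2 hz).const_add 1

theorem Dplus_neg_conj (hz : z ∈ Dplus k₀) : -(starRingEnd ℂ) z ∈ Dplus k₀ := by
  simpa [Dplus] using hz

theorem ScatPot.differentiableOn_scatA (h : ScatPot k₀ Q Qp Qm t) (i j) :
    DifferentiableOn ℂ (fun z => scatA k₀ Q Qp Qm t z i j) (Dplus k₀) := by
  have h0 : DifferentiableOn ℂ (fun z => (gam k₀ z)⁻¹) (Dplus k₀) :=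
    (differentiableOn_gam.mono fun z hz => ne_zero_of_mem_Dplus hz).inv
      fun z hz => gam_ne_zero (Dplus_subset h.pos hz)
  have h1 : DifferentiableOn ℂ (fun z => (gam k₀ z)⁻¹ *
      ∑ k, star (jostCol k₀ (fun x => reflQ Q x (-t)) (-Qp) (-(starRingEnd ℂ) z) k i) *
        jostCol k₀ (fun x => Q x t) Qm z k j) (Dplus k₀) := by
    refine h0.mul (DifferentiableOn.fun_sum fun k _ => DifferentiableOn.mul ?_
      (h.left.differentiableOn_jostCol k j))
    intro z hz
    -- The antiholomorphic argument -z* occurs under a further conjugation, and conj ∘ G ∘ conj is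
    -- holomorphic for holomorphic G.
    have h2 : DifferentiableAt ℂ
        (fun w => jostCol k₀ (fun x => reflQ Q x (-t)) (-Qp) (-w) k i) ((starRingEnd ℂ) z) := by
      have h3 := (h.right.differentiableOn_jostCol k i).differentiableAt
        (isOpen_Dplus.mem_nhds (Dplus_neg_conj hz))
      exact h3.comp ((starRingEnd ℂ) z) (differentiableAt_id.neg)
    have h4 := h2.conj_conj
    rw [Complex.conj_conj] at h4
    exact h4.differentiableWithinAt
  refine h1.congr fun z hz => ?_
  simp only [h.scatA_eq (Dplus_subset h.pos hz), Matrix.smul_apply, smul_eq_mul, Matrix.mul_apply,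
    Matrix.conjTranspose_apply]

theorem ScatPot.continuousOn_scatA (h : ScatPot k₀ Q Qp Qm t) :
    ContinuousOn (scatA k₀ Q Qp Qm t) (Good k₀) := by
  have h0 : ContinuousOn (fun z => (gam k₀ z)⁻¹) (Good k₀) :=
    (differentiableOn_gam.continuousOn.mono fun z hz => hz.1).inv₀ fun z hz => gam_ne_zero hz
  have h1 : ContinuousOn (fun z => jostCol k₀ (fun x => reflQ Q x (-t)) (-Qp)
      (-(starRingEnd ℂ) z)) (Good k₀) :=
    h.right.continuousOn_jostCol.comp (Complex.continuous_conj.neg).continuousOn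
      fun z hz => Good.neg_conj hz
  refine ContinuousOn.congr ?_ fun z hz => h.scatA_eq hz
  have h2 : Continuous fun p : ℂ × Matrix (Fin m ⊕ Fin m) (Fin m) ℂ ×
      Matrix (Fin m ⊕ Fin m) (Fin m) ℂ => p.1 • (p.2.1ᴴ * p.2.2) :=
    continuous_fst.smul ((continuous_fst.comp continuous_snd).matrix_conjTranspose.matrix_mul
      (continuous_snd.comp continuous_snd))
  exact h2.comp_continuousOn (h0.prodMk (h1.prodMk h.left.continuousOn_jostCol))

theorem ScatPot.differentiableOn_det (h : ScatPot k₀ Q Qp Qm t) :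
    DifferentiableOn ℂ (fun z => (scatA k₀ Q Qp Qm t z).det) (Dplus k₀) := by
  simp only [Matrix.det_apply]
  refine DifferentiableOn.fun_sum fun σ _ => ?_
  refine (DifferentiableOn.fun_finsetProd fun i _ => h.differentiableOn_scatA (σ i) i).const_smul _

theorem ScatPot.continuousOn_det (h : ScatPot k₀ Q Qp Qm t) :
    ContinuousOn (fun z => (scatA k₀ Q Qp Qm t z).det) (Good k₀) :=
  (continuous_id.matrix_det).comp_continuousOn h.continuousOn_scatA

end Parameter

/-! ### Limits at infinity and at the origin -/

section Asymptotics

open Set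
open scoped Matrix

variable {m : ℕ} {k₀ t : ℝ} {Q : ℝ → ℝ → Matrix (Fin m) (Fin m) ℂ}
  {Qp Qm : Matrix (Fin m) (Fin m) ℂ} {z : ℂ} {q : ℝ → Matrix (Fin m) (Fin m) ℂ}
  {q₀ : Matrix (Fin m) (Fin m) ℂ}

/-- An off-diagonal matrix has no component from the first block to itself. This removes the
nonoscillating part of the first Picard iterate at z = ∞. -/
theorem fstProj_mul_offAlg_mul (q : Matrix (Fin m) (Fin m) ℂ) :
    fstProj m * (offAlg q * fstProj m) = 0 := by
  have h : (Matrix.fromBlocks 1 0 0 0 : BMat m) * (offDiag q * Matrix.fromBlocks 1 0 0 0) = 0 := by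
    rw [offDiag, Matrix.fromBlocks_multiply, Matrix.fromBlocks_multiply]
    simp
  exact h

theorem norm_lamOf_ge (hk : 0 < k₀) (hz : 2 * k₀ ≤ ‖z‖) : ‖z‖ / 4 ≤ ‖lamOf k₀ z‖ := by
  have h0 : 0 < ‖z‖ := by linarith
  have h1 : ‖(k₀ : ℂ) ^ 2 / z‖ ≤ ‖z‖ / 4 := by
    rw [norm_div, norm_pow, Complex.norm_real, Real.norm_eq_abs, sq_abs, div_le_iff₀ h0]
    nlinarith
  have h2 := norm_sub_le_norm_add z ((k₀ : ℂ) ^ 2 / z)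
  rw [lamOf, norm_div, Complex.norm_ofNat]
  linarith

/-- The projection `projAlg₁` is `O(1/z)` close to `fstProj` at infinity. -/
theorem exists_norm_projAlg₁_sub_le (hk : 0 < k₀) (q : Matrix (Fin m) (Fin m) ℂ) :
    ∃ C, 0 ≤ C ∧ ∀ z ∈ Good k₀, 2 * k₀ ≤ ‖z‖ → ‖projAlg₁ k₀ q z - fstProj m‖ ≤ C / ‖z‖ := by
  refine ⟨4 * (k₀ * ‖sigThree m‖ + ‖offAlg q‖), by positivity, fun z hz hzk => ?_⟩
  have h0 : 0 < ‖z‖ := by linarith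
  have hl := norm_lamOf_ge hk hzk
  have hli : ‖(lamOf k₀ z)⁻¹‖ ≤ 4 / ‖z‖ := by
    rw [norm_inv, inv_le_comm₀ (norm_pos_iff.2 hz.2.1) (by positivity), inv_div]
    exact hl
  have h1 : ‖-((k₀ : ℂ) ^ 2 / (2 * z))‖ ≤ k₀ := by
    rw [norm_neg, norm_div, norm_pow, Complex.norm_real, Real.norm_eq_abs, sq_abs, norm_mul,
      Complex.norm_ofNat, div_le_iff₀ (by positivity)]
    nlinarith
  have h2 : ‖Complex.I / 2‖ ≤ 1 := by
    rw [norm_div, Complex.norm_I, Complex.norm_ofNat]; norm_num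
  rw [projAlg₁_eq hz, add_assoc, add_sub_cancel_left]
  refine (norm_add_le _ _).trans ?_
  rw [norm_smul, norm_smul, norm_mul, norm_mul]
  calc ‖(lamOf k₀ z)⁻¹‖ * ‖-((k₀ : ℂ) ^ 2 / (2 * z))‖ * ‖sigThree m‖ +
        ‖(lamOf k₀ z)⁻¹‖ * ‖Complex.I / 2‖ * ‖offAlg q‖
      ≤ 4 / ‖z‖ * k₀ * ‖sigThree m‖ + 4 / ‖z‖ * 1 * ‖offAlg q‖ := by gcongr
    _ = 4 * (k₀ * ‖sigThree m‖ + ‖offAlg q‖) / ‖z‖ := by ring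

/-- The first Picard iterate splits into its constant and its oscillating part. -/
theorem picard_one_eq {𝔸 : Type*} [NormedRing 𝔸] [NormedAlgebra ℂ 𝔸] [CompleteSpace 𝔸]
    {V : ℝ → 𝔸} {p₁ p₂ e : 𝔸} {μ : ℂ} (hVi : ∀ x, IntegrableOn V (Iic x)) (hμ : μ.re ≤ 0) (x : ℝ) :
    picard p₁ p₂ μ V e 1 x = p₁ * ((∫ y in Iic x, V y) * e) +
      p₂ * ((∫ y in Iic x, Complex.exp (μ * ((x - y : ℝ) : ℂ)) • V y) * e) := by
  have h1 := integrableOn_exp_sub_smul hμ (hVi x)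
  have e1 : ∀ y : ℝ, vker p₁ p₂ μ (x - y) * (V y * picard p₁ p₂ μ V e 0 y) =
      p₁ * (V y * e) + p₂ * ((Complex.exp (μ * ((x - y : ℝ) : ℂ)) • V y) * e) := fun y => by
    simp only [vker, picard, add_mul, smul_mul_assoc, mul_smul_comm]
  rw [picard]
  simp_rw [e1]
  rw [integral_add (((hVi x).mul_const _).const_mul _) ((h1.mul_const _).const_mul _),
    integral_const_mul_of_integrable ((hVi x).mul_const _),
    integral_const_mul_of_integrable (h1.mul_const _),
    integral_mul_const_of_integrable (hVi x), integral_mul_const_of_integrable h1]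

theorem LeftPot.fstProj_integral (h : LeftPot k₀ q q₀) (x : ℝ) :
    fstProj m * ((∫ y in Iic x, pert q q₀ y) * fstProj m) = 0 := by
  rw [← integral_mul_const_of_integrable (h.integrableOn_pert x),
    ← integral_const_mul_of_integrable ((h.integrableOn_pert x).mul_const _)]
  have : ∀ y, fstProj m * (pert q q₀ y * fstProj m) = 0 := fun y => fstProj_mul_offAlg_mul _
  simp [this]

/-- The filter of spectral parameters at infinity. -/
def infGood (k₀ : ℝ) : Filter ℂ := comap norm atTop ⊓ 𝓟 (Good k₀)

instance : (infGood k₀).IsCountablyGenerated := by unfold infGood; infer_instance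

theorem tendsto_norm_infGood : Tendsto (fun z : ℂ => ‖z‖) (infGood k₀) atTop :=
  tendsto_comap.mono_left inf_le_left

theorem eventually_good_infGood : ∀ᶠ z in infGood k₀, z ∈ Good k₀ :=
  mem_inf_of_right (mem_principal_self _)

theorem tendsto_projAlg₁ (hk : 0 < k₀) (q : Matrix (Fin m) (Fin m) ℂ) :
    Tendsto (projAlg₁ k₀ q) (infGood k₀) (𝓝 (fstProj m)) := by
  obtain ⟨C, hC, h⟩ := exists_norm_projAlg₁_sub_le hk q
  rw [tendsto_iff_norm_sub_tendsto_zero]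
  refine squeeze_zero' (Eventually.of_forall fun _ => norm_nonneg _) ?_
    (tendsto_const_nhds.div_atTop (tendsto_norm_infGood (k₀ := k₀)) : Tendsto (fun z => C / ‖z‖) _ _)
  filter_upwards [eventually_good_infGood, tendsto_norm_infGood.eventually_ge_atTop (2 * k₀)]
    with z hz hzk using h z hz hzk

theorem tendsto_projAlg₂ (hk : 0 < k₀) (q : Matrix (Fin m) (Fin m) ℂ) :
    Tendsto (projAlg₂ k₀ q) (infGood k₀) (𝓝 (1 - fstProj m)) :=
  ((tendsto_projAlg₁ hk q).const_sub 1).congr fun z => (projAlg₂_eq q z).symm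

theorem tendsto_norm_lamOf (hk : 0 < k₀) :
    Tendsto (fun z => ‖2 * Complex.I * lamOf k₀ z‖) (infGood k₀) atTop := by
  have h1 : Tendsto (fun z : ℂ => ‖z‖ / 4) (infGood k₀) atTop :=
    tendsto_norm_infGood.atTop_div_const (by norm_num)
  refine tendsto_atTop_mono' _ ?_ h1
  filter_upwards [tendsto_norm_infGood.eventually_ge_atTop (2 * k₀)] with z hz
  have := norm_lamOf_ge hk hz
  rw [norm_mul, norm_mul, Complex.norm_I, Complex.norm_ofNat]
  linarith [norm_nonneg (lamOf k₀ z)]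

/-- It is enough that the first Picard iterate tends to 0: its constant part does so by
`LeftPot.fstProj_integral`, its oscillating part by the Riemann-Lebesgue lemma, as |λ| → ∞ with Im λ
≥ 0. -/
theorem LeftPot.tendsto_jostAlg (h : LeftPot k₀ q q₀) :
    Tendsto (jostAlg k₀ q q₀) (infGood k₀) (𝓝 (fstProj m)) := by
  have t1 := tendsto_projAlg₁ h.pos q₀
  have t2 := tendsto_projAlg₂ h.pos q₀
  have b1 : ∀ᶠ z in infGood k₀, ‖projAlg₁ k₀ q₀ z‖ ≤ ‖fstProj m‖ + 1 :=
    t1.norm.eventually_le_const (by linarith)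
  have b2 : ∀ᶠ z in infGood k₀, ‖projAlg₂ k₀ q₀ z‖ ≤ ‖1 - fstProj m‖ + 1 :=
    t2.norm.eventually_le_const (by linarith)
  set S := {z | z ∈ Good k₀ ∧ ‖projAlg₁ k₀ q₀ z‖ ≤ ‖fstProj m‖ + 1 ∧
    ‖projAlg₂ k₀ q₀ z‖ ≤ ‖1 - fstProj m‖ + 1}
  have hS : S ∈ infGood k₀ := by
    filter_upwards [eventually_good_infGood, b1, b2] with z h1 h2 h3 using ⟨h1, h2, h3⟩
  refine tendsto_volt_parameter (𝔸 := BAlg m) (p₁ := projAlg₁ k₀ q₀) (p₂ := projAlg₂ k₀ q₀)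
    (e := projAlg₁ k₀ q₀) (S := S) (μ := fun z => 2 * Complex.I * lamOf k₀ z)
    (C := ‖fstProj m‖ + 1 + (‖1 - fstProj m‖ + 1)) (B := ‖fstProj m‖ + 1)
    h.continuous_pert h.integrableOn_pert
    hS (fun z hz => re_two_I_lam_nonpos hz.1) (fun z hz => add_le_add hz.2.1 hz.2.2)
    (fun z hz => hz.2.1) t1 (fun x => ?_) 0
  have t3 := tendsto_integral_exp_smul (l := infGood k₀)
    (μ := fun z => 2 * Complex.I * lamOf k₀ z) (by
      filter_upwards [eventually_good_infGood] with z hz using re_two_I_lam_nonpos hz)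
    (tendsto_norm_lamOf h.pos) (h.integrableOn_pert x)
  have t4 := (t1.mul ((tendsto_const_nhds (x := ∫ y in Iic x, pert q q₀ y)).mul t1)).add
    (t2.mul (t3.mul t1))
  rw [h.fstProj_integral, zero_mul, mul_zero, add_zero] at t4
  refine t4.congr' ?_
  filter_upwards [eventually_good_infGood] with z hz
  rw [picard_one_eq h.integrableOn_pert (re_two_I_lam_nonpos hz)]

theorem eigL_tendsto (q₀ : Matrix (Fin m) (Fin m) ℂ) :
    Tendsto (eigL q₀) (infGood k₀) (𝓝 (Matrix.fromRows 1 0)) := by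
  have h1 : Tendsto (fun z : ℂ => -(Complex.I / z)) (infGood k₀) (𝓝 0) := by
    rw [tendsto_zero_iff_norm_tendsto_zero]
    have : Tendsto (fun z : ℂ => 1 / ‖z‖) (infGood k₀) (𝓝 0) :=
      tendsto_const_nhds.div_atTop tendsto_norm_infGood
    refine this.congr fun z => ?_
    rw [norm_neg, norm_div, Complex.norm_I]
  refine tendsto_pi_nhds.2 fun i => tendsto_pi_nhds.2 fun j => ?_
  rcases i with i | i
  · exact tendsto_const_nhds
  · have := h1.mul_const (q₀ᴴ i j)
    rw [zero_mul] at this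
    exact this

theorem LeftPot.tendsto_jostCol (h : LeftPot k₀ q q₀) :
    Tendsto (jostCol k₀ q q₀) (infGood k₀) (𝓝 (Matrix.fromRows 1 0)) := by
  have h1 : Continuous fun p : BMat m × Matrix (Fin m ⊕ Fin m) (Fin m) ℂ => p.1 * p.2 :=
    continuous_fst.matrix_mul continuous_snd
  have h2 := (h1.tendsto ((Matrix.fromBlocks 1 0 0 0 : BMat m), Matrix.fromRows 1 0)).comp
    (Tendsto.prodMk_nhds (show Tendsto (fun z => jostM k₀ q q₀ z 0) (infGood k₀)
      (𝓝 (Matrix.fromBlocks 1 0 0 0 : BMat m)) from h.tendsto_jostAlg) (eigL_tendsto q₀))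
  have h3 : (Matrix.fromBlocks 1 0 0 0 : BMat m) *
      (Matrix.fromRows 1 0 : Matrix (Fin m ⊕ Fin m) (Fin m) ℂ) = Matrix.fromRows 1 0 := by
    rw [Matrix.fromBlocks_mul_fromRows]; simp
  rw [h3] at h2
  exact h2

theorem tendsto_neg_conj_infGood :
    Tendsto (fun z : ℂ => -(starRingEnd ℂ) z) (infGood k₀) (infGood k₀) := by
  refine tendsto_inf.2 ⟨tendsto_comap_iff.2 ?_, tendsto_principal.2 ?_⟩
  · simpa [Function.comp_def] using tendsto_norm_infGood (k₀ := k₀)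
  · filter_upwards [eventually_good_infGood] with z hz using Good.neg_conj hz

theorem gam_tendsto : Tendsto (gam k₀) (infGood k₀) (𝓝 1) := by
  have h1 : Tendsto (fun z : ℂ => (k₀ : ℂ) ^ 2 / z ^ 2) (infGood k₀) (𝓝 0) := by
    rw [tendsto_zero_iff_norm_tendsto_zero]
    have : Tendsto (fun z : ℂ => ‖(k₀ : ℂ) ^ 2‖ / ‖z‖ ^ 2) (infGood k₀) (𝓝 0) :=
      tendsto_const_nhds.div_atTop ((tendsto_pow_atTop two_ne_zero).comp tendsto_norm_infGood)
    refine this.congr fun z => ?_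
    rw [norm_div, norm_pow z]
  have h2 := h1.const_add 1
  rw [add_zero] at h2
  exact h2

theorem conjTranspose_fromRows_mul_self :
    (Matrix.fromRows 1 0 : Matrix (Fin m ⊕ Fin m) (Fin m) ℂ)ᴴ * (Matrix.fromRows 1 0 : Matrix (Fin m ⊕ Fin m) (Fin m) ℂ) = 1 := by
  rw [Matrix.conjTranspose_fromRows_eq_fromCols_conjTranspose, Matrix.fromCols_mul_fromRows]
  simp

theorem ScatPot.tendsto_scatA (h : ScatPot k₀ Q Qp Qm t) :
    Tendsto (scatA k₀ Q Qp Qm t) (infGood k₀) (𝓝 1) := by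
  have h2 : Continuous fun p : Matrix (Fin m ⊕ Fin m) (Fin m) ℂ ×
      Matrix (Fin m ⊕ Fin m) (Fin m) ℂ => p.1ᴴ * p.2 :=
    continuous_fst.matrix_conjTranspose.matrix_mul continuous_snd
  have h3 := (h2.tendsto _).comp
    ((h.right.tendsto_jostCol.comp tendsto_neg_conj_infGood).prodMk_nhds h.left.tendsto_jostCol)
  have h4 := ((gam_tendsto (k₀ := k₀)).inv₀ one_ne_zero).smul h3
  rw [conjTranspose_fromRows_mul_self, inv_one, one_smul] at h4
  refine h4.congr' ?_
  filter_upwards [eventually_good_infGood] with z hz using (h.scatA_eq hz).symm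

theorem ScatPot.tendsto_det (h : ScatPot k₀ Q Qp Qm t) :
    Tendsto (fun z => (scatA k₀ Q Qp Qm t z).det) (infGood k₀) (𝓝 1) := by
  have := ((continuous_id.matrix_det).tendsto _).comp h.tendsto_scatA
  simpa [Function.comp_def] using this

theorem tendsto_hat_conj (hk : 0 < k₀) :
    Tendsto (fun z : ℂ => hat k₀ ((starRingEnd ℂ) z)) (𝓝[Good k₀] 0) (infGood k₀) := by
  refine tendsto_inf.2 ⟨tendsto_comap_iff.2 ?_, tendsto_principal.2 ?_⟩
  · have h1 : Tendsto (fun z : ℂ => ‖z‖⁻¹) (𝓝[≠] 0) atTop := 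
      tendsto_norm_inv_nhdsNE_zero_atTop.congr fun z => norm_inv z
    have h2 : Tendsto (fun z : ℂ => k₀ ^ 2 * ‖z‖⁻¹) (𝓝[Good k₀] 0) atTop :=
      (h1.mono_left (nhdsWithin_mono _ fun z hz => hz.1)).const_mul_atTop (by positivity)
    refine h2.congr fun z => ?_
    simp [hat, div_eq_mul_inv]
  · filter_upwards [self_mem_nhdsWithin] with z hz using Good.hat_conj hk hz

/-- The value of `det a` at the origin. -/
theorem ScatPot.tendsto_det_zero (h : ScatPot k₀ Q Qp Qm t) :
    Tendsto (fun z => (scatA k₀ Q Qp Qm t z).det) (𝓝[Good k₀] 0)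
      (𝓝 (1 / (k₀ : ℂ) ^ (2 * m) * (Qp.det * Qmᴴ.det))) := by
  -- The map z ↦ -k₀²/z* carries the origin to infinity within `Good`, so the limit 1 there is
  -- transported by the symmetry.
  have h1 := ((Complex.continuous_conj.tendsto _).comp (h.tendsto_det.comp
    (tendsto_hat_conj h.pos))).const_mul (1 / (k₀ : ℂ) ^ (2 * m) * (Qp.det * Qmᴴ.det))
  rw [map_one, mul_one] at h1
  refine h1.congr' ?_
  filter_upwards [self_mem_nhdsWithin] with z hz using (h.det_scatA_symm hz).symm

end Asymptotics

/-! ### Rate of convergence along the imaginary axis -/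

section ImaginaryAxis

open Set Asymptotics
open scoped Matrix

variable {m : ℕ} {k₀ t : ℝ} {Q : ℝ → ℝ → Matrix (Fin m) (Fin m) ℂ}
  {Qp Qm : Matrix (Fin m) (Fin m) ℂ} {z : ℂ} {q : ℝ → Matrix (Fin m) (Fin m) ℂ}
  {q₀ : Matrix (Fin m) (Fin m) ℂ}

/-- Integrability alone would give no rate; boundedness, from continuity and the limit at -∞, is
what yields 1/y below. -/
theorem LeftPot.exists_norm_pert_le (h : LeftPot k₀ q q₀) :
    ∃ B, 0 ≤ B ∧ ∀ x ≤ 0, ‖pert q q₀ x‖ ≤ B := by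
  have h1 : Tendsto (pert q q₀) atBot (𝓝 (offDiag (q₀ - q₀) : BMat m)) :=
    (continuous_offDiag.tendsto _).comp (h.lim.sub tendsto_const_nhds)
  have h2 : Tendsto (fun x => ‖pert q q₀ x‖) atBot (𝓝 ‖(offAlg (q₀ - q₀) : BAlg m)‖) :=
    Tendsto.norm (E := BAlg m) h1
  obtain ⟨N, hN⟩ := eventually_atBot.1 (h2.eventually_le_const (lt_add_one _))
  obtain ⟨B, hB⟩ := (isCompact_Icc (a := N) (b := 0)).exists_bound_of_continuousOn
    h.continuous_pert.continuousOn
  refine ⟨max B (‖(offAlg (q₀ - q₀) : BAlg m)‖ + 1), le_max_of_le_right (by positivity),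
    fun x hx => ?_⟩
  rcases le_total x N with hxN | hxN
  · exact (hN x hxN).trans (le_max_right _ _)
  · exact (hB x ⟨hxN, hx⟩).trans (le_max_left _ _)

theorem norm_integral_exp_smul_le_of_bounded {E : Type*} [NormedAddCommGroup E] [NormedSpace ℂ E]
    {f : ℝ → E} {B a : ℝ} {μ : ℂ} (ha : 0 < a)
    (hμ : μ.re ≤ -a) {x : ℝ} (hf : ∀ y ≤ x, ‖f y‖ ≤ B) :
    ‖∫ y in Iic x, Complex.exp (μ * ((x - y : ℝ) : ℂ)) • f y‖ ≤ B / a := by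
  have hi : IntegrableOn (fun y => Real.exp (-(a * x)) * (Real.exp (a * y) * B)) (Iic x) :=
    ((integrableOn_exp_mul_Iic ha x).mul_const _).const_mul _
  have e : ∫ y in Iic x, Real.exp (-(a * x)) * (Real.exp (a * y) * B) = B / a := by
    rw [integral_const_mul, integral_mul_const, integral_exp_mul_Iic ha]
    rw [Real.exp_neg]
    field_simp
  rw [← e]
  refine norm_integral_le_of_norm_le hi ?_
  filter_upwards [ae_restrict_mem measurableSet_Iic] with y hy
  have hy' : y ≤ x := hy
  rw [norm_smul, Complex.norm_exp, ← mul_assoc, ← Real.exp_add]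
  refine mul_le_mul (Real.exp_le_exp.2 ?_) (hf y hy) (norm_nonneg _) (Real.exp_nonneg _)
  simp only [Complex.mul_re, Complex.ofReal_re, Complex.ofReal_im, mul_zero, sub_zero]
  nlinarith

theorem lamOf_mul_I {y : ℝ} (hy : y ≠ 0) :
    lamOf k₀ (y * Complex.I) = (((y - k₀ ^ 2 / y) / 2 : ℝ) : ℂ) * Complex.I := by
  have : (y : ℂ) ≠ 0 := by exact_mod_cast hy
  unfold lamOf; push_cast; field_simp; rw [Complex.I_sq]; ring

theorem mul_I_mem (hk : 0 < k₀) {y : ℝ} (hy : k₀ < y) : (y : ℂ) * Complex.I ∈ Dplus k₀ := by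
  have h0 : 0 < y := hk.trans hy
  simp [Dplus, abs_of_pos h0]
  nlinarith [mul_pos (sub_pos.2 hy) h0, mul_pos (mul_pos (sub_pos.2 hy) h0) (add_pos hk h0)]

/-- On the imaginary axis 2iλ has real part at most -y/2, so the oscillating part of the first
iterate is exponentially damped and is O(1/y) for a bounded potential. `norm_volt_sub_le` carries
the rate over to the solution. -/
theorem LeftPot.jostAlg_imag (h : LeftPot k₀ q q₀) :
    ∃ K, ∀ᶠ y : ℝ in atTop, ‖jostAlg k₀ q q₀ (y * Complex.I) - fstProj m‖ ≤ K / y := by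
  obtain ⟨B, hB0, hB⟩ := h.exists_norm_pert_le
  obtain ⟨C, hC0, hC⟩ := exists_norm_projAlg₁_sub_le h.pos q₀
  set v := vmass (pert q q₀) 0
  have hv : 0 ≤ v := vmass_nonneg 0
  set P := ‖fstProj m‖ + C with hP
  have hP0 : 0 ≤ P := by positivity
  set P' := ‖(1 : BAlg m)‖ + P with hP'
  have hP'0 : 0 ≤ P' := by positivity
  set B₁ := C * (v * P) + ‖fstProj m‖ * (v * C) + P' * (2 * B * P) with hB₁
  have hB₁0 : 0 ≤ B₁ := by positivity
  refine ⟨2 * B₁ * Real.exp (2 * (P + P') * v) + C, ?_⟩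
  filter_upwards [eventually_ge_atTop (2 * k₀), eventually_gt_atTop k₀, eventually_ge_atTop 1]
    with y hy hyk hy1
  have hy0 : 0 < y := by linarith
  set z : ℂ := y * Complex.I with hz
  have hzn : ‖z‖ = y := by simp [hz, abs_of_pos hy0]
  have hzG : z ∈ Good k₀ := Dplus_subset h.pos (mul_I_mem h.pos hyk)
  have hD := hC z hzG (by rw [hzn]; exact hy)
  rw [hzn] at hD
  have hμ0 := re_two_I_lam_nonpos hzG
  have hμ : (2 * Complex.I * lamOf k₀ z).re ≤ -(y / 2) := by
    rw [hz, lamOf_mul_I hy0.ne']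
    have : k₀ ^ 2 / y ≤ y / 2 := by
      rw [div_le_iff₀ hy0]; nlinarith [h.pos]
    have e : 2 * Complex.I * ((((y - k₀ ^ 2 / y) / 2 : ℝ) : ℂ) * Complex.I) =
        ((-(y - k₀ ^ 2 / y) : ℝ) : ℂ) := by
      push_cast; ring_nf; rw [Complex.I_sq]; ring
    rw [e, Complex.ofReal_re]
    linarith
  have hp1 : ‖projAlg₁ k₀ q₀ z‖ ≤ P := by
    have h1 : projAlg₁ k₀ q₀ z = fstProj m + (projAlg₁ k₀ q₀ z - fstProj m) := by abel
    rw [h1]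
    refine (norm_add_le _ _).trans (add_le_add le_rfl (hD.trans ?_))
    exact div_le_self hC0 hy1
  have hp2 : ‖projAlg₂ k₀ q₀ z‖ ≤ P' := by
    rw [projAlg₂_eq]
    exact (norm_sub_le _ _).trans (add_le_add le_rfl hp1)
  have hpic : ∀ x ≤ 0, ‖picard (projAlg₁ k₀ q₀ z) (projAlg₂ k₀ q₀ z) (2 * Complex.I * lamOf k₀ z)
      (pert q q₀) (projAlg₁ k₀ q₀ z) 1 x‖ ≤ B₁ / y := by
    intro x hx
    rw [picard_one_eq h.integrableOn_pert hμ0]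
    have hI : ‖∫ s in Iic x, pert q q₀ s‖ ≤ v :=
      (norm_integral_le_integral_norm _).trans (vmass_mono h.integrableOn_pert hx)
    have hJ := norm_integral_exp_smul_le_of_bounded (by positivity) hμ
      (f := pert q q₀) (x := x) fun s hs => hB s (hs.trans hx)
    have hz0 := h.fstProj_integral x
    generalize (∫ s in Iic x, pert q q₀ s) = I at hI hz0
    generalize (∫ s in Iic x, Complex.exp (2 * Complex.I * lamOf k₀ z * ((x - s : ℝ) : ℂ)) •
      pert q q₀ s) = J at hJ ⊢
    generalize projAlg₁ k₀ q₀ z = p at *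
    generalize projAlg₂ k₀ q₀ z = p' at *
    -- Since I sandwiched between two copies of `fstProj m` vanishes, each remaining term contains
    -- the difference p - `fstProj m` of order 1/y.
    have e1 : p * (I * p) = (p - fstProj m) * (I * p) + fstProj m * (I * (p - fstProj m)) := by
      rw [mul_sub I, mul_sub (fstProj m) (I * p), hz0, sub_zero, sub_mul, sub_add_cancel]
    rw [e1]
    have n1 : ‖(p - fstProj m) * (I * p)‖ ≤ C / y * (v * P) :=
      (norm_mul_le _ _).trans (mul_le_mul hD ((norm_mul_le _ _).trans
        (mul_le_mul hI hp1 (norm_nonneg _) hv)) (norm_nonneg _) (by positivity))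
    have n2 : ‖fstProj m * (I * (p - fstProj m))‖ ≤ ‖fstProj m‖ * (v * (C / y)) :=
      (norm_mul_le _ _).trans (mul_le_mul le_rfl ((norm_mul_le _ _).trans
        (mul_le_mul hI hD (norm_nonneg _) hv)) (norm_nonneg _) (norm_nonneg _))
    have n3 : ‖p' * (J * p)‖ ≤ P' * (B / (y / 2) * P) :=
      (norm_mul_le _ _).trans (mul_le_mul hp2 ((norm_mul_le _ _).trans
        (mul_le_mul hJ hp1 (norm_nonneg _) (by positivity))) (norm_nonneg _) hP'0)
    refine (norm_add_le _ _).trans ((add_le_add ((norm_add_le _ _).trans (add_le_add n1 n2))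
      n3).trans (le_of_eq ?_))
    rw [hB₁]; field_simp
  have h3 := norm_volt_sub_le h.continuous_pert h.integrableOn_pert hμ0
    (add_le_add hp1 hp2) (B := B₁ / y) (by positivity) hpic
  have h4 : jostAlg k₀ q q₀ z = volt (projAlg₁ k₀ q₀ z) (projAlg₂ k₀ q₀ z)
    (2 * Complex.I * lamOf k₀ z) (pert q q₀) (projAlg₁ k₀ q₀ z) 0 := rfl
  rw [h4]
  refine (norm_sub_le_norm_sub_add_norm_sub _ (projAlg₁ k₀ q₀ z) _).trans
    ((add_le_add h3 hD).trans (le_of_eq ?_))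
  change _ = (2 * B₁ * Real.exp (2 * (P + P') * vmass (pert q q₀) 0) + C) / y
  field_simp

/-- Closeness of order `1/y` of matrix functions. -/
def BigOInv {ι κ : Type*} (F : ℝ → Matrix ι κ ℂ) (F₀ : Matrix ι κ ℂ) : Prop :=
  ∀ i j, (fun y => F y i j - F₀ i j) =O[atTop] fun y : ℝ => y⁻¹

theorem BigOInv.tendsto {ι κ : Type*} {F : ℝ → Matrix ι κ ℂ} {F₀ : Matrix ι κ ℂ}
    (h : BigOInv F F₀) : Tendsto F atTop (𝓝 F₀) := by
  refine tendsto_pi_nhds.2 fun i => tendsto_pi_nhds.2 fun j => ?_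
  have := (h i j).trans_tendsto tendsto_inv_atTop_zero
  simpa using this.add_const (F₀ i j)

theorem BigOInv.mul {ι κ ν : Type*} [Fintype κ] {F : ℝ → Matrix ι κ ℂ} {F₀ : Matrix ι κ ℂ}
    {G : ℝ → Matrix κ ν ℂ} {G₀ : Matrix κ ν ℂ} (hF : BigOInv F F₀) (hG : BigOInv G G₀) :
    BigOInv (fun y => F y * G y) (F₀ * G₀) := by
  intro i j
  have e : (fun y => (F y * G y) i j - (F₀ * G₀) i j) = fun y =>
      ∑ k, ((F y i k - F₀ i k) * G y k j + F₀ i k * (G y k j - G₀ k j)) := by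
    funext y
    rw [Matrix.mul_apply, Matrix.mul_apply, ← Finset.sum_sub_distrib]
    exact Finset.sum_congr rfl fun k _ => by ring
  rw [e]
  refine IsBigO.fun_sum fun k _ => IsBigO.add ?_ ((hG k j).const_mul_left _)
  have h1 : Tendsto (fun y => G y k j) atTop (𝓝 (G₀ k j)) :=
    ((continuous_id.matrix_elem k j).tendsto _).comp hG.tendsto
  have h2 := (hF i k).mul (h1.isBigO_one ℝ)
  simp only [mul_one] at h2
  exact h2

theorem BigOInv.smul {ι κ : Type*} {F : ℝ → Matrix ι κ ℂ} {F₀ : Matrix ι κ ℂ} {c : ℝ → ℂ}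
    {c₀ : ℂ} (hc : (fun y => c y - c₀) =O[atTop] fun y : ℝ => y⁻¹) (hF : BigOInv F F₀) :
    BigOInv (fun y => c y • F y) (c₀ • F₀) := by
  intro i j
  have e : (fun y => (c y • F y) i j - (c₀ • F₀) i j) = fun y =>
      (c y - c₀) * F y i j + c₀ * (F y i j - F₀ i j) := by
    funext y
    simp only [Matrix.smul_apply, smul_eq_mul]; ring
  rw [e]
  have h1 : Tendsto (fun y => F y i j) atTop (𝓝 (F₀ i j)) :=
    ((continuous_id.matrix_elem i j).tendsto _).comp hF.tendsto
  have h2 := hc.mul (h1.isBigO_one ℝ)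
  simp only [mul_one] at h2
  exact h2.add ((hF i j).const_mul_left _)

theorem BigOInv.conjTranspose {ι κ : Type*} {F : ℝ → Matrix ι κ ℂ} {F₀ : Matrix ι κ ℂ}
    (hF : BigOInv F F₀) : BigOInv (fun y => (F y)ᴴ) F₀ᴴ := by
  intro i j
  refine ((hF j i).norm_left.congr_left fun y => ?_).of_norm_left
  change _ = ‖star (F y j i) - star (F₀ j i)‖
  rw [← star_sub, norm_star]

theorem BigOInv.det {n : Type*} [Fintype n] [DecidableEq n] {F : ℝ → Matrix n n ℂ}
    {F₀ : Matrix n n ℂ} (hF : BigOInv F F₀) :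
    (fun y => (F y).det - F₀.det) =O[atTop] fun y : ℝ => y⁻¹ := by
  have h1 := ((detMultilinear n).hasFDerivAt (x := F₀)).isBigO_sub
  have h2 : Tendsto F atTop (𝓝 F₀) := hF.tendsto
  have h3 := h1.comp_tendsto h2
  refine h3.trans ?_
  exact isBigO_pi.2 fun i => isBigO_pi.2 fun j => hF i j

theorem bigOInv_eigL (q₀ : Matrix (Fin m) (Fin m) ℂ) :
    BigOInv (fun y : ℝ => eigL q₀ (y * Complex.I)) (Matrix.fromRows 1 0) := by
  intro i j
  rcases i with i | i
  · have : (fun y : ℝ => eigL q₀ (y * Complex.I) (Sum.inl i) j -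
      (Matrix.fromRows 1 0 : Matrix (Fin m ⊕ Fin m) (Fin m) ℂ) (Sum.inl i) j) = fun _ => 0 := by
      funext y; exact sub_self _
    rw [this]; exact isBigO_zero _ _
  · refine IsBigO.of_bound ‖q₀ᴴ i j‖ ?_
    filter_upwards [eventually_gt_atTop 0] with y hy
    have : eigL q₀ (y * Complex.I) (Sum.inr i) j -
      (Matrix.fromRows 1 0 : Matrix (Fin m ⊕ Fin m) (Fin m) ℂ) (Sum.inr i) j =
        -(Complex.I / (y * Complex.I)) * q₀ᴴ i j := sub_zero _
    rw [this, norm_mul, norm_neg, norm_div, norm_mul, Complex.norm_I, mul_one, mul_comm, norm_inv,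
      Complex.norm_real, one_div]

theorem LeftPot.bigOInv_jostCol (h : LeftPot k₀ q q₀) :
    BigOInv (fun y : ℝ => jostCol k₀ q q₀ (y * Complex.I)) (Matrix.fromRows 1 0) := by
  have h1 : BigOInv (fun y : ℝ => jostM k₀ q q₀ (y * Complex.I) 0)
      (Matrix.fromBlocks 1 0 0 0 : BMat m) := by
    obtain ⟨K, hK⟩ := h.jostAlg_imag
    intro i j
    refine IsBigO.of_bound (‖entry i j‖ * K) ?_
    filter_upwards [hK, eventually_gt_atTop 0] with y hy hy0
    have h2 := (entry i j).le_opNorm (jostAlg k₀ q q₀ (y * Complex.I) - fstProj m)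
    refine le_trans h2 ?_
    rw [norm_inv, Real.norm_of_nonneg hy0.le, mul_assoc, ← div_eq_mul_inv]
    gcongr
  have h2 := h1.mul (bigOInv_eigL q₀)
  have h3 : (Matrix.fromBlocks 1 0 0 0 : BMat m) *
      (Matrix.fromRows 1 0 : Matrix (Fin m ⊕ Fin m) (Fin m) ℂ) = Matrix.fromRows 1 0 := by
    rw [Matrix.fromBlocks_mul_fromRows]; simp
  rw [h3] at h2
  exact h2

theorem gam_imag : (fun y : ℝ => (gam k₀ (y * Complex.I))⁻¹ - 1) =O[atTop] fun y : ℝ => y⁻¹ := by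
  have h1 : (fun y : ℝ => gam k₀ (y * Complex.I) - 1) =O[atTop] fun y : ℝ => y⁻¹ := by
    refine IsBigO.of_bound (k₀ ^ 2) ?_
    filter_upwards [eventually_ge_atTop 1] with y hy
    have hy0 : 0 < y := by linarith
    rw [gam, add_sub_cancel_left, norm_div, norm_pow, norm_pow, norm_mul, Complex.norm_I,
      Complex.norm_real, Complex.norm_real, mul_one, norm_inv, Real.norm_of_nonneg hy0.le,
      Real.norm_eq_abs, sq_abs, div_eq_mul_inv]
    gcongr
    nlinarith
  have h2 : Tendsto (fun y : ℝ => gam k₀ (y * Complex.I)) atTop (𝓝 1) := by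
    simpa using (h1.trans_tendsto tendsto_inv_atTop_zero).add_const 1
  have h3 := h1.mul ((h2.inv₀ one_ne_zero).isBigO_one ℝ)
  simp only [mul_one] at h3
  refine (h3.neg_left).congr' ?_ EventuallyEq.rfl
  filter_upwards [h2.eventually_ne one_ne_zero] with y hy
  field_simp
  ring

/-- The rate of convergence of `det a` along the imaginary axis. -/
theorem ScatPot.det_imag (h : ScatPot k₀ Q Qp Qm t) :
    (fun y : ℝ => (scatA k₀ Q Qp Qm t (y * Complex.I)).det - 1) =O[atTop] fun y : ℝ => y⁻¹ := by
  have h1 := BigOInv.smul (gam_imag (k₀ := k₀)) (h.right.bigOInv_jostCol.conjTranspose.mul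
    h.left.bigOInv_jostCol)
  rw [conjTranspose_fromRows_mul_self, one_smul] at h1
  have h2 := h1.det
  rw [Matrix.det_one] at h2
  refine h2.congr' ?_ EventuallyEq.rfl
  filter_upwards [eventually_gt_atTop k₀] with y hy
  rw [h.scatA_eq (Dplus_subset h.pos (mul_I_mem h.pos hy))]
  have : -(starRingEnd ℂ) ((y : ℂ) * Complex.I) = y * Complex.I := by simp
  rw [this]

end ImaginaryAxis

/-! ### Cauchy's theorem and formula on a half-strip with a singular boundary point -/

section Strip

open Set Complex

/-- The open half-strip `Re > 0`, `0 < Im < π`. -/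
def strip : Set ℂ := {ω | 0 < ω.re ∧ 0 < ω.im ∧ ω.im < Real.pi}

/-- The closed half-strip. -/
def cstrip : Set ℂ := {ω | 0 ≤ ω.re ∧ 0 ≤ ω.im ∧ ω.im ≤ Real.pi}

/-- The point of the closed half-strip that corresponds to the branch point. -/
def mid : ℂ := (Real.pi / 2 : ℝ) * I

/-- Functions on the half-strip that are holomorphic inside, continuous up to the boundary except
at `mid`, and dominated near the left edge. -/
structure NiceStrip (F : ℂ → ℂ) : Prop where
  cont : ContinuousOn F (cstrip \ {mid})
  diff : DifferentiableOn ℂ F strip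
  bound : ∃ ε₀ > 0, ∃ b : ℝ → ℝ, IntervalIntegrable b volume 0 Real.pi ∧
    ∀ ε ∈ Ioo (0 : ℝ) ε₀, ∀ u ∈ Icc (0 : ℝ) Real.pi, u ≠ Real.pi / 2 → ‖F (ε + u * I)‖ ≤ b u

/-- The boundary integral over the rectangle `[0, T] × [0, π]`. -/
def bdry (F : ℂ → ℂ) (T : ℝ) : ℂ :=
  (∫ x in (0 : ℝ)..T, F x) - (∫ x in (0 : ℝ)..T, F (x + Real.pi * I)) +
    I * (∫ u in (0 : ℝ)..Real.pi, F (T + u * I)) - I * ∫ u in (0 : ℝ)..Real.pi, F (u * I)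

theorem isOpen_strip : IsOpen strip :=
  (isOpen_lt continuous_const continuous_re).inter
    ((isOpen_lt continuous_const continuous_im).inter (isOpen_lt continuous_im continuous_const))

theorem strip_subset : strip ⊆ cstrip := fun _ h => ⟨h.1.le, h.2.1.le, h.2.2.le⟩

theorem strip_subset' : strip ⊆ cstrip \ {mid} := fun ω h => ⟨strip_subset h, fun e => by
  have : ω = mid := e
  rw [this] at h
  have := h.1
  simp [mid] at this⟩

theorem mem_cstrip {x u : ℝ} (hx : 0 ≤ x) (hu : u ∈ Icc (0 : ℝ) Real.pi) :
    (x + u * I : ℂ) ∈ cstrip := by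
  simpa [cstrip] using ⟨hx, hu.1, hu.2⟩

theorem mem_cstrip_diff {x u : ℝ} (hx : 0 ≤ x) (hu : u ∈ Icc (0 : ℝ) Real.pi)
    (h : x ≠ 0 ∨ u ≠ Real.pi / 2) : (x + u * I : ℂ) ∈ cstrip \ {mid} := by
  refine ⟨mem_cstrip hx hu, fun e => ?_⟩
  have e : (x + u * I : ℂ) = mid := e
  have h1 := congrArg re e
  have h2 := congrArg im e
  simp [mid] at h1 h2
  rcases h with h | h
  · exact h h1
  · exact h h2

theorem pi_half_mem : Real.pi / 2 ∈ Icc (0 : ℝ) Real.pi :=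
  ⟨by positivity, by linarith [Real.pi_pos]⟩

variable {F G Φ : ℂ → ℂ} {T : ℝ}

theorem continuousOn_edge_bottom (h : ContinuousOn F (cstrip \ {mid})) :
    ContinuousOn (fun x : ℝ => F x) (Ici 0) := by
  refine h.comp (by fun_prop) fun x hx => ?_
  have := mem_cstrip_diff (x := x) (u := 0) hx ⟨le_rfl, Real.pi_pos.le⟩
    (Or.inr (by linarith [Real.pi_pos]))
  simpa using this

theorem continuousOn_edge_top (h : ContinuousOn F (cstrip \ {mid})) :
    ContinuousOn (fun x : ℝ => F (x + Real.pi * I)) (Ici 0) := by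
  refine h.comp (by fun_prop) fun x hx => ?_
  exact mem_cstrip_diff (x := x) (u := Real.pi) hx ⟨Real.pi_pos.le, le_rfl⟩
    (Or.inr (by linarith [Real.pi_pos]))

theorem continuousOn_edge_right (h : ContinuousOn F (cstrip \ {mid})) (hT : 0 < T) :
    ContinuousOn (fun u : ℝ => F (T + u * I)) (Icc 0 Real.pi) :=
  h.comp (by fun_prop) fun u hu => mem_cstrip_diff hT.le hu (Or.inl hT.ne')

theorem continuousOn_edge_left (h : ContinuousOn F (cstrip \ {mid})) :
    ContinuousOn (fun u : ℝ => F (u * I)) (Icc 0 Real.pi \ {Real.pi / 2}) := by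
  refine h.comp (by fun_prop) fun u hu => ?_
  have := mem_cstrip_diff (x := 0) le_rfl hu.1 (Or.inr hu.2)
  simpa using this

theorem intervalIntegrable_bottom (h : ContinuousOn F (cstrip \ {mid})) (hT : 0 ≤ T) :
    IntervalIntegrable (fun x : ℝ => F x) volume 0 T :=
  ((continuousOn_edge_bottom h).mono (by rw [uIcc_of_le hT]; exact Icc_subset_Ici_self)).intervalIntegrable

theorem intervalIntegrable_top (h : ContinuousOn F (cstrip \ {mid})) (hT : 0 ≤ T) :
    IntervalIntegrable (fun x : ℝ => F (x + Real.pi * I)) volume 0 T :=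
  ((continuousOn_edge_top h).mono (by rw [uIcc_of_le hT]; exact Icc_subset_Ici_self)).intervalIntegrable

theorem intervalIntegrable_right (h : ContinuousOn F (cstrip \ {mid})) (hT : 0 < T) :
    IntervalIntegrable (fun u : ℝ => F (T + u * I)) volume 0 Real.pi :=
  ((continuousOn_edge_right h hT).mono (by rw [uIcc_of_le Real.pi_pos.le])).intervalIntegrable

theorem tendsto_edge_left (h : ContinuousOn F (cstrip \ {mid})) {u : ℝ}
    (hu : u ∈ Icc (0 : ℝ) Real.pi) (hne : u ≠ Real.pi / 2) :
    Tendsto (fun ε : ℝ => F (ε + u * I)) (𝓝[>] 0) (𝓝 (F (u * I))) := by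
  have h0 := mem_cstrip_diff (x := 0) le_rfl hu (Or.inr hne)
  rw [ofReal_zero, zero_add] at h0
  refine (h _ h0).tendsto.comp (tendsto_nhdsWithin_iff.2 ⟨?_, ?_⟩)
  · have : Continuous fun ε : ℝ => (ε + u * I : ℂ) := by fun_prop
    exact (by simpa using this.tendsto 0 : Tendsto (fun ε : ℝ => (ε + u * I : ℂ)) (𝓝 0) _).mono_left
      nhdsWithin_le_nhds
  · filter_upwards [self_mem_nhdsWithin] with ε hε
    exact mem_cstrip_diff (le_of_lt hε) hu (Or.inr hne)

theorem NiceStrip.norm_left_le (h : NiceStrip F) : ∃ b : ℝ → ℝ,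
    IntervalIntegrable b volume 0 Real.pi ∧
    ∀ u ∈ Icc (0 : ℝ) Real.pi, u ≠ Real.pi / 2 → ‖F (u * I)‖ ≤ b u := by
  obtain ⟨ε₀, hε₀, b, hb, hbd⟩ := h.bound
  refine ⟨b, hb, fun u hu hne => ?_⟩
  refine le_of_tendsto (tendsto_edge_left h.cont hu hne).norm ?_
  filter_upwards [Ioo_mem_nhdsGT hε₀] with ε hε using hbd ε hε u hu hne

theorem aestronglyMeasurable_left (h : ContinuousOn F (cstrip \ {mid})) :
    AEStronglyMeasurable (fun u : ℝ => F (u * I)) (volume.restrict (uIoc 0 Real.pi)) := by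
  rw [uIoc_of_le Real.pi_pos.le]
  have h1 : AEStronglyMeasurable (fun u : ℝ => F (u * I))
      (volume.restrict (Icc 0 Real.pi \ {Real.pi / 2})) :=
    (continuousOn_edge_left h).aestronglyMeasurable
      (measurableSet_Icc.diff (measurableSet_singleton _))
  have h2 : (volume.restrict (Icc (0 : ℝ) Real.pi \ {Real.pi / 2})) =
      volume.restrict (Ioc 0 Real.pi) := by
    rw [Measure.restrict_congr_set Ioc_ae_eq_Icc]
    exact Measure.restrict_congr_set (sdiff_null_ae_eq_self (by simp))
  rwa [h2] at h1

theorem ae_ne_mid : ∀ᵐ u : ℝ ∂volume, u ≠ Real.pi / 2 := by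
  rw [ae_iff]
  simp

theorem NiceStrip.intervalIntegrable_left (h : NiceStrip F) :
    IntervalIntegrable (fun u : ℝ => F (u * I)) volume 0 Real.pi := by
  obtain ⟨b, hb, hbd⟩ := h.norm_left_le
  refine hb.mono_fun' (aestronglyMeasurable_left h.cont) ?_
  filter_upwards [ae_restrict_mem measurableSet_uIoc, ae_restrict_of_ae ae_ne_mid] with u hu hne
  rw [uIoc_of_le Real.pi_pos.le] at hu
  exact hbd u ⟨hu.1.le, hu.2⟩ hne

theorem tendsto_integral_left {f : ℝ → ℂ} (hT : 0 < T) (hf : IntervalIntegrable f volume 0 T) :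
    Tendsto (fun ε : ℝ => ∫ x in ε..T, f x) (𝓝[>] 0) (𝓝 (∫ x in (0 : ℝ)..T, f x)) := by
  have h1 : IntegrableOn f (uIcc 0 T) := by
    rw [uIcc_of_le hT.le, integrableOn_Icc_iff_integrableOn_Ioc]
    exact (intervalIntegrable_iff_integrableOn_Ioc_of_le hT.le).1 hf
  have h2 := intervalIntegral.continuousOn_primitive_interval_left h1 0 left_mem_uIcc
  refine h2.tendsto.mono_left ?_
  rw [nhdsWithin_le_iff, uIcc_of_le hT.le]
  exact mem_of_superset (Ioo_mem_nhdsGT hT) Ioo_subset_Icc_self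

/-- Cauchy's theorem on the half-strip. -/
theorem NiceStrip.bdry_eq_zero (h : NiceStrip F) (hT : 0 < T) : bdry F T = 0 := by
  obtain ⟨ε₀, hε₀, b, hb, hbd⟩ := h.bound
  -- The left edge contains the singular point `mid`, so it is first shifted to Re ω = ε; the limit
  -- ε → 0 is taken by domination.
  have key : ∀ᶠ ε : ℝ in 𝓝[>] 0, (∫ x in ε..T, F x) - (∫ x in ε..T, F (x + Real.pi * I)) +
      I * (∫ u in (0 : ℝ)..Real.pi, F (T + u * I)) -
        I * (∫ u in (0 : ℝ)..Real.pi, F (ε + u * I)) = 0 := by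
    filter_upwards [Ioo_mem_nhdsGT hT] with ε hε
    have h1 := integral_boundary_rect_eq_zero_of_continuousOn_of_differentiableOn F (ε : ℂ)
      (T + Real.pi * I) (h.cont.mono ?_) (h.diff.mono ?_)
    · simpa [smul_eq_mul] using h1
    · intro ω hω
      rw [mem_reProdIm] at hω
      simp only [ofReal_re, ofReal_im, add_re, add_im, mul_re, mul_im, I_re, I_im, mul_zero,
        mul_one, sub_zero, zero_add, add_zero] at hω
      rw [uIcc_of_le hε.2.le, uIcc_of_le Real.pi_pos.le] at hω
      have := mem_cstrip_diff (x := ω.re) (u := ω.im) (hε.1.le.trans hω.1.1) hω.2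
        (Or.inl (hε.1.trans_le hω.1.1).ne')
      rwa [re_add_im] at this
    · intro ω hω
      rw [mem_reProdIm] at hω
      simp only [ofReal_re, ofReal_im, add_re, add_im, mul_re, mul_im, I_re, I_im, mul_zero,
        mul_one, sub_zero, zero_add, add_zero] at hω
      rw [min_eq_left hε.2.le, max_eq_right hε.2.le, min_eq_left Real.pi_pos.le,
        max_eq_right Real.pi_pos.le] at hω
      exact ⟨hε.1.trans hω.1.1, hω.2.1, hω.2.2⟩
  have t1 := tendsto_integral_left hT (intervalIntegrable_bottom h.cont hT.le)
  have t2 := tendsto_integral_left hT (intervalIntegrable_top h.cont hT.le)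
  have t3 : Tendsto (fun ε : ℝ => ∫ u in (0 : ℝ)..Real.pi, F (ε + u * I)) (𝓝[>] 0)
      (𝓝 (∫ u in (0 : ℝ)..Real.pi, F (u * I))) := by
    refine intervalIntegral.tendsto_integral_filter_of_dominated_convergence b ?_ ?_ hb ?_
    · filter_upwards [self_mem_nhdsWithin] with ε hε
      exact (intervalIntegrable_iff.1 (intervalIntegrable_right h.cont hε)).aestronglyMeasurable
    · filter_upwards [Ioo_mem_nhdsGT hε₀] with ε hε
      filter_upwards [ae_ne_mid] with u hne hu
      rw [uIoc_of_le Real.pi_pos.le] at hu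
      exact hbd ε hε u ⟨hu.1.le, hu.2⟩ hne
    · filter_upwards [ae_ne_mid] with u hne hu
      rw [uIoc_of_le Real.pi_pos.le] at hu
      exact tendsto_edge_left h.cont ⟨hu.1.le, hu.2⟩ hne
  have t4 := ((t1.sub t2).add_const (I * ∫ u in (0 : ℝ)..Real.pi, F (T + u * I))).sub
    (t3.const_mul I)
  exact tendsto_nhds_unique t4 (tendsto_const_nhds.congr' (key.mono fun _ h => h.symm))

theorem integral_inv_add_mul_I {a b c : ℝ} (hc : c ≠ 0) :
    ∫ x in a..b, ((x : ℂ) + c * I)⁻¹ = log (b + c * I) - log (a + c * I) := by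
  have hs : ∀ x : ℝ, (x : ℂ) + c * I ∈ slitPlane := fun x => Or.inr (by simpa using hc)
  refine intervalIntegral.integral_eq_sub_of_hasDerivAt (f := fun x : ℝ => log (x + c * I))
    (fun x _ => ?_) ?_
  · have h1 : HasDerivAt (fun x : ℝ => (x : ℂ) + c * I) 1 x :=
      (ofRealCLM.hasDerivAt (x := x)).add_const _
    simpa using h1.clog_real (hs x)
  · refine Continuous.intervalIntegrable ?_ _ _
    exact Continuous.inv₀ (by fun_prop) fun x => slitPlane_ne_zero (hs x)

theorem integral_inv_add_mul_I' {a c d : ℝ} (ha : 0 < a) :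
    I * ∫ u in c..d, ((a : ℂ) + u * I)⁻¹ = log (a + d * I) - log (a + c * I) := by
  have hs : ∀ x : ℝ, (a : ℂ) + x * I ∈ slitPlane := fun x => Or.inl (by simpa using ha)
  rw [← intervalIntegral.integral_const_mul]
  refine intervalIntegral.integral_eq_sub_of_hasDerivAt (f := fun x : ℝ => log (a + x * I))
    (fun x _ => ?_) ?_
  · have h1 : HasDerivAt (fun x : ℝ => (a : ℂ) + x * I) (1 * I) x :=
      ((ofRealCLM.hasDerivAt (x := x)).mul_const I).const_add _
    simpa [div_eq_mul_inv] using h1.clog_real (hs x)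
  · refine Continuous.intervalIntegrable ?_ _ _
    exact continuous_const.mul (Continuous.inv₀ (by fun_prop) fun x => slitPlane_ne_zero (hs x))

theorem log_neg_of_im_pos {w : ℂ} (h : 0 < w.im) : log (-w) = log w - Real.pi * I := by
  rw [log, log, norm_neg, arg_neg_eq_arg_sub_pi_of_im_pos h]; push_cast; ring

theorem log_neg_of_im_neg {w : ℂ} (h : w.im < 0) : log (-w) = log w + Real.pi * I := by
  rw [log, log, norm_neg, arg_neg_eq_arg_add_pi_of_im_neg h]; push_cast; ring

/-- The winding number of the boundary of the rectangle. -/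
theorem bdry_inv {ω₀ : ℂ} (h : ω₀ ∈ strip) (hT : ω₀.re < T) :
    bdry (fun ω => (ω - ω₀)⁻¹) T = 2 * Real.pi * I := by
  obtain ⟨hr, hi, hi'⟩ := h
  set a := ω₀.re
  set c := ω₀.im
  have hω : ω₀ = a + c * I := (re_add_im ω₀).symm
  have e1 : (∫ x in (0 : ℝ)..T, ((x : ℂ) - ω₀)⁻¹) =
      log ((T - a : ℝ) + (-c : ℝ) * I) - log ((-a : ℝ) + (-c : ℝ) * I) := by
    rw [← integral_inv_add_mul_I (by linarith : (-c) ≠ 0),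
      ← zero_sub a, ← intervalIntegral.integral_comp_sub_right (fun x : ℝ => ((x : ℂ) + (-c : ℝ) * I)⁻¹)]
    refine intervalIntegral.integral_congr fun x _ => ?_
    simp only [hω]; congr 1; push_cast; ring
  have e2 : (∫ x in (0 : ℝ)..T, ((x : ℂ) + Real.pi * I - ω₀)⁻¹) =
      log ((T - a : ℝ) + (Real.pi - c : ℝ) * I) - log ((-a : ℝ) + (Real.pi - c : ℝ) * I) := by
    rw [← integral_inv_add_mul_I (by linarith : (Real.pi - c) ≠ 0),
      ← zero_sub a, ← intervalIntegral.integral_comp_sub_right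
        (fun x : ℝ => ((x : ℂ) + (Real.pi - c : ℝ) * I)⁻¹)]
    refine intervalIntegral.integral_congr fun x _ => ?_
    simp only [hω]; congr 1; push_cast; ring
  have e3 : I * (∫ u in (0 : ℝ)..Real.pi, ((T : ℂ) + u * I - ω₀)⁻¹) =
      log ((T - a : ℝ) + (Real.pi - c : ℝ) * I) - log ((T - a : ℝ) + (-c : ℝ) * I) := by
    rw [← integral_inv_add_mul_I' (by linarith : 0 < T - a),
      ← zero_sub c, ← intervalIntegral.integral_comp_sub_right
        (fun u : ℝ => (((T - a : ℝ) : ℂ) + u * I)⁻¹)]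
    congr 1
    refine intervalIntegral.integral_congr fun x _ => ?_
    simp only [hω]; congr 1; push_cast; ring
  have e4 : I * (∫ u in (0 : ℝ)..Real.pi, ((u : ℂ) * I - ω₀)⁻¹) =
      log ((a : ℝ) + (c - Real.pi : ℝ) * I) - log ((a : ℝ) + (c : ℝ) * I) := by
    have e5 : (∫ u in (0 : ℝ)..Real.pi, ((u : ℂ) * I - ω₀)⁻¹) =
        -∫ u in (0 : ℝ)..Real.pi, ((a : ℂ) + (c - u : ℝ) * I)⁻¹ := by
      rw [← intervalIntegral.integral_neg]
      refine intervalIntegral.integral_congr fun x _ => ?_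
      simp only [hω]
      rw [← inv_neg]; congr 1; push_cast; ring
    rw [e5, intervalIntegral.integral_comp_sub_left (fun u : ℝ => ((a : ℂ) + u * I)⁻¹), sub_zero,
      mul_neg, integral_inv_add_mul_I' hr]
    ring
  -- Seen from ω₀, the left edge crosses the branch cut of the logarithm. The shifts -πi here and
  -- +πi in `e7` together give the winding contribution 2πi; all other terms telescope.
  have e6 : log ((a : ℝ) + (c - Real.pi : ℝ) * I) =
      log ((-a : ℝ) + (Real.pi - c : ℝ) * I) - Real.pi * I := by
    rw [← log_neg_of_im_pos (by simpa using hi')]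
    congr 1; push_cast; ring
  have e7 : log ((a : ℝ) + (c : ℝ) * I) = log ((-a : ℝ) + (-c : ℝ) * I) + Real.pi * I := by
    rw [← log_neg_of_im_neg (by simpa using hi)]
    congr 1; push_cast; ring
  rw [bdry, e1, e2, e3, e4, e6, e7]
  ring

theorem continuousOn_dslope_of (h : ContinuousOn Φ (cstrip \ {mid}))
    (hd : DifferentiableOn ℂ Φ strip) {ω₀ : ℂ} (h₀ : ω₀ ∈ strip) :
    ContinuousOn (dslope Φ ω₀) (cstrip \ {mid}) := by
  intro ω hω
  by_cases e : ω = ω₀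
  · subst e
    exact (continuousAt_dslope_same.2 (hd.differentiableAt (isOpen_strip.mem_nhds h₀))).continuousWithinAt
  · exact (continuousWithinAt_dslope_of_ne e).2 (h ω hω)

/-- Near the left edge the distance to ω₀ is at least Re ω₀ / 2, so the difference quotient inherits
the domination. This reduces Cauchy's formula to Cauchy's theorem. -/
theorem NiceStrip.dslope (h : NiceStrip Φ) {ω₀ : ℂ} (h₀ : ω₀ ∈ strip) :
    NiceStrip (dslope Φ ω₀) := by
  refine ⟨continuousOn_dslope_of h.cont h.diff h₀, ?_, ?_⟩
  · exact (differentiableOn_dslope (isOpen_strip.mem_nhds h₀)).2 h.diff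
  · obtain ⟨ε₀, hε₀, b, hb, hbd⟩ := h.bound
    have hr : 0 < ω₀.re := h₀.1
    refine ⟨min ε₀ (ω₀.re / 2), by positivity,
      fun u => (2 / ω₀.re) * (b u + ‖Φ ω₀‖), (hb.add intervalIntegrable_const).const_mul _, ?_⟩
    intro ε hε u hu hne
    have h1 : ε < ω₀.re / 2 := hε.2.trans_le (min_le_right _ _)
    have h2 : ω₀.re / 2 ≤ ‖(ε + u * I : ℂ) - ω₀‖ := by
      refine le_trans ?_ (abs_re_le_norm _)
      rw [abs_of_neg] <;> simp <;> linarith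
    have h3 : (ε + u * I : ℂ) ≠ ω₀ := by
      intro e; rw [e] at h2; simp at h2; linarith
    rw [dslope_of_ne _ h3, slope_def_field, norm_div, div_le_iff₀ (by linarith)]
    have h4 : ‖Φ (ε + u * I) - Φ ω₀‖ ≤ b u + ‖Φ ω₀‖ :=
      (norm_sub_le _ _).trans (by gcongr; exact hbd ε ⟨hε.1, hε.2.trans_le (min_le_left _ _)⟩ u hu hne)
    have h5 : 0 ≤ b u + ‖Φ ω₀‖ := (norm_nonneg _).trans h4
    calc ‖Φ (ε + u * I) - Φ ω₀‖ ≤ b u + ‖Φ ω₀‖ := h4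
      _ = 2 / ω₀.re * (b u + ‖Φ ω₀‖) * (ω₀.re / 2) := by field_simp
      _ ≤ _ := by gcongr

/-- Cauchy's integral formula on the half-strip. -/
theorem NiceStrip.bdry_div (h : NiceStrip Φ) {ω₀ : ℂ} (h₀ : ω₀ ∈ strip) (hT : ω₀.re < T) :
    bdry (fun ω => Φ ω * (ω - ω₀)⁻¹) T = 2 * Real.pi * I * Φ ω₀ := by
  have hT0 : 0 < T := h₀.1.trans hT
  have h1 := (h.dslope h₀)
  have h2 := h1.bdry_eq_zero hT0
  have h3 := bdry_inv h₀ hT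
  have hb : ∀ x : ℝ, (x : ℂ) ≠ ω₀ := fun x e => by
    have := congrArg im e; simp at this; exact h₀.2.1.ne this
  have ht : ∀ x : ℝ, (x : ℂ) + Real.pi * I ≠ ω₀ := fun x e => by
    have := congrArg im e; simp at this; exact h₀.2.2.ne' this
  have hr : ∀ u : ℝ, (T : ℂ) + u * I ≠ ω₀ := fun x e => by
    have := congrArg re e; simp at this; exact hT.ne' this
  have hl : ∀ u : ℝ, (u : ℂ) * I ≠ ω₀ := fun x e => by
    have := congrArg re e; simp at this; exact h₀.1.ne this
  have i1 : IntervalIntegrable (fun x : ℝ => ((x : ℂ) - ω₀)⁻¹) volume 0 T :=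
    (Continuous.inv₀ (by fun_prop) fun x => sub_ne_zero.2 (hb x)).intervalIntegrable _ _
  have i2 : IntervalIntegrable (fun x : ℝ => ((x : ℂ) + Real.pi * I - ω₀)⁻¹) volume 0 T :=
    (Continuous.inv₀ (by fun_prop) fun x => sub_ne_zero.2 (ht x)).intervalIntegrable _ _
  have i3 : IntervalIntegrable (fun u : ℝ => ((T : ℂ) + u * I - ω₀)⁻¹) volume 0 Real.pi :=
    (Continuous.inv₀ (by fun_prop) fun x => sub_ne_zero.2 (hr x)).intervalIntegrable _ _
  have i4 : IntervalIntegrable (fun u : ℝ => ((u : ℂ) * I - ω₀)⁻¹) volume 0 Real.pi :=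
    (Continuous.inv₀ (by fun_prop) fun x => sub_ne_zero.2 (hl x)).intervalIntegrable _ _
  have e : ∀ ω, ω ≠ ω₀ → Φ ω * (ω - ω₀)⁻¹ =
      _root_.dslope Φ ω₀ ω + Φ ω₀ * (ω - ω₀)⁻¹ := fun ω hω => by
    rw [dslope_of_ne _ hω, slope_def_field]
    field_simp [sub_ne_zero.2 hω]
    ring
  have e1 : bdry (fun ω => Φ ω * (ω - ω₀)⁻¹) T = bdry (_root_.dslope Φ ω₀) T +
      Φ ω₀ * bdry (fun ω => (ω - ω₀)⁻¹) T := by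
    simp only [bdry]
    simp_rw [e _ (hb _), e _ (ht _), e _ (hr _), e _ (hl _)]
    rw [intervalIntegral.integral_add (intervalIntegrable_bottom h1.cont hT0.le) (i1.const_mul _),
      intervalIntegral.integral_add (intervalIntegrable_top h1.cont hT0.le) (i2.const_mul _),
      intervalIntegral.integral_add (intervalIntegrable_right h1.cont hT0) (i3.const_mul _),
      intervalIntegral.integral_add h1.intervalIntegrable_left (i4.const_mul _)]
    simp only [intervalIntegral.integral_const_mul]
    ring
  rw [e1, h2, h3, zero_add]
  ring

end Strip

/-! ### The Cauchy kernel in the exponential coordinate -/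

section Kernel

open Set Complex

variable {F G H K : ℂ → ℂ} {T k₀ : ℝ} {w κ : ℂ}

/-- The boundary integral without the right edge. -/
def bdryLeft (F : ℂ → ℂ) (T : ℝ) : ℂ :=
  (∫ x in (0 : ℝ)..T, F x) - (∫ x in (0 : ℝ)..T, F (x + Real.pi * I)) -
    I * ∫ u in (0 : ℝ)..Real.pi, F (u * I)

/-- Uniform decay at the right end of the half-strip. -/
def VanishRight (F : ℂ → ℂ) : Prop :=
  ∀ ε : ℝ, 0 < ε → ∀ᶠ T : ℝ in atTop, ∀ u ∈ Icc (0 : ℝ) Real.pi, ‖F (T + u * I)‖ ≤ ε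

theorem tendsto_bdryLeft {L : ℂ} (h : ∀ᶠ T : ℝ in atTop, bdry F T = L) (hv : VanishRight F) :
    Tendsto (bdryLeft F) atTop (𝓝 L) := by
  have h1 : Tendsto (fun T : ℝ => I * ∫ u in (0 : ℝ)..Real.pi, F (T + u * I)) atTop (𝓝 0) := by
    rw [Metric.tendsto_nhds]
    intro ε hε
    filter_upwards [hv (ε / (2 * Real.pi)) (by positivity)] with T hT
    rw [dist_zero_right, norm_mul, norm_I, one_mul]
    refine (intervalIntegral.norm_integral_le_of_norm_le_const (C := ε / (2 * Real.pi))
      fun u hu => ?_).trans_lt ?_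
    · rw [uIoc_of_le Real.pi_pos.le] at hu
      exact hT u ⟨hu.1.le, hu.2⟩
    · rw [sub_zero, abs_of_pos Real.pi_pos]
      field_simp
      linarith
  have h2 : Tendsto (fun T : ℝ => L - I * ∫ u in (0 : ℝ)..Real.pi, F (T + u * I)) atTop (𝓝 (L - 0)) :=
    h1.const_sub L
  rw [sub_zero] at h2
  refine h2.congr' ?_
  filter_upwards [h] with T hT
  rw [← hT, bdry, bdryLeft]; ring

theorem NiceStrip.mul (hF : NiceStrip F) (hK : ContinuousOn K cstrip)
    (hd : DifferentiableOn ℂ K strip) : NiceStrip fun ω => F ω * K ω := by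
  refine ⟨hF.cont.mul (hK.mono sdiff_subset), hF.diff.mul hd, ?_⟩
  obtain ⟨ε₀, hε₀, b, hb, hbd⟩ := hF.bound
  have hc : IsCompact (Icc (0 : ℝ) 1 ×ℂ Icc (0 : ℝ) Real.pi) := isCompact_Icc.reProdIm isCompact_Icc
  obtain ⟨C, hC⟩ := hc.exists_bound_of_continuousOn (hK.mono fun ω hω => by
    rw [mem_reProdIm] at hω
    exact ⟨hω.1.1, hω.2⟩)
  have hC0 : 0 ≤ C := (norm_nonneg _).trans (hC 0 (by simp [mem_reProdIm, Real.pi_pos.le]))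
  refine ⟨min ε₀ 1, by positivity, fun u => b u * C, hb.mul_const _, fun ε hε u hu hne => ?_⟩
  rw [norm_mul]
  have h1 := hbd ε ⟨hε.1, hε.2.trans_le (min_le_left _ _)⟩ u hu hne
  refine mul_le_mul h1 (hC _ ?_) (norm_nonneg _) ((norm_nonneg _).trans h1)
  rw [mem_reProdIm]
  simpa using ⟨⟨hε.1.le, (hε.2.trans_le (min_le_right _ _)).le⟩, hu⟩

/-- The reflection of the half-strip in its middle line. -/
def flip (ω : ℂ) : ℂ := (starRingEnd ℂ) ω + Real.pi * I

theorem flip_add_mul_I (x u : ℝ) : flip (x + u * I) = x + (Real.pi - u : ℝ) * I := by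
  simp [flip]; ring

theorem flip_mem_cstrip {ω : ℂ} (h : ω ∈ cstrip) : flip ω ∈ cstrip := by
  obtain ⟨h1, h2, h3⟩ := h
  refine ⟨?_, ?_, ?_⟩ <;> simp [flip] <;> linarith

theorem flip_mem_strip {ω : ℂ} (h : ω ∈ strip) : flip ω ∈ strip := by
  obtain ⟨h1, h2, h3⟩ := h
  refine ⟨?_, ?_, ?_⟩ <;> simp [flip] <;> linarith

theorem flip_flip (ω : ℂ) : flip (flip ω) = ω := by
  simp [flip]

theorem flip_mid : flip mid = mid := by
  have := flip_add_mul_I 0 (Real.pi / 2)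
  simp only [ofReal_zero, zero_add] at this
  rw [mid, this]; congr 2; ring

theorem flip_mem_diff {ω : ℂ} (h : ω ∈ cstrip \ {mid}) : flip ω ∈ cstrip \ {mid} := by
  refine ⟨flip_mem_cstrip h.1, fun e => h.2 ?_⟩
  have e : flip ω = mid := e
  rw [mem_singleton_iff, ← flip_flip ω, e, flip_mid]

/-- The logarithm on the second component, in the coordinate of the half-strip. -/
def dual (H : ℂ → ℂ) (κ : ℂ) (ω : ℂ) : ℂ := (starRingEnd ℂ) (H (flip ω)) + κ

theorem NiceStrip.dual (h : NiceStrip H) (κ : ℂ) : NiceStrip (dual H κ) := by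
  refine ⟨?_, ?_, ?_⟩
  · refine ContinuousOn.add (continuous_conj.comp_continuousOn
      (h.cont.comp ?_ fun ω hω => flip_mem_diff hω)) continuousOn_const
    exact (continuous_conj.add continuous_const).continuousOn
  · intro ω hω
    have h1 : DifferentiableAt ℂ (fun ω => H (ω + Real.pi * I)) ((starRingEnd ℂ) ω) := by
      have h2 := h.diff.differentiableAt (isOpen_strip.mem_nhds (flip_mem_strip hω))
      exact h2.comp ((starRingEnd ℂ) ω) (differentiableAt_id.add_const _)
    have h3 := h1.conj_conj
    rw [conj_conj] at h3
    exact (h3.add_const κ).differentiableWithinAt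
  · obtain ⟨ε₀, hε₀, b, hb, hbd⟩ := h.bound
    have hb' : IntervalIntegrable (fun u => b (Real.pi - u)) volume 0 Real.pi := by
      have := hb.comp_sub_left Real.pi
      rw [sub_zero, sub_self] at this
      exact this.symm
    refine ⟨ε₀, hε₀, fun u => b (Real.pi - u) + ‖κ‖, hb'.add intervalIntegrable_const,
      fun ε hε u hu hne => ?_⟩
    refine (norm_add_le _ _).trans (add_le_add ?_ le_rfl)
    rw [RCLike.norm_conj, flip_add_mul_I]
    exact hbd ε hε _ ⟨by linarith [hu.2], by linarith [hu.1]⟩ (fun e => hne (by linarith))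

/-- The Cauchy kernel `ζ/(ζ - w)` at `ζ = k₀ e^ω`. -/
def kern (k₀ : ℝ) (w ω : ℂ) : ℂ := k₀ * exp ω / (k₀ * exp ω - w)

theorem continuousOn_kern {S : Set ℂ} (hw : ∀ ω ∈ S, k₀ * exp ω ≠ w) :
    ContinuousOn (kern k₀ w) S :=
  ContinuousOn.div (by fun_prop) (by fun_prop) fun ω hω => sub_ne_zero.2 (hw ω hω)

theorem differentiableOn_kern {S : Set ℂ} (hw : ∀ ω ∈ S, k₀ * exp ω ≠ w) :
    DifferentiableOn ℂ (kern k₀ w) S :=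
  DifferentiableOn.div (by fun_prop) (by fun_prop) fun ω hω => sub_ne_zero.2 (hw ω hω)

theorem bdry_kern_eq_zero (hH : NiceStrip H) (hw : ∀ ω ∈ cstrip, k₀ * exp ω ≠ w) (hT : 0 < T) :
    bdry (fun ω => H ω * kern k₀ w ω) T = 0 :=
  (hH.mul (continuousOn_kern hw) (differentiableOn_kern fun ω hω => hw ω (strip_subset hω))).bdry_eq_zero
    hT

/-- For the inner component ζ = k₀e^{-ω}, so dζ = -ζ dω; hence the kernel -`kern` at -ω. -/
theorem bdry_kern_neg_eq_zero (hH : NiceStrip H) (hw : ∀ ω ∈ cstrip, k₀ * exp (-ω) ≠ w)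
    (hT : 0 < T) : bdry (fun ω => H ω * -kern k₀ w (-ω)) T = 0 := by
  refine (hH.mul (K := fun ω => -kern k₀ w (-ω)) ?_ ?_).bdry_eq_zero hT
  · exact ((continuousOn_kern (S := Neg.neg '' cstrip) (by rintro _ ⟨ω, hω, rfl⟩; exact hw ω hω)).comp
      continuous_neg.continuousOn (mapsTo_image _ _)).neg
  · exact ((differentiableOn_kern (S := Neg.neg '' cstrip)
      (by rintro _ ⟨ω, hω, rfl⟩; exact hw ω hω)).comp
      differentiable_neg.differentiableOn fun ω hω => mem_image_of_mem _ (strip_subset hω)).neg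

theorem exp_ne_of_cstrip {ω ω₀ : ℂ} (h : ω ∈ cstrip) (h₀ : ω₀ ∈ strip) (hne : ω ≠ ω₀) :
    exp ω ≠ exp ω₀ := fun e => by
  obtain ⟨n, hn⟩ := exp_eq_exp_iff_exists_int.1 e
  have h1 := congrArg im hn
  simp at h1
  have hn0 : n = 0 := by
    have a1 : (n : ℝ) * (2 * Real.pi) < 2 * Real.pi := by linarith [h.2.2, h₀.2.1, Real.pi_pos]
    have a2 : -(2 * Real.pi) < (n : ℝ) * (2 * Real.pi) := by linarith [h.2.1, h₀.2.2, Real.pi_pos]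
    have b1 : (n : ℝ) < 1 := by
      by_contra hc; push Not at hc; nlinarith [Real.pi_pos]
    have b2 : (-1 : ℝ) < n := by
      by_contra hc; push Not at hc; nlinarith [Real.pi_pos]
    have c1 : n < 1 := by exact_mod_cast b1
    have c2 : -1 < n := by exact_mod_cast b2
    omega
  rw [hn0] at hn
  simp at hn
  exact hne hn

/-- In the closed half-strip, of height π, exp takes the value e^{ω₀} only at ω₀. Dividing out this
simple zero leaves a pole of type 1/(ω - ω₀). The free numerator N lets one statement serve the
outer and the inner kernel. -/
theorem bdry_pole (hH : NiceStrip H) {N : ℂ → ℂ} (hN : Differentiable ℂ N) {ω₀ : ℂ}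
    (h₀ : ω₀ ∈ strip) (hN₀ : N ω₀ = exp ω₀) (hT : ω₀.re < T) :
    bdry (fun ω => H ω * (N ω / (exp ω - exp ω₀))) T = 2 * Real.pi * I * H ω₀ := by
  have hd : Differentiable ℂ (dslope exp ω₀) := fun ω =>
    ((differentiableOn_dslope (s := univ) univ_mem).2 differentiable_exp.differentiableOn).differentiableAt
      univ_mem
  have hs : dslope exp ω₀ ω₀ = exp ω₀ := by rw [dslope_same]; simp
  have hne : ∀ ω ∈ cstrip, dslope exp ω₀ ω ≠ 0 := fun ω hω => by
    by_cases e : ω = ω₀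
    · rw [e, hs]; exact exp_ne_zero _
    · rw [dslope_of_ne _ e, slope_def_field]
      exact div_ne_zero (sub_ne_zero.2 (exp_ne_of_cstrip hω h₀ e)) (sub_ne_zero.2 e)
  have h1 : NiceStrip fun ω => H ω * (N ω / dslope exp ω₀ ω) :=
    hH.mul (hN.continuous.continuousOn.div hd.continuous.continuousOn hne)
      (hN.differentiableOn.div hd.differentiableOn fun ω hω => hne ω (strip_subset hω))
  have h2 := h1.bdry_div h₀ hT
  rw [hs, hN₀, div_self (exp_ne_zero _), mul_one] at h2
  rw [← h2]
  congr 1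
  funext ω
  by_cases e : ω = ω₀
  · simp [e]
  · rw [dslope_of_ne _ e, slope_def_field, mul_assoc]
    congr 1
    rw [div_div_eq_mul_div, div_mul_eq_mul_div, mul_assoc, mul_inv_cancel₀ (sub_ne_zero.2 e), mul_one]

theorem bdry_kern (hk : 0 < k₀) (hH : NiceStrip H) {ω₀ : ℂ} (h₀ : ω₀ ∈ strip) (hT : ω₀.re < T) :
    bdry (fun ω => H ω * kern k₀ (k₀ * exp ω₀) ω) T = 2 * Real.pi * I * H ω₀ := by
  have hk' : (k₀ : ℂ) ≠ 0 := by exact_mod_cast hk.ne'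
  rw [← bdry_pole hH differentiable_exp h₀ rfl hT]
  congr 1
  funext ω
  rw [kern, ← mul_sub, mul_div_mul_left _ _ hk']

/-- After clearing negative exponentials the inner kernel is e^{ω₀}/(e^ω - e^{ω₀}): the same pole
with a constant numerator. -/
theorem bdry_kern_neg (hk : 0 < k₀) (hH : NiceStrip H) {ω₀ : ℂ} (h₀ : ω₀ ∈ strip)
    (hT : ω₀.re < T) :
    bdry (fun ω => H ω * -kern k₀ (k₀ * exp (-ω₀)) (-ω)) T = 2 * Real.pi * I * H ω₀ := by
  have hk' : (k₀ : ℂ) ≠ 0 := by exact_mod_cast hk.ne'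
  rw [← bdry_pole hH (differentiable_const (exp ω₀)) h₀ rfl hT]
  congr 1
  funext ω
  congr 1
  rw [kern, ← mul_sub, mul_div_mul_left _ _ hk', exp_neg, exp_neg]
  have h1 := exp_ne_zero ω
  have h2 := exp_ne_zero ω₀
  by_cases e : exp ω = exp ω₀
  · simp [e]
  · have h3 : exp ω - exp ω₀ ≠ 0 := sub_ne_zero.2 e
    have h4 : (exp ω)⁻¹ - (exp ω₀)⁻¹ ≠ 0 := sub_ne_zero.2 fun h => e (inv_injective h)
    rw [← neg_div, div_eq_div_iff h4 h3]
    field_simp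
    ring

theorem norm_kern_le {ω : ℂ} (hk : 0 < k₀) (h : 2 * ‖w‖ ≤ k₀ * Real.exp ω.re) :
    ‖kern k₀ w ω‖ ≤ 2 := by
  have h0 : ‖(k₀ : ℂ) * exp ω‖ = k₀ * Real.exp ω.re := by
    rw [norm_mul, norm_real, Real.norm_of_nonneg hk.le, norm_exp]
  have h1 : 0 < k₀ * Real.exp ω.re := by positivity
  have h2 : k₀ * Real.exp ω.re / 2 ≤ ‖(k₀ : ℂ) * exp ω - w‖ := by
    have := norm_sub_norm_le ((k₀ : ℂ) * exp ω) w
    rw [h0] at this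
    linarith
  rw [kern, norm_div, h0, div_le_iff₀ (by linarith)]
  linarith

theorem norm_kern_neg_le {ω : ℂ} (hk : 0 < k₀) (hw : w ≠ 0) (h : 2 * (k₀ * Real.exp ω.re) ≤ ‖w‖) :
    ‖kern k₀ w ω‖ ≤ 2 * (k₀ * Real.exp ω.re) / ‖w‖ := by
  have h0 : ‖(k₀ : ℂ) * exp ω‖ = k₀ * Real.exp ω.re := by
    rw [norm_mul, norm_real, Real.norm_of_nonneg hk.le, norm_exp]
  have h1 : 0 < k₀ * Real.exp ω.re := by positivity
  have hw' : 0 < ‖w‖ := norm_pos_iff.2 hw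
  have h2 : ‖w‖ / 2 ≤ ‖(k₀ : ℂ) * exp ω - w‖ := by
    have := norm_sub_norm_le w ((k₀ : ℂ) * exp ω)
    rw [h0, norm_sub_rev] at this
    linarith
  rw [kern, norm_div, h0, div_le_div_iff₀ (by linarith) hw']
  nlinarith

theorem VanishRight.mul_kern (hk : 0 < k₀) (hH : VanishRight H) (w : ℂ) :
    VanishRight fun ω => H ω * kern k₀ w ω := by
  intro ε hε
  have h1 : Tendsto (fun T : ℝ => k₀ * Real.exp T) atTop atTop :=
    Real.tendsto_exp_atTop.const_mul_atTop hk
  filter_upwards [hH (ε / 2) (by positivity), h1.eventually_ge_atTop (2 * ‖w‖)] with T hT hw u hu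
  rw [norm_mul]
  have h2 : ‖kern k₀ w (T + u * I)‖ ≤ 2 := norm_kern_le hk (by simpa using hw)
  calc _ ≤ ε / 2 * 2 := mul_le_mul (hT u hu) h2 (norm_nonneg _) (by positivity)
    _ = ε := by ring

/-- The right end is now the origin, where the logarithm tends to κ rather than to 0; the decay
comes from the kernel, which is O(e^{-T}). -/
theorem VanishRight.dual_mul_kern (hk : 0 < k₀) (hH : VanishRight H) (hw : w ≠ 0) :
    VanishRight fun ω => dual H κ ω * -kern k₀ w (-ω) := by
  intro ε hε
  have hw' : 0 < ‖w‖ := norm_pos_iff.2 hw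
  have h1 : Tendsto (fun T : ℝ => k₀ * Real.exp (-T)) atTop (𝓝 0) := by
    simpa using Real.tendsto_exp_neg_atTop_nhds_zero.const_mul k₀
  have h2 : Tendsto (fun T : ℝ => (1 + ‖κ‖) * (2 * (k₀ * Real.exp (-T)) / ‖w‖)) atTop (𝓝 0) := by
    simpa using ((h1.const_mul 2).div_const ‖w‖).const_mul (1 + ‖κ‖)
  filter_upwards [hH 1 one_pos, h1.eventually_le_const (show 0 < ‖w‖ / 2 by positivity),
    h2.eventually_le_const hε] with T hT hT2 hT3 u hu
  rw [norm_mul, norm_neg]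
  have hA : ‖dual H κ (T + u * I)‖ ≤ 1 + ‖κ‖ := by
    refine (norm_add_le _ _).trans (add_le_add ?_ le_rfl)
    rw [RCLike.norm_conj, flip_add_mul_I]
    exact hT _ ⟨by linarith [hu.2], by linarith [hu.1]⟩
  refine le_trans (mul_le_mul hA (norm_kern_neg_le hk hw ?_) (norm_nonneg _) (by positivity)) ?_
  · simp; linarith
  · simpa using hT3

/-- The two boundary integrals. -/
def cauchyJ (k₀ : ℝ) (H : ℂ → ℂ) (κ w : ℂ) (T : ℝ) : ℂ :=
  bdryLeft (fun ω => H ω * kern k₀ w ω) T + bdryLeft (fun ω => dual H κ ω * -kern k₀ w (-ω)) T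

theorem norm_k_exp (hk : 0 < k₀) (ω : ℂ) : ‖(k₀ : ℂ) * exp ω‖ = k₀ * Real.exp ω.re := by
  rw [norm_mul, norm_real, Real.norm_of_nonneg hk.le, norm_exp]

theorem k_exp_ne (hk : 0 < k₀) {ω ω' : ℂ} (h : 0 < ω.re) (h' : ω'.re ≤ 0) :
    (k₀ : ℂ) * exp ω' ≠ k₀ * exp ω := fun e => by
  have := congrArg norm e
  rw [norm_k_exp hk, norm_k_exp hk] at this
  have h1 := Real.exp_injective (mul_left_cancel₀ hk.ne' this)
  linarith

/-- A point of the outer component is a pole of the first kernel only; the second is holomorphic on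
the whole closed half-strip. -/
theorem tendsto_cauchyJ_of_outer (hk : 0 < k₀) (hH : NiceStrip H) (hv : VanishRight H) {ω₀ : ℂ}
    (h₀ : ω₀ ∈ strip) :
    Tendsto (cauchyJ k₀ H κ (k₀ * exp ω₀)) atTop (𝓝 (2 * Real.pi * I * H ω₀)) := by
  have hk' : (k₀ : ℂ) ≠ 0 := by exact_mod_cast hk.ne'
  rw [← add_zero (2 * Real.pi * I * H ω₀)]
  refine Tendsto.add (tendsto_bdryLeft ?_ (hv.mul_kern hk _)) (tendsto_bdryLeft ?_
    (hv.dual_mul_kern hk (mul_ne_zero hk' (exp_ne_zero _))))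
  · filter_upwards [eventually_gt_atTop ω₀.re] with T hT using bdry_kern hk hH h₀ hT
  · filter_upwards [eventually_gt_atTop 0] with T hT
    exact bdry_kern_neg_eq_zero (hH.dual κ) (fun ω hω => k_exp_ne hk h₀.1 (by simpa using hω.1)) hT

theorem tendsto_cauchyJ_of_inner (hk : 0 < k₀) (hH : NiceStrip H) (hv : VanishRight H) {ω₀ : ℂ}
    (h₀ : ω₀ ∈ strip) :
    Tendsto (cauchyJ k₀ H κ (k₀ * exp (-ω₀))) atTop (𝓝 (2 * Real.pi * I * dual H κ ω₀)) := by
  have hk' : (k₀ : ℂ) ≠ 0 := by exact_mod_cast hk.ne'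
  rw [← zero_add (2 * Real.pi * I * dual H κ ω₀)]
  refine Tendsto.add (tendsto_bdryLeft ?_ (hv.mul_kern hk _)) (tendsto_bdryLeft ?_
    (hv.dual_mul_kern hk (mul_ne_zero hk' (exp_ne_zero _))))
  · filter_upwards [eventually_gt_atTop 0] with T hT
    refine bdry_kern_eq_zero hH (fun ω hω e => ?_) hT
    have := congrArg norm e
    rw [norm_k_exp hk, norm_k_exp hk] at this
    have h1 := Real.exp_injective (mul_left_cancel₀ hk.ne' this)
    have h2 := hω.1
    have h3 := h₀.1
    simp at h1
    linarith
  · filter_upwards [eventually_gt_atTop ω₀.re] with T hT using bdry_kern_neg hk (hH.dual κ) h₀ hT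

theorem tendsto_cauchyJ_zero (hk : 0 < k₀) (hH : NiceStrip H) (hv : VanishRight H) (hw : w ≠ 0)
    (h1 : ∀ ω ∈ cstrip, k₀ * exp ω ≠ w) (h2 : ∀ ω ∈ cstrip, k₀ * exp (-ω) ≠ w) :
    Tendsto (cauchyJ k₀ H κ w) atTop (𝓝 0) := by
  rw [← add_zero (0 : ℂ)]
  refine Tendsto.add (tendsto_bdryLeft ?_ (hv.mul_kern hk _)) (tendsto_bdryLeft ?_
    (hv.dual_mul_kern hk hw))
  · filter_upwards [eventually_gt_atTop 0] with T hT using bdry_kern_eq_zero hH h1 hT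
  · filter_upwards [eventually_gt_atTop 0] with T hT using bdry_kern_neg_eq_zero (hH.dual κ) h2 hT

end Kernel

/-! ### The logarithm of the jump as a sum of two Cauchy integrals -/

section Jump

open Set Complex

variable {F G H K : ℂ → ℂ} {T k₀ : ℝ} {w κ : ℂ}

/-- The data of a logarithm of `det a` in the coordinate of the half-strip. -/
structure LogData (H : ℂ → ℂ) (κ : ℂ) : Prop where
  nice : NiceStrip H
  vanish : VanishRight H
  re : κ.re = 0
  glue : H 0 = (starRingEnd ℂ) (H (Real.pi * I)) + κ

/-- The logarithm of the jump on the positive real axis. -/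
def edgeR (H : ℂ → ℂ) (s : ℝ) : ℝ := -2 * (H s).re

/-- The logarithm of the jump on the negative real axis. -/
def edgeL (H : ℂ → ℂ) (s : ℝ) : ℝ := -2 * (H (s + Real.pi * I)).re

/-- The logarithm of the jump on the upper semicircle. -/
def edgeC (H : ℂ → ℂ) (κ : ℂ) (u : ℝ) : ℂ :=
  -(H (u * I) + H ((Real.pi - u : ℝ) * I) + (starRingEnd ℂ) κ)

/-- The part over the real axis of the integrand. -/
def edgeReal (k₀ : ℝ) (H : ℂ → ℂ) (w : ℂ) (s : ℝ) : ℂ :=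
  edgeR H s * (kern k₀ w s + kern k₀ w (-(s + Real.pi * I))) -
    edgeL H s * (kern k₀ w (s + Real.pi * I) + kern k₀ w (-s))

/-- The part over the circle of the integral. -/
def edgeCirc (k₀ : ℝ) (H : ℂ → ℂ) (κ w : ℂ) : ℂ :=
  -(I * ∫ u in (0 : ℝ)..Real.pi, edgeC H κ u * kern k₀ w (u * I)) +
    I * ∫ u in (0 : ℝ)..Real.pi, (starRingEnd ℂ) (edgeC H κ u) * kern k₀ w (-(u * I))

theorem dual_ofReal (s : ℝ) :
    dual H κ s = (starRingEnd ℂ) (H (s + Real.pi * I)) + κ := by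
  simp [dual, flip]

theorem dual_add_pi (s : ℝ) : dual H κ (s + Real.pi * I) = (starRingEnd ℂ) (H s) + κ := by
  simp [dual, flip]

theorem dual_mul_I (u : ℝ) :
    dual H κ (u * I) = (starRingEnd ℂ) (H ((Real.pi - u : ℝ) * I)) + κ := by
  have := flip_add_mul_I 0 u
  simp only [ofReal_zero, zero_add] at this
  rw [dual, this]

theorem conj_kern (ω : ℂ) :
    (starRingEnd ℂ) (kern k₀ ((starRingEnd ℂ) w) ω) = kern k₀ w ((starRingEnd ℂ) ω) := by
  simp [kern, ← exp_conj]

theorem kern_periodic (ω : ℂ) : kern k₀ w (ω + 2 * Real.pi * I) = kern k₀ w ω := by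
  rw [kern, kern, exp_periodic]

theorem intervalIntegral_conj {f : ℝ → ℂ} {a b : ℝ} :
    (starRingEnd ℂ) (∫ x in a..b, f x) = ∫ x in a..b, (starRingEnd ℂ) (f x) := by
  simp only [intervalIntegral, map_sub, ← integral_conj]

theorem IntervalIntegrable.conj {f : ℝ → ℂ} {a b : ℝ} (h : IntervalIntegrable f volume a b) :
    IntervalIntegrable (fun x => (starRingEnd ℂ) (f x)) volume a b :=
  ⟨conjCLE.toContinuousLinearMap.integrable_comp h.1, conjCLE.toContinuousLinearMap.integrable_comp h.2⟩

theorem integral_add_conj_mul {p k : ℝ → ℂ} {a b : ℝ} (hp : IntervalIntegrable p volume a b)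
    (hk : Continuous k) :
    (∫ x in a..b, p x * k x) + ∫ x in a..b, (starRingEnd ℂ) (p x) * k x =
      ∫ x in a..b, ((2 * (p x).re : ℝ) : ℂ) * k x := by
  rw [← intervalIntegral.integral_add (hp.mul_continuousOn hk.continuousOn)
    ((IntervalIntegrable.conj hp).mul_continuousOn hk.continuousOn)]
  refine intervalIntegral.integral_congr fun x _ => ?_
  simp only [← add_mul, add_conj]

/-- Off the contour the kernel is continuous on all edges. -/
theorem continuous_kern_comp {γ : ℝ → ℂ} (hγ : Continuous γ)
    (h : ∀ x, k₀ * exp (γ x) ≠ w) : Continuous fun x => kern k₀ w (γ x) :=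
  Continuous.div (by fun_prop) (by fun_prop) fun x => sub_ne_zero.2 (h x)

theorem k_exp_real_ne (hw : w.im ≠ 0) (s : ℝ) : (k₀ : ℂ) * exp s ≠ w := fun e => hw (by
  rw [← e, ← ofReal_exp, ← ofReal_mul, ofReal_im])

theorem k_exp_real_add_ne (hw : w.im ≠ 0) (s : ℝ) : (k₀ : ℂ) * exp (s + Real.pi * I) ≠ w :=
  fun e => hw (by rw [← e, exp_add, exp_pi_mul_I, mul_neg_one, mul_neg, ← ofReal_exp, ← ofReal_mul,
    ← ofReal_neg, ofReal_im])

theorem k_exp_real_neg_add_ne (hw : w.im ≠ 0) (s : ℝ) : (k₀ : ℂ) * exp (-(s + Real.pi * I)) ≠ w :=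
  fun e => hw (by rw [← e, neg_add, exp_add, exp_neg_pi_mul_I, mul_neg_one, mul_neg, ← ofReal_neg,
    ← ofReal_exp, ← ofReal_mul, ← ofReal_neg, ofReal_im])

theorem k_exp_mul_I_ne (hk : 0 < k₀) (hw : ‖w‖ ≠ k₀) (u : ℝ) : (k₀ : ℂ) * exp (u * I) ≠ w :=
  fun e => hw (by rw [← e, norm_k_exp hk]; simp)

theorem k_exp_neg_mul_I_ne (hk : 0 < k₀) (hw : ‖w‖ ≠ k₀) (u : ℝ) : (k₀ : ℂ) * exp (-(u * I)) ≠ w :=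
  fun e => hw (by rw [← e, norm_k_exp hk]; simp)

theorem NiceStrip.intervalIntegrable_flip (h : NiceStrip H) :
    IntervalIntegrable (fun u : ℝ => H ((Real.pi - u : ℝ) * I)) volume 0 Real.pi := by
  have := h.intervalIntegrable_left.comp_sub_left Real.pi
  rw [sub_zero, sub_self] at this
  exact this.symm

/-- The cut-off contour integral of the logarithm of the jump. -/
theorem LogData.edge_eq (h : LogData H κ) (hk : 0 < k₀) (hw : w.im ≠ 0) (hw' : ‖w‖ ≠ k₀)
    (hT : 0 ≤ T) :
    (∫ s in (0 : ℝ)..T, edgeReal k₀ H w s) + edgeCirc k₀ H κ w =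
      -(cauchyJ k₀ H κ w T + (starRingEnd ℂ) (cauchyJ k₀ H κ ((starRingEnd ℂ) w) T)) := by
  have c1 : Continuous fun s : ℝ => kern k₀ w s := continuous_kern_comp (by fun_prop) (k_exp_real_ne hw)
  have c2 : Continuous fun s : ℝ => kern k₀ w (s + Real.pi * I) :=
    continuous_kern_comp (by fun_prop) (k_exp_real_add_ne hw)
  have c3 : Continuous fun s : ℝ => kern k₀ w (-s) :=
    continuous_kern_comp (by fun_prop) fun s => by simpa using k_exp_real_ne hw (-s)
  have c4 : Continuous fun s : ℝ => kern k₀ w (-(s + Real.pi * I)) :=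
    continuous_kern_comp (by fun_prop) (k_exp_real_neg_add_ne hw)
  have c5 : Continuous fun u : ℝ => kern k₀ w (u * I) :=
    continuous_kern_comp (by fun_prop) (k_exp_mul_I_ne hk hw')
  have c6 : Continuous fun u : ℝ => kern k₀ w (-(u * I)) :=
    continuous_kern_comp (by fun_prop) (k_exp_neg_mul_I_ne hk hw')
  have p1 := intervalIntegrable_bottom h.nice.cont hT
  have p2 := intervalIntegrable_top h.nice.cont hT
  have p3 := intervalIntegrable_bottom (h.nice.dual κ).cont hT
  have p4 := intervalIntegrable_top (h.nice.dual κ).cont hT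
  have p5 := h.nice.intervalIntegrable_left
  have p6 := (h.nice.dual κ).intervalIntegrable_left
  have q1 := integral_add_conj_mul p1 c1
  have q2 := integral_add_conj_mul p2 c2
  have q3 := integral_add_conj_mul p3 c3
  have q4 := integral_add_conj_mul p4 c4
  -- On the circle the outer boundary value and the reflected inner one meet at the same point, and
  -- their sum is minus the logarithm of the jump.
  have r5 : (∫ u in (0 : ℝ)..Real.pi, H (u * I) * kern k₀ w (u * I)) +
      ∫ u in (0 : ℝ)..Real.pi, (starRingEnd ℂ) (dual H κ (u * I)) * kern k₀ w (u * I) =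
      -∫ u in (0 : ℝ)..Real.pi, edgeC H κ u * kern k₀ w (u * I) := by
    rw [← intervalIntegral.integral_add (p5.mul_continuousOn c5.continuousOn)
      ((IntervalIntegrable.conj p6).mul_continuousOn c5.continuousOn),
      ← intervalIntegral.integral_neg]
    refine intervalIntegral.integral_congr fun u _ => ?_
    simp only [edgeC, dual_mul_I, map_add, conj_conj]
    ring
  have r6 : (∫ u in (0 : ℝ)..Real.pi, (starRingEnd ℂ) (H (u * I)) * kern k₀ w (-(u * I))) +
      ∫ u in (0 : ℝ)..Real.pi, dual H κ (u * I) * kern k₀ w (-(u * I)) =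
      -∫ u in (0 : ℝ)..Real.pi, (starRingEnd ℂ) (edgeC H κ u) * kern k₀ w (-(u * I)) := by
    rw [← intervalIntegral.integral_add ((IntervalIntegrable.conj p5).mul_continuousOn c6.continuousOn)
      (p6.mul_continuousOn c6.continuousOn),
      ← intervalIntegral.integral_neg]
    refine intervalIntegral.integral_congr fun u _ => ?_
    simp only [edgeC, dual_mul_I, map_add, map_neg, conj_conj]
    ring
  -- Conjugation moves the top edge to Im = -π; the period 2πi of the kernel moves it back.
  have k1 : ∀ s : ℝ, kern k₀ w (s + -(Real.pi * I)) = kern k₀ w (s + Real.pi * I) :=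
    fun s => by
      rw [← kern_periodic]; congr 1; ring
  have k2 : ∀ s : ℝ, kern k₀ w (-(s + -(Real.pi * I))) = kern k₀ w (-(s + Real.pi * I)) :=
    fun s => by
      rw [← kern_periodic (-(s + Real.pi * I))]; congr 1; ring
  have J2 : (starRingEnd ℂ) (cauchyJ k₀ H κ ((starRingEnd ℂ) w) T) =
      (∫ s in (0 : ℝ)..T, (starRingEnd ℂ) (H s) * kern k₀ w s) -
      (∫ s in (0 : ℝ)..T, (starRingEnd ℂ) (H (s + Real.pi * I)) * kern k₀ w (s + Real.pi * I)) +
      I * (∫ u in (0 : ℝ)..Real.pi, (starRingEnd ℂ) (H (u * I)) * kern k₀ w (-(u * I))) -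
      (∫ s in (0 : ℝ)..T, (starRingEnd ℂ) (dual H κ s) * kern k₀ w (-s)) +
      (∫ s in (0 : ℝ)..T, (starRingEnd ℂ) (dual H κ (s + Real.pi * I)) *
        kern k₀ w (-(s + Real.pi * I))) -
      I * ∫ u in (0 : ℝ)..Real.pi, (starRingEnd ℂ) (dual H κ (u * I)) * kern k₀ w (u * I) := by
    rw [cauchyJ, bdryLeft, bdryLeft]
    simp only [mul_neg, intervalIntegral.integral_neg, map_add, map_sub, map_mul, map_neg, conj_I,
      intervalIntegral_conj, conj_kern, conj_ofReal, k1, k2, neg_neg]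
    ring
  have S1 : (∫ s in (0 : ℝ)..T, edgeReal k₀ H w s) =
      -(∫ s in (0 : ℝ)..T, ((2 * (H s).re : ℝ) : ℂ) * kern k₀ w s) +
      (∫ s in (0 : ℝ)..T, ((2 * (H (s + Real.pi * I)).re : ℝ) : ℂ) * kern k₀ w (s + Real.pi * I)) +
      (∫ s in (0 : ℝ)..T, ((2 * (dual H κ s).re : ℝ) : ℂ) * kern k₀ w (-s)) -
      ∫ s in (0 : ℝ)..T, ((2 * (dual H κ (s + Real.pi * I)).re : ℝ) : ℂ) *
        kern k₀ w (-(s + Real.pi * I)) := by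
    have i : ∀ {p k : ℝ → ℂ}, IntervalIntegrable p volume 0 T → Continuous k →
        IntervalIntegrable (fun s => ((2 * (p s).re : ℝ) : ℂ) * k s) volume 0 T := fun {p k} hp hk => by
      have := (hp.add (IntervalIntegrable.conj hp)).mul_continuousOn hk.continuousOn (μ := volume)
      refine this.congr fun x _ => ?_
      simp only [add_conj]
    rw [neg_add_eq_sub, ← intervalIntegral.integral_sub (i p2 c2) (i p1 c1),
      ← intervalIntegral.integral_add ((i p2 c2).sub (i p1 c1)) (i p3 c3),
      ← intervalIntegral.integral_sub (((i p2 c2).sub (i p1 c1)).add (i p3 c3)) (i p4 c4)]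
    refine intervalIntegral.integral_congr fun s _ => ?_
    simp only [edgeReal, edgeR, edgeL, dual_ofReal, dual_add_pi, add_re, conj_re, h.re, add_zero]
    push_cast; ring
  rw [S1, J2, cauchyJ, bdryLeft, bdryLeft, edgeCirc, ← q1, ← q2, ← q3, ← q4]
  simp only [mul_neg, intervalIntegral.integral_neg]
  linear_combination (-I) * r5 + I * r6

end Jump

/-! ### Removing the cut-off, and integrability of the logarithm of the jump -/

section Limits

open Set Complex

variable {H : ℂ → ℂ} {T k₀ : ℝ} {w κ : ℂ}

theorem im_k_exp_nonneg (hk : 0 < k₀) {ω : ℂ} (h : ω ∈ cstrip) : 0 ≤ ((k₀ : ℂ) * exp ω).im := by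
  rw [im_ofReal_mul, exp_im]
  have := Real.sin_nonneg_of_nonneg_of_le_pi h.2.1 h.2.2
  positivity

theorem im_k_exp_pos (hk : 0 < k₀) {ω : ℂ} (h : ω ∈ strip) : 0 < ((k₀ : ℂ) * exp ω).im := by
  rw [im_ofReal_mul, exp_im]
  have := Real.sin_pos_of_pos_of_lt_pi h.2.1 h.2.2
  positivity

theorem im_k_exp_neg_nonpos (hk : 0 < k₀) {ω : ℂ} (h : ω ∈ cstrip) :
    ((k₀ : ℂ) * exp (-ω)).im ≤ 0 := by
  rw [im_ofReal_mul, exp_im, neg_im, Real.sin_neg]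
  have := Real.sin_nonneg_of_nonneg_of_le_pi h.2.1 h.2.2
  have h1 : 0 ≤ k₀ * (Real.exp (-ω).re * Real.sin ω.im) := by positivity
  linarith

theorem im_k_exp_neg_neg (hk : 0 < k₀) {ω : ℂ} (h : ω ∈ strip) :
    ((k₀ : ℂ) * exp (-ω)).im < 0 := by
  rw [im_ofReal_mul, exp_im, neg_im, Real.sin_neg]
  have := Real.sin_pos_of_pos_of_lt_pi h.2.1 h.2.2
  have h1 : 0 < k₀ * (Real.exp (-ω).re * Real.sin ω.im) := by positivity
  linarith

theorem norm_k_exp_gt (hk : 0 < k₀) {ω : ℂ} (h : 0 < ω.re) : k₀ < ‖(k₀ : ℂ) * exp ω‖ := by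
  rw [norm_k_exp hk]
  have := Real.one_lt_exp_iff.2 h
  nlinarith

theorem norm_k_exp_ge (hk : 0 < k₀) {ω : ℂ} (h : 0 ≤ ω.re) : k₀ ≤ ‖(k₀ : ℂ) * exp ω‖ := by
  rw [norm_k_exp hk]
  have := Real.one_le_exp h
  nlinarith

theorem norm_k_exp_neg_lt (hk : 0 < k₀) {ω : ℂ} (h : 0 < ω.re) : ‖(k₀ : ℂ) * exp (-ω)‖ < k₀ := by
  rw [norm_k_exp hk, neg_re]
  have := Real.exp_lt_one_iff.2 (neg_lt_zero.2 h)
  nlinarith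

theorem norm_k_exp_neg_le (hk : 0 < k₀) {ω : ℂ} (h : 0 ≤ ω.re) : ‖(k₀ : ℂ) * exp (-ω)‖ ≤ k₀ := by
  rw [norm_k_exp hk, neg_re]
  have := Real.exp_le_one_iff.2 (neg_nonpos.2 h)
  nlinarith

/-- The cut-off contour integral. -/
def cutInt (k₀ : ℝ) (H : ℂ → ℂ) (κ w : ℂ) (T : ℝ) : ℂ :=
  (∫ s in (0 : ℝ)..T, edgeReal k₀ H w s) + edgeCirc k₀ H κ w

/-- The conjugate point lies below the real axis and outside the circle, hence off the closures of
both components of D⁺, and its Cauchy integral vanishes. Only the residue at ω₀ remains. -/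
theorem LogData.tendsto_cutInt_outer (h : LogData H κ) (hk : 0 < k₀) {ω₀ : ℂ} (h₀ : ω₀ ∈ strip) :
    Tendsto (cutInt k₀ H κ (k₀ * exp ω₀)) atTop (𝓝 (-(2 * Real.pi * I * H ω₀))) := by
  set w := (k₀ : ℂ) * exp ω₀ with hw
  have hi : 0 < w.im := im_k_exp_pos hk h₀
  have hn : k₀ < ‖w‖ := norm_k_exp_gt hk h₀.1
  have h1 := tendsto_cauchyJ_of_outer (κ := κ) hk h.nice h.vanish h₀
  have h2 : Tendsto (cauchyJ k₀ H κ ((starRingEnd ℂ) w)) atTop (𝓝 0) := by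
    refine tendsto_cauchyJ_zero hk h.nice h.vanish ?_ (fun ω hω e => ?_) fun ω hω e => ?_
    · intro e; rw [map_eq_zero] at e; rw [e] at hi; simp at hi
    · have := im_k_exp_nonneg hk hω; rw [e, conj_im] at this; linarith
    · have := norm_k_exp_neg_le hk hω.1; rw [e, RCLike.norm_conj] at this; linarith
  have h3 := (h1.add ((continuous_conj.tendsto 0).comp h2)).neg
  rw [map_zero, add_zero] at h3
  refine h3.congr' ?_
  filter_upwards [eventually_ge_atTop 0] with T hT
  exact (h.edge_eq hk hi.ne' hn.ne' hT).symm

theorem LogData.tendsto_cutInt_inner (h : LogData H κ) (hk : 0 < k₀) {ω₀ : ℂ} (h₀ : ω₀ ∈ strip) :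
    Tendsto (cutInt k₀ H κ (k₀ * exp (-ω₀))) atTop (𝓝 (-(2 * Real.pi * I * dual H κ ω₀))) := by
  set w := (k₀ : ℂ) * exp (-ω₀) with hw
  have hi : w.im < 0 := im_k_exp_neg_neg hk h₀
  have hn : ‖w‖ < k₀ := norm_k_exp_neg_lt hk h₀.1
  have h1 := tendsto_cauchyJ_of_inner (κ := κ) hk h.nice h.vanish h₀
  have h2 : Tendsto (cauchyJ k₀ H κ ((starRingEnd ℂ) w)) atTop (𝓝 0) := by
    refine tendsto_cauchyJ_zero hk h.nice h.vanish ?_ (fun ω hω e => ?_) fun ω hω e => ?_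
    · intro e; rw [map_eq_zero] at e; rw [e] at hi; simp at hi
    · have := norm_k_exp_ge hk hω.1; rw [e, RCLike.norm_conj] at this; linarith
    · have := im_k_exp_neg_nonpos hk hω; rw [e, conj_im] at this; linarith
  have h3 := (h1.add ((continuous_conj.tendsto 0).comp h2)).neg
  rw [map_zero, add_zero] at h3
  refine h3.congr' ?_
  filter_upwards [eventually_ge_atTop 0] with T hT
  exact (h.edge_eq hk hi.ne hn.ne hT).symm

theorem continuousOn_edgeR (h : ContinuousOn H (cstrip \ {mid})) : ContinuousOn (edgeR H) (Ici 0) :=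
  continuousOn_const.mul (continuous_re.comp_continuousOn (continuousOn_edge_bottom h))

theorem continuousOn_edgeL (h : ContinuousOn H (cstrip \ {mid})) : ContinuousOn (edgeL H) (Ici 0) :=
  continuousOn_const.mul (continuous_re.comp_continuousOn (continuousOn_edge_top h))

theorem NiceStrip.intervalIntegrable_edgeC (h : NiceStrip H) (κ : ℂ) :
    IntervalIntegrable (edgeC H κ) volume 0 Real.pi :=
  ((h.intervalIntegrable_left.add h.intervalIntegrable_flip).add intervalIntegrable_const).neg

theorem kern_real (s : ℝ) : kern k₀ w s = (k₀ * Real.exp s : ℝ) / ((k₀ * Real.exp s : ℝ) - w) := by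
  rw [kern]; push_cast; rfl

theorem kern_neg_real (s : ℝ) :
    kern k₀ w (-s) = (k₀ * Real.exp (-s) : ℝ) / ((k₀ * Real.exp (-s) : ℝ) - w) := by
  rw [kern]; push_cast; rfl

theorem kern_real_add (s : ℝ) :
    kern k₀ w (s + Real.pi * I) = (k₀ * Real.exp s : ℝ) / ((k₀ * Real.exp s : ℝ) + w) := by
  rw [kern, exp_add, exp_pi_mul_I, mul_neg_one, mul_neg, ← neg_div_neg_eq]; push_cast; congr 1 <;> ring

theorem kern_neg_real_add (s : ℝ) :
    kern k₀ w (-(s + Real.pi * I)) =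
      (k₀ * Real.exp (-s) : ℝ) / ((k₀ * Real.exp (-s) : ℝ) + w) := by
  rw [kern, neg_add, exp_add, exp_neg_pi_mul_I, mul_neg_one, mul_neg, ← neg_div_neg_eq]
  push_cast; congr 1 <;> ring

theorem continuous_kerns (hw : w.im ≠ 0) :
    (Continuous fun s : ℝ => kern k₀ w s) ∧ (Continuous fun s : ℝ => kern k₀ w (s + Real.pi * I)) ∧
    (Continuous fun s : ℝ => kern k₀ w (-s)) ∧
    Continuous fun s : ℝ => kern k₀ w (-(s + Real.pi * I)) :=
  ⟨continuous_kern_comp (by fun_prop) (k_exp_real_ne hw),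
    continuous_kern_comp (by fun_prop) (k_exp_real_add_ne hw),
    continuous_kern_comp (by fun_prop) fun s => by simpa using k_exp_real_ne hw (-s),
    continuous_kern_comp (by fun_prop) (k_exp_real_neg_add_ne hw)⟩

theorem continuousOn_edgeReal (h : ContinuousOn H (cstrip \ {mid})) (hw : w.im ≠ 0) :
    ContinuousOn (edgeReal k₀ H w) (Ici 0) := by
  obtain ⟨c1, c2, c3, c4⟩ := continuous_kerns (k₀ := k₀) hw
  exact ((continuous_ofReal.comp_continuousOn (continuousOn_edgeR h)).mul
    (c1.add c4).continuousOn).sub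
    ((continuous_ofReal.comp_continuousOn (continuousOn_edgeL h)).mul (c2.add c3).continuousOn)

theorem norm_div_sub_le {x : ℝ} (hw : w.im ≠ 0) : ‖(x : ℂ) / (x - w)‖ ≤ 1 + ‖w‖ / |w.im| := by
  have h1 : |w.im| ≤ ‖(x : ℂ) - w‖ := by simpa using abs_im_le_norm ((x : ℂ) - w)
  have h2 : 0 < |w.im| := abs_pos.2 hw
  have h3 : (x : ℂ) - w ≠ 0 := norm_pos_iff.1 (h2.trans_le h1)
  have h4 : (x : ℂ) / (x - w) = 1 + w / (x - w) := by field_simp; ring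
  rw [h4]
  refine (norm_add_le _ _).trans (by rw [norm_one, norm_div]; gcongr)

theorem norm_kerns_le (hw : w.im ≠ 0) (s : ℝ) :
    ‖kern k₀ w s‖ ≤ 1 + ‖w‖ / |w.im| ∧ ‖kern k₀ w (s + Real.pi * I)‖ ≤ 1 + ‖w‖ / |w.im| ∧
    ‖kern k₀ w (-s)‖ ≤ 1 + ‖w‖ / |w.im| ∧ ‖kern k₀ w (-(s + Real.pi * I))‖ ≤ 1 + ‖w‖ / |w.im| := by
  have hw' : (-w).im ≠ 0 := by simpa using hw
  have key : ∀ x : ℝ, ‖(x : ℂ) / (x + w)‖ ≤ 1 + ‖w‖ / |w.im| := fun x => by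
    have := norm_div_sub_le (x := x) hw'
    rwa [sub_neg_eq_add, norm_neg, neg_im, abs_neg] at this
  rw [kern_real, kern_real_add, kern_neg_real, kern_neg_real_add]
  exact ⟨norm_div_sub_le hw, key _, norm_div_sub_le hw, key _⟩

/-- At w = iR the imaginary parts of the kernels at x and -x are opposite, which turns the
difference of the two edge terms into the nonnegative sum of the edges times a single weight. -/
theorem im_edgeReal {R s : ℝ} :
    (edgeReal k₀ H (R * I) s).im = (edgeR H s + edgeL H s) *
      ((k₀ * Real.exp s) * R / ((k₀ * Real.exp s) ^ 2 + R ^ 2) -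
        (k₀ * Real.exp (-s)) * R / ((k₀ * Real.exp (-s)) ^ 2 + R ^ 2)) := by
  have e1 : ∀ x : ℝ, ((x : ℂ) / (x - R * I)).im = x * R / (x ^ 2 + R ^ 2) := fun x => by
    rw [div_im]; simp [normSq_apply]; ring
  have e2 : ∀ x : ℝ, ((x : ℂ) / (x + R * I)).im = -(x * R / (x ^ 2 + R ^ 2)) := fun x => by
    rw [div_im]; simp [normSq_apply]; ring
  rw [edgeReal, kern_real, kern_real_add, kern_neg_real, kern_neg_real_add, sub_im, im_ofReal_mul,
    im_ofReal_mul, add_im, add_im, e1, e1, e2, e2]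
  ring

/-- With x = k₀e^s, y = k₀e^{-s} and xy = k₀² the weight factors as
(x-y)R²(R²-k₀²)/((x²+R²)(y²+R²)). Here R²-k₀² ≥ 3R²/4 and the denominator is at most 4R⁴, whence
3/16. -/
theorem weight_ge (hk : 0 < k₀) {R s : ℝ} (hs : 0 ≤ s) (hR : 2 * k₀ ≤ R)
    (hsR : k₀ * Real.exp s ≤ R) :
    3 / 16 * (k₀ * Real.exp s - k₀ * Real.exp (-s)) ≤
      R * ((k₀ * Real.exp s) * R / ((k₀ * Real.exp s) ^ 2 + R ^ 2) -
        (k₀ * Real.exp (-s)) * R / ((k₀ * Real.exp (-s)) ^ 2 + R ^ 2)) := by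
  set x := k₀ * Real.exp s with hx
  set y := k₀ * Real.exp (-s) with hy
  have hxy : x * y = k₀ ^ 2 := by
    rw [hx, hy, Real.exp_neg]; field_simp
  have hx0 : 0 < x := by positivity
  have hy0 : 0 < y := by positivity
  have hyx : y ≤ x := by
    rw [hx, hy]; gcongr; linarith
  have hR0 : 0 < R := by linarith
  have e : R * (x * R / (x ^ 2 + R ^ 2) - y * R / (y ^ 2 + R ^ 2)) =
      (x - y) * (R ^ 2 * (R ^ 2 - x * y) / ((x ^ 2 + R ^ 2) * (y ^ 2 + R ^ 2))) := by
    field_simp; ring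
  rw [e, mul_comm (3 / 16), hxy]
  refine mul_le_mul_of_nonneg_left ?_ (by linarith)
  rw [le_div_iff₀ (by positivity)]
  have a1 : x ^ 2 + R ^ 2 ≤ 2 * R ^ 2 := by nlinarith
  have a2 : y ^ 2 + R ^ 2 ≤ 2 * R ^ 2 := by nlinarith
  have a3 : 3 / 4 * R ^ 2 ≤ R ^ 2 - k₀ ^ 2 := by nlinarith
  calc 3 / 16 * ((x ^ 2 + R ^ 2) * (y ^ 2 + R ^ 2)) ≤ 3 / 16 * ((2 * R ^ 2) * (2 * R ^ 2)) := by gcongr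
    _ = R ^ 2 * (3 / 4 * R ^ 2) := by ring
    _ ≤ _ := by gcongr

theorem weight_nonneg (hk : 0 < k₀) {R s : ℝ} (hs : 0 ≤ s) (hR : 2 * k₀ ≤ R) :
    0 ≤ R * ((k₀ * Real.exp s) * R / ((k₀ * Real.exp s) ^ 2 + R ^ 2) -
        (k₀ * Real.exp (-s)) * R / ((k₀ * Real.exp (-s)) ^ 2 + R ^ 2)) := by
  set x := k₀ * Real.exp s with hx
  set y := k₀ * Real.exp (-s) with hy
  have hxy : x * y = k₀ ^ 2 := by
    rw [hx, hy, Real.exp_neg]; field_simp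
  have hx0 : 0 < x := by positivity
  have hy0 : 0 < y := by positivity
  have hyx : y ≤ x := by
    rw [hx, hy]; gcongr; linarith
  have hR0 : 0 < R := by linarith
  have e : R * (x * R / (x ^ 2 + R ^ 2) - y * R / (y ^ 2 + R ^ 2)) =
      (x - y) * (R ^ 2 * (R ^ 2 - x * y) / ((x ^ 2 + R ^ 2) * (y ^ 2 + R ^ 2))) := by
    field_simp; ring
  rw [e, hxy]
  have a3 : 0 ≤ R ^ 2 - k₀ ^ 2 := by nlinarith
  have a4 : 0 ≤ x - y := by linarith
  positivity

theorem k_exp_add_half (σ : ℝ) : (k₀ : ℂ) * exp (σ + (Real.pi / 2 : ℝ) * I) = (k₀ * Real.exp σ : ℝ) * I := by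
  rw [exp_add, ofReal_div, ofReal_ofNat, exp_pi_div_two_mul_I]; push_cast; ring

/-- Seen from far away the kernel on the circle is O(k₀/|w|), so the circle part stays bounded after
multiplication by |w|. -/
theorem norm_edgeCirc_le (h : NiceStrip H) (hk : 0 < k₀) (hw : 2 * k₀ ≤ ‖w‖) :
    ‖w‖ * ‖edgeCirc k₀ H κ w‖ ≤ 4 * k₀ * ∫ u in (0 : ℝ)..Real.pi, ‖edgeC H κ u‖ := by
  have hw0 : 0 < ‖w‖ := by linarith
  have hI := (h.intervalIntegrable_edgeC κ).norm
  have b : ∀ g : ℝ → ℂ, (∀ u, ‖g u‖ = ‖edgeC H κ u‖) → ∀ k : ℝ → ℂ, (∀ u, ‖k u‖ ≤ 2 * k₀ / ‖w‖) →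
      ‖∫ u in (0 : ℝ)..Real.pi, g u * k u‖ ≤
        (∫ u in (0 : ℝ)..Real.pi, ‖edgeC H κ u‖) * (2 * k₀ / ‖w‖) := fun g hg k hkk => by
    rw [← intervalIntegral.integral_mul_const]
    refine intervalIntegral.norm_integral_le_of_norm_le Real.pi_pos.le ?_ (hI.mul_const _)
    refine Eventually.of_forall fun u _ => ?_
    rw [norm_mul, hg]
    exact mul_le_mul_of_nonneg_left (hkk u) (norm_nonneg _)
  have hker : ∀ ω : ℂ, ω.re = 0 → ‖kern k₀ w ω‖ ≤ 2 * k₀ / ‖w‖ := fun ω hω => by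
    have := norm_kern_neg_le (ω := ω) hk (norm_pos_iff.1 hw0) (by simpa [hω] using hw)
    simpa [hω] using this
  have b1 := b (edgeC H κ) (fun _ => rfl) (fun u => kern k₀ w (u * I)) fun u => hker _ (by simp)
  have b2 := b (fun u => (starRingEnd ℂ) (edgeC H κ u)) (fun _ => RCLike.norm_conj _)
    (fun u => kern k₀ w (-(u * I))) fun u => hker _ (by simp)
  have b3 : ‖edgeCirc k₀ H κ w‖ ≤ 2 * ((∫ u in (0 : ℝ)..Real.pi, ‖edgeC H κ u‖) * (2 * k₀ / ‖w‖)) := by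
    rw [edgeCirc]
    refine (norm_add_le _ _).trans ?_
    rw [norm_neg, norm_mul, norm_mul, norm_I, one_mul, one_mul]
    linarith
  calc _ ≤ ‖w‖ * _ := mul_le_mul_of_nonneg_left b3 hw0.le
    _ = _ := by field_simp; ring

/-- Decay of `H` along the imaginary axis and positivity of the logarithm of the jump on the real
axis make the latter integrable. -/
theorem LogData.integrableOn_edge (h : LogData H κ) (hk : 0 < k₀)
    (hR : ∀ s : ℝ, 0 ≤ s → 0 ≤ edgeR H s) (hL : ∀ s : ℝ, 0 ≤ s → 0 ≤ edgeL H s) {C : ℝ}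
    (hC : ∀ᶠ s : ℝ in atTop, k₀ * Real.exp s * ‖H (s + (Real.pi / 2 : ℝ) * I)‖ ≤ C) :
    IntegrableOn (fun s => edgeR H s + edgeL H s) (Ioi 0) := by
  have hcont : ContinuousOn (fun s => edgeR H s + edgeL H s) (Ici 0) :=
    (continuousOn_edgeR h.nice.cont).add (continuousOn_edgeL h.nice.cont)
  have hint : ∀ a b : ℝ, 0 ≤ a → a ≤ b →
      IntervalIntegrable (fun s => edgeR H s + edgeL H s) volume a b := fun a b ha hab =>
    (hcont.mono (by rw [uIcc_of_le hab]; exact fun x hx => ha.trans hx.1)).intervalIntegrable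
  set M := ∫ u in (0 : ℝ)..Real.pi, ‖edgeC H κ u‖ with hM
  -- A bound independent of S. Take w = iR with R = k₀e^σ and σ ≥ S large: R times the imaginary
  -- part of the limit is at most 2πC from the decay of H plus 4k₀M from the circle. Starting at 1
  -- ensures e^s - e^{-s} ≥ 1 below.
  have key : ∀ S : ℝ, 1 ≤ S →
      3 / 16 * k₀ * (∫ s in (1 : ℝ)..S, (edgeR H s + edgeL H s)) ≤ 2 * Real.pi * C + 4 * k₀ * M := by
    intro S hS
    obtain ⟨σ, hσC, hσS⟩ := (hC.and (eventually_ge_atTop S)).exists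
    have hσ1 : 1 ≤ σ := hS.trans hσS
    set R := k₀ * Real.exp σ with hRdef
    have hR2 : 2 * k₀ ≤ R := by
      have := Real.add_one_le_exp σ
      rw [hRdef]; nlinarith
    have hR0 : 0 < R := by linarith
    have h₀ : (σ + (Real.pi / 2 : ℝ) * I : ℂ) ∈ strip := by
      refine ⟨by simp; linarith, by simp; positivity, by simp; linarith [Real.pi_pos]⟩
    have ht := h.tendsto_cutInt_outer hk h₀
    rw [k_exp_add_half, ← hRdef] at ht
    have hwim : ((R : ℂ) * I).im ≠ 0 := by simpa using hR0.ne'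
    have hwn : ‖(R : ℂ) * I‖ = R := by simp [abs_of_pos hR0]
    have ht' : Tendsto (fun T : ℝ => R * (∫ s in (0 : ℝ)..T, edgeReal k₀ H (R * I) s).im) atTop
        (𝓝 (R * (-(2 * Real.pi * I * H (σ + (Real.pi / 2 : ℝ) * I)) - edgeCirc k₀ H κ (R * I)).im)) := by
      have := ht.sub_const (edgeCirc k₀ H κ (R * I))
      refine (((continuous_im.tendsto _).comp this).const_mul R).congr fun T => ?_
      simp [cutInt]
    have hb : R * (-(2 * Real.pi * I * H (σ + (Real.pi / 2 : ℝ) * I)) - edgeCirc k₀ H κ (R * I)).im ≤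
        2 * Real.pi * C + 4 * k₀ * M := by
      have e1 := norm_edgeCirc_le (κ := κ) h.nice hk (by rw [hwn]; exact hR2)
      rw [hwn] at e1
      have e2 : (-(2 * Real.pi * I * H (σ + (Real.pi / 2 : ℝ) * I)) - edgeCirc k₀ H κ (R * I)).im ≤
          2 * Real.pi * ‖H (σ + (Real.pi / 2 : ℝ) * I)‖ + ‖edgeCirc k₀ H κ (R * I)‖ := by
        refine (le_abs_self _).trans ((abs_im_le_norm _).trans ((norm_sub_le _ _).trans ?_))
        rw [norm_neg, norm_mul, norm_mul, norm_mul, norm_I, mul_one, norm_real,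
          Real.norm_of_nonneg Real.pi_pos.le, RCLike.norm_ofNat]
      calc _ ≤ R * _ := mul_le_mul_of_nonneg_left e2 hR0.le
        _ = 2 * Real.pi * (R * ‖H (σ + (Real.pi / 2 : ℝ) * I)‖) + R * ‖edgeCirc k₀ H κ (R * I)‖ := by ring
        _ ≤ _ := add_le_add (mul_le_mul_of_nonneg_left hσC (by positivity)) e1
    -- No integrability is known yet, so the lower bound is proved for each cut-off T ≥ S and passed
    -- to the limit.
    refine le_trans (ge_of_tendsto ht' ?_) hb
    filter_upwards [eventually_ge_atTop S] with T hT
    set W : ℝ → ℝ := fun s => R * ((k₀ * Real.exp s) * R / ((k₀ * Real.exp s) ^ 2 + R ^ 2) -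
        (k₀ * Real.exp (-s)) * R / ((k₀ * Real.exp (-s)) ^ 2 + R ^ 2)) with hW
    have hWc : Continuous W := by
      refine continuous_const.mul (Continuous.sub (Continuous.div (by fun_prop) (by fun_prop) ?_)
        (Continuous.div (by fun_prop) (by fun_prop) ?_)) <;> intro s <;> positivity
    have hII : ∀ a b : ℝ, 0 ≤ a → a ≤ b →
        IntervalIntegrable (fun s => (edgeR H s + edgeL H s) * W s) volume a b := fun a b ha hab =>
      (hint a b ha hab).mul_continuousOn hWc.continuousOn
    have e3 : R * (∫ s in (0 : ℝ)..T, edgeReal k₀ H (R * I) s).im =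
        ∫ s in (0 : ℝ)..T, (edgeR H s + edgeL H s) * W s := by
      have hi : IntervalIntegrable (edgeReal k₀ H (R * I)) volume 0 T :=
        ((continuousOn_edgeReal h.nice.cont hwim).mono (by
          rw [uIcc_of_le (by linarith)]; exact Icc_subset_Ici_self)).intervalIntegrable
      have := imCLM.intervalIntegral_comp_comm hi
      simp only [imCLM_apply] at this
      rw [← this, ← intervalIntegral.integral_const_mul]
      refine intervalIntegral.integral_congr fun s _ => ?_
      simp only [im_edgeReal, hW]; ring
    rw [e3, ← intervalIntegral.integral_const_mul]
    calc _ ≤ ∫ s in (1 : ℝ)..S, (edgeR H s + edgeL H s) * W s := by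
          refine intervalIntegral.integral_mono_on hS ((hint 1 S zero_le_one hS).const_mul _)
            (hII 1 S zero_le_one hS) fun s hs => ?_
          have hs0 : 0 ≤ s := zero_le_one.trans hs.1
          rw [mul_comm (3 / 16 * k₀)]
          refine mul_le_mul_of_nonneg_left ?_ (add_nonneg (hR s hs0) (hL s hs0))
          refine le_trans ?_ (weight_ge hk hs0 hR2 ?_)
          · have a1 := Real.add_one_le_exp s
            have a2 := Real.exp_le_one_iff.2 (neg_nonpos.2 hs0)
            have a3 : 1 ≤ Real.exp s - Real.exp (-s) := by linarith [hs.1]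
            nlinarith
          · rw [hRdef]; gcongr; exact hs.2.trans hσS
      _ ≤ _ := by
          refine intervalIntegral.integral_mono_interval zero_le_one hS hT ?_ (hII 0 T le_rfl (by linarith))
          filter_upwards [ae_restrict_mem measurableSet_Ioc] with s hs
          exact mul_nonneg (add_nonneg (hR s hs.1.le) (hL s hs.1.le)) (weight_nonneg hk hs.1.le hR2)
  have h1 : IntegrableOn (fun s => edgeR H s + edgeL H s) (Ioi 1) := by
    refine integrableOn_Ioi_of_intervalIntegral_norm_bounded ((2 * Real.pi * C + 4 * k₀ * M) / (3 / 16 * k₀)) 1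
      (b := fun S : ℝ => S) (l := atTop) (fun S => ?_) tendsto_id ?_
    · rcases le_total 1 S with h | h
      · exact (intervalIntegrable_iff_integrableOn_Ioc_of_le h).1 (hint 1 S zero_le_one h)
      · simp [Ioc_eq_empty_of_le h]
    · filter_upwards [eventually_ge_atTop 1] with S hS
      rw [le_div_iff₀ (by positivity), mul_comm]
      have e : (∫ s in (1 : ℝ)..S, ‖edgeR H s + edgeL H s‖) =
          ∫ s in (1 : ℝ)..S, (edgeR H s + edgeL H s) := by
        refine intervalIntegral.integral_congr fun s hs => ?_
        rw [uIcc_of_le hS] at hs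
        have hs0 : 0 ≤ s := zero_le_one.trans hs.1
        exact Real.norm_of_nonneg (add_nonneg (hR s hs0) (hL s hs0))
      rw [e]
      exact key S hS
  have h2 := (intervalIntegrable_iff_integrableOn_Ioc_of_le zero_le_one).1 (hint 0 1 le_rfl zero_le_one)
  rw [← Ioc_union_Ioi_eq_Ioi zero_le_one]
  exact h2.union h1

end Limits

/-! ### The full contour integral, including its value at the origin -/

section Contour

open Set Complex

variable {H ℓ : ℂ → ℂ} {k₀ : ℝ} {w κ : ℂ}

theorem kern_zero (hk : 0 < k₀) (ω : ℂ) : kern k₀ 0 ω = 1 := by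
  rw [kern, sub_zero, div_self]
  exact mul_ne_zero (by exact_mod_cast hk.ne') (exp_ne_zero _)

theorem kerns_continuous_bounded (hk : 0 < k₀) (hw : w.im ≠ 0 ∨ w = 0) : ∃ B : ℝ,
    ((Continuous fun s : ℝ => kern k₀ w s) ∧ ∀ s : ℝ, ‖kern k₀ w s‖ ≤ B) ∧
    ((Continuous fun s : ℝ => kern k₀ w (s + Real.pi * I)) ∧
      ∀ s : ℝ, ‖kern k₀ w (s + Real.pi * I)‖ ≤ B) ∧
    ((Continuous fun s : ℝ => kern k₀ w (-s)) ∧ ∀ s : ℝ, ‖kern k₀ w (-s)‖ ≤ B) ∧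
    ((Continuous fun s : ℝ => kern k₀ w (-(s + Real.pi * I))) ∧
      ∀ s : ℝ, ‖kern k₀ w (-(s + Real.pi * I))‖ ≤ B) := by
  rcases hw with hw | rfl
  · obtain ⟨c1, c2, c3, c4⟩ := continuous_kerns (k₀ := k₀) hw
    have h := norm_kerns_le (k₀ := k₀) hw
    exact ⟨_, ⟨c1, fun s => (h s).1⟩, ⟨c2, fun s => (h s).2.1⟩, ⟨c3, fun s => (h s).2.2.1⟩,
      ⟨c4, fun s => (h s).2.2.2⟩⟩
  · refine ⟨1, ?_⟩
    simp only [kern_zero hk, norm_one, le_refl, implies_true, and_true]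
    exact ⟨continuous_const, continuous_const, continuous_const, continuous_const⟩

/-- Integrability of the logarithm of the jump over the real axis. -/
structure EdgeIntegrable (H : ℂ → ℂ) : Prop where
  right : IntegrableOn (edgeR H) (Ioi 0)
  left : IntegrableOn (edgeL H) (Ioi 0)

theorem EdgeIntegrable.of_add (hc : ContinuousOn H (cstrip \ {mid}))
    (hR : ∀ s : ℝ, 0 ≤ s → 0 ≤ edgeR H s) (hL : ∀ s : ℝ, 0 ≤ s → 0 ≤ edgeL H s)
    (h : IntegrableOn (fun s => edgeR H s + edgeL H s) (Ioi 0)) : EdgeIntegrable H := by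
  refine ⟨Integrable.mono' h ?_ ?_, Integrable.mono' h ?_ ?_⟩
  · exact ((continuousOn_edgeR hc).mono Ioi_subset_Ici_self).aestronglyMeasurable measurableSet_Ioi
  · filter_upwards [ae_restrict_mem measurableSet_Ioi] with s hs
    have hs' : (0 : ℝ) ≤ s := le_of_lt hs
    rw [Real.norm_of_nonneg (hR s hs')]; linarith [hL s hs']
  · exact ((continuousOn_edgeL hc).mono Ioi_subset_Ici_self).aestronglyMeasurable measurableSet_Ioi
  · filter_upwards [ae_restrict_mem measurableSet_Ioi] with s hs
    have hs' : (0 : ℝ) ≤ s := le_of_lt hs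
    rw [Real.norm_of_nonneg (hL s hs')]; linarith [hR s hs']

theorem integrableOn_ofReal_mul {e : ℝ → ℝ} {k : ℝ → ℂ} (he : IntegrableOn e (Ioi 0))
    (hk : Continuous k) {B : ℝ} (hB : ∀ s, ‖k s‖ ≤ B) :
    IntegrableOn (fun s => (e s : ℂ) * k s) (Ioi 0) :=
  Integrable.mul_bdd (μ := volume.restrict (Ioi 0)) (c := B) he.ofReal hk.aestronglyMeasurable
    (Eventually.of_forall hB)

theorem EdgeIntegrable.mul_kerns (h : EdgeIntegrable H) (hk : 0 < k₀) (hw : w.im ≠ 0 ∨ w = 0) :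
    IntegrableOn (fun s : ℝ => (edgeR H s : ℂ) * kern k₀ w s) (Ioi 0) ∧
    IntegrableOn (fun s : ℝ => (edgeR H s : ℂ) * kern k₀ w (-(s + Real.pi * I))) (Ioi 0) ∧
    IntegrableOn (fun s : ℝ => (edgeL H s : ℂ) * kern k₀ w (s + Real.pi * I)) (Ioi 0) ∧
    IntegrableOn (fun s : ℝ => (edgeL H s : ℂ) * kern k₀ w (-s)) (Ioi 0) := by
  obtain ⟨B, h1, h2, h3, h4⟩ := kerns_continuous_bounded hk hw
  exact ⟨integrableOn_ofReal_mul h.right h1.1 h1.2, integrableOn_ofReal_mul h.right h4.1 h4.2,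
    integrableOn_ofReal_mul h.left h2.1 h2.2, integrableOn_ofReal_mul h.left h3.1 h3.2⟩

theorem EdgeIntegrable.edgeReal (h : EdgeIntegrable H) (hk : 0 < k₀) (hw : w.im ≠ 0 ∨ w = 0) :
    IntegrableOn (edgeReal k₀ H w) (Ioi 0) := by
  obtain ⟨h1, h2, h3, h4⟩ := h.mul_kerns hk hw
  refine ((h1.add h2).sub (h3.add h4)).congr (Eventually.of_forall fun s => ?_)
  simp only [MMKdV.edgeReal, Pi.add_apply, Pi.sub_apply]; ring

/-- The contour integral in the coordinate of the half-strip. -/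
def fullInt (k₀ : ℝ) (H : ℂ → ℂ) (κ w : ℂ) : ℂ :=
  (∫ s in Ioi (0 : ℝ), edgeReal k₀ H w s) + edgeCirc k₀ H κ w

theorem EdgeIntegrable.tendsto_cutInt (h : EdgeIntegrable H) (hk : 0 < k₀) (hw : w.im ≠ 0 ∨ w = 0) :
    Tendsto (cutInt k₀ H κ w) atTop (𝓝 (fullInt k₀ H κ w)) :=
  (intervalIntegral_tendsto_integral_Ioi 0 (h.edgeReal hk hw) tendsto_id).add_const _

theorem LogData.fullInt_outer (h : LogData H κ) (hi : EdgeIntegrable H) (hk : 0 < k₀) {ω₀ : ℂ}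
    (h₀ : ω₀ ∈ strip) : fullInt k₀ H κ (k₀ * exp ω₀) = -(2 * Real.pi * I * H ω₀) :=
  tendsto_nhds_unique (hi.tendsto_cutInt hk (Or.inl (im_k_exp_pos hk h₀).ne'))
    (h.tendsto_cutInt_outer hk h₀)

theorem LogData.fullInt_inner (h : LogData H κ) (hi : EdgeIntegrable H) (hk : 0 < k₀) {ω₀ : ℂ}
    (h₀ : ω₀ ∈ strip) : fullInt k₀ H κ (k₀ * exp (-ω₀)) = -(2 * Real.pi * I * dual H κ ω₀) :=
  tendsto_nhds_unique (hi.tendsto_cutInt hk (Or.inl (im_k_exp_neg_neg hk h₀).ne))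
    (h.tendsto_cutInt_inner hk h₀)

theorem k_exp_neg_add_half (σ : ℝ) :
    (k₀ : ℂ) * exp (-(σ + (Real.pi / 2 : ℝ) * I)) = (-(k₀ * Real.exp (-σ)) : ℝ) * I := by
  rw [neg_add, exp_add, ← neg_mul, ← ofReal_neg, ← ofReal_neg, ofReal_neg (Real.pi / 2), neg_mul,
    exp_neg ((Real.pi / 2 : ℝ) * I), ofReal_div, ofReal_ofNat, exp_pi_div_two_mul_I, inv_I]
  push_cast; ring

theorem tendsto_kern_zero (hk : 0 < k₀) (ω : ℂ) :
    Tendsto (fun σ : ℝ => kern k₀ (k₀ * exp (-(σ + (Real.pi / 2 : ℝ) * I))) ω) atTop (𝓝 (kern k₀ 0 ω)) := by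
  have h1 : Tendsto (fun σ : ℝ => (k₀ : ℂ) * exp (-(σ + (Real.pi / 2 : ℝ) * I))) atTop (𝓝 0) := by
    rw [tendsto_zero_iff_norm_tendsto_zero]
    simp only [norm_k_exp hk]
    simpa using Real.tendsto_exp_neg_atTop_nhds_zero.const_mul k₀
  refine tendsto_const_nhds.div (h1.const_sub _) ?_
  rw [sub_zero]
  exact mul_ne_zero (by exact_mod_cast hk.ne') (exp_ne_zero _)

theorem norm_kern_imag_le {R s : ℝ} :
    ‖kern k₀ (R * I) s‖ ≤ 1 ∧ ‖kern k₀ (R * I) (s + Real.pi * I)‖ ≤ 1 ∧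
    ‖kern k₀ (R * I) (-s)‖ ≤ 1 ∧ ‖kern k₀ (R * I) (-(s + Real.pi * I))‖ ≤ 1 := by
  have key : ∀ x : ℝ, ∀ r : ℝ, ‖(x : ℂ) / (x - r * I)‖ ≤ 1 := fun x r => by
    rw [norm_div]
    refine div_le_one_of_le₀ ?_ (norm_nonneg _)
    have := abs_re_le_norm ((x : ℂ) - r * I)
    simpa using this
  have key' : ∀ x : ℝ, ∀ r : ℝ, ‖(x : ℂ) / (x + r * I)‖ ≤ 1 := fun x r => by
    have := key x (-r)
    rwa [ofReal_neg, neg_mul, sub_neg_eq_add] at this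
  rw [kern_real, kern_real_add, kern_neg_real, kern_neg_real_add]
  exact ⟨key _ _, key' _ _, key _ _, key' _ _⟩

theorem norm_kern_circ_le {ω : ℂ} (hk : 0 < k₀) (hω : ω.re = 0) (hw : 2 * ‖w‖ ≤ k₀) :
    ‖kern k₀ w ω‖ ≤ 2 := norm_kern_le hk (by simpa [hω] using hw)

/-- The origin is approached along the negative imaginary axis, inside the inner component. There
|x/(x - ir)| ≤ 1 for real x, so the integrable edges dominate, while on the circle the kernel is at
most 2. The logarithm tends to κ because H vanishes at the right end. -/
theorem LogData.fullInt_zero (h : LogData H κ) (hi : EdgeIntegrable H) (hk : 0 < k₀) :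
    fullInt k₀ H κ 0 = -(2 * Real.pi * I * κ) := by
  set W : ℝ → ℂ := fun σ => k₀ * exp (-(σ + (Real.pi / 2 : ℝ) * I)) with hW
  have hst : ∀ σ : ℝ, 0 < σ → (σ + (Real.pi / 2 : ℝ) * I : ℂ) ∈ strip := fun σ hσ =>
    ⟨by simp; linarith, by simp; positivity, by simp; linarith [Real.pi_pos]⟩
  have t1 : Tendsto (fun σ => fullInt k₀ H κ (W σ)) atTop (𝓝 (-(2 * Real.pi * I * κ))) := by
    have e1 : Tendsto (fun σ : ℝ => dual H κ (σ + (Real.pi / 2 : ℝ) * I)) atTop (𝓝 κ) := by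
      have : Tendsto (fun σ : ℝ => H (σ + (Real.pi / 2 : ℝ) * I)) atTop (𝓝 0) := by
        rw [Metric.tendsto_nhds]
        intro ε hε
        filter_upwards [h.vanish (ε / 2) (by positivity)] with σ hσ
        rw [dist_zero_right]
        linarith [hσ _ pi_half_mem]
      have h2 := ((continuous_conj.tendsto _).comp this).add_const κ
      rw [map_zero, zero_add] at h2
      refine h2.congr fun σ => ?_
      rw [dual, flip_add_mul_I]
      simp only [Function.comp]
      congr 4; push_cast; ring
    refine (e1.const_mul (2 * Real.pi * I)).neg.congr' ?_
    filter_upwards [eventually_gt_atTop 0] with σ hσ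
    exact (h.fullInt_inner hi hk (hst σ hσ)).symm
  refine tendsto_nhds_unique ?_ t1
  have hsmall : ∀ᶠ σ in atTop, 2 * ‖W σ‖ ≤ k₀ := by
    have : Tendsto (fun σ : ℝ => 2 * (k₀ * Real.exp (-σ))) atTop (𝓝 0) := by
      simpa using (Real.tendsto_exp_neg_atTop_nhds_zero.const_mul k₀).const_mul 2
    filter_upwards [this.eventually_le_const hk] with σ hσ
    simp only [hW, norm_k_exp hk]
    simpa using hσ
  have hWi : ∀ σ, W σ = (-(k₀ * Real.exp (-σ)) : ℝ) * I := fun σ => k_exp_neg_add_half σ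
  have hWn : ∀ σ : ℝ, -(k₀ * Real.exp (-σ)) ≠ 0 := fun σ => by
    have := Real.exp_pos (-σ)
    exact neg_ne_zero.2 (by positivity)
  have hIm : ∀ σ, (W σ).im ≠ 0 := fun σ => by
    rw [hWi, im_ofReal_mul, I_im, mul_one]; exact hWn σ
  refine Tendsto.add ?_ ?_
  · refine tendsto_integral_filter_of_dominated_convergence
      (fun s => (|edgeR H s| + |edgeL H s|) * 2) ?_ ?_ ((hi.right.abs.add hi.left.abs).mul_const 2) ?_
    · exact Eventually.of_forall fun σ => (hi.edgeReal hk (Or.inl (hIm σ))).aestronglyMeasurable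
    · refine Eventually.of_forall fun σ => Eventually.of_forall fun s => ?_
      obtain ⟨b1, b2, b3, b4⟩ := norm_kern_imag_le (k₀ := k₀) (R := -(k₀ * Real.exp (-σ))) (s := s)
      rw [MMKdV.edgeReal, hWi]
      refine (norm_sub_le _ _).trans ?_
      rw [norm_mul, norm_mul, norm_real, norm_real, add_mul]
      refine add_le_add ?_ ?_ <;> rw [Real.norm_eq_abs] <;>
        refine mul_le_mul_of_nonneg_left ((norm_add_le _ _).trans ?_) (abs_nonneg _) <;> linarith
    · refine Eventually.of_forall fun s => ?_
      exact (((tendsto_kern_zero hk _).add (tendsto_kern_zero hk _)).const_mul _).sub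
        (((tendsto_kern_zero hk _).add (tendsto_kern_zero hk _)).const_mul _)
  · have hI := h.nice.intervalIntegrable_edgeC κ
    have b : ∀ g : ℝ → ℂ, IntervalIntegrable g volume 0 Real.pi → ∀ p : ℝ → ℂ, Continuous p →
        (∀ u, (p u).re = 0) →
        Tendsto (fun σ => I * ∫ u in (0 : ℝ)..Real.pi, g u * kern k₀ (W σ) (p u)) atTop
          (𝓝 (I * ∫ u in (0 : ℝ)..Real.pi, g u * kern k₀ 0 (p u))) := by
      intro g hg p hp hre
      refine Tendsto.const_mul I ?_
      refine intervalIntegral.tendsto_integral_filter_of_dominated_convergence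
        (fun u => ‖g u‖ * 2) ?_ ?_ (hg.norm.mul_const 2) ?_
      · filter_upwards [hsmall] with σ hσ
        have hc : Continuous fun u => kern k₀ (W σ) (p u) := continuous_kern_comp hp fun u e => by
          have := congrArg norm e
          rw [norm_k_exp hk, hre, Real.exp_zero, mul_one] at this
          linarith
        exact (intervalIntegrable_iff.1 (hg.mul_continuousOn hc.continuousOn)).aestronglyMeasurable
      · filter_upwards [hsmall] with σ hσ
        refine Eventually.of_forall fun u _ => ?_
        rw [norm_mul]
        exact mul_le_mul_of_nonneg_left (norm_kern_circ_le hk (hre u) hσ) (norm_nonneg _)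
      · exact Eventually.of_forall fun u _ => (tendsto_kern_zero hk _).const_mul _
    exact (b _ hI (fun u => u * I) (by fun_prop) (by simp)).neg.add
      (b _ (IntervalIntegrable.conj hI) (fun u => -(u * I)) (by fun_prop) (by simp))

end Contour

/-! ### Substitution from the half-strip back to the contour Σ -/

section Unfold

open Set Complex

variable {H ℓ : ℂ → ℂ} {k₀ : ℝ} {w κ : ℂ}

theorem hasDerivAt_mul_exp (c σ s : ℝ) :
    HasDerivAt (fun s => c * Real.exp (σ * s)) (c * (Real.exp (σ * s) * σ)) s := by
  have h1 : HasDerivAt (fun s : ℝ => σ * s) σ s := by simpa using (hasDerivAt_id s).const_mul σ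
  exact h1.exp.const_mul c

theorem injOn_mul_exp {c σ : ℝ} (hc : c ≠ 0) (hσ : σ ≠ 0) (S : Set ℝ) :
    InjOn (fun s : ℝ => c * Real.exp (σ * s)) S := fun _ _ _ _ e =>
  mul_left_cancel₀ hσ (Real.exp_injective (mul_left_cancel₀ hc e))

theorem mul_log_div {k₀ x : ℝ} (hk : 0 < k₀) (hx : 0 < x) : k₀ * Real.exp (Real.log (x / k₀)) = x := by
  rw [Real.exp_log (by positivity)]; field_simp

theorem image_exp_one (hk : 0 < k₀) : (fun s : ℝ => k₀ * Real.exp (1 * s)) '' Ioi 0 = Ioi k₀ := by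
  ext x
  simp only [mem_image, mem_Ioi, one_mul]
  constructor
  · rintro ⟨s, hs, rfl⟩
    have := Real.one_lt_exp_iff.2 hs
    nlinarith
  · intro hx
    exact ⟨Real.log (x / k₀), Real.log_pos ((one_lt_div hk).2 hx), mul_log_div hk (hk.trans hx)⟩

theorem image_exp_neg (hk : 0 < k₀) :
    (fun s : ℝ => k₀ * Real.exp (-1 * s)) '' Ioi 0 = Ioo 0 k₀ := by
  ext x
  simp only [mem_image, mem_Ioi, neg_one_mul, mem_Ioo]
  constructor
  · rintro ⟨s, hs, rfl⟩
    have := Real.exp_lt_one_iff.2 (neg_lt_zero.2 hs)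
    have := Real.exp_pos (-s)
    exact ⟨by positivity, by nlinarith⟩
  · intro hx
    refine ⟨-Real.log (x / k₀), neg_pos.2 (Real.log_neg (by have := hx.1; positivity) ((div_lt_one hk).2 hx.2)), ?_⟩
    rw [neg_neg, mul_log_div hk hx.1]

theorem image_neg_mul_exp (σ : ℝ) (S : Set ℝ) :
    (fun s : ℝ => -k₀ * Real.exp (σ * s)) '' S =
      -((fun s : ℝ => k₀ * Real.exp (σ * s)) '' S) := by
  rw [← image_neg_eq_neg, image_image]
  simp only [neg_mul]

theorem image_neg_exp_one (hk : 0 < k₀) :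
    (fun s : ℝ => -k₀ * Real.exp (1 * s)) '' Ioi 0 = Iio (-k₀) := by
  rw [image_neg_mul_exp, image_exp_one hk]; simp

theorem image_neg_exp_neg (hk : 0 < k₀) :
    (fun s : ℝ => -k₀ * Real.exp (-1 * s)) '' Ioi 0 = Ioo (-k₀) 0 := by
  rw [image_neg_mul_exp, image_exp_neg hk]; simp

/-- Exponential substitution on one of the four pieces of the real axis. -/
theorem exp_substitution {c σ : ℝ} (hc : c ≠ 0) (hσ : σ ≠ 0) {f : ℝ → ℂ} {g : ℝ → ℂ}
    (hfg : ∀ s : ℝ, 0 < s → |c * (Real.exp (σ * s) * σ)| • f (c * Real.exp (σ * s)) = g s) :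
    (IntegrableOn f ((fun s : ℝ => c * Real.exp (σ * s)) '' Ioi 0) ↔ IntegrableOn g (Ioi 0)) ∧
    ∫ x in (fun s : ℝ => c * Real.exp (σ * s)) '' Ioi 0, f x = ∫ s in Ioi (0 : ℝ), g s := by
  have hd : ∀ s ∈ Ioi (0 : ℝ), HasDerivWithinAt (fun s => c * Real.exp (σ * s))
      (c * (Real.exp (σ * s) * σ)) (Ioi 0) s := fun s _ => (hasDerivAt_mul_exp c σ s).hasDerivWithinAt
  constructor
  · rw [integrableOn_image_iff_integrableOn_abs_deriv_smul measurableSet_Ioi hd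
      (injOn_mul_exp hc hσ _)]
    exact integrableOn_congr_fun (fun s hs => hfg s hs) measurableSet_Ioi
  · rw [integral_image_eq_integral_abs_deriv_smul measurableSet_Ioi hd (injOn_mul_exp hc hσ _)]
    exact setIntegral_congr_fun measurableSet_Ioi fun s hs => hfg s hs

/-- The values of the logarithm of the jump on the pieces of the contour. -/
structure EdgeValues (k₀ : ℝ) (H : ℂ → ℂ) (κ : ℂ) (ℓ : ℂ → ℂ) : Prop where
  outer : ∀ s : ℝ, 0 < s → ℓ ((k₀ * Real.exp s : ℝ) : ℂ) = edgeR H s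
  outer' : ∀ s : ℝ, 0 < s → ℓ ((-(k₀ * Real.exp s) : ℝ) : ℂ) = edgeL H s
  inner : ∀ s : ℝ, 0 < s → ℓ ((k₀ * Real.exp (-s) : ℝ) : ℂ) = edgeL H s
  inner' : ∀ s : ℝ, 0 < s → ℓ ((-(k₀ * Real.exp (-s)) : ℝ) : ℂ) = edgeR H s
  upper : ∀ u ∈ Icc (0 : ℝ) Real.pi, ℓ (k₀ * exp (I * u)) = edgeC H κ u
  lower : ∀ u ∈ Ioc (0 : ℝ) Real.pi, ℓ (k₀ * exp (I * ((-u : ℝ) : ℂ))) = (starRingEnd ℂ) (edgeC H κ u)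

/-- The four pieces of the real axis are ±k₀e^{±s}, s > 0. The symmetry makes the edge values at
k₀e^s and -k₀e^{-s} agree, and likewise at -k₀e^s and k₀e^{-s}; the reversed orientation of the
middle segment matches the signs in `edgeReal`. -/
theorem EdgeValues.real_substitution (hv : EdgeValues k₀ H κ ℓ) (hi : EdgeIntegrable H) (hk : 0 < k₀)
    (hw : w.im ≠ 0 ∨ w = 0) :
    Integrable (fun x : ℝ => ℓ x / (x - w)) ∧
    (∫ x in Iio (-k₀), ℓ (x : ℂ) / (x - w)) + (∫ x in Ioi k₀, ℓ (x : ℂ) / (x - w)) -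
      (∫ x in (-k₀)..k₀, ℓ (x : ℂ) / (x - w)) = ∫ s in Ioi (0 : ℝ), edgeReal k₀ H w s := by
  have hk0 := hk.ne'
  set f : ℝ → ℂ := fun x => ℓ x / (x - w) with hf
  have A1 := exp_substitution (c := k₀) (σ := 1) (f := f)
    (g := fun s : ℝ => (edgeR H s : ℂ) * kern k₀ w s) hk0 one_ne_zero fun s hs => by
    simp only [hf, one_mul, mul_one]
    rw [abs_of_pos (by positivity), hv.outer s hs, kern_real, real_smul]; ring
  have A2 := exp_substitution (c := k₀) (σ := -1) (f := f)
    (g := fun s : ℝ => (edgeL H s : ℂ) * kern k₀ w (-s)) hk0 (by norm_num) fun s hs => by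
    simp only [hf, neg_one_mul, mul_neg, mul_one, abs_neg]
    rw [abs_of_pos (by positivity), hv.inner s hs, kern_neg_real, real_smul]; ring
  have A3 := exp_substitution (c := -k₀) (σ := 1) (f := f)
    (g := fun s : ℝ => -((edgeL H s : ℂ) * kern k₀ w (s + Real.pi * I))) (neg_ne_zero.2 hk0)
    one_ne_zero fun s hs => by
    simp only [hf, one_mul, mul_one, neg_mul, abs_neg]
    rw [abs_of_pos (by positivity), hv.outer' s hs, kern_real_add, real_smul, ofReal_neg,
      ← neg_add', div_neg]; ring
  have A4 := exp_substitution (c := -k₀) (σ := -1) (f := f)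
    (g := fun s : ℝ => -((edgeR H s : ℂ) * kern k₀ w (-(s + Real.pi * I)))) (neg_ne_zero.2 hk0)
    (by norm_num) fun s hs => by
    simp only [hf, mul_neg, mul_one, neg_mul, neg_neg, one_mul]
    rw [abs_of_pos (by positivity), hv.inner' s hs, kern_neg_real_add, real_smul, ofReal_neg,
      ← neg_add', div_neg]; ring
  rw [image_exp_one hk] at A1
  rw [image_exp_neg hk] at A2
  rw [image_neg_exp_one hk] at A3
  rw [image_neg_exp_neg hk] at A4
  obtain ⟨i1, i2, i3, i4⟩ := hi.mul_kerns hk hw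
  have j1 := A1.1.2 i1
  have j2 := A2.1.2 i4
  have j3 := A3.1.2 i3.neg
  have j4 := A4.1.2 i2.neg
  have k2 : IntegrableOn f (Ioc 0 k₀) := by rwa [integrableOn_Ioc_iff_integrableOn_Ioo]
  have k4 : IntegrableOn f (Ioc (-k₀) 0) := by rwa [integrableOn_Ioc_iff_integrableOn_Ioo]
  have k3 : IntegrableOn f (Iic (-k₀)) := by rwa [integrableOn_Iic_iff_integrableOn_Iio]
  refine ⟨?_, ?_⟩
  · have : (univ : Set ℝ) = Iic (-k₀) ∪ Ioc (-k₀) 0 ∪ Ioc 0 k₀ ∪ Ioi k₀ := by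
      rw [Iic_union_Ioc_eq_Iic (by linarith), Iic_union_Ioc_eq_Iic hk.le, Iic_union_Ioi]
    rw [← integrableOn_univ, this]
    exact ((k3.union k4).union k2).union j1
  · have m1 : (∫ x in (-k₀)..k₀, f x) = (∫ x in Ioo (-k₀) 0, f x) + ∫ x in Ioo 0 k₀, f x := by
      rw [← intervalIntegral.integral_add_adjacent_intervals (b := 0),
        intervalIntegral.integral_of_le (by linarith), intervalIntegral.integral_of_le hk.le,
        integral_Ioc_eq_integral_Ioo, integral_Ioc_eq_integral_Ioo]
      · exact (intervalIntegrable_iff_integrableOn_Ioc_of_le (by linarith)).2 k4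
      · exact (intervalIntegrable_iff_integrableOn_Ioc_of_le hk.le).2 k2
    have m2 : (∫ s in Ioi (0 : ℝ), edgeReal k₀ H w s) =
        (∫ s in Ioi (0 : ℝ), (edgeR H s : ℂ) * kern k₀ w s) +
        (∫ s in Ioi (0 : ℝ), (edgeR H s : ℂ) * kern k₀ w (-(s + Real.pi * I))) -
        ((∫ s in Ioi (0 : ℝ), (edgeL H s : ℂ) * kern k₀ w (s + Real.pi * I)) +
        ∫ s in Ioi (0 : ℝ), (edgeL H s : ℂ) * kern k₀ w (-s)) := by
      rw [← integral_add i1 i2, ← integral_add i3 i4]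
      refine Eq.trans ?_ (integral_sub (i1.add i2) (i3.add i4))
      refine integral_congr_ae (Eventually.of_forall fun s => ?_)
      simp only [edgeReal]; ring
    have n1 := A1.2; have n2 := A2.2; have n3 := A3.2; have n4 := A4.2
    rw [integral_neg] at n3 n4
    rw [m1, m2, n1, n2, n3, n4]
    ring

theorem EdgeValues.circle_substitution (hv : EdgeValues k₀ H κ ℓ) (hn : NiceStrip H) (hk : 0 < k₀)
    (hw : ‖w‖ ≠ k₀) :
    IntervalIntegrable (fun u : ℝ => ℓ (k₀ * exp (I * u)) / (k₀ * exp (I * u) - w)) volume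
      (-Real.pi) Real.pi ∧
    -(∫ u in (0 : ℝ)..Real.pi,
        ℓ (k₀ * exp (I * u)) / (k₀ * exp (I * u) - w) * (I * (k₀ * exp (I * u)))) +
      (∫ u in (-Real.pi)..(0 : ℝ),
        ℓ (k₀ * exp (I * u)) / (k₀ * exp (I * u) - w) * (I * (k₀ * exp (I * u)))) =
      edgeCirc k₀ H κ w := by
  have hI := hn.intervalIntegrable_edgeC κ
  have hJ := IntervalIntegrable.conj hI
  have hc : Continuous fun u : ℝ => (k₀ * exp (I * u) - w)⁻¹ := by
    refine Continuous.inv₀ (by fun_prop) fun u => sub_ne_zero.2 ?_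
    rw [mul_comm I]
    exact k_exp_mul_I_ne hk hw u
  refine ⟨?_, ?_⟩
  · have a1 : IntervalIntegrable (fun u : ℝ => ℓ (k₀ * exp (I * u))) volume 0 Real.pi :=
      hI.congr fun u hu => by
        rw [uIoc_of_le Real.pi_pos.le] at hu
        exact (hv.upper u ⟨hu.1.le, hu.2⟩).symm
    have a2 : IntervalIntegrable (fun u : ℝ => ℓ (k₀ * exp (I * u))) volume (-Real.pi) 0 := by
      have b1 : IntervalIntegrable (fun u : ℝ => ℓ (k₀ * exp (I * ((-u : ℝ) : ℂ)))) volume 0 Real.pi :=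
        hJ.congr fun u hu => by
          rw [uIoc_of_le Real.pi_pos.le] at hu
          exact (hv.lower u ⟨hu.1, hu.2⟩).symm
      have := ((IntervalIntegrable.iff_comp_neg enorm_ne_top).1 b1).symm
      rw [neg_zero] at this
      refine this.congr fun u _ => ?_
      simp only [neg_neg]
    simp only [div_eq_mul_inv]
    exact (a2.trans a1).mul_continuousOn hc.continuousOn
  · rw [edgeCirc, ← neg_zero, ← intervalIntegral.integral_comp_neg, neg_zero,
      ← intervalIntegral.integral_const_mul, ← intervalIntegral.integral_const_mul]
    congr 1
    · congr 1
      refine intervalIntegral.integral_congr fun u hu => ?_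
      rw [uIcc_of_le Real.pi_pos.le] at hu
      simp only [hv.upper u hu, kern]
      rw [mul_comm (u : ℂ) I]; ring
    · refine intervalIntegral.integral_congr_ae (Eventually.of_forall fun u hu => ?_)
      rw [uIoc_of_le Real.pi_pos.le] at hu
      simp only [hv.lower u hu, kern]
      rw [mul_comm (u : ℂ) I, ofReal_neg, mul_neg]; ring

theorem EdgeValues.sigIntegrable (hv : EdgeValues k₀ H κ ℓ) (hn : NiceStrip H) (hi : EdgeIntegrable H)
    (hk : 0 < k₀) (hw : w.im ≠ 0 ∨ w = 0) (hw' : ‖w‖ ≠ k₀) :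
    SigIntegrable k₀ (fun ζ => ℓ ζ / (ζ - w)) ∧
    sigInt k₀ (fun ζ => ℓ ζ / (ζ - w)) = fullInt k₀ H κ w := by
  obtain ⟨h1, h2⟩ := hv.real_substitution hi hk hw
  obtain ⟨h3, h4⟩ := hv.circle_substitution hn hk hw'
  refine ⟨⟨h1, h3⟩, ?_⟩
  rw [fullInt, ← h2, ← h4, sigInt]
  ring

end Unfold

/-! ### Removing the zeros of `det a` in the outer component -/

section Zeros

open Set Complex

variable {f : ℂ → ℂ} {k₀ : ℝ} {w z c : ℂ} {N : ℕ} {zs : Fin N → ℂ} {ν : Fin N → ℕ}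

/-- The quotient by ∏(z - z_n)^{ν_n} is a formal 0/0 at a zero, so there it is replaced by the local
factor from the order of vanishing. Both prescriptions agree nearby, which makes the quotient
holomorphic and nonzero at the zeros. -/
theorem exists_remove_zeros {U : Set ℂ} (hU : IsOpen U) (hf : DifferentiableOn ℂ f U)
    (hinj : Function.Injective zs) (hzs : ∀ n, zs n ∈ U)
    (hν : ∀ n, analyticOrderAt f (zs n) = ν n) :
    ∃ G : ℂ → ℂ, (∀ n, DifferentiableAt ℂ G (zs n)) ∧ (∀ n, G (zs n) ≠ 0) ∧
      (∀ z, (∀ n, z ≠ zs n) → G z = f z / ∏ n, (z - zs n) ^ ν n) ∧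
      ∀ n, f (zs n) = G (zs n) * ∏ j, (zs n - zs j) ^ ν j := by
  classical
  have han : ∀ n, AnalyticAt ℂ f (zs n) := fun n => hf.analyticAt (hU.mem_nhds (hzs n))
  choose g hga hg0 hge using fun n => ((han n).analyticOrderAt_eq_natCast).1 (hν n)
  set G : ℂ → ℂ := fun z => if h : ∃ n, z = zs n then
    g h.choose z / ∏ j ∈ Finset.univ.erase h.choose, (z - zs j) ^ ν j
    else f z / ∏ n, (z - zs n) ^ ν n with hG
  have hGz : ∀ n, G (zs n) = g n (zs n) / ∏ j ∈ Finset.univ.erase n, (zs n - zs j) ^ ν j := fun n => by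
    have h : ∃ k, zs n = zs k := ⟨n, rfl⟩
    have hc : h.choose = n := (hinj h.choose_spec).symm
    simp only [hG, dif_pos h, hc]
  have hPne : ∀ n, ∏ j ∈ Finset.univ.erase n, (zs n - zs j) ^ ν j ≠ 0 := fun n =>
    Finset.prod_ne_zero_iff.2 fun j hj =>
      pow_ne_zero _ (sub_ne_zero.2 fun e => (Finset.ne_of_mem_erase hj) (hinj e).symm)
  have hloc : ∀ n, G =ᶠ[𝓝 (zs n)] fun z => g n z / ∏ j ∈ Finset.univ.erase n, (z - zs j) ^ ν j := by
    intro n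
    have h1 : ∀ᶠ z in 𝓝 (zs n), ∀ j ∈ Finset.univ.erase n, z ≠ zs j :=
      (Finset.eventually_all _).2 fun j hj =>
        isOpen_ne.mem_nhds fun e => (Finset.ne_of_mem_erase hj) (hinj e).symm
    filter_upwards [h1, hge n] with z hz hz'
    by_cases e : z = zs n
    · rw [e, hGz]
    · have hne : ¬∃ k, z = zs k := fun ⟨k, hk⟩ => by
        by_cases hkn : k = n
        · exact e (hkn ▸ hk)
        · exact hz k (Finset.mem_erase.2 ⟨hkn, Finset.mem_univ _⟩) hk
      simp only [hG, dif_neg hne]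
      rw [hz', ← Finset.mul_prod_erase _ _ (Finset.mem_univ n), smul_eq_mul,
        mul_div_mul_left _ _ (pow_ne_zero _ (sub_ne_zero.2 e))]
  refine ⟨G, fun n => ?_, fun n => ?_, fun z hz => ?_, fun n => ?_⟩
  · refine DifferentiableAt.congr_of_eventuallyEq ?_ (hloc n)
    exact (hga n).differentiableAt.div (by fun_prop) (hPne n)
  · rw [hGz]; exact div_ne_zero (hg0 n) (hPne n)
  · simp only [hG]; rw [dif_neg fun ⟨n, hn⟩ => hz n hn]
  · rw [(hge n).self_of_nhds, hGz, ← Finset.mul_prod_erase _ _ (Finset.mem_univ n), smul_eq_mul]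
    field_simp [hPne n]

/-- The part of `D⁺` in the upper half plane. -/
def outerD (k₀ : ℝ) : Set ℂ := {z | k₀ < ‖z‖ ∧ 0 < z.im}

/-- The closure of `outerD`. -/
def outerK (k₀ : ℝ) : Set ℂ := {z | k₀ ≤ ‖z‖ ∧ 0 ≤ z.im}

theorem isOpen_outerD : IsOpen (outerD k₀) :=
  (isOpen_lt continuous_const continuous_norm).inter (isOpen_lt continuous_const continuous_im)

theorem isClosed_outerK : IsClosed (outerK k₀) :=
  (isClosed_le continuous_const continuous_norm).inter (isClosed_le continuous_const continuous_im)

theorem outerD_subset : outerD k₀ ⊆ outerK k₀ \ {I * k₀} := fun z hz => ⟨⟨hz.1.le, hz.2.le⟩, fun e => by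
  have e : z = I * k₀ := e
  have h1 := hz.1
  have h2 := hz.2
  rw [e] at h1 h2
  simp at h1 h2
  rw [abs_of_pos h2] at h1
  exact lt_irrefl _ h1⟩

theorem outerD_iff (hk : 0 < k₀) : z ∈ outerD k₀ ↔ z ∈ Dplus k₀ ∧ 0 < z.im := by
  refine ⟨fun h => ⟨?_, h.2⟩, fun h => ⟨?_, h.2⟩⟩
  · have h1 := h.1
    exact mul_pos (by nlinarith [norm_nonneg z]) h.2
  · have h1 : 0 < (‖z‖ ^ 2 - k₀ ^ 2) * z.im := h.1
    have h2 := pos_of_mul_pos_left h1 h.2.le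
    exact lt_of_pow_lt_pow_left₀ 2 (norm_nonneg _) (by linarith)

theorem outerK_subset_good (hk : 0 < k₀) : outerK k₀ \ {I * k₀} ⊆ Good k₀ := fun z hz => by
  obtain ⟨⟨h1, h2⟩, h3⟩ := hz
  refine good_of_mem hk ?_
  rcases h2.lt_or_eq with h2 | h2
  · rcases h1.lt_or_eq with h1 | h1
    · exact Or.inl ((outerD_iff hk).1 ⟨h1, h2⟩).1
    · refine Or.inr ⟨Or.inr h1.symm, ?_⟩
      rintro (e | e | e)
      · rw [e] at h2; simp at h2
      · exact h3 e
      · have e : z = -(I * k₀) := e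
        rw [e] at h2; simp at h2; linarith
  · refine Or.inr ⟨Or.inl h2.symm, ?_⟩
    rintro (e | e | e)
    · rw [e, norm_zero] at h1; linarith
    · exact h3 e
    · have e : z = -(I * k₀) := e
      rw [e] at h2; simp at h2; linarith

theorem sq_div_eq (hw : w ≠ 0) : (k₀ : ℂ) ^ 2 / w = ((k₀ ^ 2 / ‖w‖ ^ 2 : ℝ) : ℂ) * (starRingEnd ℂ) w := by
  have h : (starRingEnd ℂ) w ≠ 0 := by simpa using hw
  push_cast
  rw [← mul_conj']
  field_simp

/-- The factors of the quartet do not vanish on the closure of the outer region. -/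
theorem quartet_factors (hk : 0 < k₀) (hw : w ∈ outerD k₀) (hz : z ∈ outerK k₀) :
    z - (starRingEnd ℂ) w ≠ 0 ∧ z + (k₀ : ℂ) ^ 2 / w ≠ 0 ∧
      z + (k₀ : ℂ) ^ 2 / (starRingEnd ℂ) w ≠ 0 := by
  have hw0 : 0 < ‖w‖ := hk.trans hw.1
  have hwn : w ≠ 0 := norm_pos_iff.1 hw0
  have hr : 0 < k₀ ^ 2 / ‖w‖ ^ 2 := by positivity
  have hn : ‖(k₀ : ℂ) ^ 2 / w‖ < k₀ := by
    rw [norm_div, norm_pow, norm_real, Real.norm_of_nonneg hk.le, div_lt_iff₀ hw0]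
    nlinarith [hw.1]
  refine ⟨fun e => ?_, fun e => ?_, fun e => ?_⟩
  · have := congrArg im e
    simp at this
    linarith [hw.2, hz.2]
  · have : z = -((k₀ : ℂ) ^ 2 / w) := eq_neg_of_add_eq_zero_left e
    have h1 := hz.1
    rw [this, norm_neg] at h1
    linarith
  · have : z = -((k₀ : ℂ) ^ 2 / (starRingEnd ℂ) w) := eq_neg_of_add_eq_zero_left e
    have h2 : ‖(k₀ : ℂ) ^ 2 / (starRingEnd ℂ) w‖ < k₀ := by
      rwa [norm_div, RCLike.norm_conj, ← norm_div]
    have h1 := hz.1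
    rw [this, norm_neg] at h1
    linarith

/-- The quotient of `z - w` and the quartet of `w`. -/
def qfac (k₀ : ℝ) (w z : ℂ) : ℂ :=
  (z - (starRingEnd ℂ) w) * (z + (k₀ : ℂ) ^ 2 / w) / (z + (k₀ : ℂ) ^ 2 / (starRingEnd ℂ) w)

theorem qfac_mul_quartet (hk : 0 < k₀) (hw : w ∈ outerD k₀) (hz : z ∈ outerK k₀) :
    qfac k₀ w z * quartet k₀ w z = z - w := by
  obtain ⟨h1, h2, h3⟩ := quartet_factors hk hw hz
  rw [qfac, quartet]
  field_simp

theorem qfac_ne_zero (hk : 0 < k₀) (hw : w ∈ outerD k₀) (hz : z ∈ outerK k₀) : qfac k₀ w z ≠ 0 := by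
  obtain ⟨h1, h2, h3⟩ := quartet_factors hk hw hz
  exact div_ne_zero (mul_ne_zero h1 h2) h3

theorem differentiableAt_qfac (hk : 0 < k₀) (hw : w ∈ outerD k₀) (hz : z ∈ outerK k₀) :
    DifferentiableAt ℂ (qfac k₀ w) z := by
  obtain ⟨h1, h2, h3⟩ := quartet_factors hk hw hz
  exact DifferentiableAt.div (by fun_prop) (by fun_prop) h3

/-- What the trace formula uses about `f = det a`. -/
structure DetData (k₀ : ℝ) (f : ℂ → ℂ) (c : ℂ) : Prop where
  pos : 0 < k₀
  diff : DifferentiableOn ℂ f (Dplus k₀)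
  cont : ContinuousOn f (Good k₀)
  inf : Tendsto f (infGood k₀) (𝓝 1)
  imag : (fun y : ℝ => f (y * I) - 1) =O[atTop] fun y : ℝ => y⁻¹
  norm_c : ‖c‖ = 1
  symm : ∀ z ∈ Good k₀, f z = c * (starRingEnd ℂ) (f (hat k₀ ((starRingEnd ℂ) z)))
  le : ∀ x : ℝ, x ≠ 0 → ‖f x‖ ≤ 1
  ne : ∀ z ∈ Sig₀ k₀, f z ≠ 0
  branch : ∃ (p : ℕ) (c' : ℂ), c' ≠ 0 ∧
    Tendsto (fun z => (z - I * k₀) ^ p * f z) (𝓝[Dplus k₀] (I * k₀)) (𝓝 c')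

/-- The product over the zeros. -/
def blaschke (k₀ : ℝ) (zs : Fin N → ℂ) (ν : Fin N → ℕ) (z : ℂ) : ℂ := ∏ n, quartet k₀ (zs n) z ^ ν n

/-- The zeros in the outer region and their orders. -/
structure ZeroData (k₀ : ℝ) (f : ℂ → ℂ) (zs : Fin N → ℂ) (ν : Fin N → ℕ) : Prop where
  inj : Function.Injective zs
  mem : ∀ n, zs n ∈ outerD k₀
  zero_iff : ∀ z ∈ outerD k₀, f z = 0 ↔ ∃ n, z = zs n
  order : ∀ n, analyticOrderAt f (zs n) = ν n

/-- The reduced function is f/∏(z - z_n)^{ν_n} times ∏ `qfac`^{ν_n}. The factors `qfac` are regular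
and nonzero on all of `outerK k₀`, so no second division at the zeros occurs, and they also do not
affect the pole order at the branch point. The factor 1/I matches `brf`. -/
theorem DetData.exists_reduced (h : DetData k₀ f c) (hz : ZeroData k₀ f zs ν) :
    ∃ g : ℂ → ℂ, DifferentiableOn ℂ g (outerD k₀) ∧ ContinuousOn g (outerK k₀ \ {I * k₀}) ∧
      (∀ z ∈ outerK k₀ \ {I * k₀}, g z ≠ 0 ∧ f z = g z * blaschke k₀ zs ν z) ∧
      ∃ (p : ℕ) (c' : ℂ), c' ≠ 0 ∧
        Tendsto (fun z => ((z - I * k₀) / I) ^ p * g z) (𝓝[outerD k₀] (I * k₀)) (𝓝 c') := by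
  have hk := h.pos
  have hsub : outerD k₀ ⊆ Dplus k₀ := fun z hz => ((outerD_iff hk).1 hz).1
  obtain ⟨G, hGd, hG0, hGe, hGz⟩ := exists_remove_zeros isOpen_outerD (h.diff.mono hsub) hz.inj hz.mem
    hz.order
  set P : ℂ → ℂ := fun z => ∏ n, (z - zs n) ^ ν n with hP
  have hPd : Differentiable ℂ P := by fun_prop
  have hP0 : ∀ z, (∀ n, z ≠ zs n) → P z ≠ 0 := fun z hz =>
    Finset.prod_ne_zero_iff.2 fun n _ => pow_ne_zero _ (sub_ne_zero.2 (hz n))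
  have hev : ∀ z, (∀ n, z ≠ zs n) → ∀ᶠ y in 𝓝 z, G y = f y / P y := fun z hz => by
    have : ∀ᶠ y in 𝓝 z, ∀ n, y ≠ zs n := eventually_all.2 fun n => isOpen_ne.mem_nhds (hz n)
    exact this.mono fun y hy => hGe y hy
  set q : ℂ → ℂ := fun z => ∏ n, qfac k₀ (zs n) z ^ ν n with hq
  have hqd : ∀ z ∈ outerK k₀, DifferentiableAt ℂ q z := fun z hzK =>
    DifferentiableAt.fun_finsetProd fun n _ => (differentiableAt_qfac hk (hz.mem n) hzK).pow _
  have hq0 : ∀ z ∈ outerK k₀, q z ≠ 0 := fun z hzK =>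
    Finset.prod_ne_zero_iff.2 fun n _ => pow_ne_zero _ (qfac_ne_zero hk (hz.mem n) hzK)
  have hqB : ∀ z ∈ outerK k₀, q z * blaschke k₀ zs ν z = P z := fun z hzK => by
    rw [hq, blaschke, ← Finset.prod_mul_distrib]
    exact Finset.prod_congr rfl fun n _ => by
      rw [← mul_pow, qfac_mul_quartet hk (hz.mem n) hzK]
  have hbK : I * k₀ ∈ outerK k₀ := by simp [outerK, abs_of_pos hk, hk.le]
  have hbz : ∀ n, I * (k₀ : ℂ) ≠ zs n := fun n e => (outerD_subset (hz.mem n)).2 e.symm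
  refine ⟨fun z => G z * q z, ?_, ?_, ?_, ?_⟩
  · intro z hzU
    refine DifferentiableAt.differentiableWithinAt (DifferentiableAt.mul ?_
      (hqd z (outerD_subset hzU).1))
    by_cases e : ∃ n, z = zs n
    · obtain ⟨n, rfl⟩ := e; exact hGd n
    · push Not at e
      refine DifferentiableAt.congr_of_eventuallyEq ?_ (hev z e)
      exact ((h.diff.mono hsub).differentiableAt (isOpen_outerD.mem_nhds hzU)).div (hPd z) (hP0 z e)
  · intro z hzK
    refine ContinuousWithinAt.mul ?_ (hqd z hzK.1).continuousAt.continuousWithinAt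
    by_cases e : ∃ n, z = zs n
    · obtain ⟨n, rfl⟩ := e; exact (hGd n).continuousAt.continuousWithinAt
    · push Not at e
      refine ContinuousWithinAt.congr_of_eventuallyEq ?_ ((hev z e).filter_mono nhdsWithin_le_nhds)
        (hGe z e)
      exact ((h.cont.mono (outerK_subset_good hk)) z hzK).div (hPd z).continuousAt.continuousWithinAt
        (hP0 z e)
  · intro z hzK
    have hfe : f z = G z * P z := by
      by_cases e : ∃ n, z = zs n
      · obtain ⟨n, rfl⟩ := e; exact hGz n
      · push Not at e
        rw [hGe z e]; exact (div_mul_cancel₀ _ (hP0 z e)).symm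
    refine ⟨mul_ne_zero ?_ (hq0 z hzK.1), by rw [mul_assoc, hqB z hzK.1, hfe]⟩
    by_cases e : ∃ n, z = zs n
    · obtain ⟨n, rfl⟩ := e; exact hG0 n
    · intro h0
      have hf0 : f z = 0 := by rw [hfe, h0, zero_mul]
      rcases mem_of_good hk (outerK_subset_good hk hzK) with hD | hS
      · have him : 0 < z.im := by
          refine lt_of_le_of_ne hzK.1.2 fun e0 => ?_
          have : 0 < (‖z‖ ^ 2 - k₀ ^ 2) * z.im := hD
          rw [← e0, mul_zero] at this
          exact lt_irrefl _ this
        exact e ((hz.zero_iff z ((outerD_iff hk).2 ⟨hD, him⟩)).1 hf0)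
      · exact h.ne z hS hf0
  · obtain ⟨p, c', hc', ht⟩ := h.branch
    refine ⟨p, c' / P (I * k₀) * q (I * k₀) / I ^ p, ?_, ?_⟩
    · exact div_ne_zero (mul_ne_zero (div_ne_zero hc' (hP0 _ hbz)) (hq0 _ hbK)) (pow_ne_zero _ I_ne_zero)
    · have t1 := (ht.mono_left (nhdsWithin_mono _ hsub)).div
        ((hPd (I * k₀)).continuousAt.tendsto.mono_left (nhdsWithin_le_nhds (s := outerD k₀))) (hP0 _ hbz)
      have t2 := (t1.mul ((hqd _ hbK).continuousAt.tendsto.mono_left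
        (nhdsWithin_le_nhds (s := outerD k₀)))).div_const (I ^ p)
      refine t2.congr' ?_
      filter_upwards [(hev _ hbz).filter_mono (nhdsWithin_le_nhds (s := outerD k₀))] with z hz
      simp only [Pi.div_apply]
      rw [hz, div_pow]; ring

end Zeros

/-! ### A logarithm on the half-strip, singular at most at the branch point -/

section Logarithm

open Set Complex

variable {g H : ℂ → ℂ} {k₀ : ℝ} {ω : ℂ}

theorem k_exp_mem_outerK (hk : 0 < k₀) (h : ω ∈ cstrip) : (k₀ : ℂ) * exp ω ∈ outerK k₀ :=
  ⟨norm_k_exp_ge hk h.1, im_k_exp_nonneg hk h⟩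

theorem k_exp_mem_outerD (hk : 0 < k₀) (h : ω ∈ strip) : (k₀ : ℂ) * exp ω ∈ outerD k₀ :=
  ⟨norm_k_exp_gt hk h.1, im_k_exp_pos hk h⟩

theorem k_exp_mid : (k₀ : ℂ) * exp mid = I * k₀ := by
  rw [mid, ofReal_div, ofReal_ofNat, exp_pi_div_two_mul_I, mul_comm]

theorem k_exp_mem_diff (hk : 0 < k₀) (h : ω ∈ cstrip \ {mid}) :
    (k₀ : ℂ) * exp ω ∈ outerK k₀ \ {I * k₀} := by
  refine ⟨k_exp_mem_outerK hk h.1, fun e => h.2 ?_⟩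
  have e : (k₀ : ℂ) * exp ω = I * k₀ := e
  rw [← k_exp_mid] at e
  have e' := mul_left_cancel₀ (by exact_mod_cast hk.ne') e
  refine exp_inj_of_neg_pi_lt_of_le_pi ?_ h.1.2.2 ?_ ?_ e'
  · linarith [h.1.2.1, Real.pi_pos]
  · simp [mid]; linarith [Real.pi_pos]
  · simp [mid]; linarith [Real.pi_pos]

/-- The function with a simple zero at the branch point that is used to remove the pole. -/
def brf (k₀ : ℝ) (ω : ℂ) : ℂ := (k₀ * exp ω - I * k₀) / I

theorem brf_eq (ω : ℂ) : brf k₀ ω =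
    (k₀ * (Real.exp ω.re * Real.sin ω.im - 1) : ℝ) + (-(k₀ * (Real.exp ω.re * Real.cos ω.im)) : ℝ) * I := by
  rw [brf, div_I]
  apply Complex.ext
  · rw [add_re, ofReal_re, re_ofReal_mul, I_re, mul_zero, add_zero]
    simp [exp_re, exp_im]; ring
  · rw [add_im, ofReal_im, im_ofReal_mul, I_im, mul_one, zero_add]
    simp [exp_re, exp_im]

/-- Keeping only the imaginary part gives a lower bound that does not depend on the distance to the
left edge; its logarithm is the integrable majorant. -/
theorem abs_cos_le_norm_brf (hk : 0 < k₀) (h : 0 ≤ ω.re) : k₀ * |Real.cos ω.im| ≤ ‖brf k₀ ω‖ := by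
  have h1 := abs_im_le_norm (brf k₀ ω)
  refine le_trans ?_ h1
  rw [brf_eq]
  simp only [add_im, ofReal_im, mul_im, ofReal_re, I_re, I_im, mul_zero, mul_one, zero_add, add_zero]
  rw [abs_neg, abs_mul, abs_mul, abs_of_pos hk, abs_of_pos (Real.exp_pos _)]
  have := Real.one_le_exp h
  have h2 := abs_nonneg (Real.cos ω.im)
  have h3 : |Real.cos ω.im| ≤ Real.exp ω.re * |Real.cos ω.im| := by nlinarith
  exact mul_le_mul_of_nonneg_left h3 hk.le

/-- The division by I in `brf` is made for this: on the middle line the value is a positive real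
number, and off it the imaginary part does not vanish. So the principal logarithm is available. -/
theorem brf_mem_slitPlane (hk : 0 < k₀) (h : ω ∈ cstrip \ {mid}) : brf k₀ ω ∈ slitPlane := by
  by_cases hu : ω.im = Real.pi / 2
  · left
    have hr : 0 < ω.re := by
      refine lt_of_le_of_ne h.1.1 fun e => h.2 ?_
      exact Complex.ext (by simp [mid, ← e]) (by simp [mid, hu])
    rw [brf_eq]
    simp only [add_re, ofReal_re, mul_re, ofReal_im, I_re, I_im, mul_zero, sub_zero,
      add_zero, hu, Real.sin_pi_div_two, mul_one]
    have := Real.one_lt_exp_iff.2 hr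
    exact mul_pos hk (by linarith)
  · right
    have h1 := abs_cos_le_norm_brf hk h.1.1
    rw [brf_eq]
    simp only [add_im, ofReal_im, mul_im, ofReal_re, I_re, I_im, mul_zero, mul_one, zero_add, add_zero]
    have hc : Real.cos ω.im ≠ 0 := fun hc => hu (by
      refine Real.injOn_cos ⟨h.1.2.1, h.1.2.2⟩ pi_half_mem ?_
      rw [hc, Real.cos_pi_div_two])
    have := Real.exp_pos ω.re
    exact neg_ne_zero.2 (mul_ne_zero hk.ne' (mul_ne_zero this.ne' hc))

theorem cstrip_subset_closure : cstrip ⊆ closure strip := by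
  have h1 : strip = Ioi 0 ×ℂ Ioo 0 Real.pi := by
    ext ω; simp [strip, mem_reProdIm]
  rw [h1, closure_reProdIm, closure_Ioi, closure_Ioo Real.pi_pos.ne]
  intro ω h
  rw [mem_reProdIm]
  exact ⟨h.1, h.2⟩

/-- A retraction of the plane onto the half-strip. -/
def retract (ω : ℂ) : ℂ := (max ω.re 0 : ℝ) + (max 0 (min ω.im Real.pi) : ℝ) * I

theorem continuous_retract : Continuous retract := by
  unfold retract; fun_prop

theorem retract_mem (ω : ℂ) : retract ω ∈ cstrip :=
  mem_cstrip (le_max_right _ _) ⟨le_max_left _ _, max_le Real.pi_pos.le (min_le_right _ _)⟩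

theorem retract_eq (h : ω ∈ cstrip) : retract ω = ω := by
  rw [retract, max_eq_left h.1, min_eq_left h.2.2, max_eq_right h.2.1, re_add_im]

theorem isSimplyConnected_univ_complex : IsSimplyConnected (univ : Set ℂ) := by
  have : ContractibleSpace (univ : Set ℂ) := convex_univ.contractibleSpace univ_nonempty
  exact SimplyConnectedSpace.ofContractible _

/-- A nonvanishing continuous function on the closed half-strip has a continuous logarithm. -/
theorem exists_log_cstrip {Φ : ℂ → ℂ} (hc : ContinuousOn Φ cstrip) (h0 : ∀ ω ∈ cstrip, Φ ω ≠ 0) :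
    ∃ L : ℂ → ℂ, Continuous L ∧ ∀ ω ∈ cstrip, exp (L ω) = Φ ω := by
  -- Composition with the retraction gives a function on the whole plane, which is open and simply
  -- connected, so the lift through exp exists.
  obtain ⟨L, hL, hE⟩ := exists_continuousOn_eqOn_exp_comp isSimplyConnected_univ_complex isOpen_univ
    (g := fun ω => Φ (retract ω))
    (hc.comp continuous_retract.continuousOn fun ω _ => retract_mem ω) (by
      rintro ⟨ω, -, h⟩; exact h0 _ (retract_mem ω) h)
  refine ⟨L, continuousOn_univ.1 hL, fun ω hω => ?_⟩
  have := hE (mem_univ ω)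
  simp only [Function.comp, retract_eq hω] at this
  exact this

theorem exp_lift_eqOn {S : Set ℂ} (hS : IsPreconnected S) {L₁ L₂ : ℂ → ℂ} (h₁ : ContinuousOn L₁ S)
    (h₂ : ContinuousOn L₂ S) (he : ∀ ω ∈ S, exp (L₁ ω) = exp (L₂ ω)) {a : ℂ} (ha : a ∈ S)
    (hae : L₁ a = L₂ a) : EqOn L₁ L₂ S :=
  isCoveringMap_exp.eqOn_of_comp_eqOn hS h₁ h₂ (fun ω hω => Subtype.ext (he ω hω)) ha hae

/-- By continuity H stays within π of H(ω) nearby, so it is H(ω) plus the principal logarithm of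
exp(H(y) - H(ω)), which is differentiable. -/
theorem differentiableAt_of_exp (hH : ContinuousAt H ω) (h : DifferentiableAt ℂ (fun ω => exp (H ω)) ω) :
    DifferentiableAt ℂ H ω := by
  have h1 : DifferentiableAt ℂ (fun y => H ω + log (exp (H y) * exp (-(H ω)))) ω := by
    refine (DifferentiableAt.clog (h.mul_const _) ?_).const_add _
    rw [← exp_add, add_neg_cancel, exp_zero]
    exact one_mem_slitPlane
  refine h1.congr_of_eventuallyEq ?_
  have h2 : ∀ᶠ y in 𝓝 ω, ‖H y - H ω‖ < Real.pi := by
    have := (hH.sub_const (H ω)).norm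
    simp only [sub_self, norm_zero] at this
    exact this.eventually_lt_const Real.pi_pos
  filter_upwards [h2] with y hy
  have h3 := (abs_le.1 ((abs_im_le_norm (H y - H ω)).trans hy.le))
  have h4 := (abs_lt.1 ((abs_im_le_norm (H y - H ω)).trans_lt hy))
  rw [← exp_add, ← sub_eq_add_neg, log_exp h4.1 h3.2]
  ring

theorem norm_log_le {z : ℂ} {a b : ℝ} (ha : 0 < a) (h1 : a ≤ ‖z‖) (h2 : ‖z‖ ≤ b) :
    ‖log z‖ ≤ |Real.log a| + |Real.log b| + Real.pi := by
  have h3 : ‖log z‖ ≤ |(log z).re| + |(log z).im| := norm_le_abs_re_add_abs_im _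
  rw [log_re] at h3
  have h4 : |(log z).im| ≤ Real.pi := by rw [log_im]; exact abs_arg_le_pi z
  have l1 := Real.log_le_log ha h1
  have l2 := Real.log_le_log (ha.trans_le h1) h2
  have h5 : |Real.log ‖z‖| ≤ |Real.log a| + |Real.log b| := by
    rw [abs_le]
    constructor
    · linarith [neg_abs_le (Real.log a), abs_nonneg (Real.log b)]
    · linarith [le_abs_self (Real.log b), abs_nonneg (Real.log a)]
  linarith

theorem norm_brf_le (hk : 0 < k₀) (h : ω.re ≤ 1) : ‖brf k₀ ω‖ ≤ k₀ * (Real.exp 1 + 1) := by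
  rw [brf, norm_div, norm_I, div_one]
  refine (norm_sub_le _ _).trans ?_
  rw [norm_k_exp hk, norm_mul, norm_I, norm_real, Real.norm_of_nonneg hk.le, one_mul, mul_add, mul_one]
  gcongr

theorem cos_ne_zero_of_ne {u : ℝ} (hu : u ∈ Icc (0 : ℝ) Real.pi) (hne : u ≠ Real.pi / 2) :
    Real.cos u ≠ 0 := fun hc => hne (by
  refine Real.injOn_cos hu pi_half_mem ?_
  rw [hc, Real.cos_pi_div_two])

theorem intervalIntegrable_abs_log_cos (k₀ : ℝ) (hk : 0 < k₀) :
    IntervalIntegrable (fun u => |Real.log (k₀ * |Real.cos u|)|) volume 0 Real.pi := by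
  have h1 : IntervalIntegrable (fun u => Real.log k₀ + Real.log (Real.cos u)) volume 0 Real.pi :=
    intervalIntegrable_const.add intervalIntegrable_log_cos
  refine h1.norm.congr_ae ?_
  filter_upwards [ae_restrict_mem measurableSet_uIoc, ae_restrict_of_ae ae_ne_mid] with u hu hne
  rw [uIoc_of_le Real.pi_pos.le] at hu
  have hc := cos_ne_zero_of_ne ⟨hu.1.le, hu.2⟩ hne
  rw [Real.log_mul hk.ne' (abs_ne_zero.2 hc), Real.log_abs, Real.norm_eq_abs]

/-- The region in which the logarithm is the principal one. -/
theorem isPreconnected_farStrip (R : ℝ) : IsPreconnected {ω : ℂ | R ≤ ω.re ∧ 0 ≤ ω.im ∧ ω.im ≤ Real.pi} := by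
  refine (Convex.inter (convex_halfSpace_re_ge R) (Convex.inter (convex_halfSpace_im_ge 0)
    (convex_halfSpace_im_le Real.pi))).isPreconnected

/-- Multiplication by `brf`^p cancels the pole and leaves a nonvanishing continuous function on the
closed half-strip. Its continuous logarithm, corrected by p times the principal logarithm of `brf`,
is H up to a constant. -/
theorem exists_logarithm (hk : 0 < k₀) (hd : DifferentiableOn ℂ g (outerD k₀))
    (hc : ContinuousOn g (outerK k₀ \ {I * k₀})) (h0 : ∀ z ∈ outerK k₀ \ {I * k₀}, g z ≠ 0)
    (hb : ∃ (p : ℕ) (c' : ℂ), c' ≠ 0 ∧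
        Tendsto (fun z => ((z - I * k₀) / I) ^ p * g z) (𝓝[outerD k₀] (I * k₀)) (𝓝 c'))
    (hinf : Tendsto g (comap norm atTop ⊓ 𝓟 (outerK k₀)) (𝓝 1)) :
    ∃ H : ℂ → ℂ, NiceStrip H ∧ VanishRight H ∧ ∀ ω ∈ cstrip \ {mid}, exp (H ω) = g (k₀ * exp ω) := by
  obtain ⟨p, c', hc', ht⟩ := hb
  set φ : ℂ → ℂ := fun ω => brf k₀ ω ^ p * g (k₀ * exp ω) with hφ
  have hEc : Continuous fun ω : ℂ => (k₀ : ℂ) * exp ω := by fun_prop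
  have hbc : Continuous (brf k₀) := by unfold brf; fun_prop
  have hgE : ContinuousOn (fun ω => g (k₀ * exp ω)) (cstrip \ {mid}) :=
    hc.comp hEc.continuousOn fun ω hω => k_exp_mem_diff hk hω
  have hφc : ContinuousOn φ (cstrip \ {mid}) := (hbc.pow p).continuousOn.mul hgE
  have hφ0 : ∀ ω ∈ cstrip \ {mid}, φ ω ≠ 0 := fun ω hω =>
    mul_ne_zero (pow_ne_zero _ (slitPlane_ne_zero (brf_mem_slitPlane hk hω)))
      (h0 _ (k_exp_mem_diff hk hω))
  have hφt : ∀ ω ∈ cstrip \ {mid}, Tendsto φ (𝓝[strip] ω) (𝓝 (φ ω)) := fun ω hω =>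
    (hφc ω hω).tendsto.mono_left (nhdsWithin_mono _ strip_subset')
  have hφm : Tendsto φ (𝓝[strip] mid) (𝓝 c') := by
    have h1 : Tendsto (fun ω : ℂ => (k₀ : ℂ) * exp ω) (𝓝[strip] mid) (𝓝[outerD k₀] (I * k₀)) := by
      refine tendsto_nhdsWithin_iff.2 ⟨?_, ?_⟩
      · rw [← k_exp_mid]; exact (hEc.tendsto mid).mono_left nhdsWithin_le_nhds
      · filter_upwards [self_mem_nhdsWithin] with ω hω using k_exp_mem_outerD hk hω
    exact ht.comp h1
  -- The nonzero limit c' at `mid` provides the missing boundary value.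
  set Φ := extendFrom strip φ with hΦ
  have hmid : mid ∈ cstrip := by
    have := mem_cstrip (x := 0) le_rfl pi_half_mem
    simpa [mid] using this
  have hΦc : ContinuousOn Φ cstrip := continuousOn_extendFrom cstrip_subset_closure fun ω hω => by
    by_cases e : ω = mid
    · exact ⟨c', e ▸ hφm⟩
    · exact ⟨_, hφt ω ⟨hω, e⟩⟩
  have hΦe : ∀ ω ∈ cstrip \ {mid}, Φ ω = φ ω := fun ω hω =>
    extendFrom_eq (cstrip_subset_closure hω.1) (hφt ω hω)
  have hΦ0 : ∀ ω ∈ cstrip, Φ ω ≠ 0 := fun ω hω => by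
    by_cases e : ω = mid
    · rw [e, hΦ, extendFrom_eq (cstrip_subset_closure hmid) hφm]; exact hc'
    · rw [hΦe ω ⟨hω, e⟩]; exact hφ0 ω ⟨hω, e⟩
  obtain ⟨L, hL, hLe⟩ := exists_log_cstrip hΦc hΦ0
  set H₁ : ℂ → ℂ := fun ω => L ω - p * log (brf k₀ ω) with hH₁
  have hH₁c : ContinuousOn H₁ (cstrip \ {mid}) :=
    hL.continuousOn.sub (continuousOn_const.mul
      (hbc.continuousOn.clog fun ω hω => brf_mem_slitPlane hk hω))
  have hH₁e : ∀ ω ∈ cstrip \ {mid}, exp (H₁ ω) = g (k₀ * exp ω) := fun ω hω => by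
    have hne := slitPlane_ne_zero (brf_mem_slitPlane hk hω)
    rw [hH₁, exp_sub, hLe ω hω.1, hΦe ω hω, exp_nat_mul, exp_log hne, hφ]
    exact mul_div_cancel_left₀ _ (pow_ne_zero _ hne)
  obtain ⟨C, hC⟩ := (isCompact_Icc.reProdIm isCompact_Icc :
    IsCompact (Icc (0 : ℝ) 1 ×ℂ Icc (0 : ℝ) Real.pi)).exists_bound_of_continuousOn hL.continuousOn
  have hH₁b : ∀ ε ∈ Ioo (0 : ℝ) 1, ∀ u ∈ Icc (0 : ℝ) Real.pi, u ≠ Real.pi / 2 → ‖H₁ (ε + u * I)‖ ≤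
      C + p * (|Real.log (k₀ * |Real.cos u|)| + |Real.log (k₀ * (Real.exp 1 + 1))| + Real.pi) := by
    intro ε hε u hu hne
    refine (norm_sub_le _ _).trans (add_le_add (hC _ ?_) ?_)
    · rw [mem_reProdIm]; simpa using ⟨⟨hε.1.le, hε.2.le⟩, hu⟩
    · rw [norm_mul, RCLike.norm_natCast]
      refine mul_le_mul_of_nonneg_left (norm_log_le ?_ ?_ ?_) (Nat.cast_nonneg _)
      · have := abs_pos.2 (cos_ne_zero_of_ne hu hne)
        positivity
      · have := abs_cos_le_norm_brf (ω := ε + u * I) hk (by simpa using hε.1.le)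
        simpa using this
      · exact norm_brf_le hk (by simpa using hε.2.le)
  have hbint : IntervalIntegrable (fun u => C + p * (|Real.log (k₀ * |Real.cos u|)| +
      |Real.log (k₀ * (Real.exp 1 + 1))| + Real.pi)) volume 0 Real.pi :=
    intervalIntegrable_const.add ((((intervalIntegrable_abs_log_cos k₀ hk).add
      intervalIntegrable_const).add intervalIntegrable_const).const_mul _)
  have hsmall : ∀ ε : ℝ, 0 < ε → ∃ R : ℝ, 0 < R ∧ ∀ ω : ℂ, R ≤ ω.re → 0 ≤ ω.im → ω.im ≤ Real.pi →
      ‖log (g (k₀ * exp ω))‖ ≤ ε ∧ g (k₀ * exp ω) ∈ slitPlane := by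
    intro ε hε
    have h1 : Tendsto (fun z => ‖log (g z)‖) (comap norm atTop ⊓ 𝓟 (outerK k₀)) (𝓝 0) := by
      have := ((continuousAt_clog one_mem_slitPlane).tendsto.comp hinf).norm
      simpa using this
    have h2 := (h1.eventually_le_const hε).and (hinf.eventually (isOpen_slitPlane.mem_nhds one_mem_slitPlane))
    rw [eventually_inf_principal, eventually_comap] at h2
    have h3 : Tendsto (fun s : ℝ => k₀ * Real.exp s) atTop atTop :=
      Real.tendsto_exp_atTop.const_mul_atTop hk
    obtain ⟨R, hR⟩ := eventually_atTop.1 (h3.eventually h2)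
    refine ⟨max R 1, by positivity, fun ω h1 h2 h3 => hR ω.re ((le_max_left _ _).trans h1) _
      (norm_k_exp hk ω) (k_exp_mem_outerK hk ⟨?_, h2, h3⟩)⟩
    linarith [(le_max_right R 1).trans h1]
  obtain ⟨R, hR0, hR⟩ := hsmall 1 one_pos
  set S := {ω : ℂ | R ≤ ω.re ∧ 0 ≤ ω.im ∧ ω.im ≤ Real.pi} with hS
  have hSsub : S ⊆ cstrip \ {mid} := fun ω hω => ⟨⟨hR0.le.trans hω.1, hω.2⟩, fun e => by
    have e : ω = mid := e
    have := hω.1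
    rw [e] at this
    simp [mid] at this
    linarith⟩
  have hRS : (R : ℂ) ∈ S := by simp [hS, Real.pi_pos.le]
  -- The constant by which H₁ differs from the principal logarithm far to the right, where g is
  -- close to 1. Subtracting it makes the logarithm vanish at infinity without changing its
  -- exponential, as exp d = 1.
  set d : ℂ := H₁ R - log (g (k₀ * exp R)) with hdd
  have hgne : ∀ ω ∈ S, g (k₀ * exp ω) ≠ 0 := fun ω hω => h0 _ (k_exp_mem_diff hk (hSsub hω))
  have hde : exp d = 1 := by
    rw [hdd, exp_sub, exp_log (hgne _ hRS), hH₁e _ (hSsub hRS), div_self (hgne _ hRS)]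
  have hEq : EqOn (fun ω => H₁ ω - d) (fun ω => log (g (k₀ * exp ω))) S := by
    refine exp_lift_eqOn (isPreconnected_farStrip R) ((hH₁c.mono hSsub).sub continuousOn_const)
      ((hgE.mono hSsub).clog fun ω hω => (hR ω hω.1 hω.2.1 hω.2.2).2) (fun ω hω => ?_) hRS ?_
    · rw [exp_sub, hde, div_one, hH₁e _ (hSsub hω), exp_log (hgne _ hω)]
    · rw [hdd]; ring
  refine ⟨fun ω => H₁ ω - d, ⟨hH₁c.sub continuousOn_const, fun ω hω => ?_, ?_⟩, ?_, ?_⟩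
  · refine DifferentiableAt.differentiableWithinAt (DifferentiableAt.sub_const ?_ d)
    have hn : strip ∈ 𝓝 ω := isOpen_strip.mem_nhds hω
    refine differentiableAt_of_exp ((hH₁c.mono strip_subset').continuousAt hn) ?_
    have h1 : DifferentiableAt ℂ (fun ω => g (k₀ * exp ω)) ω :=
      (hd.differentiableAt (isOpen_outerD.mem_nhds (k_exp_mem_outerD hk hω))).comp ω (by fun_prop)
    refine h1.congr_of_eventuallyEq ?_
    filter_upwards [hn] with y hy using hH₁e y (strip_subset' hy)
  · refine ⟨1, one_pos, _, hbint.add (intervalIntegrable_const (c := ‖d‖)), fun ε hε u hu hne => ?_⟩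
    exact (norm_sub_le _ _).trans (add_le_add (hH₁b ε hε u hu hne) le_rfl)
  · intro ε hε
    obtain ⟨R', hR'0, hR'⟩ := hsmall ε hε
    filter_upwards [eventually_ge_atTop R, eventually_ge_atTop R'] with T hT hT' u hu
    have hmem : (T + u * I : ℂ) ∈ S := by simpa [hS] using ⟨hT, hu⟩
    have := hEq hmem
    simp only at this
    rw [this]
    exact (hR' _ (by simpa using hT') (by simpa using hu.1) (by simpa using hu.2)).1
  · intro ω hω
    simp only
    rw [exp_sub, hde, div_one, hH₁e ω hω]

end Logarithm

/-! ### Symmetries of the Blaschke product and the logarithm of the reduced determinant -/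

section Blaschke

open Set Complex

variable {f g H : ℂ → ℂ} {k₀ : ℝ} {w z c κ ω : ℂ} {N : ℕ} {zs : Fin N → ℂ} {ν : Fin N → ℕ}

/-- The map z ↦ -k₀²/z* exchanges the two zeros of the quartet and also its two poles, so only a
constant phase can appear. -/
theorem quartet_hat (hk : 0 < k₀) (hw : w ≠ 0) (hz : z ≠ 0) :
    (starRingEnd ℂ) (quartet k₀ w (hat k₀ ((starRingEnd ℂ) z))) =
      ((starRingEnd ℂ) w / w) ^ 2 * quartet k₀ w z := by
  have hw' : (starRingEnd ℂ) w ≠ 0 := by simpa using hw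
  have hk' : (k₀ : ℂ) ≠ 0 := by exact_mod_cast hk.ne'
  rw [quartet, quartet, hat_conj]
  simp only [map_div₀, map_mul, map_sub, map_add, map_pow, conj_conj, conj_ofReal, hat]
  have e1 : (-((k₀ : ℂ) ^ 2 / z) - (starRingEnd ℂ) w) * (-((k₀ : ℂ) ^ 2 / z) + (k₀ : ℂ) ^ 2 / w) =
      (-((starRingEnd ℂ) w / w) * (k₀ ^ 2 / z ^ 2)) *
        ((z - w) * (z + (k₀ : ℂ) ^ 2 / (starRingEnd ℂ) w)) := by
    field_simp; ring
  have e2 : (-((k₀ : ℂ) ^ 2 / z) - w) * (-((k₀ : ℂ) ^ 2 / z) + (k₀ : ℂ) ^ 2 / (starRingEnd ℂ) w) =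
      (-(w / (starRingEnd ℂ) w) * (k₀ ^ 2 / z ^ 2)) *
        ((z - (starRingEnd ℂ) w) * (z + (k₀ : ℂ) ^ 2 / w)) := by
    field_simp; ring
  rw [e1, e2, mul_div_mul_comm]
  congr 1
  field_simp

theorem sig_factors (hk : 0 < k₀) (hw : w ∈ outerD k₀) (hz : z ∈ Sig k₀) :
    z - w ≠ 0 ∧ z - (starRingEnd ℂ) w ≠ 0 ∧ z + (k₀ : ℂ) ^ 2 / w ≠ 0 ∧
      z + (k₀ : ℂ) ^ 2 / (starRingEnd ℂ) w ≠ 0 := by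
  have hw0 : 0 < ‖w‖ := hk.trans hw.1
  have hwn : w ≠ 0 := norm_pos_iff.1 hw0
  have hwn' : (starRingEnd ℂ) w ≠ 0 := by simpa using hwn
  have hr : 0 < k₀ ^ 2 / ‖w‖ ^ 2 := by positivity
  have him := hw.2
  have hp : 0 < k₀ ^ 2 / ‖w‖ ^ 2 * w.im := by positivity
  have hn : ‖(k₀ : ℂ) ^ 2 / w‖ < k₀ := by
    rw [norm_div, norm_pow, norm_real, Real.norm_of_nonneg hk.le, div_lt_iff₀ hw0]
    nlinarith [hw.1]
  have hn' : ‖(k₀ : ℂ) ^ 2 / (starRingEnd ℂ) w‖ < k₀ := by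
    rwa [norm_div, RCLike.norm_conj, ← norm_div]
  have e1 : ((k₀ : ℂ) ^ 2 / w).im = -(k₀ ^ 2 / ‖w‖ ^ 2 * w.im) := by
    rw [sq_div_eq hwn, im_ofReal_mul, conj_im, mul_neg]
  have e2 : ((k₀ : ℂ) ^ 2 / (starRingEnd ℂ) w).im = k₀ ^ 2 / ‖w‖ ^ 2 * w.im := by
    rw [sq_div_eq hwn', im_ofReal_mul, conj_conj, RCLike.norm_conj]
  rcases hz with hz | hz
  · have hz : z.im = 0 := hz
    refine ⟨fun e => ?_, fun e => ?_, fun e => ?_, fun e => ?_⟩ <;> have := congrArg im e <;>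
      simp only [sub_im, add_im, hz, e1, e2, conj_im, zero_im] at this <;> linarith
  · have hz : ‖z‖ = k₀ := hz
    refine ⟨fun e => ?_, fun e => ?_, fun e => ?_, fun e => ?_⟩
    · rw [sub_eq_zero.1 e] at hz; linarith [hw.1]
    · rw [sub_eq_zero.1 e, RCLike.norm_conj] at hz; linarith [hw.1]
    · rw [eq_neg_of_add_eq_zero_left e, norm_neg] at hz; linarith
    · rw [eq_neg_of_add_eq_zero_left e, norm_neg] at hz; linarith

theorem quartet_mul_conj (hk : 0 < k₀) (hw : w ∈ outerD k₀) (hz : z ∈ Sig k₀) :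
    quartet k₀ w z * (starRingEnd ℂ) (quartet k₀ w ((starRingEnd ℂ) z)) = 1 := by
  obtain ⟨h1, h2, h3, h4⟩ := sig_factors hk hw hz
  rw [quartet, quartet]
  simp only [map_div₀, map_mul, map_sub, map_add, map_pow, conj_conj, conj_ofReal]
  field_simp

/-- For this reason the zeros leave no trace in f(ζ) · conj f(ζ*), that is in the jump. -/
theorem blaschke_mul_conj (hk : 0 < k₀) (hzs : ∀ n, zs n ∈ outerD k₀) (hz : z ∈ Sig k₀) :
    blaschke k₀ zs ν z * (starRingEnd ℂ) (blaschke k₀ zs ν ((starRingEnd ℂ) z)) = 1 := by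
  rw [blaschke, blaschke, map_prod, ← Finset.prod_mul_distrib]
  refine Finset.prod_eq_one fun n _ => ?_
  rw [map_pow, ← mul_pow, quartet_mul_conj hk (hzs n) hz, one_pow]

theorem norm_blaschke_real (hk : 0 < k₀) (hzs : ∀ n, zs n ∈ outerD k₀) (x : ℝ) :
    ‖blaschke k₀ zs ν x‖ = 1 := by
  have h := congrArg norm (blaschke_mul_conj (ν := ν) hk hzs (z := x) (Or.inl (ofReal_im x)))
  rw [conj_ofReal, norm_mul, RCLike.norm_conj, norm_one] at h
  nlinarith [norm_nonneg (blaschke k₀ zs ν x)]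

/-- The phase that the Blaschke product picks up under the second symmetry. -/
def twist (zs : Fin N → ℂ) (ν : Fin N → ℕ) : ℂ := ∏ n, (((starRingEnd ℂ) (zs n) / zs n) ^ 2) ^ ν n

theorem blaschke_hat (hk : 0 < k₀) (hzs : ∀ n, zs n ∈ outerD k₀) (hz : z ≠ 0) :
    (starRingEnd ℂ) (blaschke k₀ zs ν (hat k₀ ((starRingEnd ℂ) z))) =
      twist zs ν * blaschke k₀ zs ν z := by
  rw [blaschke, blaschke, twist, map_prod, ← Finset.prod_mul_distrib]
  refine Finset.prod_congr rfl fun n _ => ?_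
  rw [map_pow, quartet_hat hk (norm_pos_iff.1 (hk.trans (hzs n).1)) hz, mul_pow]

theorem norm_twist (hzs : ∀ n, zs n ≠ 0) : ‖twist zs ν‖ = 1 := by
  rw [twist, norm_prod]
  refine Finset.prod_eq_one fun n _ => ?_
  rw [norm_pow, norm_pow, norm_div, RCLike.norm_conj, div_self (norm_ne_zero_iff.2 (hzs n)), one_pow,
    one_pow]

/-- The inverse of the Blaschke product in the coordinate at infinity. -/
def blaschkeInv (k₀ : ℝ) (zs : Fin N → ℂ) (ν : Fin N → ℕ) (v : ℂ) : ℂ :=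
  ∏ n, (((1 - (starRingEnd ℂ) (zs n) * v) * (1 + (k₀ : ℂ) ^ 2 / zs n * v)) /
    ((1 - zs n * v) * (1 + (k₀ : ℂ) ^ 2 / (starRingEnd ℂ) (zs n) * v))) ^ ν n

theorem blaschkeInv_zero : blaschkeInv k₀ zs ν 0 = 1 := by simp [blaschkeInv]

theorem differentiableAt_blaschkeInv : DifferentiableAt ℂ (blaschkeInv k₀ zs ν) 0 := by
  refine DifferentiableAt.fun_finsetProd fun n _ => DifferentiableAt.pow ?_ _
  exact DifferentiableAt.div (by fun_prop) (by fun_prop) (by simp)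

/-- Neighbourhoods of infinity in the outer region. -/
def outerInf (k₀ : ℝ) : Filter ℂ := comap norm atTop ⊓ 𝓟 (outerK k₀)

theorem outerInf_le (hk : 0 < k₀) : outerInf k₀ ≤ infGood k₀ := by
  refine le_inf inf_le_left ?_
  rw [le_principal_iff]
  have h1 : ∀ᶠ z in outerInf k₀, k₀ < ‖z‖ :=
    (tendsto_comap.eventually (eventually_gt_atTop k₀)).filter_mono inf_le_left
  have h2 : ∀ᶠ z in outerInf k₀, z ∈ outerK k₀ := mem_inf_of_right (mem_principal_self _)
  filter_upwards [h1, h2] with z hz1 hz2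
  refine outerK_subset_good hk ⟨hz2, fun e => ?_⟩
  have e : z = I * k₀ := e
  rw [e] at hz1
  simp [abs_of_pos hk] at hz1

theorem quartet_mul_inv (hk : 0 < k₀) (hw : w ∈ outerD k₀) (hz : z ∈ outerK k₀) (hne : z ≠ w) :
    quartet k₀ w z * (((1 - (starRingEnd ℂ) w * z⁻¹) * (1 + (k₀ : ℂ) ^ 2 / w * z⁻¹)) /
    ((1 - w * z⁻¹) * (1 + (k₀ : ℂ) ^ 2 / (starRingEnd ℂ) w * z⁻¹))) = 1 := by
  obtain ⟨h1, h2, h3⟩ := quartet_factors hk hw hz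
  have hz0 : z ≠ 0 := norm_pos_iff.1 (hk.trans_le hz.1)
  have h4 : z - w ≠ 0 := sub_ne_zero.2 hne
  have a : ∀ u : ℂ, 1 - u * z⁻¹ = (z - u) * z⁻¹ := fun u => by field_simp
  have b : ∀ u : ℂ, 1 + u * z⁻¹ = (z + u) * z⁻¹ := fun u => by field_simp
  rw [a, a, b, b, quartet]
  set p := z + (k₀ : ℂ) ^ 2 / w
  set q := z + (k₀ : ℂ) ^ 2 / (starRingEnd ℂ) w
  set r := z - (starRingEnd ℂ) w
  set s := z - w
  field_simp

theorem eventually_blaschke_mul_inv (hk : 0 < k₀) (hzs : ∀ n, zs n ∈ outerD k₀) :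
    ∀ᶠ z in outerInf k₀, blaschke k₀ zs ν z * blaschkeInv k₀ zs ν z⁻¹ = 1 := by
  have h1 : ∀ᶠ z in outerInf k₀, ∀ n, ‖zs n‖ < ‖z‖ := eventually_all.2 fun n =>
    (tendsto_comap.eventually (eventually_gt_atTop ‖zs n‖)).filter_mono inf_le_left
  have h2 : ∀ᶠ z in outerInf k₀, z ∈ outerK k₀ := mem_inf_of_right (mem_principal_self _)
  filter_upwards [h1, h2] with z hz1 hz2
  rw [blaschke, blaschkeInv, ← Finset.prod_mul_distrib]
  refine Finset.prod_eq_one fun n _ => ?_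
  rw [← mul_pow, quartet_mul_inv hk (hzs n) hz2 (fun e => by have := hz1 n; rw [e] at this; exact lt_irrefl _ this), one_pow]

theorem tendsto_blaschkeInv : Tendsto (fun z => blaschkeInv k₀ zs ν z⁻¹) (outerInf k₀) (𝓝 1) := by
  have h1 : Tendsto (fun z : ℂ => z⁻¹) (outerInf k₀) (𝓝 0) := by
    rw [tendsto_zero_iff_norm_tendsto_zero]
    simp only [norm_inv]
    exact tendsto_inv_atTop_zero.comp (tendsto_comap.mono_left inf_le_left)
  have h2 := (differentiableAt_blaschkeInv (k₀ := k₀) (zs := zs) (ν := ν)).continuousAt.tendsto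
  rw [blaschkeInv_zero] at h2
  exact h2.comp h1

theorem eventually_eq_mul_inv (hk : 0 < k₀) (hzs : ∀ n, zs n ∈ outerD k₀)
    (hg : ∀ z ∈ outerK k₀ \ {I * k₀}, g z ≠ 0 ∧ f z = g z * blaschke k₀ zs ν z) :
    ∀ᶠ z in outerInf k₀, g z = f z * blaschkeInv k₀ zs ν z⁻¹ := by
  have h1 : ∀ᶠ z in outerInf k₀, k₀ < ‖z‖ :=
    (tendsto_comap.eventually (eventually_gt_atTop k₀)).filter_mono inf_le_left
  have h2 : ∀ᶠ z in outerInf k₀, z ∈ outerK k₀ := mem_inf_of_right (mem_principal_self _)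
  filter_upwards [h1, h2, eventually_blaschke_mul_inv hk hzs] with z hz1 hz2 hz3
  have hm : z ∈ outerK k₀ \ {I * k₀} := ⟨hz2, fun e => by
    have e : z = I * k₀ := e
    rw [e] at hz1
    simp [abs_of_pos hk] at hz1⟩
  rw [(hg z hm).2, mul_assoc, hz3, mul_one]

theorem tendsto_mul_I_outerInf (hk : 0 < k₀) : Tendsto (fun y : ℝ => (y : ℂ) * I) atTop (outerInf k₀) := by
  refine tendsto_inf.2 ⟨tendsto_comap_iff.2 ?_, tendsto_principal.2 ?_⟩
  · refine tendsto_abs_atTop_atTop.congr fun y => ?_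
    simp
  · filter_upwards [eventually_ge_atTop k₀] with y hy
    have : 0 ≤ y := hk.le.trans hy
    simp [outerK, abs_of_nonneg this, hy, this]

theorem isBigO_blaschkeInv :
    (fun y : ℝ => blaschkeInv k₀ zs ν ((y : ℂ) * I)⁻¹ - 1) =O[atTop] fun y : ℝ => y⁻¹ := by
  have h1 := (differentiableAt_blaschkeInv (k₀ := k₀) (zs := zs) (ν := ν)).isBigO_sub
  simp only [blaschkeInv_zero, sub_zero] at h1
  have h2 : Tendsto (fun y : ℝ => ((y : ℂ) * I)⁻¹) atTop (𝓝 0) := by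
    rw [tendsto_zero_iff_norm_tendsto_zero]
    simp only [norm_inv, norm_mul, norm_I, mul_one, norm_real, Real.norm_eq_abs]
    exact tendsto_inv_atTop_zero.comp tendsto_abs_atTop_atTop
  refine (h1.comp_tendsto h2).trans ?_
  refine Asymptotics.IsBigO.of_bound 1 (Eventually.of_forall fun y => ?_)
  simp

theorem norm_le_two_mul_exp_sub_one {x : ℂ} (h : ‖x‖ ≤ 1 / 2) : ‖x‖ ≤ 2 * ‖exp x - 1‖ := by
  have h1 := norm_exp_sub_one_sub_id_le (x := x) (by linarith)
  have h2 : ‖x‖ ≤ ‖exp x - 1 - x‖ + ‖exp x - 1‖ := by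
    have := norm_sub_le (exp x - 1) (exp x - 1 - x)
    rw [sub_sub_cancel] at this
    linarith
  nlinarith [norm_nonneg x]

/-- The logarithm of `det a` with its zeros removed, in the coordinate of the half-strip. -/
theorem DetData.exists_logData (h : DetData k₀ f c) (hz : ZeroData k₀ f zs ν) :
    ∃ (H : ℂ → ℂ) (κ : ℂ), LogData H κ ∧ exp κ = c * twist zs ν ∧
      (∀ ω ∈ cstrip \ {mid}, f (k₀ * exp ω) = exp (H ω) * blaschke k₀ zs ν (k₀ * exp ω)) ∧
      ∃ C : ℝ, ∀ᶠ s : ℝ in atTop, k₀ * Real.exp s * ‖H (s + (Real.pi / 2 : ℝ) * I)‖ ≤ C := by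
  have hk := h.pos
  have hk' : (k₀ : ℂ) ≠ 0 := by exact_mod_cast hk.ne'
  obtain ⟨g, hgd, hgc, hg, hgb⟩ := h.exists_reduced hz
  have hev := eventually_eq_mul_inv hk hz.mem hg
  have hginf : Tendsto g (outerInf k₀) (𝓝 1) := by
    have := (h.inf.mono_left (outerInf_le hk)).mul
      (tendsto_blaschkeInv (k₀ := k₀) (zs := zs) (ν := ν))
    rw [mul_one] at this
    exact this.congr' (hev.mono fun z hz => hz.symm)
  obtain ⟨H, hn, hv, hE⟩ := exists_logarithm hk hgd hgc (fun z hz => (hg z hz).1) hgb hginf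
  have hfe : ∀ ω ∈ cstrip \ {mid}, f (k₀ * exp ω) = exp (H ω) * blaschke k₀ zs ν (k₀ * exp ω) :=
    fun ω hω => by rw [hE ω hω]; exact (hg _ (k_exp_mem_diff hk hω)).2
  set κ : ℂ := H 0 - (starRingEnd ℂ) (H (Real.pi * I)) with hκ
  have m0 : (0 : ℂ) ∈ cstrip \ {mid} := by
    have := mem_cstrip_diff (x := 0) (u := 0) le_rfl ⟨le_rfl, Real.pi_pos.le⟩
      (Or.inr (by linarith [Real.pi_pos]))
    simpa using this
  have m1 : (Real.pi * I : ℂ) ∈ cstrip \ {mid} := by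
    have := mem_cstrip_diff (x := 0) (u := Real.pi) le_rfl ⟨Real.pi_pos.le, le_rfl⟩
      (Or.inr (by linarith [Real.pi_pos]))
    simpa using this
  -- The symmetry is evaluated at k₀ = k₀e^0, whose image is -k₀ = k₀e^{πi}; both are corners of the
  -- half-strip away from the branch point.
  have hκe : exp κ = c * twist zs ν := by
    have e0 := hfe 0 m0
    have e1 := hfe _ m1
    rw [exp_zero, mul_one] at e0
    rw [exp_pi_mul_I, mul_neg_one] at e1
    have hG : (k₀ : ℂ) ∈ Good k₀ := by
      have := outerK_subset_good hk (k_exp_mem_diff hk m0)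
      simpa using this
    have hS : (k₀ : ℂ) ∈ Sig₀ k₀ := by
      refine ⟨Or.inl (ofReal_im _), ?_⟩
      rintro (e | e | e)
      · exact hk' e
      · have := congrArg re e; simp at this; exact hk.ne' this
      · have e : (k₀ : ℂ) = -(I * k₀) := e
        have := congrArg re e; simp at this; exact hk.ne' this
    have hh : hat k₀ ((starRingEnd ℂ) (k₀ : ℂ)) = -k₀ := by
      rw [conj_ofReal, hat]; field_simp
    have hs := h.symm _ hG
    have hB := blaschke_hat (ν := ν) hk hz.mem hk'
    rw [hh] at hs hB
    rw [e1, map_mul, hB] at hs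
    have hne := h.ne _ hS
    rw [e0] at hne hs
    have hBne : blaschke k₀ zs ν k₀ ≠ 0 := right_ne_zero_of_mul hne
    have hs' : exp (H 0) = c * ((starRingEnd ℂ) (exp (H (Real.pi * I))) * twist zs ν) := by
      refine mul_right_cancel₀ hBne ?_
      rw [hs]; ring
    rw [hκ, exp_sub, hs', exp_conj]
    field_simp [exp_ne_zero]
  refine ⟨H, κ, ⟨hn, hv, ?_, by rw [hκ]; ring⟩, hκe, hfe, ?_⟩
  · have h1 : Real.exp κ.re = 1 := by
      rw [← norm_exp, hκe, norm_mul, h.norm_c,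
        norm_twist fun n => norm_pos_iff.1 (hk.trans (hz.mem n).1), one_mul]
    exact Real.exp_eq_one_iff _ |>.1 h1
  -- Both f and the inverse Blaschke product are 1 + O(1/y) on the imaginary axis, hence so is g =
  -- e^H. For small H the inequality |H| ≤ 2|e^H - 1| transfers the rate to H.
  · have h1 : (fun y : ℝ => g (y * I) - 1) =O[atTop] fun y : ℝ => y⁻¹ := by
      have t1 : (fun y : ℝ => blaschkeInv k₀ zs ν ((y : ℂ) * I)⁻¹) =O[atTop] fun _ : ℝ => (1 : ℝ) :=
        ((tendsto_blaschkeInv (k₀ := k₀)).comp (tendsto_mul_I_outerInf hk)).isBigO_one ℝ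
      have t2 := (h.imag.mul t1).add (isBigO_blaschkeInv (k₀ := k₀) (zs := zs) (ν := ν)
        |>.trans (Asymptotics.isBigO_of_le _ fun y => by simp) : _ =O[atTop] fun y : ℝ => y⁻¹ * 1)
      simp only [mul_one] at t2
      refine t2.congr' ?_ EventuallyEq.rfl
      filter_upwards [(tendsto_mul_I_outerInf hk).eventually hev] with y hy
      rw [hy]; ring
    obtain ⟨C, hC⟩ := h1.bound
    have ht : Tendsto (fun s : ℝ => k₀ * Real.exp s) atTop atTop :=
      Real.tendsto_exp_atTop.const_mul_atTop hk
    refine ⟨2 * C, ?_⟩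
    filter_upwards [ht.eventually hC, hv (1 / 2) (by norm_num), eventually_gt_atTop 0] with s hs1 hs2 hs0
    have hmem : (s + (Real.pi / 2 : ℝ) * I : ℂ) ∈ cstrip \ {mid} :=
      mem_cstrip_diff hs0.le pi_half_mem (Or.inl hs0.ne')
    have h3 := norm_le_two_mul_exp_sub_one (hs2 _ pi_half_mem)
    rw [hE _ hmem, k_exp_add_half] at h3
    have hp : 0 < k₀ * Real.exp s := by positivity
    rw [norm_inv, Real.norm_of_nonneg hp.le] at hs1
    calc _ ≤ k₀ * Real.exp s * (2 * (C * (k₀ * Real.exp s)⁻¹)) :=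
          mul_le_mul_of_nonneg_left (h3.trans (by linarith)) hp.le
      _ = 2 * C := by field_simp

end Blaschke

/-! ### The logarithm on all of D⁺ and the trace formula -/

section Trace

open Set Complex

variable {f g H : ℂ → ℂ} {k₀ : ℝ} {w z c κ ω : ℂ} {N : ℕ} {zs : Fin N → ℂ} {ν : Fin N → ℕ}

theorem log_k_exp (hk : 0 < k₀) (h : ω ∈ cstrip) : log (k₀ * exp ω / k₀) = ω := by
  have hk' : (k₀ : ℂ) ≠ 0 := by exact_mod_cast hk.ne'
  rw [mul_div_cancel_left₀ _ hk', log_exp (by linarith [h.2.1, Real.pi_pos]) h.2.2]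

theorem k_exp_log (hk : 0 < k₀) (hz : z ≠ 0) : (k₀ : ℂ) * exp (log (z / k₀)) = z := by
  have hk' : (k₀ : ℂ) ≠ 0 := by exact_mod_cast hk.ne'
  rw [exp_log (div_ne_zero hz hk')]; field_simp

theorem ne_zero_of_outerK (hk : 0 < k₀) (hz : z ∈ outerK k₀) : z ≠ 0 :=
  norm_pos_iff.1 (hk.trans_le hz.1)

theorem log_mem_cstrip (hk : 0 < k₀) (hz : z ∈ outerK k₀) : log (z / k₀) ∈ cstrip := by
  have him : (z / k₀).im = z.im / k₀ := by simp
  refine ⟨?_, ?_, ?_⟩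
  · rw [log_re, norm_div, norm_real, Real.norm_of_nonneg hk.le]
    exact Real.log_nonneg ((one_le_div hk).2 hz.1)
  · rw [log_im, arg_nonneg_iff, him]; exact div_nonneg hz.2 hk.le
  · rw [log_im]; exact arg_le_pi _

/-- The closure of the part of `D⁺` in the lower half plane. -/
def innerK (k₀ : ℝ) : Set ℂ := {z | ‖z‖ ≤ k₀ ∧ z.im ≤ 0}

theorem isClosed_innerK : IsClosed (innerK k₀) :=
  (isClosed_le continuous_norm continuous_const).inter (isClosed_le continuous_im continuous_const)

theorem norm_hat_conj (hk : 0 < k₀) (z : ℂ) : ‖hat k₀ ((starRingEnd ℂ) z)‖ = k₀ ^ 2 / ‖z‖ := by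
  rw [hat, norm_neg, norm_div, RCLike.norm_conj, norm_pow, norm_real, Real.norm_of_nonneg hk.le]

theorem im_hat_conj (hz : z ≠ 0) : (hat k₀ ((starRingEnd ℂ) z)).im = -(k₀ ^ 2 / ‖z‖ ^ 2 * z.im) := by
  have : (starRingEnd ℂ) z ≠ 0 := by simpa using hz
  rw [hat, neg_im, sq_div_eq this, im_ofReal_mul, conj_conj, RCLike.norm_conj]

theorem hat_conj_mem_outerK (hk : 0 < k₀) (hz : z ∈ innerK k₀) (h0 : z ≠ 0) :
    hat k₀ ((starRingEnd ℂ) z) ∈ outerK k₀ := by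
  have hp : 0 < ‖z‖ := norm_pos_iff.2 h0
  refine ⟨?_, ?_⟩
  · rw [norm_hat_conj hk, le_div_iff₀ hp]; nlinarith [hz.1]
  · rw [im_hat_conj h0]
    have : 0 ≤ k₀ ^ 2 / ‖z‖ ^ 2 := by positivity
    nlinarith [hz.2]

theorem hat_conj_k_exp (hk : 0 < k₀) (ω : ℂ) :
    hat k₀ ((starRingEnd ℂ) (k₀ * exp (-ω))) = k₀ * exp (flip ω) := by
  have hk' : (k₀ : ℂ) ≠ 0 := by exact_mod_cast hk.ne'
  rw [hat, flip, exp_add, exp_pi_mul_I, map_mul, conj_ofReal, ← exp_conj, map_neg, exp_neg]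
  have := exp_ne_zero ((starRingEnd ℂ) ω)
  field_simp

theorem hat_conj_hat_conj (hk : 0 < k₀) (z : ℂ) (hz : z ≠ 0) :
    hat k₀ ((starRingEnd ℂ) (hat k₀ ((starRingEnd ℂ) z))) = z := by
  have hk' : (k₀ : ℂ) ≠ 0 := by exact_mod_cast hk.ne'
  have hz' : (starRingEnd ℂ) z ≠ 0 := by simpa using hz
  simp only [hat, map_neg, map_div₀, map_pow, conj_conj, conj_ofReal]
  field_simp

theorem exists_inner (hk : 0 < k₀) (hz : z ∈ innerK k₀) (h0 : z ≠ 0) :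
    ∃ ω ∈ cstrip, z = k₀ * exp (-ω) := by
  have h1 := hat_conj_mem_outerK hk hz h0
  refine ⟨flip (log (hat k₀ ((starRingEnd ℂ) z) / k₀)), flip_mem_cstrip (log_mem_cstrip hk h1), ?_⟩
  set ω := flip (log (hat k₀ ((starRingEnd ℂ) z) / k₀)) with hω
  have hk' : (k₀ : ℂ) ≠ 0 := by exact_mod_cast hk.ne'
  rw [← hat_conj_hat_conj hk z h0, ← hat_conj_hat_conj hk (k₀ * exp (-ω)) (mul_ne_zero hk' (exp_ne_zero _)),
    hat_conj_k_exp hk, hω, flip_flip, k_exp_log hk (ne_zero_of_outerK hk h1)]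

theorem mem_strip_of_outerD (hk : 0 < k₀) (h : ω ∈ cstrip) (hz : (k₀ : ℂ) * exp ω ∈ outerD k₀) :
    ω ∈ strip := by
  obtain ⟨h1, h2⟩ := hz
  rw [norm_k_exp hk] at h1
  rw [im_ofReal_mul, exp_im] at h2
  have hs : Real.sin ω.im ≠ 0 := fun e => by rw [e, mul_zero, mul_zero] at h2; exact lt_irrefl _ h2
  refine ⟨?_, lt_of_le_of_ne h.2.1 fun e => hs (by rw [← e, Real.sin_zero]),
    lt_of_le_of_ne h.2.2 fun e => hs (by rw [e, Real.sin_pi])⟩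
  refine lt_of_le_of_ne h.1 fun e => ?_
  rw [← e, Real.exp_zero, mul_one] at h1
  exact lt_irrefl _ h1

theorem good_subset (hk : 0 < k₀) : Good k₀ ⊆ (outerK k₀ \ {I * k₀}) ∪ innerK k₀ := fun z hz => by
  have hne : z ≠ I * k₀ := fun e => hz.2.1 (by
    rw [e, lamOf]
    have hk' : (k₀ : ℂ) ≠ 0 := by exact_mod_cast hk.ne'
    field_simp; simp)
  have key : (k₀ ≤ ‖z‖ ∧ 0 ≤ z.im) ∨ (‖z‖ ≤ k₀ ∧ z.im ≤ 0) := by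
    rcases mem_of_good hk hz with h | ⟨h | h, -⟩
    · have h : 0 < (‖z‖ ^ 2 - k₀ ^ 2) * z.im := h
      rcases mul_pos_iff.1 h with ⟨a, b⟩ | ⟨a, b⟩
      · exact Or.inl ⟨(lt_of_pow_lt_pow_left₀ 2 (norm_nonneg _) (by linarith)).le, b.le⟩
      · exact Or.inr ⟨(lt_of_pow_lt_pow_left₀ 2 hk.le (by linarith)).le, b.le⟩
    · have h : z.im = 0 := h
      rcases le_total k₀ ‖z‖ with a | a
      · exact Or.inl ⟨a, h.ge⟩
      · exact Or.inr ⟨a, h.le⟩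
    · have h : ‖z‖ = k₀ := h
      rcases le_total 0 z.im with a | a
      · exact Or.inl ⟨h.ge, a⟩
      · exact Or.inr ⟨h.le, a⟩
  rcases key with h | h
  · exact Or.inl ⟨h, hne⟩
  · exact Or.inr h

open Classical in
/-- The logarithm of `det a` with its zeros removed. -/
def logFun (k₀ : ℝ) (H : ℂ → ℂ) (κ z : ℂ) : ℂ :=
  if z ∈ outerK k₀ then H (log (z / k₀))
  else (starRingEnd ℂ) (H (log (hat k₀ ((starRingEnd ℂ) z) / k₀))) + κ

theorem logFun_outer (hk : 0 < k₀) (h : ω ∈ cstrip) : logFun k₀ H κ (k₀ * exp ω) = H ω := by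
  rw [logFun, if_pos (k_exp_mem_outerK hk h), log_k_exp hk h]

theorem LogData.glue' (h : LogData H κ) : H (Real.pi * I) = (starRingEnd ℂ) (H 0) + κ := by
  have hc : (starRingEnd ℂ) κ = -κ := Complex.ext (by simp [h.re]) (by simp)
  rw [h.glue, map_add, conj_conj, hc]; ring

/-- The definition gives preference to the outer branch, so there is something to check where the
two closures meet, at ±k₀. There the branches agree by the gluing relation and its conjugate, which
uses that κ is imaginary. -/
theorem logFun_inner (hd : LogData H κ) (hk : 0 < k₀) (h : ω ∈ cstrip) :
    logFun k₀ H κ (k₀ * exp (-ω)) = dual H κ ω := by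
  by_cases hK : (k₀ : ℂ) * exp (-ω) ∈ outerK k₀
  · have h1 := hK.1
    have h2 := hK.2
    rw [norm_k_exp hk, neg_re] at h1
    rw [im_ofReal_mul, exp_im, neg_im, Real.sin_neg] at h2
    have hre : ω.re = 0 := by
      refine le_antisymm ?_ h.1
      by_contra hc
      push Not at hc
      have := Real.exp_lt_one_iff.2 (neg_lt_zero.2 hc)
      nlinarith
    have hsin : Real.sin ω.im = 0 := by
      refine le_antisymm ?_ (Real.sin_nonneg_of_nonneg_of_le_pi h.2.1 h.2.2)
      by_contra hc
      push Not at hc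
      have h3 : 0 < k₀ * (Real.exp (-ω).re * Real.sin ω.im) := by positivity
      linarith
    have him : ω.im = 0 ∨ ω.im = Real.pi := by
      by_contra hc
      push Not at hc
      exact (Real.sin_pos_of_pos_of_lt_pi (lt_of_le_of_ne h.2.1 (Ne.symm hc.1))
        (lt_of_le_of_ne h.2.2 hc.2)).ne' hsin
    rcases him with e | e
    · have hω : ω = ((0 : ℝ) : ℂ) := Complex.ext (by simpa using hre) (by simpa using e)
      have hω0 : ω = 0 := by rw [hω, ofReal_zero]
      have h3 := logFun_outer (H := H) (κ := κ) hk (hω0 ▸ h : (0 : ℂ) ∈ cstrip)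
      rw [hω0, neg_zero, h3, ← ofReal_zero, dual_ofReal, ofReal_zero, zero_add]
      exact hd.glue
    · have hω : ω = Real.pi * I := Complex.ext (by simpa using hre) (by simpa using e)
      have h4 : exp (-ω) = exp ω := by rw [hω, exp_neg_pi_mul_I, exp_pi_mul_I]
      rw [h4, logFun_outer hk h, hω]
      have h5 := dual_add_pi (H := H) (κ := κ) 0
      rw [ofReal_zero, zero_add] at h5
      rw [h5]
      exact hd.glue'
  · rw [logFun, if_neg hK, hat_conj_k_exp hk, log_k_exp hk (flip_mem_cstrip h), dual]

theorem logFun_of_innerK (hd : LogData H κ) (hk : 0 < k₀) (hz : z ∈ innerK k₀) (h0 : z ≠ 0) :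
    logFun k₀ H κ z = (starRingEnd ℂ) (H (log (hat k₀ ((starRingEnd ℂ) z) / k₀))) + κ := by
  obtain ⟨ω, hω, rfl⟩ := exists_inner hk hz h0
  rw [logFun_inner hd hk hω, hat_conj_k_exp hk, log_k_exp hk (flip_mem_cstrip hω), dual]

theorem continuousOn_log_im : ContinuousOn log {z : ℂ | 0 ≤ z.im ∧ z ≠ 0} := fun z hz => by
  by_cases h : z ∈ slitPlane
  · exact (continuousAt_clog h).continuousWithinAt
  · rw [mem_slitPlane_iff] at h
    push Not at h
    have hre : z.re < 0 := lt_of_le_of_ne h.1 fun e => hz.2 (Complex.ext e h.2)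
    exact (continuousWithinAt_log_of_re_neg_of_im_zero hre h.2).mono fun y hy => hy.1

theorem continuousOn_log_outerK (hk : 0 < k₀) : ContinuousOn (fun z => log (z / k₀)) (outerK k₀) := by
  refine continuousOn_log_im.comp (by fun_prop) fun z hz => ⟨?_, ?_⟩
  · have : (z / k₀).im = z.im / k₀ := by simp
    rw [this]; exact div_nonneg hz.2 hk.le
  · exact div_ne_zero (ne_zero_of_outerK hk hz) (by exact_mod_cast hk.ne')

theorem log_mem_diff (hk : 0 < k₀) (hz : z ∈ outerK k₀ \ {I * k₀}) :
    log (z / k₀) ∈ cstrip \ {mid} := ⟨log_mem_cstrip hk hz.1, fun e => hz.2 (by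
  have e : log (z / k₀) = mid := e
  rw [mem_singleton_iff, ← k_exp_mid, ← e, k_exp_log hk (ne_zero_of_outerK hk hz.1)])⟩

theorem good_inter_outerK (hk : 0 < k₀) (hz : z ∈ Good k₀) (hK : z ∈ outerK k₀) :
    z ∈ outerK k₀ \ {I * k₀} := ⟨hK, fun e => hz.2.1 (by
  have e : z = I * k₀ := e
  rw [e, lamOf]
  have hk' : (k₀ : ℂ) ≠ 0 := by exact_mod_cast hk.ne'
  field_simp; simp)⟩

/-- `Good k₀` is covered by its intersections with two closed sets, on each of which the logarithm
is given by one continuous formula. -/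
theorem continuousOn_logFun (hd : LogData H κ) (hk : 0 < k₀) : ContinuousOn (logFun k₀ H κ) (Good k₀) := by
  have c1 : ContinuousOn (logFun k₀ H κ) (Good k₀ ∩ outerK k₀) := by
    have : ContinuousOn (fun z => H (log (z / k₀))) (Good k₀ ∩ outerK k₀) :=
      hd.nice.cont.comp ((continuousOn_log_outerK hk).mono inter_subset_right) fun z hz =>
        log_mem_diff hk (good_inter_outerK hk hz.1 hz.2)
    exact this.congr fun z hz => by rw [logFun, if_pos hz.2]
  have c2 : ContinuousOn (logFun k₀ H κ) (Good k₀ ∩ innerK k₀) := by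
    have hmaps : ∀ z ∈ Good k₀ ∩ innerK k₀, hat k₀ ((starRingEnd ℂ) z) ∈ outerK k₀ \ {I * k₀} :=
      fun z hz => good_inter_outerK hk (Good.hat_conj hk hz.1) (hat_conj_mem_outerK hk hz.2 hz.1.1)
    have h1 : ContinuousOn (fun z : ℂ => hat k₀ ((starRingEnd ℂ) z)) (Good k₀ ∩ innerK k₀) := by
      refine (ContinuousOn.div continuousOn_const continuous_conj.continuousOn fun z hz => ?_).neg
      simpa using hz.1.1
    have h2 : ContinuousOn (fun z => H (log (hat k₀ ((starRingEnd ℂ) z) / k₀))) (Good k₀ ∩ innerK k₀) :=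
      hd.nice.cont.comp ((continuousOn_log_outerK hk).comp h1 fun z hz => (hmaps z hz).1)
        fun z hz => log_mem_diff hk (hmaps z hz)
    exact ((continuous_conj.comp_continuousOn h2).add continuousOn_const).congr fun z hz =>
      logFun_of_innerK hd hk hz.2 hz.1.1
  have hunion : Good k₀ = (Good k₀ ∩ outerK k₀) ∪ (Good k₀ ∩ innerK k₀) := by
    rw [← inter_union_distrib_left, left_eq_inter]
    exact (good_subset hk).trans (union_subset_union_left _ sdiff_subset)
  intro z hz
  rw [hunion]
  refine ContinuousWithinAt.union ?_ ?_
  · by_cases h : z ∈ outerK k₀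
    · exact c1 z ⟨hz, h⟩
    · exact continuousWithinAt_of_notMem_closure fun hc =>
        h (isClosed_outerK.closure_subset (closure_mono inter_subset_right hc))
  · by_cases h : z ∈ innerK k₀
    · exact c2 z ⟨hz, h⟩
    · exact continuousWithinAt_of_notMem_closure fun hc =>
        h (isClosed_innerK.closure_subset (closure_mono inter_subset_right hc))

theorem DetData.eq_exp_logFun (h : DetData k₀ f c) (hzs : ∀ n, zs n ∈ outerD k₀) (hd : LogData H κ)
    (hκ : exp κ = c * twist zs ν)
    (hH : ∀ ω ∈ cstrip \ {mid}, f (k₀ * exp ω) = exp (H ω) * blaschke k₀ zs ν (k₀ * exp ω))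
    (hz : z ∈ Good k₀) : f z = exp (logFun k₀ H κ z) * blaschke k₀ zs ν z := by
  have hk := h.pos
  have key : ∀ z ∈ outerK k₀ \ {I * k₀}, f z = exp (H (log (z / k₀))) * blaschke k₀ zs ν z :=
    fun z hz => by
      have := hH _ (log_mem_diff hk hz)
      rwa [k_exp_log hk (ne_zero_of_outerK hk hz.1)] at this
  rcases good_subset hk hz with hK | hK
  · rw [key z hK, logFun, if_pos hK.1]
  · have h1 := good_inter_outerK hk (Good.hat_conj hk hz) (hat_conj_mem_outerK hk hK hz.1)
    rw [h.symm z hz, key _ h1, map_mul, blaschke_hat hk hzs hz.1, logFun_of_innerK hd hk hK hz.1,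
      exp_add, hκ, exp_conj]
    ring

/-- The logarithm of the jump. -/
def jumpLog (k₀ : ℝ) (H : ℂ → ℂ) (κ ζ : ℂ) : ℂ :=
  -(logFun k₀ H κ ζ + (starRingEnd ℂ) (logFun k₀ H κ ((starRingEnd ℂ) ζ)))

theorem jumpLog_conj (ζ : ℂ) :
    jumpLog k₀ H κ ((starRingEnd ℂ) ζ) = (starRingEnd ℂ) (jumpLog k₀ H κ ζ) := by
  simp only [jumpLog, map_neg, map_add, conj_conj]; ring

theorem jumpLog_real (x : ℝ) : jumpLog k₀ H κ x = ((-2 * (logFun k₀ H κ x).re : ℝ) : ℂ) := by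
  rw [jumpLog, conj_ofReal, add_conj]; push_cast; ring

theorem LogData.edgeValues (hd : LogData H κ) (hk : 0 < k₀) :
    EdgeValues k₀ H κ (jumpLog k₀ H κ) := by
  have mr : ∀ s : ℝ, 0 < s → (s : ℂ) ∈ cstrip := fun s hs => by
    simpa [cstrip] using ⟨hs.le, Real.pi_pos.le⟩
  have mr' : ∀ s : ℝ, 0 < s → (s + Real.pi * I : ℂ) ∈ cstrip := fun s hs =>
    mem_cstrip hs.le ⟨Real.pi_pos.le, le_rfl⟩
  have mu : ∀ u ∈ Icc (0 : ℝ) Real.pi, (u * I : ℂ) ∈ cstrip := fun u hu => by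
    simpa using mem_cstrip (x := 0) le_rfl hu
  have e1 : ∀ s : ℝ, ((k₀ * Real.exp s : ℝ) : ℂ) = k₀ * exp s := fun s => by push_cast; rfl
  have e2 : ∀ s : ℝ, ((-(k₀ * Real.exp s) : ℝ) : ℂ) = k₀ * exp (s + Real.pi * I) := fun s => by
    rw [exp_add, exp_pi_mul_I]; push_cast; ring
  have e3 : ∀ s : ℝ, ((k₀ * Real.exp (-s) : ℝ) : ℂ) = k₀ * exp (-(s : ℂ)) := fun s => by push_cast; rfl
  have e4 : ∀ s : ℝ, ((-(k₀ * Real.exp (-s)) : ℝ) : ℂ) = k₀ * exp (-(s + Real.pi * I)) := fun s => by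
    rw [neg_add, exp_add, exp_neg_pi_mul_I]; push_cast; ring
  have hup : ∀ u ∈ Icc (0 : ℝ) Real.pi, jumpLog k₀ H κ (k₀ * exp (I * u)) = edgeC H κ u := by
    intro u hu
    have hc : (starRingEnd ℂ) ((k₀ : ℂ) * exp (I * u)) = k₀ * exp (-(u * I)) := by
      rw [map_mul, conj_ofReal, ← exp_conj, map_mul, conj_I, conj_ofReal]; congr 2; ring
    rw [jumpLog, hc, mul_comm I, logFun_outer hk (mu u hu), logFun_inner hd hk (mu u hu), dual_mul_I,
      edgeC, map_add, conj_conj, add_assoc]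
  refine ⟨fun s hs => ?_, fun s hs => ?_, fun s hs => ?_, fun s hs => ?_, hup, fun u hu => ?_⟩
  · rw [jumpLog_real, e1, logFun_outer hk (mr s hs), edgeR]
  · rw [jumpLog_real, e2, logFun_outer hk (mr' s hs), edgeL]
  · rw [jumpLog_real, e3, logFun_inner hd hk (mr s hs), dual_ofReal, edgeL, add_re, conj_re, hd.re,
      add_zero]
  · rw [jumpLog_real, e4, logFun_inner hd hk (mr' s hs), dual_add_pi, edgeR, add_re, conj_re, hd.re,
      add_zero]
  · have hc : (k₀ : ℂ) * exp (I * ((-u : ℝ) : ℂ)) = (starRingEnd ℂ) ((k₀ : ℂ) * exp (I * u)) := by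
      rw [map_mul, conj_ofReal, ← exp_conj, map_mul, conj_I, conj_ofReal]; congr 2; push_cast; ring
    rw [hc, jumpLog_conj, hup u ⟨hu.1.le, hu.2⟩]

/-- The trace formula for `f`, with `κ` the logarithm of its value at the origin. -/
theorem DetData.trace (h : DetData k₀ f c) (hz : ZeroData k₀ f zs ν) {d : ℂ → ℂ}
    (hdet : ∀ z ∈ Sig₀ k₀, d z = (f z * (starRingEnd ℂ) (f ((starRingEnd ℂ) z)))⁻¹) :
    ∃ ℓ : ℂ → ℂ, IsLogOnSig k₀ d ℓ ∧
      (∀ z ∈ Dplus k₀, SigIntegrable k₀ fun ζ => ℓ ζ / (ζ - z)) ∧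
      SigIntegrable k₀ (fun ζ => ℓ ζ / ζ) ∧
      (∀ z ∈ Dplus k₀, f z = exp (-(1 / (2 * Real.pi * I)) * sigInt k₀ fun ζ => ℓ ζ / (ζ - z)) *
        blaschke k₀ zs ν z) ∧
      c * twist zs ν = exp (-(1 / (2 * Real.pi * I)) * sigInt k₀ fun ζ => ℓ ζ / ζ) := by
  have hk := h.pos
  obtain ⟨H, κ, hd, hκ, hH, C, hC⟩ := h.exists_logData hz
  have hexp : ∀ z ∈ Good k₀, f z = exp (logFun k₀ H κ z) * blaschke k₀ zs ν z := fun z hzg =>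
    h.eq_exp_logFun hz.mem hd hκ hH hzg
  -- On the real axis |f| ≤ 1 and |B| = 1, so the reduced logarithm has nonpositive real part. This
  -- is the positivity of the jump needed for integrability.
  have hreal : ∀ x : ℝ, x ≠ 0 → (x : ℂ) ∈ Good k₀ → (logFun k₀ H κ x).re ≤ 0 := fun x hx hg => by
    have h1 := h.le x hx
    rw [hexp _ hg, norm_mul, norm_blaschke_real hk hz.mem, mul_one, norm_exp, Real.exp_le_one_iff] at h1
    exact h1
  have hgood : ∀ x : ℝ, x ≠ 0 → (x : ℂ) ∈ Good k₀ := fun x hx => by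
    refine good_of_mem hk (Or.inr ⟨Or.inl (ofReal_im _), ?_⟩)
    rintro (e | e | e)
    · exact hx (by exact_mod_cast e)
    · have := congrArg im e; simp at this; exact hk.ne this
    · have e : (x : ℂ) = -(I * k₀) := e
      have := congrArg im e; simp at this; exact hk.ne' this
  have mr : ∀ s : ℝ, 0 ≤ s → (s : ℂ) ∈ cstrip := fun s hs => by
    simpa [cstrip] using ⟨hs, Real.pi_pos.le⟩
  have mr' : ∀ s : ℝ, 0 ≤ s → (s + Real.pi * I : ℂ) ∈ cstrip := fun s hs =>
    mem_cstrip hs ⟨Real.pi_pos.le, le_rfl⟩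
  have hR : ∀ s : ℝ, 0 ≤ s → 0 ≤ edgeR H s := fun s hs => by
    have hp : k₀ * Real.exp s ≠ 0 := by positivity
    have h1 := hreal _ hp (hgood _ hp)
    rw [show ((k₀ * Real.exp s : ℝ) : ℂ) = k₀ * exp s by push_cast; rfl,
      logFun_outer hk (mr s hs)] at h1
    rw [edgeR]; linarith
  have hL : ∀ s : ℝ, 0 ≤ s → 0 ≤ edgeL H s := fun s hs => by
    have hp : -(k₀ * Real.exp s) ≠ 0 := neg_ne_zero.2 (by positivity)
    have h1 := hreal _ hp (hgood _ hp)
    rw [show ((-(k₀ * Real.exp s) : ℝ) : ℂ) = k₀ * exp (s + Real.pi * I) by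
        rw [exp_add, exp_pi_mul_I]; push_cast; ring,
      logFun_outer hk (mr' s hs)] at h1
    rw [edgeL]; linarith
  have hi : EdgeIntegrable H :=
    EdgeIntegrable.of_add hd.nice.cont hR hL (hd.integrableOn_edge hk hR hL hC)
  have hv := hd.edgeValues hk
  have hw : ∀ z ∈ Dplus k₀, z.im ≠ 0 ∧ ‖z‖ ≠ k₀ := fun z hz => by
    have hz : 0 < (‖z‖ ^ 2 - k₀ ^ 2) * z.im := hz
    refine ⟨fun e => ?_, fun e => ?_⟩
    · rw [e, mul_zero] at hz; exact lt_irrefl _ hz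
    · rw [e, sub_self, zero_mul] at hz; exact lt_irrefl _ hz
  have h2pi : (2 * Real.pi * I : ℂ) ≠ 0 := by simp [Real.pi_ne_zero]
  obtain ⟨z1, z2⟩ := hv.sigIntegrable hd.nice hi hk (w := 0) (Or.inr rfl) (by simpa using hk.ne)
  simp only [sub_zero] at z1 z2
  refine ⟨jumpLog k₀ H κ, ⟨?_, ?_, ?_⟩, ?_, z1, ?_, ?_⟩
  · have c1 := continuousOn_logFun hd hk
    have c2 : ContinuousOn (logFun k₀ H κ) (Sig₀ k₀) := c1.mono fun z hz => good_of_mem hk (Or.inr hz)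
    exact (c2.add (continuous_conj.comp_continuousOn
      (c2.comp continuous_conj.continuousOn fun z hz => Sig₀.conj hk hz))).neg
  · intro z hzS
    have hg := good_of_mem hk (Or.inr hzS)
    have hg' := good_of_mem hk (Or.inr (Sig₀.conj hk hzS))
    have hB := blaschke_mul_conj (ν := ν) hk hz.mem hzS.1
    rw [hdet z hzS, hexp z hg, hexp _ hg', jumpLog, exp_neg, exp_add, exp_conj, map_mul]
    congr 1
    linear_combination (-(exp (logFun k₀ H κ z) *
      (starRingEnd ℂ) (exp (logFun k₀ H κ ((starRingEnd ℂ) z))))) * hB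
  · intro x _
    rw [jumpLog_real, ofReal_im]
  · exact fun z hzD => (hv.sigIntegrable hd.nice hi hk (Or.inl (hw z hzD).1) (hw z hzD).2).1
  · intro z hzD
    rw [(hv.sigIntegrable hd.nice hi hk (Or.inl (hw z hzD).1) (hw z hzD).2).2,
      hexp z (Dplus_subset hk hzD)]
    congr 2
    -- A point of D⁺ lies in the open outer component or in the open inner one; being off Σ, it
    -- corresponds to an interior point of the half-strip in either case.
    have hI : fullInt k₀ H κ z = -(2 * Real.pi * I * logFun k₀ H κ z) := by
      rcases good_subset hk (Dplus_subset hk hzD) with hK | hK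
      · have him : 0 < z.im := lt_of_le_of_ne hK.1.2 (Ne.symm (hw z hzD).1)
        have hm := log_mem_cstrip hk hK.1
        have hz0 := ne_zero_of_outerK hk hK.1
        have hD := (outerD_iff hk).2 ⟨hzD, him⟩
        rw [← k_exp_log hk hz0] at hD
        have hs := mem_strip_of_outerD hk hm hD
        rw [← k_exp_log hk hz0, hd.fullInt_outer hi hk hs, logFun_outer hk hm]
      · have hz0 : z ≠ 0 := (Dplus_subset hk hzD).1
        have hn := lt_of_le_of_ne hK.1 (hw z hzD).2
        have him := lt_of_le_of_ne hK.2 (hw z hzD).1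
        obtain ⟨ω, hω, rfl⟩ := exists_inner hk hK hz0
        have hs : flip ω ∈ strip := by
          refine mem_strip_of_outerD hk (flip_mem_cstrip hω) ?_
          rw [← hat_conj_k_exp hk]
          have hp := norm_pos_iff.2 hz0
          refine ⟨?_, ?_⟩
          · rw [norm_hat_conj hk, lt_div_iff₀ hp]; nlinarith
          · rw [im_hat_conj hz0]
            have : 0 < k₀ ^ 2 / ‖(k₀ : ℂ) * exp (-ω)‖ ^ 2 := by positivity
            nlinarith
        have hs' := flip_mem_strip hs
        rw [flip_flip] at hs'
        rw [hd.fullInt_inner hi hk hs', logFun_inner hd hk hω]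
    rw [hI]; field_simp
  · rw [z2, hd.fullInt_zero hi hk, ← hκ]
    congr 1
    field_simp

end Trace

/-! ### Orders of the zeros, phases, and assembly -/

section Conclusion

open scoped Matrix

variable {m : ℕ} {k₀ t : ℝ} {Q : ℝ → ℝ → Matrix (Fin m) (Fin m) ℂ} {Qp Qm : Matrix (Fin m) (Fin m) ℂ}
  {N : ℕ} {zs : Fin N → ℂ} {ν : Fin N → ℕ}

theorem ScatPot.mk_of_limits (hk₀ : 0 < k₀)
    (hQp : Qp * Qpᴴ = (k₀ : ℂ) ^ 2 • 1 ∧ Qpᴴ * Qp = (k₀ : ℂ) ^ 2 • 1)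
    (hQm : Qm * Qmᴴ = (k₀ : ℂ) ^ 2 • 1 ∧ Qmᴴ * Qm = (k₀ : ℂ) ^ 2 • 1)
    (hcont : Continuous fun x => Q x t)
    (hlimp : Tendsto (fun x => Q x t) atTop (𝓝 Qp))
    (hlimm : Tendsto (fun x => Q x t) atBot (𝓝 Qm))
    (hintp : ∀ (c : ℝ) (i j : Fin m), IntegrableOn (fun x => Q x t i j - Qp i j) (Set.Ioi c))
    (hintm : ∀ (c : ℝ) (i j : Fin m), IntegrableOn (fun x => Q x t i j - Qm i j) (Set.Iio c)) :
    ScatPot k₀ Q Qp Qm t := by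
  refine ⟨⟨hk₀, hQm, hcont, hlimm, hintm⟩, ⟨hk₀, by simpa using hQp, ?_, ?_, fun c i j => ?_⟩⟩
  · simp only [reflQ, neg_neg]
    exact (hcont.comp continuous_neg).neg
  · simp only [reflQ, neg_neg]
    exact (hlimp.comp tendsto_neg_atBot_atTop).neg
  · have h1 : IntegrableOn (fun x => Q (-x) t i j - Qp i j) (Set.Iio c) := by
      have := (hintp (-c) i j).comp_neg_Iio
      exact this
    refine (h1.neg).congr (Eventually.of_forall fun x => ?_)
    simp [reflQ]; ring

theorem norm_det_of_phase {A : Matrix (Fin m) (Fin m) ℂ} {θ : ℝ} (hk : 0 < k₀)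
    (h : A.det = (k₀ : ℂ) ^ m * Complex.exp (Complex.I * (θ : ℂ))) : ‖A.det‖ = k₀ ^ m := by
  rw [h, norm_mul, mul_comm Complex.I, Complex.norm_exp_ofReal_mul_I, mul_one, norm_pow, Complex.norm_real,
    Real.norm_of_nonneg hk.le]

theorem ScatPot.detData (h : ScatPot k₀ Q Qp Qm t)
    (hSig : ∀ z ∈ Sig₀ k₀, (scatA k₀ Q Qp Qm t z).det ≠ 0)
    (hbranch : ∃ (p : ℕ) (c : ℂ), c ≠ 0 ∧
        Tendsto (fun z => (z - Complex.I * k₀) ^ p * (scatA k₀ Q Qp Qm t z).det)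
          (𝓝[Dplus k₀] (Complex.I * k₀)) (𝓝 c))
    (hp : ‖Qp.det‖ = k₀ ^ m) (hm : ‖Qm.det‖ = k₀ ^ m) :
    DetData k₀ (fun z => (scatA k₀ Q Qp Qm t z).det) (1 / (k₀ : ℂ) ^ (2 * m) * (Qp.det * Qmᴴ.det)) where
  pos := h.pos
  diff := h.differentiableOn_det
  cont := h.continuousOn_det
  inf := h.tendsto_det
  imag := h.det_imag
  norm_c := by
    have hk := h.pos
    rw [norm_mul, norm_mul, hp, Matrix.det_conjTranspose, norm_star, hm, norm_div, norm_one, norm_pow,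
      Complex.norm_real, Real.norm_of_nonneg hk.le]
    field_simp
    ring
  symm := fun z hz => h.det_scatA_symm hz
  le := fun x hx => h.norm_det_scatA_le hx
  ne := hSig
  branch := hbranch

/-- `analyticOrderNatAt` is 0 by default at infinite order. That case is excluded because f would
vanish on a neighbourhood, while its zeros in the outer component are finite in number. -/
theorem exists_zeroData {f : ℂ → ℂ} (hk : 0 < k₀)
    (hinj : Function.Injective zs) (hzs : ∀ n, zs n ∈ Dplus k₀ ∧ 0 < (zs n).im)
    (hzero : ∀ z ∈ Dplus k₀, 0 < z.im → (f z = 0 ↔ ∃ n, z = zs n)) :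
    ZeroData k₀ f zs fun n => analyticOrderNatAt f (zs n) := by
  have hmem : ∀ n, zs n ∈ outerD k₀ := fun n => (outerD_iff hk).2 (hzs n)
  refine ⟨hinj, hmem, fun z hz => hzero z ((outerD_iff hk).1 hz).1 hz.2, fun n => ?_⟩
  refine (Nat.cast_analyticOrderNatAt fun htop => ?_).symm
  rw [analyticOrderAt_eq_top] at htop
  have h1 : Set.range zs ∈ 𝓝 (zs n) := by
    filter_upwards [htop, isOpen_outerD.mem_nhds (hmem n)] with z hz hz'
    obtain ⟨k, hk⟩ := (hzero z ((outerD_iff hk).1 hz').1 hz'.2).1 hz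
    exact ⟨k, hk.symm⟩
  exact infinite_of_mem_nhds _ h1 (Set.finite_range zs)

theorem order_eq_one {f : ℂ → ℂ} {z : ℂ} (hf : AnalyticAt ℂ f z) (h0 : f z = 0) (h1 : deriv f z ≠ 0) :
    analyticOrderNatAt f z = 1 := by
  rw [analyticOrderNatAt, hf.analyticOrderAt_eq_one_of_zero_deriv_ne_zero h0 h1]; rfl

theorem order_eq_two {f : ℂ → ℂ} {z : ℂ} (hf : AnalyticAt ℂ f z) (h0 : f z = 0) (h1 : deriv f z = 0)
    (h2 : iteratedDeriv 2 f z ≠ 0) : analyticOrderNatAt f z = 2 := by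
  have a : ((2 : ℕ) : ℕ∞) ≤ analyticOrderAt f z := by
    rw [natCast_le_analyticOrderAt_iff_iteratedDeriv_eq_zero hf]
    intro i hi
    interval_cases i
    · simpa using h0
    · simpa using h1
  have b : ¬((3 : ℕ) : ℕ∞) ≤ analyticOrderAt f z := by
    rw [natCast_le_analyticOrderAt_iff_iteratedDeriv_eq_zero hf]
    exact fun h => h2 (h 2 (by norm_num))
  have c : analyticOrderAt f z ≠ ⊤ := fun e => b (by rw [e]; exact le_top)
  rw [← Nat.cast_analyticOrderNatAt c] at a b
  have a' : 2 ≤ analyticOrderNatAt f z := by exact_mod_cast a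
  have b' : ¬3 ≤ analyticOrderNatAt f z := fun h => b (by exact_mod_cast h)
  omega

/-- Since conj z_n / z_n = e^{-2iδ_n}, a zero of order r contributes e^{-4irδ_n} to the twist. Any
choice of the arguments δ_n serves. -/
theorem twist_mul_exp (hzs : ∀ n, zs n ≠ 0) {δ : Fin N → ℝ}
    (hδ : ∀ n, zs n = (‖zs n‖ : ℂ) * Complex.exp (Complex.I * (δ n : ℂ))) {r : ℕ} (hν : ∀ n, ν n = r) :
    twist zs ν * ∏ n, Complex.exp (4 * r * Complex.I * (δ n : ℂ)) = 1 := by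
  rw [twist, ← Finset.prod_mul_distrib]
  refine Finset.prod_eq_one fun n _ => ?_
  have hn : (‖zs n‖ : ℂ) ≠ 0 := by exact_mod_cast norm_ne_zero_iff.2 (hzs n)
  have h1 : (starRingEnd ℂ) (zs n) / zs n = Complex.exp (-(2 * Complex.I * (δ n : ℂ))) := by
    have h2 : (starRingEnd ℂ) (zs n) = (‖zs n‖ : ℂ) * Complex.exp (-(Complex.I * (δ n : ℂ))) := by
      conv_lhs => rw [hδ n]
      rw [map_mul, Complex.conj_ofReal, ← Complex.exp_conj, map_mul, Complex.conj_I, Complex.conj_ofReal,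
        neg_mul]
    rw [h2]
    conv_lhs => rw [hδ n, norm_mul, mul_comm Complex.I, Complex.norm_exp_ofReal_mul_I]
    rw [Complex.norm_real, norm_norm, mul_one, mul_div_mul_left _ _ hn, ← Complex.exp_sub]
    congr 1; ring
  rw [h1, hν, ← Complex.exp_nat_mul, ← Complex.exp_nat_mul, ← Complex.exp_add, ← Complex.exp_zero]
  congr 1; push_cast; ring

/-- The trace formula and the phase relation when all zeros have the same order `r`. -/
theorem trace_of_order (hk : 0 < k₀) {S : ℂ} {δ : Fin N → ℝ} {r : ℕ} {θp θm : ℝ}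
    (hzs : ∀ n, zs n ≠ 0)
    (hδ : ∀ n, zs n = (‖zs n‖ : ℂ) * Complex.exp (Complex.I * (δ n : ℂ)))
    (hθp : Qp.det = (k₀ : ℂ) ^ m * Complex.exp (Complex.I * (θp : ℂ)))
    (hθm : Qm.det = (k₀ : ℂ) ^ m * Complex.exp (Complex.I * (θm : ℂ)))
    (hν : ∀ n, ν n = r)
    (h : 1 / (k₀ : ℂ) ^ (2 * m) * (Qp.det * Qmᴴ.det) * twist zs ν =
      Complex.exp (-(1 / (2 * Real.pi * Complex.I)) * S)) :
    Qp.det * Qmᴴ.det = (k₀ : ℂ) ^ (2 * m) * Complex.exp (-(1 / (2 * Real.pi * Complex.I)) * S) *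
      ∏ n, Complex.exp (4 * r * Complex.I * (δ n : ℂ)) ∧
    ∃ q : ℤ, (θp : ℂ) - (θm : ℂ) = 1 / (2 * Real.pi) * S + 4 * r * ∑ n, (δ n : ℂ)
      + 2 * Real.pi * (q : ℂ) := by
  have hk' : (k₀ : ℂ) ≠ 0 := by exact_mod_cast hk.ne'
  have hkp : (k₀ : ℂ) ^ (2 * m) ≠ 0 := pow_ne_zero _ hk'
  have hpi : (Real.pi : ℂ) ≠ 0 := by exact_mod_cast Real.pi_ne_zero
  have ht := twist_mul_exp hzs hδ hν
  have h1 : Qp.det * Qmᴴ.det = (k₀ : ℂ) ^ (2 * m) * Complex.exp (-(1 / (2 * Real.pi * Complex.I)) * S) *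
      ∏ n, Complex.exp (4 * r * Complex.I * (δ n : ℂ)) := by
    rw [← h, mul_assoc, mul_assoc (1 / (k₀ : ℂ) ^ (2 * m) * (Qp.det * Qmᴴ.det)), ht]
    field_simp
  refine ⟨h1, ?_⟩
  have h2 : Complex.exp (Complex.I * ((θp : ℂ) - θm)) =
      Complex.exp (-(1 / (2 * Real.pi * Complex.I)) * S + 4 * r * Complex.I * ∑ n, (δ n : ℂ)) := by
    rw [hθp, Matrix.det_conjTranspose, hθm, star_mul', star_pow, mul_assoc] at h1
    have h3 : star (Complex.exp (Complex.I * (θm : ℂ))) = Complex.exp (-(Complex.I * θm)) := by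
      rw [← starRingEnd_apply, ← Complex.exp_conj, map_mul, Complex.conj_I, Complex.conj_ofReal, neg_mul]
    have h4 : star (k₀ : ℂ) = k₀ := Complex.conj_ofReal k₀
    rw [h3, h4] at h1
    rw [Finset.mul_sum, Complex.exp_add, Complex.exp_sum]
    refine mul_left_cancel₀ hkp ?_
    rw [← mul_assoc, ← h1, mul_sub, sub_eq_add_neg, Complex.exp_add, mul_comm 2 m, pow_mul]
    ring
  obtain ⟨q, hq⟩ := Complex.exp_eq_exp_iff_exists_int.1 h2
  refine ⟨q, mul_left_cancel₀ Complex.I_ne_zero ?_⟩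
  rw [hq]
  -- Division by i absorbs the minus sign, so after cancelling I the contour integral enters the
  -- phase relation with a plus.
  have h5 : -(1 / (2 * Real.pi * Complex.I)) = Complex.I * (1 / (2 * Real.pi)) := by
    rw [one_div, mul_inv, Complex.inv_I]; ring
  rw [h5]; ring

end Conclusion

end MMKdV

end

theorem mainTheorem11 {m : ℕ} (k₀ : ℝ) (hk₀ : 0 < k₀)
    -- the potential, its boundary values, and the time at which it is considered
    (Q : ℝ → ℝ → Matrix (Fin m) (Fin m) ℂ) (Qp Qm : Matrix (Fin m) (Fin m) ℂ) (t : ℝ)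
    (hQp : Qp * Qp.conjTranspose = (k₀ : ℂ) ^ 2 • 1 ∧ Qp.conjTranspose * Qp = (k₀ : ℂ) ^ 2 • 1)
    (hQm : Qm * Qm.conjTranspose = (k₀ : ℂ) ^ 2 • 1 ∧ Qm.conjTranspose * Qm = (k₀ : ℂ) ^ 2 • 1)
    (hcont : Continuous fun x => Q x t)
    (hlimp : Tendsto (fun x => Q x t) atTop (𝓝 Qp))
    (hlimm : Tendsto (fun x => Q x t) atBot (𝓝 Qm))
    (hintp : ∀ (c : ℝ) (i j : Fin m),
      IntegrableOn (fun x => Q x t i j - Qp i j) (Set.Ioi c))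
    (hintm : ∀ (c : ℝ) (i j : Fin m),
      IntegrableOn (fun x => Q x t i j - Qm i j) (Set.Iio c))
    -- `det a` has no zero on the continuous spectrum, and at worst a pole at the branch points
    (hSig : ∀ z ∈ MMKdV.Sig₀ k₀, (MMKdV.scatA k₀ Q Qp Qm t z).det ≠ 0)
    (hbranch : ∀ w ∈ ({Complex.I * k₀, -(Complex.I * k₀)} : Set ℂ),
      ∃ (p : ℕ) (c : ℂ), c ≠ 0 ∧
        Tendsto (fun z => (z - w) ^ p * (MMKdV.scatA k₀ Q Qp Qm t z).det)
          (𝓝[MMKdV.Dplus k₀] w) (𝓝 c))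
    -- the zeros of `det a` in the part of `D⁺` in the upper half plane are `z₁, …, z_N`
    {N : ℕ} (zs : Fin N → ℂ) (hinj : Function.Injective zs)
    (hzs : ∀ n, zs n ∈ MMKdV.Dplus k₀ ∧ 0 < (zs n).im)
    (hzero : ∀ z ∈ MMKdV.Dplus k₀, 0 < z.im →
      ((MMKdV.scatA k₀ Q Qp Qm t z).det = 0 ↔ ∃ n, z = zs n))
    -- phases
    (δ : Fin N → ℝ) (hδ : ∀ n, zs n = (‖zs n‖ : ℂ) * Complex.exp (Complex.I * (δ n : ℂ)))
    (θp θm : ℝ)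
    (hθp : Qp.det = (k₀ : ℂ) ^ m * Complex.exp (Complex.I * (θp : ℂ)))
    (hθm : Qm.det = (k₀ : ℂ) ^ m * Complex.exp (Complex.I * (θm : ℂ))) :
    -- `a` is holomorphic in `D⁺`, continuous up to `Σ₀`, and a block of `S` there
    (∀ i j, DifferentiableOn ℂ (fun z => MMKdV.scatA k₀ Q Qp Qm t z i j) (MMKdV.Dplus k₀)) ∧
    ContinuousOn (MMKdV.scatA k₀ Q Qp Qm t) (MMKdV.Dplus k₀ ∪ MMKdV.Sig₀ k₀) ∧
    (∀ z ∈ MMKdV.Sig₀ k₀,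
      MMKdV.scatA k₀ Q Qp Qm t z = (MMKdV.scatS k₀ Q Qp Qm t z).toBlocks₁₁) ∧
    -- the value of `det a` at the origin
    Tendsto (fun z => (MMKdV.scatA k₀ Q Qp Qm t z).det) (𝓝[MMKdV.Dplus k₀] 0)
      (𝓝 (1 / (k₀ : ℂ) ^ (2 * m) * (Qp.det * Qm.conjTranspose.det))) ∧
    -- `ℓ = log det (I + ρ†ρ)`
    ∃ ℓ : ℂ → ℂ, MMKdV.IsLogOnSig k₀ (MMKdV.jumpDet k₀ Q Qp Qm t) ℓ ∧
      (∀ z ∈ MMKdV.Dplus k₀, MMKdV.SigIntegrable k₀ fun ζ => ℓ ζ / (ζ - z)) ∧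
      MMKdV.SigIntegrable k₀ (fun ζ => ℓ ζ / ζ) ∧
      -- simple zeros
      ((∀ n, deriv (fun z => (MMKdV.scatA k₀ Q Qp Qm t z).det) (zs n) ≠ 0) →
        (∀ z ∈ MMKdV.Dplus k₀, (MMKdV.scatA k₀ Q Qp Qm t z).det =
          Complex.exp (-(1 / (2 * Real.pi * Complex.I)) *
              MMKdV.sigInt k₀ fun ζ => ℓ ζ / (ζ - z)) *
            ∏ n, MMKdV.quartet k₀ (zs n) z) ∧
        Qp.det * Qm.conjTranspose.det = (k₀ : ℂ) ^ (2 * m) *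
          Complex.exp (-(1 / (2 * Real.pi * Complex.I)) *
              MMKdV.sigInt k₀ fun ζ => ℓ ζ / ζ) *
            ∏ n, Complex.exp (4 * Complex.I * (δ n : ℂ)) ∧
        ∃ r : ℤ, (θp : ℂ) - (θm : ℂ) =
          1 / (2 * Real.pi) * MMKdV.sigInt k₀ (fun ζ => ℓ ζ / ζ) + 4 * ∑ n, (δ n : ℂ)
            + 2 * Real.pi * (r : ℂ)) ∧
      -- double zeros
      ((∀ n, deriv (fun z => (MMKdV.scatA k₀ Q Qp Qm t z).det) (zs n) = 0 ∧
          iteratedDeriv 2 (fun z => (MMKdV.scatA k₀ Q Qp Qm t z).det) (zs n) ≠ 0) →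
        (∀ z ∈ MMKdV.Dplus k₀, (MMKdV.scatA k₀ Q Qp Qm t z).det =
          Complex.exp (-(1 / (2 * Real.pi * Complex.I)) *
              MMKdV.sigInt k₀ fun ζ => ℓ ζ / (ζ - z)) *
            ∏ n, MMKdV.quartet k₀ (zs n) z ^ 2) ∧
        Qp.det * Qm.conjTranspose.det = (k₀ : ℂ) ^ (2 * m) *
          Complex.exp (-(1 / (2 * Real.pi * Complex.I)) *
              MMKdV.sigInt k₀ fun ζ => ℓ ζ / ζ) *
            ∏ n, Complex.exp (8 * Complex.I * (δ n : ℂ)) ∧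
        ∃ r : ℤ, (θp : ℂ) - (θm : ℂ) =
          1 / (2 * Real.pi) * MMKdV.sigInt k₀ (fun ζ => ℓ ζ / ζ) + 8 * ∑ n, (δ n : ℂ)
            + 2 * Real.pi * (r : ℂ)) := by
  have hP : MMKdV.ScatPot k₀ Q Qp Qm t :=
    MMKdV.ScatPot.mk_of_limits hk₀ hQp hQm hcont hlimp hlimm hintp hintm
  -- The phases give |det Q±| = k₀^m, which makes the constant of the symmetry unimodular.
  have hD := hP.detData hSig (hbranch _ (Set.mem_insert _ _)) (MMKdV.norm_det_of_phase hk₀ hθp)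
    (MMKdV.norm_det_of_phase hk₀ hθm)
  have hZ := MMKdV.exists_zeroData hk₀ hinj hzs hzero
  have hne : ∀ n, zs n ≠ 0 := fun n e => by
    have := (hzs n).2
    rw [e] at this
    exact lt_irrefl _ this
  have han : ∀ n, AnalyticAt ℂ (fun z => (MMKdV.scatA k₀ Q Qp Qm t z).det) (zs n) := fun n =>
    hP.differentiableOn_det.analyticAt (MMKdV.isOpen_Dplus.mem_nhds (hzs n).1)
  have h0 : ∀ n, (MMKdV.scatA k₀ Q Qp Qm t (zs n)).det = 0 := fun n =>
    (hzero _ (hzs n).1 (hzs n).2).2 ⟨n, rfl⟩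
  have hsub : MMKdV.Dplus k₀ ∪ MMKdV.Sig₀ k₀ ⊆ MMKdV.Good k₀ := fun z hz => MMKdV.good_of_mem hk₀ hz
  refine ⟨hP.differentiableOn_scatA, hP.continuousOn_scatA.mono hsub,
    fun z hz => (hP.scatS_blocks hz).1.symm,
    hP.tendsto_det_zero.mono_left (nhdsWithin_mono _ (MMKdV.Dplus_subset hk₀)), ?_⟩
  -- The trace formula is applied with the orders of the zeros left open, so that one logarithm
  -- serves both cases; the conditions on the derivatives then fix every order as 1 or as 2.
  obtain ⟨ℓ, hlog, hint, hint₀, htr, hS⟩ := hD.trace hZ fun z hz => hP.jumpDet_eq hz hSig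
  refine ⟨ℓ, hlog, hint, hint₀, fun h1 => ?_, fun h2 => ?_⟩
  · have hν : ∀ n, analyticOrderNatAt (fun z => (MMKdV.scatA k₀ Q Qp Qm t z).det) (zs n) = 1 := fun n =>
      MMKdV.order_eq_one (han n) (h0 n) (h1 n)
    have h3 := MMKdV.trace_of_order hk₀ hne hδ hθp hθm hν hS
    simp only [Nat.cast_one, mul_one] at h3
    refine ⟨fun z hz => ?_, h3⟩
    rw [htr z hz, MMKdV.blaschke]
    simp only [hν, pow_one]
  · have hν : ∀ n, analyticOrderNatAt (fun z => (MMKdV.scatA k₀ Q Qp Qm t z).det) (zs n) = 2 := fun n =>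
      MMKdV.order_eq_two (han n) (h0 n) (h2 n).1 (h2 n).2
    have h3 := MMKdV.trace_of_order hk₀ hne hδ hθp hθm hν hS
    rw [show (4 * ((2 : ℕ) : ℂ)) = 8 by norm_num] at h3
    refine ⟨fun z hz => ?_, h3⟩
    rw [htr z hz, MMKdV.blaschke]
    simp only [hν]
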